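/- Let $\overline M$ be a compact smooth manifold with boundary whose boundary is the total space of a smooth fibration $\phi:\partial\overline M\to B$ over a closed manifold $B$ with fibre a closed manifold $F$, let $x$ be a boundary defining function of $\overline M$ and put $\mathbb R^+=[0,\infty)$. On $\overline M^2$ write $x,x'$ for the lifts of the defining function from the two factors, and on $\overline M^2\times\mathbb R^+$ let $k$ be the coordinate on $\mathbb R^+$. Write $[X;P]$ for the blow-up of a p-submanifold $P$ of a manifold with corners $X$; blowing up several submanifolds successively means blowing up their lifts. The $\phi$-double space is $M^2_\phi=[M^2_b;\mathrm{diag}_\phi]$, where $M^2_b=[\overline M^2;\partial\overline M\times\partial\overline M]$ and $\mathrm{diag}_\phi$ is the set of the points of the front face of $M^2_b$, lying over some $(p,p')$, at which $x/x'=1$ and $\phi(p)=\phi(p')$. Its faces are: $\mathrm{bf}$, the lift of the front face of $M^2_b$; $\phi\mathrm f$, the front face of the blow-up of $\mathrm{diag}_\phi$; $\mathrm{lf}$ and $\mathrm{rf}$, the lifts of $\partial\overline M\times\overline M$ and $\overline M\times\partial\overline M$. Let $\beta_\phi:M^2_\phi\to\overline M^2$ be the blow-down map. Let $M^2_{k,b}$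 be obtained from $\overline M^2\times\mathbb R^+$ by blowing up $C_{111}=\partial\overline M\times\partial\overline M\times\{0\}$ and then $\overline M\times\partial\overline M\times\{0\}$, $\partial\overline M\times\overline M\times\{0\}$, $\partial\overline M\times\partial\overline M\times\mathbb R^+$, and let $\mathrm{bf}\subset M^2_{k,b}$ be the front face of the last blow-up. Let $M^2_{k,\mathrm{sc},\phi}$ be the blow-up of $M^2_{k,b}$ in $\mathrm{diag}_{k,\mathrm{sc},\phi}=\{x/x'=1,\ \phi(p)=\phi(p')\}\subset\mathrm{bf}$, and let $M^2_{k,\phi}=[M^2_{k,\mathrm{sc},\phi};\mathrm{diag}_{k,\phi}]$, where $\mathrm{diag}_{k,\phi}$ is the closure of the set of the points over $C_{111}$, but not over $\mathrm{bf}$, at which $x/x'=1$ and $\phi(p)=\phi(p')$. Let $\phi\mathrm f_0$ be the front face of this last blow-up, and $\beta_{k,\phi}:M^2_{k,\phi}\to\overline M^2\times\mathbb R^+$ the total blow-down map. Then the spaces $M^2_\phi$ and $M^2_{k,\phi}$ are well defined, i.e. the blow-ups exist. The identity in the interior extends to a b-map $$\beta'_{k,\phi}:M^2_{k,\phi}\to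 M^2_\phi\times\mathbb R^+,\qquad (\beta_\phi\times\mathrm{id})\circ\beta'_{k,\phi}=\beta_{k,\phi}.$$ This map is the blow-down map of an iterated blow-up of $M^2_\phi\times\mathbb R^+$, in which first $\mathrm{bf}\times\{0\}$ and then, in any order, (the lifts of) $\phi\mathrm f\times\{0\}$, $\mathrm{lf}\times\{0\}$ and $\mathrm{rf}\times\{0\}$ are blown up. The face $\phi\mathrm f_0$ of $M^2_{k,\phi}$ is the lift of the front face of the blow-up of $\phi\mathrm f\times\{0\}$. -/

import Mathlib

open Set Filter
open scoped Manifold ContDiff Topology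

universe u

noncomputable section

/-! ## Local models and manifolds with corners -/

/-- The local model of a manifold with corners: the product of one half-line `[0, ∞)` for every
coordinate in `C` and one line `ℝ` for every other coordinate. -/
abbrev Sector (N : ℕ) (C : Set (Fin N)) : Type :=
  {v : EuclideanSpace ℝ (Fin N) // ∀ i ∈ C, 0 ≤ v i}

instance : T2Space (EuclideanHalfSpace 1) :=
  inferInstanceAs (T2Space {v : EuclideanSpace ℝ (Fin 1) // 0 ≤ v 0})

open Classical in
/-- The inclusion of `Sector N C` into Euclidean space, as a model with corners. -/
def sectorModel (N : ℕ) (C : Set (Fin N)) :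
    ModelWithCorners ℝ (EuclideanSpace ℝ (Fin N)) (Sector N C) where
  toFun := Subtype.val
  invFun v := ⟨WithLp.toLp 2 fun i => if i ∈ C then max (v i) 0 else v i, fun i hi => by
    simp [hi]⟩
  source := univ
  target := {v | ∀ i ∈ C, 0 ≤ v i}
  map_source' v _ := v.property
  map_target' _ _ := mem_univ _
  left_inv' v _ := by
    apply Subtype.ext
    ext i
    by_cases h : i ∈ C
    · simp [h, v.2 i h]
    · simp [h]
  right_inv' v hv := by
    ext i
    by_cases h : i ∈ C
    · simp [h, hv i h]
    · simp [h]
  source_eq := rfl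
  convex_range' := by
    simp only [instIsRCLikeNormedField, ↓reduceDIte]
    apply Convex.convex_isRCLikeNormedField
    have : range (Subtype.val : Sector N C → EuclideanSpace ℝ (Fin N))
        = {v | ∀ i ∈ C, 0 ≤ v i} := Subtype.range_val
    rw [this]
    intro v hv w hw a b ha hb _ i hi
    have h1 := hv i hi
    have h2 := hw i hi
    simp only [PiLp.add_apply, PiLp.smul_apply, smul_eq_mul]
    positivity
  nonempty_interior' := by
    have hr : range (Subtype.val : Sector N C → EuclideanSpace ℝ (Fin N))
        = {v | ∀ i ∈ C, 0 ≤ v i} := Subtype.range_val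
    refine ⟨WithLp.toLp 2 fun _ => 1, ?_⟩
    change _ ∈ interior (range (Subtype.val : Sector N C → EuclideanSpace ℝ (Fin N)))
    rw [hr]
    refine mem_interior.2 ⟨⋂ i : Fin N, {v | 0 < v i}, ?_, ?_, ?_⟩
    · intro v hv i _
      exact le_of_lt (mem_iInter.1 hv i)
    · exact isOpen_iInter_of_finite fun i => isOpen_lt continuous_const (by fun_prop)
    · simp
  continuous_toFun := continuous_subtype_val
  continuous_invFun := by
    refine Continuous.subtype_mk ((PiLp.continuous_toLp 2 _).comp <| continuous_pi fun i => ?_) _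
    by_cases h : i ∈ C
    · simp only [h, if_true]
      fun_prop
    · simp only [h, if_false]
      fun_prop

/-- A (Hausdorff) smooth manifold, bundled together with its model with corners. All instances
used below are built from a manifold with boundary and `[0, ∞)` by products and blow-ups, and are
therefore locally diffeomorphic to some `Sector N C`. -/
structure Mfd : Type (u + 1) where
  {E : Type}
  [normed : NormedAddCommGroup E]
  [space : NormedSpace ℝ E]
  {H : Type}
  [topH : TopologicalSpace H]
  /-- the model with corners -/
  I : ModelWithCorners ℝ E H
  /-- the underlying set -/
  carrier : Type u
  [top : TopologicalSpace carrier]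
  [charted : ChartedSpace H carrier]
  [smooth : IsManifold I ∞ carrier]
  [hausdorff : T2Space carrier]

namespace Mfd

instance : CoeSort Mfd.{u} (Type u) := ⟨Mfd.carrier⟩

attribute [instance] Mfd.normed Mfd.space Mfd.topH Mfd.top Mfd.charted Mfd.smooth Mfd.hausdorff

/-- The product of two manifolds. -/
def prod (X Y : Mfd.{u}) : Mfd.{u} where
  I := X.I.prod Y.I
  carrier := X × Y

/-- The product `X × [0, ∞)`. The coordinate of a point `k` of the second factor is `k.val 0`. -/
def prodHalfLine (X : Mfd.{u}) : Mfd.{u} where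
  I := X.I.prod (𝓡∂ 1)
  carrier := X × EuclideanHalfSpace 1

/-- Diffeomorphisms between an open subset of `X` and an open subset of `Sector N C`. -/
abbrev CornerChart (X : Mfd.{u}) (N : ℕ) (C : Set (Fin N)) :=
  PartialDiffeomorph X.I (sectorModel N C) X (Sector N C) ∞

/-- The points of codimension `k`: in a local model exactly `k` of the half-line coordinates
vanish. -/
def codimSet (X : Mfd.{u}) (k : ℕ) : Set X :=
  {p | ∃ (N : ℕ) (C : Set (Fin N)) (φ : X.CornerChart N C), p ∈ φ.source ∧
    {i | i ∈ C ∧ (φ p).val i = 0}.ncard = k}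

/-- The boundary hypersurfaces: the closures of the connected components of the set of points of
codimension one. -/
def hypersurfaces (X : Mfd.{u}) : Set (Set X) :=
  {S | ∃ p ∈ X.codimSet 1, S = closure (connectedComponentIn (X.codimSet 1) p)}

end Mfd

/-- `ρ` is a defining function of `S`: smooth, nonnegative, vanishing exactly on `S`, with
differential nowhere zero on `S`. -/
structure IsDefiningFunction {X : Mfd.{u}} (S : Set X) (ρ : X → ℝ) : Prop where
  smooth : ContMDiff X.I 𝓘(ℝ, ℝ) ∞ ρ
  nonneg : ∀ p, 0 ≤ ρ p
  zero_iff : ∀ p, ρ p = 0 ↔ p ∈ S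
  mfderiv_ne : ∀ p ∈ S, mfderiv X.I 𝓘(ℝ, ℝ) ρ p ≠ 0

/-- b-maps: smooth maps `f : Y → X` such that, for defining functions `ρ S` and `ρ' S'` of the
boundary hypersurfaces of `X` and `Y`,
`f^*(ρ S) = h · ∏_{S'} (ρ' S') ^ e(S, S')` with `e(S, S') ∈ ℕ` and `h` smooth and nonvanishing.
(Two defining functions of the same hypersurface differ by a smooth positive factor, so the choice
of `ρ` and `ρ'` does not matter.) -/
def IsBMap {Y X : Mfd.{u}} (f : Y → X) : Prop :=
  ContMDiff Y.I X.I ∞ f ∧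
  ∃ (ρ : Set X → X → ℝ) (ρ' : Set Y → Y → ℝ) (e : Set X → Set Y →₀ ℕ),
    (∀ S ∈ X.hypersurfaces, IsDefiningFunction S (ρ S)) ∧
    (∀ S' ∈ Y.hypersurfaces, IsDefiningFunction S' (ρ' S')) ∧
    ∀ S ∈ X.hypersurfaces, (∀ S' ∈ (e S).support, S' ∈ Y.hypersurfaces) ∧
      ∃ h : Y → ℝ, ContMDiff Y.I 𝓘(ℝ, ℝ) ∞ h ∧ (∀ q, h q ≠ 0) ∧
        ∀ q, ρ S (f q) = h q * (e S).prod fun S' m => ρ' S' q ^ m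

/-! ## Blow-ups -/

/-- The blow-down map in projective coordinates. The centre is `{u | ∀ j ∈ S, u j = 0}`, the
coordinate `u i` with `i ∈ S` has sign `ε` and dominates the other ones with index in `S`:
`u i = ε t`, `u j = t v j` for the other `j ∈ S`, and `u j = v j` for `j ∉ S`, where `t = v i`. -/
def projMap {N : ℕ} (S : Set (Fin N)) (i : Fin N) (ε : ℝ) (v : Fin N → ℝ) : Fin N → ℝ := by
  classical
  exact fun j => if j = i then ε * v i else if j ∈ S then v i * v j else v j

/-- `ψ` is the projective coordinate system of `β : Y → X` belonging to the coordinate system `φ`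
of `X`, the index `i` and the sign `ε`. Its domain lies over that of `φ`, in `ψ` and `φ` the map
`β` is `projMap S i ε`, and `ψ` takes all values which this permits. -/
def IsProjectiveChart {X Y : Mfd.{u}} (β : Y → X) {N : ℕ} {C : Set (Fin N)}
    (φ : X.CornerChart N C) (S : Set (Fin N)) (i : Fin N) (ε : ℝ)
    (ψ : Y.CornerChart N (insert i C)) : Prop :=
  ψ.source ⊆ β ⁻¹' φ.source ∧
  ψ.target = {v | ∃ w ∈ φ.target, ∀ j, w.val j = projMap S i ε v.val j} ∧
  ∀ y ∈ ψ.source, ∀ j, (φ (β y)).val j = projMap S i ε (ψ y).val j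

/-- `Y`, with blow-down map `β : Y → X`, is the (spherical) blow-up `[X; P]` of the closed
p-submanifold `P` of `X`. Away from `P` the map `β` is a diffeomorphism. Near each point of `P`
there are coordinates of `X` in which `P` is a coordinate subspace `{u | ∀ i ∈ S, u i = 0}`, and
over their domain `Y` is covered by all the projective coordinate systems; the sign `ε` is `1` for
the half-line coordinates and `1` or `-1` for the others. Since `Y` is Hausdorff, these systems are
glued over `X \ P`, so that the fibre of `β` over a point of `P` is the set of inward unit normal
directions, and `(Y, β)` is unique up to a unique diffeomorphism over `X`. -/
structure IsBlowup {X Y : Mfd.{u}} (P : Set X) (β : Y → X) : Prop where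
  isClosed : IsClosed P
  smooth : ContMDiff Y.I X.I ∞ β
  diffeo_off : ∃ e : PartialDiffeomorph Y.I X.I Y X ∞,
    e.source = β ⁻¹' Pᶜ ∧ e.target = Pᶜ ∧ ∀ y ∈ e.source, e y = β y
  projective : ∀ p ∈ P, ∃ (N : ℕ) (C S : Set (Fin N)) (φ : X.CornerChart N C), p ∈ φ.source ∧
    (∀ q ∈ φ.source, q ∈ P ↔ ∀ i ∈ S, (φ q).val i = 0) ∧
    (∀ i ∈ S, ∀ ε : ℝ, (ε = 1 ∨ ε = -1 ∧ i ∉ C) →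
      ∃ ψ : Y.CornerChart N (insert i C), IsProjectiveChart β φ S i ε ψ) ∧
    ∀ y, β y ∈ φ.source → ∃ i ∈ S, ∃ ε : ℝ, (ε = 1 ∨ ε = -1 ∧ i ∉ C) ∧
      ∃ ψ : Y.CornerChart N (insert i C), IsProjectiveChart β φ S i ε ψ ∧ y ∈ ψ.source

open Classical in
/-- The lift of `Z` under the blow-down map `β` of the blow-up of `P`. -/
def lift {X Y : Type u} [TopologicalSpace Y] (β : Y → X) (P Z : Set X) : Set Y :=
  if Z ⊆ P then β ⁻¹' Z else closure (β ⁻¹' (Z \ P))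

/-- `IsIteratedBlowup X [P₁, …, Pₘ] Zs Y β Zs'` says that `Y`, with total blow-down map
`β : Y → X`, is obtained from `X` by blowing up `P₁`, then the lift of `P₂`, then the lift of the
lift of `P₃`, and so on. The list `Zs'` consists of the (iterated) lifts to `Y` of the sets in `Zs`,
followed by the lifts to `Y` of the front faces of the blow-ups of `P₁, …, Pₘ`, in this order. -/
inductive IsIteratedBlowup : (X : Mfd.{u}) → List (Set X) → List (Set X) →
    (Y : Mfd.{u}) → (Y → X) → List (Set Y) → Prop
  | nil (X : Mfd.{u}) (Zs : List (Set X)) : IsIteratedBlowup X [] Zs X id Zs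
  | cons {X X₁ Y : Mfd.{u}} {P : Set X} {Ps Zs : List (Set X)} {β : X₁ → X} {γ : Y → X₁}
      {Zs' : List (Set Y)} (hβ : IsBlowup P β)
      (hγ : IsIteratedBlowup X₁ (Ps.map (lift β P)) (Zs.map (lift β P) ++ [β ⁻¹' P]) Y γ Zs') :
      IsIteratedBlowup X (P :: Ps) Zs Y (β ∘ γ) Zs'

/-! ## Fibred boundaries -/

/-- `φ : D → B` is a smooth fibre bundle with fibre `F`. -/
def IsFibration (d b f : ℕ) {D B : Type*} (F : Type*)
    [TopologicalSpace D] [ChartedSpace (EuclideanSpace ℝ (Fin d)) D]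
    [TopologicalSpace B] [ChartedSpace (EuclideanSpace ℝ (Fin b)) B]
    [TopologicalSpace F] [ChartedSpace (EuclideanSpace ℝ (Fin f)) F] (φ : D → B) : Prop :=
  ∀ y : B, ∃ U : Set B, IsOpen U ∧ y ∈ U ∧
    ∃ Ψ : PartialDiffeomorph (𝓡 d) ((𝓡 b).prod (𝓡 f)) D (B × F) ∞,
      Ψ.source = φ ⁻¹' U ∧ Ψ.target = U ×ˢ univ ∧ ∀ a ∈ Ψ.source, (Ψ a).1 = φ a

/-- A manifold with boundary, as an object of `Mfd`. -/
def mfdOf (n : ℕ) [NeZero n] (M : Type u) [TopologicalSpace M]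
    [ChartedSpace (EuclideanHalfSpace n) M] [IsManifold (𝓡∂ n) ∞ M] [T2Space M] : Mfd.{u} where
  I := 𝓡∂ n
  carrier := M

/-- For a boundary given as the image of `ι : D → M`: the points `p` and `p'` of `M` lie on the
boundary, and `φ(p) = φ(p')`. -/
def sameFibre {D B : Type*} {M : Type u} (ι : D → M) (φ : D → B) (p p' : M) : Prop :=
  ∃ a a' : D, ι a = p ∧ ι a' = p' ∧ φ a = φ a'

/-- For a map `t = (p, p') : Y → M × M` and `x : M → ℝ`: the function `x(p) / x(p')`, defined over
the interior, tends to `1` at `q`. Wherever this quotient extends to a smooth function `s` this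
says that `s = 1` at `q`. -/
def RatioOneAt {Y M : Type*} [TopologicalSpace Y] (x : M → ℝ) (t : Y → M × M) (q : Y) : Prop :=
  Tendsto (fun q' => x (t q').1 / x (t q').2) (𝓝[{q' | 0 < x (t q').1 ∧ 0 < x (t q').2}] q) (𝓝 1)

section Spaces

variable (M : Mfd.{u}) (x : M → ℝ) (R : M → M → Prop)

/-- The `φ`-double space `M²_φ`, i.e. `[M²_b; diag_φ]` with `M²_b = [M²; ∂M × ∂M]` and
`diag_φ = {s = 1, φ(p) = φ(p')}` in the front face of `M²_b`. Here `x` is the boundary defining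
function, `s` is the extension of `x(p) / x(p')`, and `R p p'` is the relation that `p, p'` are
boundary points with `φ(p) = φ(p')`. -/
structure PhiDouble where
  /-- the b-double space -/
  Mb : Mfd.{u}
  /-- the blow-down map of the b-double space -/
  βb : Mb → M.prod M
  blowup_b : IsBlowup (X := M.prod M) {p | x p.1 = 0 ∧ x p.2 = 0} βb
  /-- the `φ`-double space -/
  space : Mfd.{u}
  /-- the blow-down map to the b-double space -/
  βφ : space → Mb
  blowup_φ : IsBlowup
    {q | (x (βb q).1 = 0 ∧ x (βb q).2 = 0) ∧ RatioOneAt x βb q ∧ R (βb q).1 (βb q).2} βφ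

namespace PhiDouble

variable {M x R} (W : PhiDouble M x R)

/-- The total blow-down map to `M × M`. -/
def total : W.space → M.prod M := W.βb ∘ W.βφ

/-- The corner `∂M × ∂M`. -/
def corner (_W : PhiDouble M x R) : Set (M.prod M) := {p | x p.1 = 0 ∧ x p.2 = 0}

/-- The fibre diagonal in the front face of `M²_b`. -/
def diag : Set W.Mb :=
  {q | (x (W.βb q).1 = 0 ∧ x (W.βb q).2 = 0) ∧ RatioOneAt x W.βb q ∧ R (W.βb q).1 (W.βb q).2}

/-- The face `bf`: the lift of the front face of `M²_b`. -/
def bf : Set W.space := lift W.βφ W.diag (W.βb ⁻¹' W.corner)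

/-- The face `φf`: the front face of the blow-up of `diag_φ`. -/
def φf : Set W.space := W.βφ ⁻¹' W.diag

/-- The face `lf`: the lift of `∂M × M`. -/
def lf : Set W.space := lift W.βφ W.diag (lift W.βb W.corner {p | x p.1 = 0})

/-- The face `rf`: the lift of `M × ∂M`. -/
def rf : Set W.space := lift W.βφ W.diag (lift W.βb W.corner {p | x p.2 = 0})

/-- The product `f × {0}` in `M²_φ × [0, ∞)`. -/
def timesZero (f : Set W.space) : Set W.space.prodHalfLine := {q | q.1 ∈ f ∧ q.2.val 0 = 0}

end PhiDouble

/-- The corner `∂M × ∂M × {0}` of `M × M × [0, ∞)`. -/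
def C111 : Set (M.prod M).prodHalfLine := {p | x p.1.1 = 0 ∧ x p.1.2 = 0 ∧ p.2.val 0 = 0}

/-- The corner `M × ∂M × {0}`. -/
def C011 : Set (M.prod M).prodHalfLine := {p | x p.1.2 = 0 ∧ p.2.val 0 = 0}

/-- The corner `∂M × M × {0}`. -/
def C101 : Set (M.prod M).prodHalfLine := {p | x p.1.1 = 0 ∧ p.2.val 0 = 0}

/-- The corner `∂M × ∂M × [0, ∞)`. -/
def C110 : Set (M.prod M).prodHalfLine := {p | x p.1.1 = 0 ∧ x p.1.2 = 0}

/-- The space `M²_{k,b}`: the blow-up of `M × M × [0, ∞)` in `C111` and then in (the lifts of)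
`C011`, `C101`, `C110`. -/
structure KBDouble where
  Y₁ : Mfd.{u}
  β₁ : Y₁ → (M.prod M).prodHalfLine
  blowup₁ : IsBlowup (C111 M x) β₁
  Y₂ : Mfd.{u}
  β₂ : Y₂ → Y₁
  blowup₂ : IsBlowup (lift β₁ (C111 M x) (C011 M x)) β₂
  Y₃ : Mfd.{u}
  β₃ : Y₃ → Y₂
  blowup₃ : IsBlowup (lift β₂ (lift β₁ (C111 M x) (C011 M x)) (lift β₁ (C111 M x) (C101 M x))) β₃
  space : Mfd.{u}
  β₄ : space → Y₃
  blowup₄ : IsBlowup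
    (lift β₃ (lift β₂ (lift β₁ (C111 M x) (C011 M x)) (lift β₁ (C111 M x) (C101 M x)))
      (lift β₂ (lift β₁ (C111 M x) (C011 M x)) (lift β₁ (C111 M x) (C110 M x)))) β₄

namespace KBDouble

variable {M x} (K : KBDouble M x)

/-- The total blow-down map of `M²_{k,b}`. -/
def total : K.space → (M.prod M).prodHalfLine := K.β₁ ∘ K.β₂ ∘ K.β₃ ∘ K.β₄

/-- The face `bf` of `M²_{k,b}`: the front face of the blow-up of (the lift of) `C110`. -/
def bf : Set K.space := K.β₄ ⁻¹'
  (lift K.β₃ (lift K.β₂ (lift K.β₁ (C111 M x) (C011 M x)) (lift K.β₁ (C111 M x) (C101 M x)))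
    (lift K.β₂ (lift K.β₁ (C111 M x) (C011 M x)) (lift K.β₁ (C111 M x) (C110 M x))))

/-- The fibre diagonal `diag_{k,sc,φ} = {ζ = 1, φ(p) = φ(p')}` in `bf`; `ζ` is the extension of
`x(p) / x(p')`. -/
def diagSc (R : M → M → Prop) : Set K.space :=
  {q | q ∈ K.bf ∧ RatioOneAt x (fun q' => (K.total q').1) q ∧ R (K.total q).1.1 (K.total q).1.2}

/-- For a map `β₅ : Y → M²_{k,b}`, the closure of the set of the points of `Y` over `C111`, but not
over `bf`, for which `ζ = 1` and `φ(p) = φ(p')`. For `Y = M²_{k,sc,φ}` this is `diag_{k,φ}`: away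
from `bf` and the face `sc` over it, i.e. for `ξ' = x' / k > 0`, the equations `X = (ζ - 1) / ξ' = 0`
and `U = (y - y') / ξ' = 0` say that `ζ = 1` and `y = y'`. -/
def diagPhi (R : M → M → Prop) {Y : Mfd.{u}} (β₅ : Y → K.space) : Set Y :=
  closure {q | K.total (β₅ q) ∈ C111 M x ∧ β₅ q ∉ K.bf ∧
    RatioOneAt x (fun q' => (K.total (β₅ q')).1) q ∧
    R (K.total (β₅ q)).1.1 (K.total (β₅ q)).1.2}

end KBDouble

/-- The space `M²_{k,φ}`, the blow-up of `M²_{k,b}` in `diag_{k,sc,φ}`, which gives `M²_{k,sc,φ}`,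
and then in `diag_{k,φ}`. -/
structure KPhiDouble where
  /-- the space `M²_{k,b}` -/
  Kb : KBDouble M x
  /-- the space `M²_{k,sc,φ}` -/
  Ksc : Mfd.{u}
  β₅ : Ksc → Kb.space
  blowup₅ : IsBlowup (Kb.diagSc R) β₅
  /-- the space `M²_{k,φ}` -/
  space : Mfd.{u}
  β₆ : space → Ksc
  blowup₆ : IsBlowup (Kb.diagPhi R β₅) β₆

namespace KPhiDouble

variable {M x R} (K : KPhiDouble M x R)

/-- The total blow-down map `β_{k,φ}` of `M²_{k,φ}`. -/
def total : K.space → (M.prod M).prodHalfLine := K.Kb.total ∘ K.β₅ ∘ K.β₆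

/-- The face `φf₀` of `M²_{k,φ}`: the front face of the blow-up of `diag_{k,φ}`. -/
def φf₀ : Set K.space := K.β₆ ⁻¹' (K.Kb.diagPhi R K.β₅)

end KPhiDouble

end Spaces

end

/-!
Blow-ups are compared through functions. Let `P` be a p-submanifold, the ideal of which is generated
by smooth functions `g a`. The blow-up of `P` is the closure of the graph of `g / |g|` over the
complement of `P`; it carries the direction `θ`, the extension of `g / |g|`, and the function `ρ`
defining the front face, with `g = ρ θ` (`Blow`, `exists_blow`). A smooth map `f` lifts to the
blow-up as soon as the ideal becomes principal along `f`, i.e. `g ∘ f = t w` where `w` is nowhere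
zero, `t ≥ 0`, and `t ≠ 0` on a dense set (`Blow.exists_lift`). Every blow-up in the sense of
projective coordinate charts arises in this way (`IsBlowup.exists_blow`). Hence two spaces over the
same base, obtained by different chains of blow-ups, are diffeomorphic if on each of them the ideals
blown up for the other one become principal, one after the other: the two lifts are inverse to each
other over the interior, hence everywhere (`exists_diffeo`).

For the existence of the successive blow-ups, a space is considered together with defining functions
`r l` of all its boundary hypersurfaces (`LC`), and a centre inside a hypersurface together with
functions `Z a` which, up to multiples of a defining function, generate the ideal of a coordinate
subspace (`LCZ`). Both structures are inherited by the blow-up of a corner (`CornerBlow`) and of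
such a centre (`RelBlow`), and the old defining functions pull back to monomials in the new ones.

Let `E` be a family of functions on `M` extending the composition of the fibration `φ` with an
embedding of `B` (`exists_fibredBoundary`); this uses coordinates of `M` near the boundary in which
some of the coordinates are those of `B`. On the b-double space, with `x = ρ l` and `x' = ρ r`, the
fibre diagonal is given by `ρ = 0`, `l - r = 0` and `E(p) - E(p') = 0`. It is a p-submanifold, since
`l - r` and `E(p) - E(p')` are part of a coordinate system near it (`FibredBoundary.lcz`). So `M²_φ`
exists. The space `M²_{k,b}` turns out to be the blow-up of `M²_b × [0, ∞)` in the corner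
`ρ = k = 0` and then in the disjoint corners `l = k = 0` and `r = k = 0`. In terms of this, the
centre `diag_{k,sc,φ}` is given by `l - r`, `E(p) - E(p')` and the defining function of `bf`, and
`diag_{k,φ}` by the quotients of the first two by the defining function of the front face over
`diag_{k,sc,φ}`, together with the defining function of the front face over `ρ = k = 0`
(`KBDouble.diagPhi_eq`). So `M²_{k,φ}` exists.

Finally, the ideals of the corners `bf × {0}`, `φf × {0}`, `lf × {0}` and `rf × {0}` of
`M²_φ × [0, ∞)` become principal on `M²_{k,φ}` (`KTower.exists_map`), and conversely
(`KTower.exists_inv`), which identifies `M²_{k,φ}` with the iterated blow-up. The faces `φf`, `lf`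
and `rf` are pairwise disjoint, so that the last three blow-ups may be done in any order. The face
`φf₀` is found by comparing zero sets of functions, and the blow-down map is a b-map because the
defining functions pull back to monomials (`IsMonomial.isBMap`).
-/

noncomputable section

/-- Smooth real functions on a manifold. -/
notation "Smooth[" X "]" => ContMDiff (Mfd.I X) 𝓘(ℝ, ℝ) ∞

/-- Real functions which are smooth on a subset of a manifold. -/
notation "SmoothOn[" X "]" => ContMDiffOn (Mfd.I X) 𝓘(ℝ, ℝ) ∞

/-! ### Coordinate systems with values in a sector -/

/-- The sector of `κ → ℝ` in which the coordinates with index in `C` are nonnegative. -/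
def sect {κ : Type} (C : Set κ) : Set (κ → ℝ) := {v | ∀ i ∈ C, 0 ≤ v i}

section sect
variable {κ : Type} {C : Set κ}

lemma mem_sect {v : κ → ℝ} : v ∈ sect C ↔ ∀ i ∈ C, 0 ≤ v i := Iff.rfl

lemma convex_sect : Convex ℝ (sect C) := by
  intro v hv w hw a b ha hb _ i hi; have h1 := hv i hi; have h2 := hw i hi
  simp only [Pi.add_apply, Pi.smul_apply, smul_eq_mul]; positivity

variable [Fintype κ]

lemma interior_sect_nonempty : (interior (sect C)).Nonempty := by
  refine ⟨fun _ => 1, mem_interior.2 ⟨⋂ i : κ, {v | 0 < v i}, ?_, ?_, ?_⟩⟩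
  · intro v hv i _; exact le_of_lt (mem_iInter.1 hv i)
  · exact isOpen_iInter_of_finite fun i => isOpen_lt continuous_const (continuous_apply i)
  · simp

lemma uniqueDiffOn_sect : UniqueDiffOn ℝ (sect C) :=
  uniqueDiffOn_convex convex_sect interior_sect_nonempty

lemma uniqueDiffOn_relOpen {T : Set (κ → ℝ)} (h : ∃ O, IsOpen O ∧ T = O ∩ sect C) :
    UniqueDiffOn ℝ T := by
  obtain ⟨O, hO, rfl⟩ := h; rw [inter_comm]; exact uniqueDiffOn_sect.inter hO

end sect

/-- A coordinate system on an open subset of `X`: a diffeomorphism onto a relatively open subset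
of the sector `sect C` of `κ → ℝ`. In contrast to `Mfd.CornerChart` the index type is arbitrary and
smoothness on the sector is smoothness within a subset of the vector space. -/
structure Crd (X : Mfd.{u}) (κ : Type) [Fintype κ] (C : Set κ) where
  /-- the coordinates -/
  toFun : X → κ → ℝ
  /-- the inverse -/
  inv : (κ → ℝ) → X
  /-- the domain -/
  source : Set X
  /-- the set of values -/
  target : Set (κ → ℝ)
  open_source : IsOpen source
  open_target : ∃ O, IsOpen O ∧ target = O ∩ sect C
  map_source : ∀ q ∈ source, toFun q ∈ target
  map_target : ∀ v ∈ target, inv v ∈ source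
  left_inv : ∀ q ∈ source, inv (toFun q) = q
  right_inv : ∀ v ∈ target, toFun (inv v) = v
  smooth : ContMDiffOn X.I 𝓘(ℝ, κ → ℝ) ∞ toFun source
  smooth_inv : ContMDiffOn 𝓘(ℝ, κ → ℝ) X.I ∞ inv target

namespace Crd

variable {X Y : Mfd.{u}} {κ κ' : Type} [Fintype κ] [Fintype κ'] {C : Set κ} {C' : Set κ'}

instance : CoeFun (Crd X κ C) fun _ => X → κ → ℝ := ⟨Crd.toFun⟩

lemma target_subset (c : Crd X κ C) : c.target ⊆ sect C := by
  obtain ⟨O, _, h⟩ := c.open_target; grind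

lemma uniqueDiffOn (c : Crd X κ C) : UniqueDiffOn ℝ c.target := uniqueDiffOn_relOpen c.open_target

lemma nonneg (c : Crd X κ C) {q : X} (hq : q ∈ c.source) {i : κ} (hi : i ∈ C) : 0 ≤ c q i :=
  c.target_subset (c.map_source q hq) i hi

lemma injOn (c : Crd X κ C) : InjOn c c.source := fun a ha b hb h => by
  rw [← c.left_inv a ha, ← c.left_inv b hb]; exact congrArg c.inv h

lemma continuousOn (c : Crd X κ C) : ContinuousOn c c.source := c.smooth.continuousOn

lemma continuousOn_inv (c : Crd X κ C) : ContinuousOn c.inv c.target := c.smooth_inv.continuousOn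

lemma smooth_apply (c : Crd X κ C) (i : κ) :
    SmoothOn[X] (fun q => c q i) c.source :=
  (contMDiff_iff_contDiff.2 (contDiff_apply ℝ ℝ i)).comp_contMDiffOn c.smooth

lemma mem_nhds (c : Crd X κ C) {q : X} (hq : q ∈ c.source) : c.source ∈ 𝓝 q :=
  c.open_source.mem_nhds hq

lemma isOpen_inter_preimage (c : Crd X κ C) {O : Set (κ → ℝ)} (hO : IsOpen O) :
    IsOpen (c.source ∩ c ⁻¹' O) :=
  c.continuousOn.isOpen_inter_preimage c.open_source hO

lemma relOpen_inv_preimage (c : Crd X κ C) {U : Set X} (hU : IsOpen U) :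
    ∃ O, IsOpen O ∧ c.target ∩ c.inv ⁻¹' U = O ∩ sect C := by
  obtain ⟨O₁, h1, e1⟩ := c.open_target
  obtain ⟨u, hu, e⟩ := continuousOn_iff'.1 c.continuousOn_inv U hU; refine ⟨u ∩ O₁, hu.inter h1, ?_⟩
  grind

/-- The restriction of a coordinate system to an open set. -/
def restrict (c : Crd X κ C) (U : Set X) (hU : IsOpen U) : Crd X κ C where
  toFun := c
  inv := c.inv
  source := c.source ∩ U
  target := c.target ∩ c.inv ⁻¹' U
  open_source := c.open_source.inter hU
  open_target := c.relOpen_inv_preimage hU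
  map_source q hq := ⟨c.map_source q hq.1, by
    change c.inv (c q) ∈ U
    rw [c.left_inv q hq.1]; exact hq.2⟩
  map_target v hv := ⟨c.map_target v hv.1, hv.2⟩
  left_inv q hq := c.left_inv q hq.1
  right_inv v hv := c.right_inv v hv.1
  smooth := c.smooth.mono inter_subset_left
  smooth_inv := c.smooth_inv.mono inter_subset_left

/-- The pull-back of a coordinate system by a diffeomorphism between open sets. -/
def pullback (c : Crd X κ C) (e : PartialDiffeomorph Y.I X.I Y X ∞) : Crd Y κ C where
  toFun q := c (e q)
  inv v := e.symm (c.inv v)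
  source := e.source ∩ e ⁻¹' c.source
  target := c.target ∩ c.inv ⁻¹' e.target
  open_source := e.contMDiffOn_toFun.continuousOn.isOpen_inter_preimage e.open_source c.open_source
  open_target := c.relOpen_inv_preimage e.open_target
  map_source q hq := ⟨c.map_source _ hq.2, by
    change c.inv (c (e q)) ∈ e.target
    rw [c.left_inv _ hq.2]; exact e.map_source' hq.1⟩
  map_target v hv := ⟨e.map_target' hv.2, by
    change e (e.symm (c.inv v)) ∈ c.source
    have : e (e.symm (c.inv v)) = c.inv v := e.right_inv' hv.2
    rw [this]; exact c.map_target v hv.1⟩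
  left_inv q hq := by rw [c.left_inv _ hq.2]; exact e.left_inv' hq.1
  right_inv v hv := by
    have : e (e.symm (c.inv v)) = c.inv v := e.right_inv' hv.2; rw [this, c.right_inv v hv.1]
  smooth := c.smooth.comp (e.contMDiffOn_toFun.mono inter_subset_left) inter_subset_right
  smooth_inv := e.contMDiffOn_invFun.comp (c.smooth_inv.mono inter_subset_left) inter_subset_right

/-- A change of coordinates. -/
def change (c : Crd X κ C) (Θ : (κ → ℝ) → κ' → ℝ) (Θ' : (κ' → ℝ) → κ → ℝ)
    {O : Set (κ → ℝ)} {O' : Set (κ' → ℝ)} (hO : IsOpen O) (hO' : IsOpen O')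
    (hΘ : ContDiffOn ℝ ∞ Θ (O ∩ sect C)) (hΘ' : ContDiffOn ℝ ∞ Θ' (O' ∩ sect C'))
    (hm : MapsTo Θ (O ∩ sect C) (O' ∩ sect C')) (hm' : MapsTo Θ' (O' ∩ sect C') (O ∩ sect C))
    (hl : ∀ v ∈ O ∩ sect C, Θ' (Θ v) = v) (hr : ∀ v ∈ O' ∩ sect C', Θ (Θ' v) = v) :
    Crd X κ' C' where
  toFun q := Θ (c q)
  inv v := c.inv (Θ' v)
  source := c.source ∩ c ⁻¹' O
  target := (O' ∩ sect C') ∩ Θ' ⁻¹' c.target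
  open_source := c.isOpen_inter_preimage hO
  open_target := by
    obtain ⟨O₁, h1, e1⟩ := c.open_target
    obtain ⟨u, hu, e⟩ := continuousOn_iff'.1 hΘ'.continuousOn O₁ h1
    refine ⟨u ∩ O', hu.inter hO', ?_⟩; rw [inter_assoc u O' (sect C'), ← e]; ext v; constructor
    · grind
    · rintro ⟨h', h⟩; refine ⟨h, ?_⟩; rw [mem_preimage, e1]; exact ⟨h', (hm' h).2⟩
  map_source q hq := by
    have h := c.map_source q hq.1; have h2 : c q ∈ O ∩ sect C := ⟨hq.2, c.target_subset h⟩
    refine ⟨hm h2, ?_⟩; grind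
  map_target v hv := by
    refine ⟨c.map_target _ hv.2, ?_⟩; change c (c.inv (Θ' v)) ∈ O
    rw [c.right_inv _ hv.2]; exact (hm' hv.1).1
  left_inv q hq := by rw [hl _ ⟨hq.2, c.target_subset (c.map_source q hq.1)⟩, c.left_inv q hq.1]
  right_inv v hv := by rw [c.right_inv _ hv.2, hr _ hv.1]
  smooth := (contMDiffOn_iff_contDiffOn.2 hΘ).comp (c.smooth.mono inter_subset_left)
    fun q hq => ⟨hq.2, c.target_subset (c.map_source q hq.1)⟩
  smooth_inv := c.smooth_inv.comp (contMDiffOn_iff_contDiffOn.2 (hΘ'.mono inter_subset_left))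
    fun v hv => hv.2

/-- Renaming the indices of a coordinate system. -/
def reindex (c : Crd X κ C) (e : κ ≃ κ') : Crd X κ' (e '' C) where
  toFun q i := c q (e.symm i)
  inv v := c.inv fun i => v (e i)
  source := c.source
  target := {v | (fun i => v (e i)) ∈ c.target}
  open_source := c.open_source
  open_target := by
    obtain ⟨O, hO, h⟩ := c.open_target
    refine ⟨{v | (fun i => v (e i)) ∈ O}, hO.preimage (by fun_prop), ?_⟩
    ext v
    simp only [h, mem_ofPred_eq, mem_inter_iff, sect, mem_image, forall_exists_index, and_imp]
    grind
  map_source q hq := by simpa using c.map_source q hq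
  map_target v hv := c.map_target _ hv
  left_inv q hq := by simpa using c.left_inv q hq
  right_inv v hv := by ext i; simp [c.right_inv _ hv]
  smooth := (contMDiff_iff_contDiff.2 (show ContDiff ℝ ∞ fun (v : κ → ℝ) i => v (e.symm i) by
    fun_prop)).comp_contMDiffOn c.smooth
  smooth_inv := c.smooth_inv.comp (contMDiff_iff_contDiff.2
    (show ContDiff ℝ ∞ fun (v : κ' → ℝ) i => v (e i) by fun_prop)).contMDiffOn fun v hv => hv

end Crd

/-! Conversion between coordinate systems and corner charts. -/

lemma sectorModel_val_smooth (N : ℕ) (C : Set (Fin N)) :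
    ContMDiff (sectorModel N C) 𝓘(ℝ, EuclideanSpace ℝ (Fin N)) ∞
      (Subtype.val : Sector N C → EuclideanSpace ℝ (Fin N)) :=
  (sectorModel N C).contMDiff

lemma range_sectorModel (N : ℕ) (C : Set (Fin N)) :
    range (sectorModel N C) = {v | ∀ i ∈ C, 0 ≤ v i} :=
  Subtype.range_val

lemma sectorModel_symm_val {N : ℕ} {C : Set (Fin N)} {v : EuclideanSpace ℝ (Fin N)}
    (hv : ∀ i ∈ C, 0 ≤ v i) : ((sectorModel N C).symm v).val = v :=
  (sectorModel N C).right_inv (by rw [range_sectorModel]; exact hv)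

lemma sectorModel_symm_coe {N : ℕ} {C : Set (Fin N)} (v : Sector N C) :
    (sectorModel N C).symm v.val = v :=
  (sectorModel N C).left_inv v

namespace Crd
variable {X Y : Mfd.{u}} {N : ℕ} {C : Set (Fin N)}

/-- The coordinate system given by a corner chart. -/
def ofChart (φ : X.CornerChart N C) : Crd X (Fin N) C where
  toFun q i := (φ q).val i
  inv v := φ.symm ((sectorModel N C).symm (WithLp.toLp 2 v))
  source := φ.source
  target := {v | v ∈ sect C ∧ (sectorModel N C).symm (WithLp.toLp 2 v) ∈ φ.target}
  open_source := φ.open_source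
  open_target := by
    refine ⟨{v | (sectorModel N C).symm (WithLp.toLp 2 v) ∈ φ.target}, ?_, ?_⟩
    · exact φ.open_target.preimage
        ((sectorModel N C).continuous_symm.comp (PiLp.continuous_toLp 2 _))
    · ext v; exact and_comm
  map_source q hq := by
    refine ⟨(φ q).2, ?_⟩; change (sectorModel N C).symm (φ q).val ∈ _; rw [sectorModel_symm_coe]
    exact φ.map_source' hq
  map_target v hv := φ.map_target' hv.2
  left_inv q hq := by
    change φ.symm ((sectorModel N C).symm (φ q).val) = q; rw [sectorModel_symm_coe]
    exact φ.left_inv' hq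
  right_inv v hv := by
    have : φ (φ.symm ((sectorModel N C).symm (WithLp.toLp 2 v))) = _ := φ.right_inv' hv.2
    rw [this, sectorModel_symm_val (v := WithLp.toLp 2 v) hv.1]
  smooth := by
    have h := (sectorModel_val_smooth N C).comp_contMDiffOn φ.contMDiffOn_toFun
    exact (contMDiff_iff_contDiff.2 (PiLp.contDiff_ofLp)).comp_contMDiffOn h
  smooth_inv := by
    refine φ.contMDiffOn_invFun.comp (t := φ.target) ?_ fun v hv => hv.2
    refine (sectorModel N C).contMDiffOn_symm.comp (t := range (sectorModel N C))
      (contMDiff_iff_contDiff.2 PiLp.contDiff_toLp).contMDiffOn ?_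
    intro v hv; rw [mem_preimage, range_sectorModel]; exact hv.1

/-- The corner chart given by a coordinate system. -/
def toChart (c : Crd X (Fin N) C) : X.CornerChart N C where
  toFun q := (sectorModel N C).symm (WithLp.toLp 2 (c q))
  invFun v := c.inv v.val
  source := c.source
  target := {v | (v.val : Fin N → ℝ) ∈ c.target}
  map_source' q hq := by
    have := c.map_source q hq
    rw [mem_ofPred_eq, sectorModel_symm_val (v := WithLp.toLp 2 (c q)) (c.target_subset this)]
    exact this
  map_target' v hv := c.map_target _ hv
  left_inv' q hq := by
    have := c.map_source q hq
    rw [sectorModel_symm_val (v := WithLp.toLp 2 (c q)) (c.target_subset this)]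
    exact c.left_inv q hq
  right_inv' v hv := by rw [c.right_inv _ hv]; exact sectorModel_symm_coe v
  open_source := c.open_source
  open_target := by
    obtain ⟨O, hO, h⟩ := c.open_target
    have : {v : Sector N C | (v.val : Fin N → ℝ) ∈ c.target}
        = (fun v : Sector N C => (v.val : Fin N → ℝ)) ⁻¹' O := by
      ext v; simp only [mem_ofPred_eq, mem_preimage, h, mem_inter_iff, and_iff_left_iff_imp]
      exact fun _ => v.2
    rw [this]; exact hO.preimage ((PiLp.continuous_ofLp 2 _).comp continuous_subtype_val)
  contMDiffOn_toFun := by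
    refine (sectorModel N C).contMDiffOn_symm.comp (t := range (sectorModel N C))
      ((contMDiff_iff_contDiff.2 PiLp.contDiff_toLp).comp_contMDiffOn c.smooth) ?_
    intro q hq; rw [mem_preimage, range_sectorModel]; exact c.target_subset (c.map_source q hq)
  contMDiffOn_invFun := by
    refine c.smooth_inv.comp (t := c.target) ?_ fun v hv => hv
    exact ((contMDiff_iff_contDiff.2 PiLp.contDiff_ofLp).comp
      (sectorModel_val_smooth N C)).contMDiffOn

lemma toChart_val (c : Crd X (Fin N) C) {q : X} (hq : q ∈ c.source) (i : Fin N) :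
    (c.toChart q).val i = c q i := by
  change ((sectorModel N C).symm (WithLp.toLp 2 (c q))).val i = _
  rw [sectorModel_symm_val (v := WithLp.toLp 2 (c q)) (c.target_subset (c.map_source q hq))]

end Crd

/-! ### Integrals depending on a parameter in a convex set -/

section Param

variable {E F : Type} [NormedAddCommGroup E] [NormedSpace ℝ E] [NormedAddCommGroup F]
  [NormedSpace ℝ F]

lemma intervalIntegrable_of_continuousOn_prod {f : E → ℝ → F} {T : Set E}
    (hf : ContinuousOn (Function.uncurry f) (T ×ˢ Icc 0 1)) {v : E} (hv : v ∈ T) :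
    IntervalIntegrable (f v) MeasureTheory.volume 0 1 := by
  apply ContinuousOn.intervalIntegrable; rw [uIcc_of_le zero_le_one]
  exact hf.comp (f := fun τ : ℝ => (v, τ)) (by fun_prop) fun τ hτ => ⟨hv, hτ⟩

/-- The set `T` need not be open or locally compact, so that compactness of the interval is used. -/
lemma continuousOn_integral_of_continuousOn_prod {f : E → ℝ → F} {T : Set E}
    (hf : ContinuousOn (Function.uncurry f) (T ×ˢ Icc 0 1)) :
    ContinuousOn (fun v => ∫ τ in (0 : ℝ)..1, f v τ) T := by
  intro v hv; rw [ContinuousWithinAt, Metric.tendsto_nhds]; intro ε hε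
  obtain ⟨w, hw, h⟩ := isCompact_Icc.mem_uniformity_of_prod hf hv
    (Metric.dist_mem_uniformity (half_pos hε))
  filter_upwards [hw, self_mem_nhdsWithin] with v' hv' hv'T
  rw [dist_eq_norm, ← intervalIntegral.integral_sub
    (intervalIntegrable_of_continuousOn_prod hf hv'T)
    (intervalIntegrable_of_continuousOn_prod hf hv)]
  have := intervalIntegral.norm_integral_le_of_norm_le_const (a := 0) (b := 1) (C := ε / 2)
    (f := fun τ => f v' τ - f v τ) fun τ hτ => by
      rw [uIoc_of_le zero_le_one] at hτ; have := h v' hv' τ (Ioc_subset_Icc_self hτ)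
      rw [← dist_eq_norm]; exact le_of_lt this
  simp only [sub_zero, abs_one, mul_one] at this; linarith

variable [CompleteSpace F]

/-- Differentiation under the integral sign, within a convex set. -/
lemma hasFDerivWithinAt_integral {f : E → ℝ → F} {f' : E → ℝ → E →L[ℝ] F} {T : Set E}
    (hT : Convex ℝ T) (hf : ContinuousOn (Function.uncurry f) (T ×ˢ Icc 0 1))
    (hf' : ContinuousOn (Function.uncurry f') (T ×ˢ Icc 0 1))
    (hd : ∀ τ ∈ Icc (0 : ℝ) 1, ∀ v ∈ T, HasFDerivWithinAt (fun v => f v τ) (f' v τ) T v)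
    {v : E} (hv : v ∈ T) :
    HasFDerivWithinAt (fun v => ∫ τ in (0 : ℝ)..1, f v τ) (∫ τ in (0 : ℝ)..1, f' v τ) T v := by
  rw [hasFDerivWithinAt_iff_isLittleO, Asymptotics.isLittleO_iff]; intro ε hε
  obtain ⟨w, hw, h⟩ := isCompact_Icc.mem_uniformity_of_prod hf' hv
    (Metric.dist_mem_uniformity hε)
  obtain ⟨δ, hδ, hδw⟩ := Metric.mem_nhdsWithin_iff.1 hw
  have hball : Metric.ball v δ ∩ T ∈ 𝓝[T] v :=
    inter_mem (mem_nhdsWithin_of_mem_nhds (Metric.ball_mem_nhds v hδ)) self_mem_nhdsWithin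
  filter_upwards [hball] with v' hv'
  have i1 := intervalIntegrable_of_continuousOn_prod hf hv
  have i2 := intervalIntegrable_of_continuousOn_prod hf hv'.2
  have i3 := intervalIntegrable_of_continuousOn_prod hf' hv
  have i4 : IntervalIntegrable (fun τ => f' v τ (v' - v)) MeasureTheory.volume 0 1 := by
    apply ContinuousOn.intervalIntegrable; rw [uIcc_of_le zero_le_one]
    have : ContinuousOn (fun τ => f' v τ) (Icc 0 1) :=
      hf'.comp (f := fun τ : ℝ => (v, τ)) (by fun_prop) fun τ hτ => ⟨hv, hτ⟩
    exact this.clm_apply continuousOn_const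
  rw [ContinuousLinearMap.intervalIntegral_apply i3, ← intervalIntegral.integral_sub i2 i1,
    ← intervalIntegral.integral_sub (i2.sub i1) i4]
  have := intervalIntegral.norm_integral_le_of_norm_le_const (a := 0) (b := 1)
    (C := ε * ‖v' - v‖) (f := fun τ => f v' τ - f v τ - f' v τ (v' - v)) fun τ hτ => by
      rw [uIoc_of_le zero_le_one] at hτ; have hτ' := Ioc_subset_Icc_self hτ
      refine Convex.norm_image_sub_le_of_norm_hasFDerivWithin_le'
        (s := Metric.ball v δ ∩ T) (f := fun v => f v τ) (f' := fun v => f' v τ)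
        (fun u hu => (hd τ hτ' u hu.2).mono inter_subset_right) (fun u hu => ?_)
        ((convex_ball v δ).inter hT) ⟨Metric.mem_ball_self hδ, hv⟩ hv'
      have := h u (hδw hu) τ hτ'; rw [← dist_eq_norm]; exact le_of_lt this
  simpa using this

end Param

/-- Integrals of a smooth function along a family of linear maps preserving a convex set depend
smoothly on the point. -/
lemma contDiffOn_integral_comp_linear {E : Type} [NormedAddCommGroup E] [NormedSpace ℝ E]
    {T : Set E} (hT : Convex ℝ T) (hU : UniqueDiffOn ℝ T) (L : ℝ → E →L[ℝ] E) (hL : Continuous L)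
    (hm : ∀ τ ∈ Icc (0 : ℝ) 1, MapsTo (L τ) T T) (n : ℕ) :
    ∀ {F F' : Type} [NormedAddCommGroup F] [NormedSpace ℝ F] [NormedAddCommGroup F']
      [NormedSpace ℝ F'] [CompleteSpace F'] (K : ℝ → F →L[ℝ] F') (_ : Continuous K) (G : E → F)
      (_ : ContDiffOn ℝ n G T),
      ContDiffOn ℝ n (fun v => ∫ τ in (0 : ℝ)..1, K τ (G (L τ v))) T := by
  have cont : ∀ {F F' : Type} [NormedAddCommGroup F] [NormedSpace ℝ F] [NormedAddCommGroup F']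
      [NormedSpace ℝ F'] (K : ℝ → F →L[ℝ] F') (_ : Continuous K) (G : E → F)
      (_ : ContinuousOn G T), ContinuousOn (Function.uncurry fun v τ => K τ (G (L τ v)))
        (T ×ˢ Icc 0 1) := by
    intro F F' _ _ _ _ K hK G hG
    refine ContinuousOn.clm_apply (hK.comp continuous_snd).continuousOn ?_
    refine hG.comp (f := fun p : E × ℝ => L p.2 p.1) ?_ fun p hp => hm p.2 hp.2 hp.1
    exact (Continuous.clm_apply (hL.comp continuous_snd) continuous_fst).continuousOn
  induction n with
  | zero =>
    intro F F' _ _ _ _ _ K hK G hG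
    exact contDiffOn_zero.2
      (continuousOn_integral_of_continuousOn_prod (cont K hK G hG.continuousOn))
  | succ n ih =>
    intro F F' _ _ _ _ _ K hK G hG
    have hG' := (contDiffOn_succ_iff_fderivWithin (n := n) hU).1 (by exact_mod_cast hG)
    let K' : ℝ → (E →L[ℝ] F) →L[ℝ] (E →L[ℝ] F') := fun τ =>
      (ContinuousLinearMap.compL ℝ E F F' (K τ)).comp
        ((ContinuousLinearMap.compL ℝ E E F).flip (L τ))
    have hK' : Continuous K' := by
      refine Continuous.clm_comp ?_ ?_
      · exact (ContinuousLinearMap.compL ℝ E F F').continuous.comp hK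
      · exact (ContinuousLinearMap.compL ℝ E E F).flip.continuous.comp hL
    have key := (contDiffOn_succ_iff_hasFDerivWithinAt_of_uniqueDiffOn (n := n)
      (f := fun v => ∫ τ in (0 : ℝ)..1, K τ (G (L τ v))) hU).2 ⟨by simp,
      fun v => ∫ τ in (0 : ℝ)..1, K' τ (fderivWithin ℝ G T (L τ v)), ih K' hK' _ hG'.2.2, ?_⟩
    · exact_mod_cast key
    · intro v hv
      refine hasFDerivWithinAt_integral (f := fun v τ => K τ (G (L τ v)))
        (f' := fun v τ => K' τ (fderivWithin ℝ G T (L τ v))) hT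
        (cont K hK G hG.continuousOn) (cont K' hK' _ hG'.2.2.continuousOn) ?_ hv
      intro τ hτ v hv; have h1 := (hG'.1 (L τ v) (hm τ hτ hv)).hasFDerivWithinAt
      have h2 := h1.comp v (L τ).hasFDerivWithinAt (hm τ hτ)
      exact (K τ).hasFDerivAt.comp_hasFDerivWithinAt v h2

/-- Hadamard's lemma in a sector: near a point of `{v | ∀ i ∈ S, v i = 0}`, a smooth function
vanishing on this set is a combination of the coordinates with index in `S`. -/
lemma hadamard_sect {κ : Type} [Fintype κ] [DecidableEq κ] {C : Set κ} (S : Finset κ)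
    {v₀ : κ → ℝ} (hv₀ : ∀ i ∈ S, v₀ i = 0) {r : ℝ} {h : (κ → ℝ) → ℝ}
    (hh : ContDiffOn ℝ ∞ h (Metric.ball v₀ r ∩ sect C))
    (h0 : ∀ v ∈ Metric.ball v₀ r ∩ sect C, (∀ i ∈ S, v i = 0) → h v = 0) :
    ∃ A : κ → (κ → ℝ) → ℝ, (∀ i, ContDiffOn ℝ ∞ (A i) (Metric.ball v₀ r ∩ sect C)) ∧
      ∀ v ∈ Metric.ball v₀ r ∩ sect C, h v = ∑ i ∈ S, A i v * v i := by
  set T := Metric.ball v₀ r ∩ sect C with hTdef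
  have hT : Convex ℝ T := (convex_ball _ _).inter convex_sect
  have hU : UniqueDiffOn ℝ T := uniqueDiffOn_relOpen ⟨_, Metric.isOpen_ball, rfl⟩
  -- the projection onto the coordinates with index in `S`
  let Q : (κ → ℝ) →L[ℝ] (κ → ℝ) :=
    ContinuousLinearMap.pi fun i => if i ∈ S then ContinuousLinearMap.proj i else 0
  have hQ : ∀ v i, Q v i = if i ∈ S then v i else 0 := by
    intro v i
    by_cases hi : i ∈ S <;> simp [Q, hi]
  let L : ℝ → (κ → ℝ) →L[ℝ] (κ → ℝ) := fun τ => ContinuousLinearMap.id ℝ _ + (τ - 1) • Q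
  have hLa : ∀ τ v i, L τ v i = if i ∈ S then τ * v i else v i := by
    intro τ v i
    simp only [L, _root_.add_apply, ContinuousLinearMap.id_apply,
      _root_.smul_apply, Pi.add_apply, Pi.smul_apply, smul_eq_mul, hQ]
    grind
  have hL : Continuous L := by fun_prop
  have hm : ∀ τ ∈ Icc (0 : ℝ) 1, MapsTo (L τ) T T := by
    rintro τ ⟨h0τ, h1τ⟩ v ⟨hvb, hvs⟩; refine ⟨?_, fun i hi => ?_⟩
    · have hr : 0 < r := dist_nonneg.trans_lt (Metric.mem_ball.1 hvb)
      rw [Metric.mem_ball, dist_pi_lt_iff hr] at hvb ⊢; intro i; have := hvb i; rw [hLa]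
      split_ifs with hi
      · rw [hv₀ i hi, Real.dist_eq, sub_zero] at this ⊢; rw [abs_mul, abs_of_nonneg h0τ]
        nlinarith [abs_nonneg (v i)]
      · exact this
    · have := hvs i hi; rw [hLa]; split_ifs
      · positivity
      · exact this
  have hd := (contDiffOn_infty_iff_fderivWithin hU).1 hh
  refine ⟨fun i v => ∫ τ in (0 : ℝ)..1, fderivWithin ℝ h T (L τ v) (Pi.single i 1), ?_, ?_⟩
  · intro i; rw [contDiffOn_infty]; intro n
    exact contDiffOn_integral_comp_linear hT hU L hL hm n
      (fun _ => ContinuousLinearMap.apply ℝ ℝ (Pi.single i 1)) continuous_const _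
      (hd.2.of_le (by exact_mod_cast le_top))
  · intro v hv
    have hcont : ContinuousOn (fun τ => fderivWithin ℝ h T (L τ v)) (Icc (0 : ℝ) 1) :=
      hd.2.continuousOn.comp (f := fun τ => L τ v)
        ((hL.clm_apply continuous_const).continuousOn) fun τ hτ => hm τ hτ hv
    have hderiv : ∀ τ ∈ Icc (0 : ℝ) 1,
        HasDerivWithinAt (fun τ => h (L τ v)) (fderivWithin ℝ h T (L τ v) (Q v)) (Icc 0 1) τ := by
      intro τ hτ; have h1 := (hd.1 (L τ v) (hm τ hτ hv)).hasFDerivWithinAt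
      have h2 : HasDerivWithinAt (fun τ => L τ v) (Q v) (Icc 0 1) τ := by
        have : (fun τ => L τ v) = fun τ : ℝ => v + (τ - 1) • Q v := by ext τ; simp [L]
        rw [this]
        have := (((hasDerivWithinAt_id τ (Icc (0 : ℝ) 1)).sub_const 1).smul_const (Q v)).const_add v
        simpa using this
      exact h1.comp_hasDerivWithinAt τ h2 fun τ hτ => hm τ hτ hv
    have hc2 : ContinuousOn (fun τ => fderivWithin ℝ h T (L τ v) (Q v)) (Icc (0 : ℝ) 1) :=
      hcont.clm_apply continuousOn_const
    have ftc := intervalIntegral.integral_eq_sub_of_hasDeriv_right_of_le zero_le_one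
      (f := fun τ => h (L τ v)) (f' := fun τ => fderivWithin ℝ h T (L τ v) (Q v))
      (fun τ hτ => (hderiv τ hτ).continuousWithinAt)
      (fun τ hτ => ((hderiv τ (Ioo_subset_Icc_self hτ)).hasDerivAt
        (Icc_mem_nhds hτ.1 hτ.2)).hasDerivWithinAt)
      (by
        apply ContinuousOn.intervalIntegrable
        rwa [uIcc_of_le zero_le_one])
    have e1 : L 1 v = v := by ext i; rw [hLa]; split_ifs <;> simp
    have e0 : h (L 0 v) = 0 := by
      refine h0 _ (hm 0 ⟨le_rfl, zero_le_one⟩ hv) fun i hi => ?_; rw [hLa, if_pos hi, zero_mul]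
    have hQv : Q v = ∑ i ∈ S, v i • Pi.single i (1 : ℝ) := by
      ext j; rw [hQ, Finset.sum_apply]; simp [Pi.single_apply]
    simp only [e1, e0, sub_zero] at ftc; rw [← ftc]; simp_rw [hQv, map_sum, map_smul, smul_eq_mul]
    rw [intervalIntegral.integral_finsetSum]
    · refine Finset.sum_congr rfl fun i _ => ?_; rw [intervalIntegral.integral_const_mul, mul_comm]
    · intro i _; apply ContinuousOn.intervalIntegrable; rw [uIcc_of_le zero_le_one]
      exact continuousOn_const.mul (hcont.clm_apply continuousOn_const)

variable {X Y Z : Mfd.{u}} {ι κ : Type} [Fintype ι] [Fintype κ] {n : ℕ} {C : Set κ} {c : Crd X κ C}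
  {S : Finset κ} {p : X} {β : Y → X} {r : Fin n → X → ℝ} {g : X → ι → ℝ} {θ : Y → ι → ℝ} {ρ : Y → ℝ}
  {A : X → ι → κ → ℝ} {B : X → κ → ι → ℝ} {m : X → ℝ} {r' : Fin (n + 1) → Y → ℝ} {e : ι → Fin n}
  {l : Fin n}

/-! ### Smooth functions near a point and local generators of a submanifold -/

section Hadamard

variable [DecidableEq κ]

/-- Hadamard's lemma on a manifold with corners, for a finite family of functions. -/
lemma Crd.hadamard (c : Crd X κ C) (S : Finset κ) (hp : p ∈ c.source)
    (hpS : ∀ i ∈ S, c p i = 0) [Finite ι] {U : Set X} (hU : IsOpen U) (hpU : p ∈ U)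
    {h : X → ι → ℝ} (hh : ∀ a, SmoothOn[X] (fun q => h q a) U)
    (h0 : ∀ q ∈ c.source ∩ U, (∀ i ∈ S, c q i = 0) → ∀ a, h q a = 0) :
    ∃ V ⊆ c.source ∩ U, IsOpen V ∧ p ∈ V ∧ ∃ A : X → ι → κ → ℝ,
      (∀ a i, SmoothOn[X] (fun q => A q a i) V) ∧
      ∀ q ∈ V, ∀ a, h q a = ∑ i ∈ S, A q a i * c q i := by
  obtain ⟨O, hO, e⟩ := (c.restrict U hU).open_target
  have hpO : c p ∈ O := by
    have : c p ∈ (c.restrict U hU).target := (c.restrict U hU).map_source p ⟨hp, hpU⟩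
    rw [e] at this; exact this.1
  obtain ⟨r, hr, hrO⟩ := Metric.isOpen_iff.1 hO _ hpO
  have hsub : Metric.ball (c p) r ∩ sect C ⊆ (c.restrict U hU).target := by
    grind
  have key : ∀ a, ∃ A : κ → (κ → ℝ) → ℝ,
      (∀ i, ContDiffOn ℝ ∞ (A i) (Metric.ball (c p) r ∩ sect C)) ∧
      ∀ v ∈ Metric.ball (c p) r ∩ sect C, h (c.inv v) a = ∑ i ∈ S, A i v * v i := by
    intro a; refine hadamard_sect S hpS (h := fun v => h (c.inv v) a) ?_ ?_
    · rw [← contMDiffOn_iff_contDiffOn]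
      exact (hh a).comp (c.smooth_inv.mono fun v hv => (hsub hv).1) fun v hv => (hsub hv).2
    · intro v hv hvS; have h1 := hsub hv; refine h0 _ ⟨c.map_target v h1.1, h1.2⟩ ?_ a
      rw [c.right_inv v h1.1]; exact hvS
  choose A hA hA' using key
  refine ⟨(c.source ∩ c ⁻¹' Metric.ball (c p) r) ∩ U, fun q hq => ⟨hq.1.1, hq.2⟩,
    (c.isOpen_inter_preimage Metric.isOpen_ball).inter hU,
    ⟨⟨hp, Metric.mem_ball_self hr⟩, hpU⟩, fun q a i => A a i (c q), ?_, ?_⟩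
  · intro a i
    refine (contMDiffOn_iff_contDiffOn.2 (hA a i)).comp (c.smooth.mono fun q hq => hq.1.1) ?_
    exact fun q hq => ⟨hq.1.2, c.target_subset (c.map_source q hq.1.1)⟩
  · intro q hq a; have := hA' a (c q) ⟨hq.1.2, c.target_subset (c.map_source q hq.1.1)⟩
    rwa [c.left_inv q hq.1.1] at this

end Hadamard

/-- In the coordinates `c`, the functions `g a` and the coordinates with index in `S` generate the
same ideal of smooth functions; `A` and `B` are the matrices expressing the ones by the others. -/
structure Gen (g : X → ι → ℝ) [DecidableEq κ] (c : Crd X κ C) (S : Finset κ) (A : X → ι → κ → ℝ)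
    (B : X → κ → ι → ℝ) : Prop where
  smooth_A : ∀ a i, SmoothOn[X] (fun q => A q a i) c.source
  smooth_B : ∀ i a, SmoothOn[X] (fun q => B q i a) c.source
  eq_A : ∀ q ∈ c.source, ∀ a, g q a = ∑ i ∈ S, A q a i * c q i
  eq_B : ∀ q ∈ c.source, ∀ i ∈ S, c q i = ∑ a, B q i a * g q a

/-- Near `p` the common zero set of the functions `g a` is a p-submanifold, the ideal of which is
generated by the `g a`. -/
def GenAt (g : X → ι → ℝ) (p : X) : Prop :=
  ∃ (κ : Type) (_ : Fintype κ) (_ : DecidableEq κ) (C : Set κ) (c : Crd X κ C) (S : Finset κ)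
    (A : X → ι → κ → ℝ) (B : X → κ → ι → ℝ), p ∈ c.source ∧ Gen g c S A B

namespace Gen

variable [DecidableEq κ]

lemma restrict (h : Gen g c S A B) {U : Set X} (hU : IsOpen U) : Gen g (c.restrict U hU) S A B where
  smooth_A a i := (h.smooth_A a i).mono inter_subset_left
  smooth_B i a := (h.smooth_B i a).mono inter_subset_left
  eq_A q hq := h.eq_A q hq.1
  eq_B q hq := h.eq_B q hq.1

lemma zero_iff (h : Gen g c S A B) {q : X} (hq : q ∈ c.source) :
    (∀ a, g q a = 0) ↔ ∀ i ∈ S, c q i = 0 := by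
  constructor
  · intro h0 i hi; rw [h.eq_B q hq i hi]; simp [h0]
  · intro h0 a; rw [h.eq_A q hq a]; exact Finset.sum_eq_zero fun i hi => by rw [h0 i hi, mul_zero]

/-- The generators of the ideal of a p-submanifold generate it in any adapted coordinates. -/
lemma transfer (h : Gen g c S A B) (hg : ∀ a, Smooth[X] fun q => g q a)
    {κ' : Type} [Fintype κ'] [DecidableEq κ'] {C' : Set κ'} (c' : Crd X κ' C') (S' : Finset κ')
    (hc' : ∀ q ∈ c'.source, (∀ a, g q a = 0) ↔ ∀ i ∈ S', c' q i = 0) (hp : p ∈ c.source)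
    (hp' : p ∈ c'.source) (hpg : ∀ a, g p a = 0) :
    ∃ (V : Set X) (hV : IsOpen V) (A' : X → ι → κ' → ℝ) (B' : X → κ' → ι → ℝ), p ∈ V ∧
      Gen g (c'.restrict V hV) S' A' B' := by
  obtain ⟨V₁, hV₁s, hV₁, hpV₁, A', hA', eA'⟩ := c'.hadamard S' hp' ((hc' p hp').1 hpg) isOpen_univ
    (mem_univ p) (h := g) (fun a => (hg a).contMDiffOn) fun q hq => (hc' q hq.1).2
  obtain ⟨V₂, hV₂s, hV₂, hpV₂, D, hD, eD⟩ := c.hadamard S hp ((h.zero_iff hp).1 hpg)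
    c'.open_source hp' (ι := S') (h := fun q i => c' q i) (fun i => c'.smooth_apply i)
    fun q hq h0 i => (hc' q hq.2).1 ((h.zero_iff hq.1).2 h0) i i.2
  refine ⟨V₁ ∩ V₂, hV₁.inter hV₂, A', fun q i a =>
    if hi : i ∈ S' then ∑ j ∈ S, D q ⟨i, hi⟩ j * B q j a else 0, ⟨hpV₁, hpV₂⟩, ?_, ?_, ?_, ?_⟩
  · exact fun a i => (hA' a i).mono fun q hq => hq.2.1
  · intro i a
    by_cases hi : i ∈ S'
    · simp only [hi, dif_pos]; refine contMDiffOn_finsetSum fun j hj => ContMDiffOn.mul ?_ ?_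
      · exact (hD _ _).mono fun q hq => hq.2.2
      · exact (h.smooth_B _ _).mono fun q hq => (hV₂s hq.2.2).1
    · simp only [hi, dif_neg, not_false_eq_true]; exact contMDiffOn_const
  · exact fun q hq => eA' q hq.2.1
  · intro q hq i hi; change c' q i = _; simp only [hi, dif_pos]; rw [eD q hq.2.2 ⟨i, hi⟩]
    simp_rw [Finset.sum_mul]; rw [Finset.sum_comm]; refine Finset.sum_congr rfl fun j hj => ?_
    rw [h.eq_B q (hV₂s hq.2.2).1 j hj, Finset.mul_sum]
    grind

end Gen

/-! ### The dimension -/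

namespace Crd

/-- The differential of a coordinate system at a point, as a linear isomorphism. -/
lemma exists_tangentEquiv (c : Crd X κ C) (hp : p ∈ c.source) :
    ∃ T : X.E ≃ₗ[ℝ] (κ → ℝ), HasMFDerivAt X.I 𝓘(ℝ, κ → ℝ) c p
        (show TangentSpace X.I p →L[ℝ] TangentSpace 𝓘(ℝ, κ → ℝ) (c p) from
          mfderiv X.I 𝓘(ℝ, κ → ℝ) c p) ∧
      (∀ v : X.E, T v = (mfderiv X.I 𝓘(ℝ, κ → ℝ) c p : X.E →L[ℝ] (κ → ℝ)) v) ∧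
      ∀ w : κ → ℝ, T.symm w =
        (mfderivWithin 𝓘(ℝ, κ → ℝ) X.I c.inv c.target (c p) : (κ → ℝ) →L[ℝ] X.E) w := by
  have h1 : HasMFDerivAt X.I 𝓘(ℝ, κ → ℝ) c p (mfderiv X.I 𝓘(ℝ, κ → ℝ) c p) :=
    ((c.smooth.contMDiffAt (c.mem_nhds hp)).mdifferentiableAt (by simp)).hasMFDerivAt
  have hct := c.map_source p hp
  have h2 : HasMFDerivWithinAt 𝓘(ℝ, κ → ℝ) X.I c.inv c.target (c p)
      (mfderivWithin 𝓘(ℝ, κ → ℝ) X.I c.inv c.target (c p)) :=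
    ((c.smooth_inv _ hct).mdifferentiableWithinAt (by simp)).hasMFDerivWithinAt
  have hu : UniqueMDiffWithinAt 𝓘(ℝ, κ → ℝ) c.target (c p) :=
    uniqueMDiffWithinAt_iff_uniqueDiffWithinAt.2 (c.uniqueDiffOn _ hct)
  have e1 : (mfderivWithin 𝓘(ℝ, κ → ℝ) X.I c.inv c.target (c p)).comp
      (mfderiv X.I 𝓘(ℝ, κ → ℝ) c p) = ContinuousLinearMap.id ℝ (TangentSpace X.I p) := by
    have h3 := h2.comp p (h1.hasMFDerivWithinAt (s := c.source)) c.map_source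
    have h4 : HasMFDerivWithinAt X.I X.I (id : X → X) c.source p
        (ContinuousLinearMap.id ℝ (TangentSpace X.I p)) := (hasMFDerivAt_id p).hasMFDerivWithinAt
    have h5 := h4.congr_of_eventuallyEq (f₁ := c.inv ∘ c)
      (eventually_of_mem self_mem_nhdsWithin fun q hq => c.left_inv q hq) (c.left_inv p hp)
    have hu' : UniqueMDiffWithinAt X.I c.source p := c.open_source.uniqueMDiffWithinAt hp
    exact hu'.eq h3 h5
  have e2 : (mfderiv X.I 𝓘(ℝ, κ → ℝ) c p).comp
      (mfderivWithin 𝓘(ℝ, κ → ℝ) X.I c.inv c.target (c p)) =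
        ContinuousLinearMap.id ℝ (TangentSpace 𝓘(ℝ, κ → ℝ) (c p)) := by
    have h1' : HasMFDerivAt X.I 𝓘(ℝ, κ → ℝ) c (c.inv (c p)) (mfderiv X.I 𝓘(ℝ, κ → ℝ) c p) := by
      rw [c.left_inv p hp]; exact h1
    have h3 := h1'.comp_hasMFDerivWithinAt (c p) h2
    have h4 : HasMFDerivWithinAt 𝓘(ℝ, κ → ℝ) 𝓘(ℝ, κ → ℝ) (id : (κ → ℝ) → κ → ℝ) c.target (c p)
        (ContinuousLinearMap.id ℝ (TangentSpace 𝓘(ℝ, κ → ℝ) (c p))) :=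
      (hasMFDerivAt_id _).hasMFDerivWithinAt
    have h5 := h4.congr_of_eventuallyEq (f₁ := c ∘ c.inv)
      (eventually_of_mem self_mem_nhdsWithin fun q hq => c.right_inv q hq)
      (c.right_inv _ hct)
    exact hu.eq h3 h5
  let D : X.E →L[ℝ] (κ → ℝ) := mfderiv X.I 𝓘(ℝ, κ → ℝ) c p
  let D' : (κ → ℝ) →L[ℝ] X.E := mfderivWithin 𝓘(ℝ, κ → ℝ) X.I c.inv c.target (c p)
  exact ⟨{ toFun := D, map_add' := map_add D, map_smul' := map_smul D, invFun := D'
           left_inv := fun v => DFunLike.congr_fun e1 v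
           right_inv := fun w => DFunLike.congr_fun e2 w }, h1, fun v => rfl, fun w => rfl⟩

lemma finiteDimensional (c : Crd X κ C) (hp : p ∈ c.source) :
    FiniteDimensional ℝ X.E := by
  obtain ⟨T, -⟩ := c.exists_tangentEquiv hp; exact Module.Finite.equiv T.symm

lemma card_eq (c : Crd X κ C) (hp : p ∈ c.source) :
    Fintype.card κ = Module.finrank ℝ X.E := by
  obtain ⟨T, -⟩ := c.exists_tangentEquiv hp; rw [T.finrank_eq, Module.finrank_fintype_fun_eq_card]

end Crd

/-! ### Gluing of smooth maps which agree on a dense set -/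

/-- A map given on a dense set, which near every point extends smoothly, extends smoothly. -/
lemma exists_smooth_glue {E' H' N : Type*} [NormedAddCommGroup E'] [NormedSpace ℝ E']
    [TopologicalSpace H'] (J : ModelWithCorners ℝ E' H') [TopologicalSpace N] [ChartedSpace H' N]
    [T2Space N] {D : Set Z} (hD : Dense D) (f₀ : Z → N)
    (hloc : ∀ z, ∃ (U : Set Z) (h : Z → N), IsOpen U ∧ z ∈ U ∧ ContMDiffOn Z.I J ∞ h U ∧
      ∀ z' ∈ U ∩ D, h z' = f₀ z') :
    ∃ f : Z → N, ContMDiff Z.I J ∞ f ∧ (∀ z ∈ D, f z = f₀ z) ∧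
      ∀ (U : Set Z) (h : Z → N), IsOpen U → ContinuousOn h U → (∀ z' ∈ U ∩ D, h z' = f₀ z') →
        EqOn f h U := by
  choose U h hU hzU hh he using hloc
  have key : ∀ (V : Set Z) (k : Z → N), IsOpen V → ContinuousOn k V →
      (∀ z' ∈ V ∩ D, k z' = f₀ z') → EqOn (fun z => h z z) k V := by
    intro V k hV hk hke z hz; by_contra hne; have hO : IsOpen (U z ∩ V) := (hU z).inter hV
    have hc1 : ContinuousAt (h z) z :=
      ((hh z).continuousOn.mono inter_subset_left).continuousAt (hO.mem_nhds ⟨hzU z, hz⟩)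
    have hc2 : ContinuousAt k z :=
      (hk.mono inter_subset_right).continuousAt (hO.mem_nhds ⟨hzU z, hz⟩)
    have : ∀ᶠ z' in 𝓝 z, h z z' ≠ k z' := by
      obtain ⟨s, t, hs, ht, hsz, htz, hst⟩ := t2_separation hne
      filter_upwards [hc1 (hs.mem_nhds hsz), hc2 (ht.mem_nhds htz)] with z' h1 h2 h3
      grind
    obtain ⟨z', hz'D, hz'⟩ := hD.inter_nhds_nonempty (this.and (hO.mem_nhds ⟨hzU z, hz⟩))
    exact hz'.1 ((he z z' ⟨hz'.2.1, hz'D⟩).trans (hke z' ⟨hz'.2.2, hz'D⟩).symm)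
  refine ⟨fun z => h z z, ?_, fun z hz => he z z ⟨hzU z, hz⟩, key⟩; intro z
  refine ((hh z).contMDiffAt ((hU z).mem_nhds (hzU z))).congr_of_eventuallyEq ?_
  exact eventually_of_mem ((hU z).mem_nhds (hzU z))
    (key (U z) (h z) (hU z) (hh z).continuousOn (he z))

/-! ### Manifolds with corners as subsets of an ambient manifold -/

section Sub

variable {EA HA : Type} [NormedAddCommGroup EA] [NormedSpace ℝ EA] [TopologicalSpace HA]
  (J : ModelWithCorners ℝ EA HA) {A : Type u} [TopologicalSpace A] [ChartedSpace HA A]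

/-- A coordinate system on a relatively open part of a subset `Y` of a manifold `A`, which is the
restriction of a smooth map of `A` and has a smooth inverse into `A`. -/
structure SubCrd (Y : Set A) (κ : Type) [Fintype κ] (C : Set κ) where
  /-- the coordinates -/
  F : A → κ → ℝ
  /-- the open set on which they are defined -/
  O : Set A
  /-- the inverse -/
  Φ : (κ → ℝ) → A
  /-- the set of values on `Y` -/
  T : Set (κ → ℝ)
  open_O : IsOpen O
  open_T : ∃ U, IsOpen U ∧ T = U ∩ sect C
  smooth_F : ContMDiffOn J 𝓘(ℝ, κ → ℝ) ∞ F O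
  smooth_Φ : ContMDiffOn 𝓘(ℝ, κ → ℝ) J ∞ Φ T
  map_F : ∀ y ∈ Y ∩ O, F y ∈ T
  map_Φ : ∀ v ∈ T, Φ v ∈ Y ∩ O
  left_inv : ∀ y ∈ Y ∩ O, Φ (F y) = y
  right_inv : ∀ v ∈ T, F (Φ v) = v

namespace SubCrd

variable {J} {Y : Set A} {N : ℕ}

open Classical in
/-- Replacing the coordinates with values in a line by their exponentials, and numbering them. -/
def toQuadrant (s : SubCrd J Y κ C) (e : κ ≃ Fin N) : SubCrd J Y (Fin N) univ where
  F y i := if e.symm i ∈ C then s.F y (e.symm i) else Real.exp (s.F y (e.symm i))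
  O := s.O
  Φ v := s.Φ fun k => if k ∈ C then v (e k) else Real.log (v (e k))
  T := {v | (∀ k ∉ C, 0 < v (e k)) ∧
    (fun k => if k ∈ C then v (e k) else Real.log (v (e k))) ∈ s.T}
  open_O := s.open_O
  open_T := by
    obtain ⟨U, hU, h⟩ := s.open_T
    have hc : ContinuousOn (fun (v : Fin N → ℝ) k => if k ∈ C then v (e k) else Real.log (v (e k)))
        {v | ∀ k ∉ C, 0 < v (e k)} := by
      refine continuousOn_pi.2 fun k => ?_; split_ifs with hk
      · fun_prop
      · exact ContinuousOn.log (by fun_prop) fun v hv => (hv k hk).ne'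
    have ho : IsOpen {v : Fin N → ℝ | ∀ k ∉ C, 0 < v (e k)} := by
      simp only [ofPred_forall]
      exact isOpen_iInter_of_finite fun k => isOpen_iInter_of_finite fun _ =>
        isOpen_lt continuous_const (by fun_prop)
    refine ⟨_, hc.isOpen_inter_preimage ho hU, ?_⟩; ext v
    simp only [h, mem_inter_iff, mem_ofPred_eq, mem_preimage, mem_sect]
    refine ⟨fun ⟨h1, h2, h3⟩ => ⟨⟨h1, h2⟩, fun i _ => ?_⟩, fun ⟨⟨h1, h2⟩, h3⟩ =>
      ⟨h1, h2, fun k hk => by simpa [hk] using h3 (e k) trivial⟩⟩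
    by_cases hi : e.symm i ∈ C
    · simpa [hi] using h3 _ hi
    · simpa using (h1 _ hi).le
  smooth_F := by
    refine contMDiffOn_pi_space.2 fun i => ?_; have := contMDiffOn_pi_space.1 s.smooth_F (e.symm i)
    split_ifs; exacts [this, (contMDiff_iff_contDiff.2 Real.contDiff_exp).comp_contMDiffOn this]
  smooth_Φ := by
    refine s.smooth_Φ.comp (contMDiffOn_iff_contDiffOn.2 (contDiffOn_pi.2 fun k => ?_))
      fun v hv => hv.2
    split_ifs with hk
    · fun_prop
    · exact ContDiffOn.log (by fun_prop) fun v hv => (hv.1 k hk).ne'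
  map_F y hy := by
    refine ⟨fun k hk => by simpa [hk] using Real.exp_pos _, ?_⟩
    convert s.map_F y hy using 1; ext k
    by_cases hk : k ∈ C <;> simp [hk]
  map_Φ v hv := s.map_Φ _ hv.2
  left_inv y hy := by
    rw [← s.left_inv y hy]; congr 1; ext k; rw [s.left_inv y hy]
    by_cases hk : k ∈ C <;> simp [hk]
  right_inv v hv := by
    ext i; rw [s.right_inv _ hv.2]
    by_cases hi : e.symm i ∈ C
    · simp [hi]
    · simpa [hi] using Real.exp_log (by simpa using hv.1 _ hi)

lemma mem_quadrant (s : SubCrd J Y (Fin N) univ) {v : Fin N → ℝ} (hv : v ∈ s.T) (i : Fin N) :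
    0 ≤ v i := by
  obtain ⟨U, -, e⟩ := s.open_T; exact (e ▸ hv).2 i trivial

open Classical in
/-- A chart of the topological space `Y`. -/
def toHomeo (s : SubCrd J Y (Fin N) univ) (y₀ : Y) : OpenPartialHomeomorph Y (Sector N univ) where
  toFun y := (sectorModel N univ).symm (WithLp.toLp 2 (s.F y))
  invFun v := if h : v.val.ofLp ∈ s.T then ⟨s.Φ v.val, (s.map_Φ _ h).1⟩ else y₀
  source := {y | (y : A) ∈ s.O}
  target := {v | v.val.ofLp ∈ s.T}
  map_source' y hy := by
    have := s.map_F y ⟨y.2, hy⟩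
    rwa [mem_ofPred_eq, sectorModel_symm_val fun i _ => s.mem_quadrant this i]
  map_target' v hv := by
    rw [mem_ofPred_eq] at hv; simp only [hv, dite_true, mem_ofPred_eq]; exact (s.map_Φ _ hv).2
  left_inv' y hy := by
    have := s.map_F y ⟨y.2, hy⟩
    simp only [sectorModel_symm_val (v := WithLp.toLp 2 (s.F y)) fun i _ => s.mem_quadrant this i,
      this, dite_true]
    exact Subtype.ext (s.left_inv y ⟨y.2, hy⟩)
  right_inv' v hv := by
    rw [mem_ofPred_eq] at hv; simp only [hv, dite_true, s.right_inv _ hv]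
    exact sectorModel_symm_coe v
  open_source := s.open_O.preimage continuous_subtype_val
  open_target := by
    obtain ⟨O, hO, h⟩ := s.open_T
    have : {v : Sector N univ | v.val.ofLp ∈ s.T} =
        (fun v : Sector N univ => v.val.ofLp) ⁻¹' O := by
      ext v; simp only [mem_ofPred_eq, h]; exact and_iff_left v.2
    rw [this]; exact hO.preimage ((PiLp.continuous_ofLp 2 _).comp continuous_subtype_val)
  continuousOn_toFun :=
    ((sectorModel N univ).continuous_symm.comp (PiLp.continuous_toLp 2 _)).comp_continuousOn
      (s.smooth_F.continuousOn.comp continuous_subtype_val.continuousOn fun y hy => hy)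
  continuousOn_invFun := by
    rw [Topology.IsInducing.subtypeVal.continuousOn_iff]
    refine (s.smooth_Φ.continuousOn.comp (f := fun v : Sector N univ => v.val.ofLp)
      ((PiLp.continuous_ofLp 2 _).comp continuous_subtype_val).continuousOn
      fun v hv => hv).congr fun v hv => ?_
    have hv' : v.val.ofLp ∈ s.T := hv; simp [hv']

lemma toHomeo_val (s : SubCrd J Y (Fin N) univ) (y₀ : Y) {y : Y} (hy : (y : A) ∈ s.O) :
    (s.toHomeo y₀ y).val.ofLp = s.F y := by
  change ((sectorModel N univ).symm _).val.ofLp = _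
  rw [sectorModel_symm_val fun i _ => s.mem_quadrant (s.map_F y ⟨y.2, hy⟩) i]

lemma toHomeo_symm_val (s : SubCrd J Y (Fin N) univ) (y₀ : Y) {v : Sector N univ}
    (hv : v.val.ofLp ∈ s.T) : ((s.toHomeo y₀).symm v : A) = s.Φ v.val.ofLp :=
  congrArg Subtype.val (dif_pos hv)

end SubCrd

variable [T2Space A] {J} {Y : Set A} {N : ℕ} (ch : Y → SubCrd J Y (Fin N) univ)
  (hch : ∀ y : Y, (y : A) ∈ (ch y).O)

namespace SubCrd

/-- The atlas formed by the coordinate systems with nonnegative coordinates. -/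
abbrev charted : ChartedSpace (Sector N univ) Y where
  atlas := {e | ∃ (s : SubCrd J Y (Fin N) univ) (y₀ : Y), e = s.toHomeo y₀}
  chartAt y := (ch y).toHomeo y
  mem_chart_source y := hch y
  chart_mem_atlas y := ⟨ch y, y, rfl⟩

/-- A subset covered by coordinate systems, as a manifold. -/
abbrev mfd : Mfd.{u} where
  I := sectorModel N univ
  carrier := Y
  charted := charted ch hch
  smooth := by
    letI := charted ch hch; apply isManifold_of_contDiffOn; rintro _ _ ⟨s, y₀, rfl⟩ ⟨s', y₁, rfl⟩
    have h1 : ContMDiffOn 𝓘(ℝ, Fin N → ℝ) 𝓘(ℝ, Fin N → ℝ) ∞ (s'.F ∘ s.Φ) (s.T ∩ s.Φ ⁻¹' s'.O) :=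
      s'.smooth_F.comp (s.smooth_Φ.mono inter_subset_left) inter_subset_right
    have key : ∀ v ∈ (sectorModel N univ).symm ⁻¹' ((s.toHomeo y₀).symm ≫ₕ s'.toHomeo y₁).source ∩
        range (sectorModel N univ), v.ofLp ∈ s.T ∩ s.Φ ⁻¹' s'.O ∧
          ((s.toHomeo y₀).symm ((sectorModel N univ).symm v) : A) = s.Φ v.ofLp := by
      rintro v ⟨⟨hv1, hv2⟩, hv3⟩
      have e : ((sectorModel N univ).symm v).val = v := (sectorModel N univ).right_inv hv3
      have e2 := s.toHomeo_symm_val y₀ hv1; rw [e] at e2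
      have h3 : ((s.toHomeo y₀).symm ((sectorModel N univ).symm v) : A) ∈ s'.O := hv2
      exact ⟨⟨e ▸ hv1, by rwa [e2] at h3⟩, e2⟩
    refine ((PiLp.contDiff_toLp.comp_contDiffOn (contMDiffOn_iff_contDiffOn.1 h1)).comp
      PiLp.contDiff_ofLp.contDiffOn fun v hv => (key v hv).1).congr fun v hv => ?_
    obtain ⟨hv1, hv2⟩ := key v hv
    change ((sectorModel N univ).symm (WithLp.toLp 2 (s'.F ((s.toHomeo y₀).symm
      ((sectorModel N univ).symm v) : A)))).val = _
    rw [hv2]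
    exact sectorModel_symm_val fun i _ => s'.mem_quadrant
      (s'.map_F _ ⟨(s.map_Φ _ hv1.1).1, hv1.2⟩) i

lemma toHomeo_mem_maximalAtlas (y : Y) : letI := charted ch hch
    (ch y).toHomeo y ∈ IsManifold.maximalAtlas (sectorModel N univ) ∞ Y :=
  letI := charted ch hch; letI : IsManifold (sectorModel N univ) ∞ Y := (mfd ch hch).smooth
  IsManifold.subset_maximalAtlas (chart_mem_atlas _ y)

lemma contMDiff_val : letI := charted ch hch
    ContMDiff (sectorModel N univ) J ∞ (Subtype.val : Y → A) := by
  letI := charted ch hch; letI : IsManifold (sectorModel N univ) ∞ Y := (mfd ch hch).smooth; intro y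
  have hn := ((ch y).toHomeo y).open_source.mem_nhds (hch y)
  have h3 := ((ch y).smooth_Φ.comp (f := fun v : Sector N univ => v.val.ofLp)
    ((contMDiff_iff_contDiff.2 PiLp.contDiff_ofLp).comp
      (sectorModel_val_smooth N univ)).contMDiffOn (s := ((ch y).toHomeo y).target)
    fun v hv => hv).comp (contMDiffOn_of_mem_maximalAtlas (toHomeo_mem_maximalAtlas ch hch y))
    fun y' hy' => ((ch y).toHomeo y).map_source hy'
  refine (h3.contMDiffAt hn).congr_of_eventuallyEq ?_
  filter_upwards [hn] with y' hy'
  change _ = (ch y).Φ (((ch y).toHomeo y) y').val.ofLp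
  rw [(ch y).toHomeo_val y hy', (ch y).left_inv _ ⟨y'.2, hy'⟩]

/-- The manifold carries the initial smooth structure with respect to the inclusion. -/
lemma contMDiffOn_mfd {E' H' W : Type*} [NormedAddCommGroup E'] [NormedSpace ℝ E']
    [TopologicalSpace H'] {J' : ModelWithCorners ℝ E' H'} [TopologicalSpace W] [ChartedSpace H' W]
    {f : W → Y} {U : Set W} (hf : ContMDiffOn J' J ∞ (fun w => (f w).1) U) :
    letI := charted ch hch; ContMDiffOn J' (sectorModel N univ) ∞ f U := by
  letI := charted ch hch; letI : IsManifold (sectorModel N univ) ∞ Y := (mfd ch hch).smooth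
  intro v hv
  have hc : ContinuousOn f U := Topology.IsInducing.subtypeVal.continuousOn_iff.2 hf.continuousOn
  set e := (ch (f v)).toHomeo (f v) with he; have hev : f v ∈ e.source := hch (f v)
  have h1 : ContMDiffOn J' (sectorModel N univ) ∞ (e ∘ f) (U ∩ f ⁻¹' e.source) := by
    refine (sectorModel N univ).contMDiffOn_symm.comp (t := range (sectorModel N univ))
      ((contMDiff_iff_contDiff.2 PiLp.contDiff_toLp).comp_contMDiffOn
        ((ch (f v)).smooth_F.comp (hf.mono inter_subset_left) fun w hw => hw.2)) fun w hw => ?_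
    rw [mem_preimage, range_sectorModel]
    exact fun i _ => (ch (f v)).mem_quadrant ((ch (f v)).map_F (f w) ⟨(f w).2, hw.2⟩) i
  have h4 := (contMDiffOn_symm_of_mem_maximalAtlas (toHomeo_mem_maximalAtlas ch hch (f v))).comp h1
    fun w hw => e.map_source hw.2
  exact ((h4 v ⟨hv, hev⟩).congr (f₁ := f) (fun w hw => (e.left_inv hw.2).symm)
    (e.left_inv hev).symm).mono_of_mem_nhdsWithin
      (inter_mem self_mem_nhdsWithin (hc v hv (e.open_source.mem_nhds hev)))

end SubCrd

/-- A subset of a manifold which is covered by coordinate systems is a manifold with corners. -/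
lemma exists_mfd_of_subCrd (hcov : ∀ y ∈ Y, ∃ (κ : Type) (_ : Fintype κ) (C : Set κ)
    (s : SubCrd J Y κ C) (_ : κ ≃ Fin N), y ∈ s.O) :
    ∃ (Z : Mfd.{u}) (j : Z → A), Topology.IsEmbedding j ∧ range j = Y ∧ ContMDiff Z.I J ∞ j ∧
      (∀ {W : Mfd.{u}} {f : W → Z} {U : Set W}, ContMDiffOn W.I J ∞ (fun w => j (f w)) U →
        ContMDiffOn W.I Z.I ∞ f U) ∧
      ∀ {κ : Type} [Fintype κ] {C : Set κ} (s : SubCrd J Y κ C) (_ : Z),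
        ∃ c : Crd Z κ C, c.source = j ⁻¹' s.O ∧ c.target = s.T ∧ ∀ z, c z = s.F (j z) := by
  classical
  have hcov' : ∀ y : Y, ∃ s : SubCrd J Y (Fin N) univ, (y : A) ∈ s.O := fun y => by
    obtain ⟨κ, _, C, s, e, hs⟩ := hcov y y.2; exact ⟨s.toQuadrant e, hs⟩
  choose ch hch using hcov'; have hval := SubCrd.contMDiff_val ch hch
  refine ⟨SubCrd.mfd ch hch, Subtype.val, Topology.IsEmbedding.subtypeVal, Subtype.range_val, hval,
    fun h => SubCrd.contMDiffOn_mfd ch hch h, ?_⟩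
  intro κ _ C s y₀; letI := SubCrd.charted ch hch
  set k : (κ → ℝ) → Y := fun v => if h : v ∈ s.T then ⟨s.Φ v, (s.map_Φ _ h).1⟩ else y₀
  have hk : ∀ v ∈ s.T, (k v).1 = s.Φ v := fun v hv => congrArg Subtype.val (dif_pos hv)
  exact ⟨{
    toFun := fun y => s.F y.1
    inv := k
    source := Subtype.val ⁻¹' s.O
    target := s.T
    open_source := s.open_O.preimage continuous_subtype_val
    open_target := s.open_T
    map_source := fun y hy => s.map_F y ⟨y.2, hy⟩
    map_target := fun v hv => by rw [mem_preimage, hk v hv]; exact (s.map_Φ v hv).2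
    left_inv := fun y hy => Subtype.ext (by
      rw [hk _ (s.map_F y ⟨y.2, hy⟩)]
      exact s.left_inv y ⟨y.2, hy⟩)
    right_inv := fun v hv => by rw [hk v hv]; exact s.right_inv v hv
    smooth := s.smooth_F.comp hval.contMDiffOn fun y hy => hy
    smooth_inv := SubCrd.contMDiffOn_mfd ch hch (s.smooth_Φ.congr hk) }, rfl, rfl, fun z => rfl⟩

end Sub

/-! ### The Euclidean norm of a finite family of functions -/

section nrm

/-- The Euclidean norm of a finite family of real numbers. -/
def nrm (w : ι → ℝ) : ℝ := √(∑ a, w a ^ 2)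

lemma nrm_nonneg (w : ι → ℝ) : 0 ≤ nrm w := Real.sqrt_nonneg _

lemma nrm_sq (w : ι → ℝ) : nrm w ^ 2 = ∑ a, w a ^ 2 :=
  Real.sq_sqrt (Finset.sum_nonneg fun _ _ => sq_nonneg _)

lemma nrm_eq_zero {w : ι → ℝ} : nrm w = 0 ↔ ∀ a, w a = 0 := by
  rw [nrm, Real.sqrt_eq_zero (Finset.sum_nonneg fun _ _ => sq_nonneg _),
    Finset.sum_eq_zero_iff_of_nonneg fun _ _ => sq_nonneg _]
  simp

lemma nrm_ne_zero {w : ι → ℝ} : nrm w ≠ 0 ↔ ∃ a, w a ≠ 0 := by rw [Ne, nrm_eq_zero]; push Not; rfl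

lemma nrm_pos {w : ι → ℝ} : 0 < nrm w ↔ ∃ a, w a ≠ 0 := by
  rw [← nrm_ne_zero]; exact ⟨fun h => h.ne', fun h => lt_of_le_of_ne (nrm_nonneg _) h.symm⟩

lemma nrm_smul {t : ℝ} (ht : 0 ≤ t) (w : ι → ℝ) : nrm (fun a => t * w a) = t * nrm w := by
  rw [nrm, nrm]; simp_rw [mul_pow]
  rw [← Finset.mul_sum, Real.sqrt_mul (sq_nonneg t), Real.sqrt_sq ht]

lemma continuous_nrm : Continuous (nrm : (ι → ℝ) → ℝ) := Real.continuous_sqrt.comp (by fun_prop)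

lemma contMDiffOn_nrm {E H M : Type*} [NormedAddCommGroup E] [NormedSpace ℝ E] [TopologicalSpace H]
    {I : ModelWithCorners ℝ E H} [TopologicalSpace M] [ChartedSpace H M] {w : M → ι → ℝ} {s : Set M}
    (hw : ∀ a, ContMDiffOn I 𝓘(ℝ, ℝ) ∞ (fun p => w p a) s) (h0 : ∀ p ∈ s, ∃ a, w p a ≠ 0) :
    ContMDiffOn I 𝓘(ℝ, ℝ) ∞ (fun p => nrm (w p)) s := by
  have h1 : ContMDiffOn I 𝓘(ℝ, ℝ) ∞ (fun p => ∑ a, w p a ^ 2) s :=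
    contMDiffOn_finsetSum fun a _ => (hw a).pow 2
  have h2 : ContDiffOn ℝ ∞ Real.sqrt {x | x ≠ 0} := fun x hx =>
    (Real.contDiffAt_sqrt hx).contDiffWithinAt
  refine (contMDiffOn_iff_contDiffOn.2 h2).comp h1 fun p hp => ?_; have := nrm_pos.2 (h0 p hp)
  have h3 := nrm_sq (w p); change ∑ a, w p a ^ 2 ≠ 0; rw [← h3]; positivity

end nrm

/-! ### Projective coordinates -/

/-- The blow-down map in projective coordinates, for an arbitrary index type. -/
def projCoord [DecidableEq κ] (S : Finset κ) (i : κ) (ε : ℝ) (v : κ → ℝ) : κ → ℝ :=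
  fun j => if j = i then ε * v i else if j ∈ S then v i * v j else v j

lemma projMap_eq_projCoord {N : ℕ} (S : Finset (Fin N)) (i : Fin N) (ε : ℝ) (v : Fin N → ℝ) :
    projMap (S : Set (Fin N)) i ε v = projCoord S i ε v := by
  ext j; simp [projMap, projCoord]

section projCoord

variable [DecidableEq κ] {i : κ} {ε : ℝ}

lemma contDiff_projCoord : ContDiff ℝ ∞ (projCoord S i ε) := by
  refine contDiff_pi.2 fun j => ?_; unfold projCoord; split_ifs <;> fun_prop

lemma projCoord_mem_sect (hε : ε = 1 ∨ ε = -1 ∧ i ∉ C) {v : κ → ℝ}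
    (hv : v ∈ sect (insert i C)) : projCoord S i ε v ∈ sect C := by
  intro j hj; have hi := hv i (mem_insert _ _); unfold projCoord; split_ifs with h1 h2
  · rcases hε with rfl | ⟨-, h⟩
    · simpa using hi
    · exact absurd (h1 ▸ hj) h
  · exact mul_nonneg hi (hv j (mem_insert_of_mem _ hj))
  · exact hv j (mem_insert_of_mem _ hj)

end projCoord

/-! ### The blow-up as the closure of a graph -/

section Model

variable (g : X → ι → ℝ)

/-- The closure of the graph of `g / |g|`. -/
def blowupSet : Set (X × (ι → ℝ)) :=
  closure {y | (∃ a, g y.1 a ≠ 0) ∧ y.2 = fun a => g y.1 a / nrm (g y.1)}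

variable {g}

lemma exists_graph_of_mem_blowupSet {y : X × (ι → ℝ)} (hy : y ∈ blowupSet g)
    {U : Set (X × (ι → ℝ))} (hU : IsOpen U) (hyU : y ∈ U) :
    ∃ p, (∃ a, g p a ≠ 0) ∧ (p, fun a => g p a / nrm (g p)) ∈ U := by
  obtain ⟨⟨p, θ⟩, h1, h2, h3⟩ := mem_closure_iff.1 hy U hU hyU
  grind

lemma mem_blowupSet_of_ne (hp : ∃ a, g p a ≠ 0) : (p, fun a => g p a / nrm (g p)) ∈ blowupSet g :=
  subset_closure ⟨hp, rfl⟩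

lemma nrm_of_mem_blowupSet {y : X × (ι → ℝ)} (hy : y ∈ blowupSet g) : nrm y.2 = 1 := by
  by_contra h
  have hU : IsOpen {y : X × (ι → ℝ) | nrm y.2 ≠ 1} :=
    isOpen_ne_fun (continuous_nrm.comp continuous_snd) continuous_const
  obtain ⟨p, hp, hp2⟩ := exists_graph_of_mem_blowupSet hy hU h; apply hp2; have h0 := nrm_pos.2 hp
  have : (fun a => g p a / nrm (g p)) = fun a => (nrm (g p))⁻¹ * g p a := by
    ext a; rw [div_eq_inv_mul]
  change nrm (fun a => g p a / nrm (g p)) = 1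
  rw [this, nrm_smul (by positivity), inv_mul_cancel₀ h0.ne']

variable (hg : ∀ a, Smooth[X] fun q => g q a)

include hg in
lemma eq_mul_of_mem_blowupSet {y : X × (ι → ℝ)} (hy : y ∈ blowupSet g) (a : ι) :
    g y.1 a = nrm (g y.1) * y.2 a := by
  by_contra h; have hc : Continuous g := continuous_pi fun a => (hg a).continuous
  have hU : IsOpen {y : X × (ι → ℝ) | g y.1 a ≠ nrm (g y.1) * y.2 a} :=
    isOpen_ne_fun (((continuous_apply a).comp hc).comp continuous_fst)
      (((continuous_nrm.comp hc).comp continuous_fst).mul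
        ((continuous_apply a).comp continuous_snd))
  obtain ⟨p, hp, hp2⟩ := exists_graph_of_mem_blowupSet hy hU h
  exact hp2 (mul_div_cancel₀ _ (nrm_pos.2 hp).ne').symm

variable [DecidableEq κ]

/-- The components, in the coordinates `c`, of the direction `θ`. -/
def dirComp (B : X → κ → ι → ℝ) (y : X × (ι → ℝ)) (j : κ) : ℝ := ∑ a, B y.1 j a * y.2 a

lemma contMDiffOn_dirComp (h : Gen g c S A B) (j : κ) :
    ContMDiffOn (X.I.prod 𝓘(ℝ, ι → ℝ)) 𝓘(ℝ, ℝ) ∞ (fun y : X × (ι → ℝ) => dirComp B y j)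
      (Prod.fst ⁻¹' c.source) := by
  refine contMDiffOn_finsetSum fun a _ => ContMDiffOn.mul ?_ ?_
  · exact (h.smooth_B j a).comp contMDiff_fst.contMDiffOn fun y hy => hy
  · exact ((contMDiff_iff_contDiff.2 (contDiff_apply ℝ ℝ a)).comp contMDiff_snd).contMDiffOn

lemma isOpen_fst_source (c : Crd X κ C) : IsOpen (Prod.fst ⁻¹' c.source : Set (X × (ι → ℝ))) :=
  c.open_source.preimage continuous_fst

include hg in
lemma coord_eq_mul_dirComp (h : Gen g c S A B) {y : X × (ι → ℝ)} (hy : y ∈ blowupSet g)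
    (hyc : y.1 ∈ c.source) {j : κ} (hj : j ∈ S) : c y.1 j = nrm (g y.1) * dirComp B y j := by
  rw [h.eq_B _ hyc j hj, dirComp, Finset.mul_sum]; refine Finset.sum_congr rfl fun a _ => ?_
  rw [eq_mul_of_mem_blowupSet hg hy a]; ring

lemma dirComp_graph (h : Gen g c S A B) (hpc : p ∈ c.source) {j : κ} (hj : j ∈ S) :
    dirComp B (p, fun a => g p a / nrm (g p)) j = c p j / nrm (g p) := by
  rw [h.eq_B p hpc j hj, dirComp, Finset.sum_div]
  grind

lemma dirComp_nonneg (h : Gen g c S A B) {y : X × (ι → ℝ)} (hy : y ∈ blowupSet g)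
    (hyc : y.1 ∈ c.source) {j : κ} (hj : j ∈ S) (hjC : j ∈ C) : 0 ≤ dirComp B y j := by
  by_contra hlt; rw [not_le] at hlt
  have hU := (contMDiffOn_dirComp h j).continuousOn.isOpen_inter_preimage (isOpen_fst_source c)
    (isOpen_Iio (a := (0 : ℝ)))
  obtain ⟨p, hp, hp1, hp2⟩ := exists_graph_of_mem_blowupSet hy hU ⟨hyc, hlt⟩
  rw [mem_preimage, dirComp_graph h hp1 hj] at hp2
  exact absurd hp2 (not_lt.2 (div_nonneg (c.nonneg hp1 hjC) (nrm_nonneg _)))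

lemma sum_mul_dirComp (h : Gen g c S A B) {y : X × (ι → ℝ)} (hy : y ∈ blowupSet g)
    (hyc : y.1 ∈ c.source) (a : ι) : ∑ j ∈ S, A y.1 a j * dirComp B y j = y.2 a := by
  by_contra hne
  have h1 : ContMDiffOn (X.I.prod 𝓘(ℝ, ι → ℝ)) 𝓘(ℝ, ℝ) ∞
      (fun y : X × (ι → ℝ) => ∑ j ∈ S, A y.1 a j * dirComp B y j - y.2 a)
      (Prod.fst ⁻¹' c.source) := by
    refine ContMDiffOn.sub (contMDiffOn_finsetSum fun j _ => ContMDiffOn.mul ?_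
      (contMDiffOn_dirComp h j)) ?_
    · exact (h.smooth_A a j).comp contMDiff_fst.contMDiffOn fun y hy => hy
    · exact ((contMDiff_iff_contDiff.2 (contDiff_apply ℝ ℝ a)).comp contMDiff_snd).contMDiffOn
  have hU := h1.continuousOn.isOpen_inter_preimage (isOpen_fst_source c)
    (isOpen_ne (x := (0 : ℝ)))
  obtain ⟨p, hp, hp1, hp2⟩ := exists_graph_of_mem_blowupSet hy hU ⟨hyc, sub_ne_zero.2 hne⟩
  apply hp2; simp only; rw [h.eq_A p hp1 a, Finset.sum_div, sub_eq_zero]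
  refine Finset.sum_congr rfl fun j hj => ?_; rw [dirComp_graph h hp1 hj]; ring

lemma exists_dirComp_ne (h : Gen g c S A B) {y : X × (ι → ℝ)} (hy : y ∈ blowupSet g)
    (hyc : y.1 ∈ c.source) : ∃ j ∈ S, dirComp B y j ≠ 0 := by
  by_contra hcon; push Not at hcon
  have : ∀ a, y.2 a = 0 := fun a => by
    rw [← sum_mul_dirComp h hy hyc a]
    exact Finset.sum_eq_zero fun j hj => by rw [hcon j hj, mul_zero]
  have h1 := nrm_of_mem_blowupSet hy; rw [nrm_eq_zero.2 this] at h1; exact zero_ne_one h1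

/-- The coordinates of the direction with dominating component `i`, of sign `ε`. -/
def hatDir (i : κ) (ε : ℝ) (v : κ → ℝ) (j : κ) : ℝ := if j = i then ε else v j

lemma projCoord_apply_of_mem {i : κ} {ε : ℝ} {v : κ → ℝ} {j : κ} (hj : j ∈ S) :
    projCoord S i ε v j = v i * hatDir i ε v j := by
  unfold projCoord hatDir; split_ifs <;> first | ring | rfl

/-- The values of the projective coordinates. -/
def projTarget (c : Crd X κ C) (S : Finset κ) (i : κ) (ε : ℝ) : Set (κ → ℝ) :=
  {v | v ∈ sect (insert i C) ∧ projCoord S i ε v ∈ c.target}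

lemma relOpen_projTarget {i : κ} {ε : ℝ} (hε : ε = 1 ∨ ε = -1 ∧ i ∉ C) :
    ∃ U, IsOpen U ∧ projTarget c S i ε = U ∩ sect (insert i C) := by
  obtain ⟨O, hO, e⟩ := c.open_target
  refine ⟨projCoord S i ε ⁻¹' O, hO.preimage contDiff_projCoord.continuous, ?_⟩; ext v
  simp only [projTarget, e, mem_inter_iff, mem_ofPred_eq, mem_preimage]
  exact ⟨fun h => ⟨h.2.1, h.1⟩, fun h => ⟨h.2, h.1, projCoord_mem_sect hε h.2⟩⟩

/-- The points of the projective coordinate domain with positive first coordinate are dense. -/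
lemma projTarget_subset_closure {i : κ} {ε : ℝ} (hε : ε = 1 ∨ ε = -1 ∧ i ∉ C) :
    projTarget c S i ε ⊆ closure (projTarget c S i ε ∩ {v | 0 < v i}) := by
  intro v hv; obtain ⟨U, hU, e⟩ := relOpen_projTarget (c := c) (S := S) hε; have hv' := hv
  rw [e] at hv'; have hc : Continuous fun s : ℝ => v + s • Pi.single i (1 : ℝ) := by fun_prop
  have h0 : Tendsto (fun s : ℝ => v + s • Pi.single i (1 : ℝ)) (𝓝[>] 0) (𝓝 v) := by
    have := (hc.tendsto 0).mono_left (nhdsWithin_le_nhds (s := Ioi 0)); simpa using this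
  refine mem_closure_of_tendsto h0 ?_
  filter_upwards [h0 (hU.mem_nhds hv'.1), self_mem_nhdsWithin] with s hs hs0
  have hs0 : 0 < s := hs0; constructor
  · rw [e]; refine ⟨hs, fun j hj => ?_⟩; have := hv'.2 j hj
    simp only [Pi.add_apply, Pi.smul_apply, Pi.single_apply, smul_eq_mul]
    split_ifs <;> simp <;> linarith
  · have := hv'.2 i (mem_insert _ _)
    simp only [mem_ofPred_eq, Pi.add_apply, Pi.smul_apply, Pi.single_eq_same, smul_eq_mul]; linarith

/-- On the domain of projective coordinates, the matrices expressing the generators and the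
coordinates by each other are inverse to each other on the direction, also over the centre. -/
lemma sum_B_sum_A (h : Gen g c S A B) {i : κ} {ε : ℝ} (hε : ε = 1 ∨ ε = -1 ∧ i ∉ C) {v : κ → ℝ}
    (hv : v ∈ projTarget c S i ε) {j : κ} (hj : j ∈ S) :
    ∑ a, B (c.inv (projCoord S i ε v)) j a *
      ∑ k ∈ S, A (c.inv (projCoord S i ε v)) a k * hatDir i ε v k = hatDir i ε v j := by
  have hinv : ContMDiffOn 𝓘(ℝ, κ → ℝ) X.I ∞ (fun v => c.inv (projCoord S i ε v))
      (projTarget c S i ε) :=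
    c.smooth_inv.comp (contMDiff_iff_contDiff.2 contDiff_projCoord).contMDiffOn fun v hv => hv.2
  have hm : MapsTo (fun v => c.inv (projCoord S i ε v)) (projTarget c S i ε) c.source :=
    fun v hv => c.map_target _ hv.2
  have hhat : ∀ j, Continuous fun v : κ → ℝ => hatDir i ε v j := by
    intro j; unfold hatDir; split_ifs <;> fun_prop
  refine EqOn.of_subset_closure (s := projTarget c S i ε ∩ {v | 0 < v i})
    (t := projTarget c S i ε)
    (f := fun v => ∑ a, B (c.inv (projCoord S i ε v)) j a *
      ∑ k ∈ S, A (c.inv (projCoord S i ε v)) a k * hatDir i ε v k)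
    (g := fun v => hatDir i ε v j) ?_ ?_ (hhat j).continuousOn inter_subset_left
    (projTarget_subset_closure hε) hv
  · rintro v ⟨hv, hvi⟩; have hvi : 0 < v i := hvi; set p := c.inv (projCoord S i ε v) with hp
    have hps : p ∈ c.source := hm hv
    have hcp : ∀ k ∈ S, c p k = v i * hatDir i ε v k := fun k hk => by
      rw [hp, c.right_inv _ hv.2, projCoord_apply_of_mem hk]
    have e := h.eq_B p hps j hj; rw [hcp j hj] at e; apply mul_left_cancel₀ hvi.ne'
    change v i * ∑ a, B p j a * ∑ k ∈ S, A p a k * hatDir i ε v k = _; rw [e, Finset.mul_sum]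
    refine Finset.sum_congr rfl fun a _ => ?_; rw [h.eq_A p hps a, mul_left_comm, Finset.mul_sum]
    congr 1; exact Finset.sum_congr rfl fun k hk => by rw [hcp k hk]; ring
  · refine continuousOn_finsetSum _ fun a _ => ContinuousOn.mul ?_
      (continuousOn_finsetSum _ fun k _ => ContinuousOn.mul ?_ (hhat k).continuousOn)
    · exact (h.smooth_B j a).continuousOn.comp hinv.continuousOn hm
    · exact (h.smooth_A a k).continuousOn.comp hinv.continuousOn hm

end Model

section Model

lemma isOpen_gen_ne (hg : ∀ a, Smooth[X] fun q => g q a) : IsOpen {p | ∃ a, g p a ≠ 0} := by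
  rw [ofPred_exists]; exact isOpen_iUnion fun a => isOpen_ne_fun (hg a).continuous continuous_const

lemma contMDiffOn_normalized (hg : ∀ a, Smooth[X] fun q => g q a) :
    ContMDiffOn X.I (X.I.prod 𝓘(ℝ, ι → ℝ)) ∞
      (fun p => ((p, fun a => g p a / nrm (g p)) : X × (ι → ℝ))) {p | ∃ a, g p a ≠ 0} := by
  refine contMDiffOn_id.prodMk (contMDiffOn_pi_space.2 fun a => ?_)
  exact (hg a).contMDiffOn.div₀ (contMDiffOn_nrm (fun a => (hg a).contMDiffOn) fun p hp => hp)
    fun p hp => (nrm_pos.2 hp).ne'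

/-- The coordinates of the blow-up away from the centre. -/
def offSubCrd (hg : ∀ a, Smooth[X] fun q => g q a) (c : Crd X κ C) :
    SubCrd (X.I.prod 𝓘(ℝ, ι → ℝ)) (blowupSet g) κ C where
  F y := c y.1
  O := Prod.fst ⁻¹' (c.source ∩ {p | ∃ a, g p a ≠ 0})
  Φ v := (c.inv v, fun a => g (c.inv v) a / nrm (g (c.inv v)))
  T := c.target ∩ c.inv ⁻¹' {p | ∃ a, g p a ≠ 0}
  open_O := (c.open_source.inter (isOpen_gen_ne hg)).preimage continuous_fst
  open_T := c.relOpen_inv_preimage (isOpen_gen_ne hg)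
  smooth_F := c.smooth.comp contMDiff_fst.contMDiffOn fun y hy => hy.1
  smooth_Φ := (contMDiffOn_normalized hg).comp (c.smooth_inv.mono inter_subset_left)
    fun v hv => hv.2
  map_F y hy := ⟨c.map_source _ hy.2.1, by rw [mem_preimage, c.left_inv _ hy.2.1]; exact hy.2.2⟩
  map_Φ v hv := ⟨mem_blowupSet_of_ne hv.2, c.map_target v hv.1, hv.2⟩
  left_inv y hy := by
    rw [c.left_inv _ hy.2.1]; refine Prod.ext rfl (funext fun a => ?_)
    change g y.1 a / nrm (g y.1) = y.2 a
    rw [eq_mul_of_mem_blowupSet hg hy.1 a, mul_div_cancel_left₀ _ (nrm_pos.2 hy.2.2).ne']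
  right_inv v hv := c.right_inv v hv.1

variable [DecidableEq κ]

/-- The value of the projective coordinates at a point of the blow-up. -/
def projVal (c : Crd X κ C) (S : Finset κ) (B : X → κ → ι → ℝ) (i : κ) (ε : ℝ) (y : X × (ι → ℝ))
    (j : κ) : ℝ :=
  if j = i then ε * c y.1 i else
    if j ∈ S then dirComp B y j / (ε * dirComp B y i) else c y.1 j

lemma eps_sq {ε : ℝ} {P : Prop} (hε : ε = 1 ∨ ε = -1 ∧ P) : ε * ε = 1 := by
  grind

variable {i : κ} {ε : ℝ}

lemma mul_coord_eq (hg : ∀ a, Smooth[X] fun q => g q a) (h : Gen g c S A B) (hi : i ∈ S)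
    {y : X × (ι → ℝ)} (hyb : y ∈ blowupSet g) (hyc : y.1 ∈ c.source) :
    ε * c y.1 i = nrm (g y.1) * (ε * dirComp B y i) := by
  rw [coord_eq_mul_dirComp hg h hyb hyc hi, mul_left_comm]

lemma projCoord_projVal (hg : ∀ a, Smooth[X] fun q => g q a) (h : Gen g c S A B)
    (hi : i ∈ S) (hε : ε = 1 ∨ ε = -1 ∧ i ∉ C) {y : X × (ι → ℝ)} (hyb : y ∈ blowupSet g)
    (hyc : y.1 ∈ c.source) (hyi : 0 < ε * dirComp B y i) :
    projCoord S i ε (projVal c S B i ε y) = c y.1 := by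
  ext j; simp only [projCoord, projVal, if_true]; split_ifs with h1 h2
  · grind
  · rw [mul_coord_eq hg h hi hyb hyc, coord_eq_mul_dirComp hg h hyb hyc h2, mul_assoc,
      mul_div_cancel₀ _ hyi.ne']
  · rfl

/-- The generators in projective coordinates. -/
def dirVal (A : X → ι → κ → ℝ) (c : Crd X κ C) (S : Finset κ) (i : κ) (ε : ℝ)
    (v : κ → ℝ) (a : ι) : ℝ :=
  ∑ k ∈ S, A (c.inv (projCoord S i ε v)) a k * hatDir i ε v k

lemma dirVal_ne (h : Gen g c S A B) (hi : i ∈ S) (hε : ε = 1 ∨ ε = -1 ∧ i ∉ C) {v : κ → ℝ}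
    (hv : v ∈ projTarget c S i ε) : ∃ a, dirVal A c S i ε v a ≠ 0 := by
  by_contra hcon; push Not at hcon; have h1 := sum_B_sum_A h hε hv hi
  rw [Finset.sum_eq_zero fun a _ => by rw [← dirVal, hcon a, mul_zero], hatDir, if_pos rfl] at h1
  grind

lemma contMDiffOn_dirVal (h : Gen g c S A B) (a : ι) :
    ContMDiffOn 𝓘(ℝ, κ → ℝ) 𝓘(ℝ, ℝ) ∞ (fun v => dirVal A c S i ε v a) (projTarget c S i ε) := by
  refine contMDiffOn_finsetSum fun k _ => ContMDiffOn.mul ?_ ?_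
  · exact (h.smooth_A a k).comp (c.smooth_inv.comp
      (contMDiff_iff_contDiff.2 contDiff_projCoord).contMDiffOn fun v hv => hv.2)
      fun v hv => c.map_target _ hv.2
  · refine (contMDiff_iff_contDiff.2 ?_).contMDiffOn; unfold hatDir; split_ifs <;> fun_prop

lemma dirVal_smooth_pair (h : Gen g c S A B) (hi : i ∈ S) (hε : ε = 1 ∨ ε = -1 ∧ i ∉ C) :
    ContMDiffOn 𝓘(ℝ, κ → ℝ) (X.I.prod 𝓘(ℝ, ι → ℝ)) ∞
      (fun v => ((c.inv (projCoord S i ε v),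
        fun a => dirVal A c S i ε v a / nrm (dirVal A c S i ε v)) : X × (ι → ℝ)))
      (projTarget c S i ε) := by
  refine ContMDiffOn.prodMk (c.smooth_inv.comp
    (contMDiff_iff_contDiff.2 contDiff_projCoord).contMDiffOn fun v hv => hv.2)
    (contMDiffOn_pi_space.2 fun a => ?_)
  exact (contMDiffOn_dirVal h a).div₀ (contMDiffOn_nrm (fun a => contMDiffOn_dirVal h a)
    fun v hv => dirVal_ne h hi hε hv) fun v hv => (nrm_pos.2 (dirVal_ne h hi hε hv)).ne'

lemma dirComp_dirVal (h : Gen g c S A B) (hε : ε = 1 ∨ ε = -1 ∧ i ∉ C) {v : κ → ℝ}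
    (hv : v ∈ projTarget c S i ε) {j : κ} (hj : j ∈ S) :
    dirComp B (c.inv (projCoord S i ε v),
      fun a => dirVal A c S i ε v a / nrm (dirVal A c S i ε v)) j =
        hatDir i ε v j / nrm (dirVal A c S i ε v) := by
  rw [← sum_B_sum_A h hε hv hj, dirComp, Finset.sum_div]
  exact Finset.sum_congr rfl fun a _ => by simp only [dirVal]; ring

/-- The projective coordinates of the blow-up. -/
def projSubCrd (hg : ∀ a, Smooth[X] fun q => g q a) (h : Gen g c S A B) (hi : i ∈ S)
    (hε : ε = 1 ∨ ε = -1 ∧ i ∉ C) : SubCrd (X.I.prod 𝓘(ℝ, ι → ℝ)) (blowupSet g) κ (insert i C) where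
  F := projVal c S B i ε
  O := Prod.fst ⁻¹' c.source ∩ {y | 0 < ε * dirComp B y i}
  Φ v := (c.inv (projCoord S i ε v), fun a => dirVal A c S i ε v a / nrm (dirVal A c S i ε v))
  T := projTarget c S i ε
  open_O := (contMDiffOn_const.mul (contMDiffOn_dirComp h i)).continuousOn.isOpen_inter_preimage
    (isOpen_fst_source c) (isOpen_Ioi (a := (0 : ℝ)))
  open_T := relOpen_projTarget hε
  smooth_F := by
    have hc : ∀ j, ContMDiffOn (X.I.prod 𝓘(ℝ, ι → ℝ)) 𝓘(ℝ, ℝ) ∞ (fun y : X × (ι → ℝ) => c y.1 j)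
        (Prod.fst ⁻¹' c.source ∩ {y | 0 < ε * dirComp B y i}) := fun j =>
      (c.smooth_apply j).comp contMDiff_fst.contMDiffOn fun y hy => hy.1
    have hd := fun j => (contMDiffOn_dirComp h j).mono
      (inter_subset_left (t := {y | 0 < ε * dirComp B y i}))
    refine contMDiffOn_pi_space.2 fun j => ?_; unfold projVal; split_ifs
    exacts [contMDiffOn_const.mul (hc i), (hd j).div₀ (contMDiffOn_const.mul (hd i)) fun y hy =>
      ne_of_gt hy.2, hc j]
  smooth_Φ := dirVal_smooth_pair h hi hε
  map_F := by
    rintro y ⟨hyb, hyc, hyi : 0 < ε * dirComp B y i⟩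
    refine ⟨fun j hj => ?_, by
      rw [projCoord_projVal hg h hi hε hyb hyc hyi]; exact c.map_source _ hyc⟩
    simp only [projVal]; split_ifs with h1 h2
    · rw [mul_coord_eq hg h hi hyb hyc]; exact mul_nonneg (nrm_nonneg _) hyi.le
    · exact div_nonneg (dirComp_nonneg h hyb hyc h2 (mem_of_mem_insert_of_ne hj h1)) hyi.le
    · exact c.nonneg hyc (mem_of_mem_insert_of_ne hj h1)
  map_Φ v hv := by
    have hps : c.inv (projCoord S i ε v) ∈ c.source := c.map_target _ hv.2; refine ⟨?_, hps, ?_⟩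
    · refine closure_minimal ?_ isClosed_closure ((((dirVal_smooth_pair h hi hε).continuousOn v
        hv).mono inter_subset_left).mem_closure_image (projTarget_subset_closure hε hv))
      rintro _ ⟨w, ⟨hw, hwi : 0 < w i⟩, rfl⟩
      have hgw : g (c.inv (projCoord S i ε w)) = fun a => w i * dirVal A c S i ε w a := by
        ext a; rw [h.eq_A _ (c.map_target _ hw.2) a, dirVal, Finset.mul_sum]
        refine Finset.sum_congr rfl fun k hk => ?_
        rw [c.right_inv _ hw.2, projCoord_apply_of_mem hk]; ring
      obtain ⟨a, ha⟩ := dirVal_ne h hi hε hw; refine subset_closure ⟨⟨a, ?_⟩, funext fun a => ?_⟩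
      · grind
      · simp only [hgw]; rw [nrm_smul hwi.le, mul_div_mul_left _ _ hwi.ne']
    · change 0 < ε * dirComp B _ i; rw [dirComp_dirVal h hε hv hi]; simp only [hatDir, if_true]
      rw [← mul_div_assoc, eps_sq hε]; exact div_pos one_pos (nrm_pos.2 (dirVal_ne h hi hε hv))
  left_inv := by
    rintro y ⟨hyb, hyc : y.1 ∈ c.source, hyi : 0 < ε * dirComp B y i⟩
    have e1 := projCoord_projVal hg h hi hε hyb hyc hyi
    have e2 : ∀ k ∈ S, hatDir i ε (projVal c S B i ε y) k
        = (ε * dirComp B y i)⁻¹ * dirComp B y k := by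
      intro k hk; simp only [hatDir, projVal]; split_ifs with h1
      · grind
      · rw [div_eq_inv_mul]
    have e3 : dirVal A c S i ε (projVal c S B i ε y) = fun a => (ε * dirComp B y i)⁻¹ * y.2 a := by
      ext a; rw [dirVal, e1, c.left_inv _ hyc, ← sum_mul_dirComp h hyb hyc a, Finset.mul_sum]
      exact Finset.sum_congr rfl fun k hk => by rw [e2 k hk]; ring
    refine Prod.ext ?_ (funext fun a => ?_)
    · simp only [e1]; exact c.left_inv _ hyc
    · simp only [e3]
      rw [nrm_smul (by positivity), nrm_of_mem_blowupSet hyb, mul_one,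
        mul_div_cancel_left₀ _ (inv_pos.2 hyi).ne']
  right_inv v hv := by
    have hn := nrm_pos.2 (dirVal_ne h hi hε hv); ext j; simp only [projVal, c.right_inv _ hv.2]
    split_ifs with h1 h2
    · simp only [projCoord, if_true]; rw [← mul_assoc, eps_sq hε, one_mul, h1]
    · rw [dirComp_dirVal h hε hv h2, dirComp_dirVal h hε hv hi]
      simp only [hatDir, if_true, h1, if_false]
      grind
    · simp [projCoord, h1, h2]

end Model

/-! ### Existence of blow-ups -/

/-- Every point of `X` lies in the domain of a coordinate system. -/
def HasCrd (X : Mfd.{u}) : Prop :=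
  ∀ p : X, ∃ (κ : Type) (_ : Fintype κ) (C : Set κ) (c : Crd X κ C), p ∈ c.source

section reindex

variable {κ' : Type}
  [DecidableEq κ] [Fintype κ'] [DecidableEq κ']

lemma Gen.reindex (h : Gen g c S A B) (e : κ ≃ κ') :
    Gen g (c.reindex e) (S.map e.toEmbedding) (fun q a k => A q a (e.symm k))
      (fun q k a => B q (e.symm k) a) where
  smooth_A a i := h.smooth_A a _
  smooth_B i a := h.smooth_B _ a
  eq_A q hq a := by
    rw [Finset.sum_map, h.eq_A q hq a]; refine Finset.sum_congr rfl fun i _ => ?_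
    change _ = A q a (e.symm (e i)) * c q (e.symm (e i)); rw [e.symm_apply_apply]
  eq_B q hq i hi := by
    obtain ⟨j, hj, rfl⟩ := Finset.mem_map.1 hi
    change c q (e.symm (e j)) = ∑ a, B q (e.symm (e j)) a * g q a; rw [e.symm_apply_apply]
    exact h.eq_B q hq j hj

lemma GenAt.exists_fin (h : GenAt g p) : ∃ (N : ℕ) (C : Set (Fin N)) (c : Crd X (Fin N) C)
    (S : Finset (Fin N)) (A : X → ι → Fin N → ℝ) (B : X → Fin N → ι → ℝ), p ∈ c.source ∧
      Gen g c S A B := by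
  obtain ⟨κ, _, _, C, c, S, A, B, hp, hG⟩ := h
  exact ⟨_, _, _, _, _, _, hp, hG.reindex (Fintype.equivFin κ)⟩

/-- Every point of the blow-up lies in the domain of a projective coordinate system. -/
lemma Gen.exists_proj (h : Gen g c S A B) {y : X × (ι → ℝ)} (hy : y ∈ blowupSet g)
    (hyc : y.1 ∈ c.source) :
    ∃ i ∈ S, ∃ ε : ℝ, (ε = 1 ∨ ε = -1 ∧ i ∉ C) ∧ 0 < ε * dirComp B y i := by
  obtain ⟨i, hi, hne⟩ := exists_dirComp_ne h hy hyc; rcases lt_or_gt_of_ne hne with hlt | hgt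
  · exact ⟨i, hi, -1, Or.inr ⟨rfl, fun hC => absurd hlt
      (not_lt.2 (dirComp_nonneg h hy hyc hi hC))⟩, by linarith⟩
  grind

end reindex

/-- `ψ` is the projective coordinate system over `c` with index `i` and sign `ε`. -/
def IsProj (β : Y → X) [DecidableEq κ]
    (c : Crd X κ C) (S : Finset κ) (i : κ) (ε : ℝ) (ψ : Crd Y κ (insert i C)) : Prop :=
  (∀ y ∈ ψ.source, β y ∈ c.source) ∧ ψ.target = projTarget c S i ε ∧
    ∀ y ∈ ψ.source, c (β y) = projCoord S i ε (ψ y)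

/-- `β : Y → X` is the blow-up of the common zero set of the functions `g a`, where
`ρ = |g ∘ β|` and `θ` is the smooth extension of `g ∘ β / ρ`. -/
structure Blow (β : Y → X) (g : X → ι → ℝ) (θ : Y → ι → ℝ) (ρ : Y → ℝ) : Prop where
  smooth_g : ∀ a, Smooth[X] fun p => g p a
  smooth_β : ContMDiff Y.I X.I ∞ β
  smooth_θ : ∀ a, Smooth[Y] fun y => θ y a
  smooth_ρ : Smooth[Y] ρ
  eq_ρ : ∀ y, ρ y = nrm (g (β y))
  mem : ∀ y, (β y, θ y) ∈ blowupSet g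
  dense : Dense {y | ρ y ≠ 0}
  dense_base : Dense {p | ∃ a, g p a ≠ 0}
  proper : IsProperMap β
  lift : ∀ {Z : Mfd.{u}} {f : Z → X} {w : Z → ι → ℝ}, ContMDiff Z.I X.I ∞ f →
    (∀ a, Smooth[Z] fun z => w z a) → (∀ z, (f z, w z) ∈ blowupSet g) →
    ∃ F : Z → Y, ContMDiff Z.I Y.I ∞ F ∧ ∀ z, β (F z) = f z ∧ θ (F z) = w z
  diffeo_off : ∃ e : PartialDiffeomorph Y.I X.I Y X ∞, e.source = β ⁻¹' {p | ∃ a, g p a ≠ 0} ∧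
    e.target = {p | ∃ a, g p a ≠ 0} ∧ ∀ y, e y = β y
  proj : ∀ {κ : Type} [Fintype κ] [DecidableEq κ] {C : Set κ} {c : Crd X κ C} {S : Finset κ}
    {A : X → ι → κ → ℝ} {B : X → κ → ι → ℝ}, Gen g c S A B → c.source.Nonempty →
    ∀ i ∈ S, ∀ ε : ℝ, (ε = 1 ∨ ε = -1 ∧ i ∉ C) → ∃ ψ : Crd Y κ (insert i C),
      ψ.source = {y | β y ∈ c.source ∧ 0 < ε * dirComp B (β y, θ y) i} ∧
      ψ.target = projTarget c S i ε ∧ ∀ y ∈ ψ.source, ψ y = projVal c S B i ε (β y, θ y)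

namespace Blow

variable (h : Blow β g θ ρ)

include h

lemma eq (y : Y) (a : ι) : g (β y) a = ρ y * θ y a := by
  rw [h.eq_ρ]; exact eq_mul_of_mem_blowupSet h.smooth_g (h.mem y) a

lemma nrm_θ (y : Y) : nrm (θ y) = 1 := nrm_of_mem_blowupSet (h.mem y)

lemma exists_θ_ne (y : Y) : ∃ a, θ y a ≠ 0 := nrm_ne_zero.1 (by rw [h.nrm_θ y]; exact one_ne_zero)

lemma nonneg (y : Y) : 0 ≤ ρ y := by rw [h.eq_ρ]; exact nrm_nonneg _

lemma eq_zero_iff {y : Y} : ρ y = 0 ↔ ∀ a, g (β y) a = 0 := by rw [h.eq_ρ, nrm_eq_zero]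

lemma ne_zero_iff {y : Y} : ρ y ≠ 0 ↔ ∃ a, g (β y) a ≠ 0 := by rw [h.eq_ρ, nrm_ne_zero]

lemma hasCrd (hgen : ∀ p, (∀ a, g p a = 0) → GenAt g p) (hX : HasCrd X) :
    HasCrd Y := by
  intro y
  by_cases hy : ∀ a, g (β y) a = 0
  · obtain ⟨κ, _, _, C, c, S, A, B, hp, hG⟩ := hgen _ hy
    obtain ⟨i, hi, ε, hε, hpos⟩ := hG.exists_proj (h.mem _) hp
    obtain ⟨ψ, hs, -, -⟩ := h.proj hG ⟨_, hp⟩ i hi ε hε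
    grind
  · push Not at hy; obtain ⟨e, hs, -, he⟩ := h.diffeo_off; obtain ⟨κ, _, C, c, hc⟩ := hX (β y)
    refine ⟨κ, _, C, c.pullback e, ?_, ?_⟩
    · rw [hs]; exact hy
    grind

lemma exists_isProj [DecidableEq κ] (hG : Gen g c S A B)
    (hne : c.source.Nonempty) {i : κ} (hi : i ∈ S) {ε : ℝ} (hε : ε = 1 ∨ ε = -1 ∧ i ∉ C) :
    ∃ ψ : Crd Y κ (insert i C), IsProj β c S i ε ψ ∧
      ψ.source = {y | β y ∈ c.source ∧ 0 < ε * dirComp B (β y, θ y) i} := by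
  obtain ⟨ψ, h1, h2, h3⟩ := h.proj hG hne i hi ε hε
  refine ⟨ψ, ⟨fun y hy => (h1 ▸ hy).1, h2, fun y hy => ?_⟩, h1⟩; rw [h3 y hy]; rw [h1] at hy
  exact (projCoord_projVal h.smooth_g hG hi hε (h.mem y) hy.1 hy.2).symm

/-- A blow-up in the present sense is one in the sense of `IsBlowup`. -/
lemma isBlowup (hgen : ∀ p, (∀ a, g p a = 0) → GenAt g p) :
    IsBlowup {p | ∀ a, g p a = 0} β where
  isClosed := by have := (isOpen_gen_ne h.smooth_g).isClosed_compl; convert this using 1; ext; simp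
  smooth := h.smooth_β
  diffeo_off := by
    obtain ⟨e, hs, ht, he⟩ := h.diffeo_off
    have : ({p | ∀ a, g p a = 0}ᶜ : Set X) = {p | ∃ a, g p a ≠ 0} := by ext; simp
    grind
  projective := by
    intro p hp; obtain ⟨N, C, c, S, A, B, hpc, hG⟩ := (hgen p hp).exists_fin
    have key : ∀ i ∈ S, ∀ ε : ℝ, (ε = 1 ∨ ε = -1 ∧ i ∉ C) → ∃ ψ : Y.CornerChart N (insert i C),
        IsProjectiveChart β c.toChart (S : Set _) i ε ψ ∧
          ψ.source = {y | β y ∈ c.source ∧ 0 < ε * dirComp B (β y, θ y) i} := by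
      intro i hi ε hε; obtain ⟨ψ, ⟨h1, h2, h3⟩, hs⟩ := h.exists_isProj hG ⟨p, hpc⟩ hi hε
      refine ⟨ψ.toChart, ⟨h1, ?_, fun y hy j => ?_⟩, hs⟩
      · ext v; change v.val.ofLp ∈ ψ.target ↔ _; rw [h2]; simp only [projMap_eq_projCoord]
        refine ⟨fun hv => ⟨⟨WithLp.toLp 2 (projCoord S i ε v.val.ofLp), c.target_subset hv.2⟩, hv.2,
          fun j => rfl⟩, ?_⟩
        rintro ⟨w, hw, e⟩; refine ⟨v.2, ?_⟩; rw [← show w.val.ofLp = _ from funext e]; exact hw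
      · rw [projMap_eq_projCoord, show (ψ.toChart y).val.ofLp = ψ y from funext fun j =>
          ψ.toChart_val hy j, ← h3 y hy]
        exact c.toChart_val (h1 y hy) j
    refine ⟨_, C, S, c.toChart, hpc, ?_, ?_, ?_⟩
    · intro q hq; rw [mem_ofPred_eq, hG.zero_iff hq]
      exact forall₂_congr fun i _ => by rw [c.toChart_val hq]
    · exact fun i hi ε hε => (key i hi ε hε).imp fun _ h => h.1
    · intro y hy; obtain ⟨i, hi, ε, hε, hpos⟩ := hG.exists_proj (h.mem y) hy
      obtain ⟨ψ, h1, h2⟩ := key i hi ε hε; exact ⟨i, hi, ε, hε, ψ, h1, by rw [h2]; exact ⟨hy, hpos⟩⟩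

/-- Transport of a blow-up by a diffeomorphism. -/
lemma comp_diffeo (e : Z → Y) (e' : Y → Z)
    (he : ContMDiff Z.I Y.I ∞ e) (he' : ContMDiff Y.I Z.I ∞ e') (h1 : ∀ z, e' (e z) = z)
    (h2 : ∀ y, e (e' y) = y) : Blow (β ∘ e) g (θ ∘ e) (ρ ∘ e) := by
  let E : PartialDiffeomorph Z.I Y.I Z Y ∞ :=
    { toFun := e, invFun := e', source := univ, target := univ, map_source' := fun _ _ => trivial
      map_target' := fun _ _ => trivial, left_inv' := fun z _ => h1 z, right_inv' := fun y _ => h2 y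
      open_source := isOpen_univ, open_target := isOpen_univ
      contMDiffOn_toFun := he.contMDiffOn, contMDiffOn_invFun := he'.contMDiffOn }
  let H : Z ≃ₜ Y := { toFun := e, invFun := e', left_inv := h1, right_inv := h2
                      continuous_toFun := he.continuous, continuous_invFun := he'.continuous }
  refine ⟨h.smooth_g, h.smooth_β.comp he, fun a => (h.smooth_θ a).comp he, h.smooth_ρ.comp he,
    fun z => h.eq_ρ _, fun z => h.mem _, ?_, h.dense_base, ?_, fun hf hw hm => ?_, ?_, ?_⟩
  · exact h.dense.preimage H.isOpenMap
  · exact h.proper.comp H.isProperMap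
  · obtain ⟨F, hF, h3⟩ := h.lift hf hw hm
    exact ⟨e' ∘ F, he'.comp hF, fun z => by simpa only [Function.comp_apply, h2] using h3 z⟩
  · obtain ⟨f, f1, f2, f3⟩ := h.diffeo_off
    refine ⟨{ toFun := f ∘ e, invFun := e' ∘ f.symm, source := e ⁻¹' f.source, target := f.target
              map_source' := fun z hz => f.map_source' hz
              map_target' := fun p hp => ?_
              left_inv' := fun z hz => ?_
              right_inv' := fun p hp => ?_
              open_source := f.open_source.preimage he.continuous
              open_target := f.open_target
              contMDiffOn_toFun := f.contMDiffOn_toFun.comp he.contMDiffOn fun z hz => hz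
              contMDiffOn_invFun := he'.comp_contMDiffOn f.contMDiffOn_invFun }, ?_, f2, ?_⟩
    · change e (e' (f.symm p)) ∈ f.source; rw [h2]; exact f.map_target' hp
    · change e' (f.symm (f (e z))) = z; have : f.symm (f (e z)) = e z := f.left_inv' hz
      rw [this, h1]
    · change f (e (e' (f.symm p))) = p; rw [h2]; exact f.right_inv' hp
    · grind
    · exact fun z => f3 _
  · intro κ _ _ C c S A B hG hne i hi ε hε; obtain ⟨ψ, s1, s2, s3⟩ := h.proj hG hne i hi ε hε
    refine ⟨ψ.pullback E, ?_, ?_, ?_⟩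
    · ext z; change z ∈ univ ∩ e ⁻¹' ψ.source ↔ _; rw [s1]; simp
    · change ψ.target ∩ ψ.inv ⁻¹' univ = _; rw [s2]; simp
    · intro z hz; exact s3 _ hz.2

end Blow

/-- Existence of blow-ups. -/
lemma exists_blow (hg : ∀ a, Smooth[X] fun q => g q a) (hd : Dense {p | ∃ a, g p a ≠ 0})
    (hgen : ∀ p, (∀ a, g p a = 0) → GenAt g p) (hX : HasCrd X) :
    ∃ (Y : Mfd.{u}) (β : Y → X) (θ : Y → ι → ℝ) (ρ : Y → ℝ), Blow β g θ ρ := by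
  classical
  set D := {p | ∃ a, g p a ≠ 0}; have hD : IsOpen D := isOpen_gen_ne hg
  -- the closure of the graph, with projective coordinates over the centre, the old ones elsewhere
  obtain ⟨Z, j, hj, hjr, hjs, hjl, hjc⟩ := exists_mfd_of_subCrd (J := X.I.prod 𝓘(ℝ, ι → ℝ))
      (Y := blowupSet g) (N := Module.finrank ℝ X.E) fun y hy => by
    by_cases h0 : ∀ a, g y.1 a = 0
    · obtain ⟨κ, _, _, C, c, S, A, B, hp, hG⟩ := hgen _ h0
      obtain ⟨i, hi, ε, hε, hpos⟩ := hG.exists_proj hy hp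
      exact ⟨κ, _, _, projSubCrd hg hG hi hε, Fintype.equivFinOfCardEq (c.card_eq hp), hp, hpos⟩
    · push Not at h0; obtain ⟨κ, _, C, c, hp⟩ := hX y.1
      exact ⟨κ, _, C, offSubCrd hg c, Fintype.equivFinOfCardEq (c.card_eq hp), hp, h0⟩
  have hjm : ∀ z, j z ∈ blowupSet g := fun z => by rw [← hjr]; exact mem_range_self z
  have hβ : ContMDiff Z.I X.I ∞ fun z => (j z).1 := contMDiff_fst.comp hjs
  have hθ : ∀ a, Smooth[Z] fun z => (j z).2 a := fun a =>
    (contMDiff_iff_contDiff.2 (contDiff_apply ℝ ℝ a)).comp (contMDiff_snd.comp hjs)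
  -- the inverse of the blow-down map over the complement of the centre
  have hZ : ∀ p : X, ∃ z : Z, p ∈ D → j z = (p, fun a => g p a / nrm (g p)) := by
    have h1 : ∀ p ∈ D, ∃ z, j z = (p, fun a => g p a / nrm (g p)) := fun p hp => by
      have h1 := mem_blowupSet_of_ne hp; rwa [← hjr] at h1
    intro p
    by_cases hp : p ∈ D
    · grind
    · obtain ⟨p', hp'⟩ := hd.nonempty_iff.2 ⟨p⟩; exact (h1 p' hp').imp fun z _ h => absurd h hp
  choose k hk using hZ
  have hjeq : ∀ z, (j z).1 ∈ D → k (j z).1 = z := by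
    intro z hz; apply hj.injective; rw [hk _ hz]; refine Prod.ext rfl (funext fun a => ?_)
    change g (j z).1 a / nrm (g (j z).1) = _
    rw [eq_mul_of_mem_blowupSet hg (hjm z) a, mul_div_cancel_left₀ _ (nrm_pos.2 hz).ne']
  refine ⟨Z, fun z => (j z).1, fun z => (j z).2, fun z => nrm (g (j z).1), hg, hβ, hθ, ?_,
    fun z => rfl, hjm, ?_, hd, ?_, fun {W f w} hf hw hm => ?_, ?_, ?_⟩
  · intro z
    by_cases h0 : ∀ a, g (j z).1 a = 0
    · obtain ⟨κ, _, _, C, c, S, A, B, hp, hG⟩ := hgen _ h0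
      -- near the front face, `|g|` is the quotient of a coordinate by the same component of `θ`
      obtain ⟨i, hi, hne⟩ := exists_dirComp_ne hG (hjm z) hp
      have h1 : SmoothOn[Z] (fun z => dirComp B (j z) i) (j ⁻¹' (Prod.fst ⁻¹' c.source)) :=
        (contMDiffOn_dirComp hG i).comp hjs.contMDiffOn fun z hz => hz
      have h2 := (((c.smooth_apply i).comp hβ.contMDiffOn fun z hz => hz).mono
        inter_subset_left).div₀ (h1.mono (inter_subset_left
          (t := (fun z => dirComp B (j z) i) ⁻¹' {x | x ≠ 0}))) fun z hz => hz.2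
      have hn := (h1.continuousOn.isOpen_inter_preimage ((isOpen_fst_source c).preimage
        hjs.continuous) (isOpen_ne (x := (0 : ℝ)))).mem_nhds ⟨hp, hne⟩
      refine (h2.contMDiffAt hn).congr_of_eventuallyEq ?_
      filter_upwards [hn] with z' hz'
      exact eq_div_of_mul_eq hz'.2 (coord_eq_mul_dirComp hg hG (hjm z') hz'.1 hi).symm
    · push Not at h0
      exact (contMDiffOn_nrm (fun a => ((hg a).comp hβ).contMDiffOn) fun z hz => hz).contMDiffAt
        (IsOpen.mem_nhds (hD.preimage hβ.continuous) h0)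
  · intro z; rw [mem_closure_iff_nhds]; intro t ht
    obtain ⟨s, hs, hst⟩ := (hj.isInducing.nhds_eq_comap z ▸ ht : t ∈ comap j (𝓝 (j z)))
    obtain ⟨U, hUs, hU, hzU⟩ := mem_nhds_iff.1 hs
    obtain ⟨p, hp, hpU⟩ := exists_graph_of_mem_blowupSet (hjm z) hU hzU; rw [← hk p hp] at hpU
    refine ⟨k p, hst (hUs hpU), ?_⟩; rw [mem_ofPred_eq, hk p hp, nrm_ne_zero]; exact hp
  · -- the fibres of the direction are contained in a cube
    have hcube : ∀ z a, |(j z).2 a| ≤ 1 := by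
      intro z a
      have h2 : (j z).2 a ^ 2 ≤ ∑ b, (j z).2 b ^ 2 :=
        Finset.single_le_sum (f := fun b => (j z).2 b ^ 2) (fun b _ => sq_nonneg _)
          (Finset.mem_univ a)
      rw [← nrm_sq, nrm_of_mem_blowupSet (hjm z), one_pow] at h2
      exact (sq_le_one_iff_abs_le_one _).1 h2
    let Q := Icc (fun _ => -1 : ι → ℝ) (fun _ => 1)
    have hQ : CompactSpace Q := isCompact_iff_compactSpace.1 isCompact_Icc
    let j' : Z → X × Q := fun z => ((j z).1, ⟨(j z).2,
      fun a => (abs_le.1 (hcube z a)).1, fun a => (abs_le.1 (hcube z a)).2⟩)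
    have hi : Topology.IsClosedEmbedding (Prod.map id Subtype.val : X × Q → X × (ι → ℝ)) :=
      Topology.IsClosedEmbedding.id.prodMap isClosed_Icc.isClosedEmbedding_subtypeVal
    have hj' := (hi.of_comp_iff (f := j')).1 ⟨hj, by
      change IsClosed (range j); rw [hjr]
      exact isClosed_closure⟩
    exact (isProperMap_fst_of_compactSpace (X := X) (Y := Q)).comp hj'.isProperMap
  · have h1 : ∀ z, ∃ y, j y = (f z, w z) := fun z => by
      have := hm z; rwa [← hjr] at this
    choose F hF using h1
    exact ⟨F, contMDiffOn_univ.1 (hjl ((hf.prodMk (contMDiff_pi_space.2 hw)).contMDiffOn.congr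
      fun z _ => hF z)), fun z => by rw [hF]; exact ⟨rfl, rfl⟩⟩
  · exact ⟨{ toFun := fun z => (j z).1, invFun := k
             source := (fun z => (j z).1) ⁻¹' D
             target := D
             map_source' := fun z hz => hz
             map_target' := fun p hp => by rw [mem_preimage, hk p hp]; exact hp
             left_inv' := fun z hz => hjeq z hz
             right_inv' := fun p hp => by rw [hk p hp]
             open_source := hD.preimage hβ.continuous
             open_target := hD
             contMDiffOn_toFun := hβ.contMDiffOn
             contMDiffOn_invFun := hjl ((contMDiffOn_normalized hg).congr hk) },
           rfl, rfl, fun z => rfl⟩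
  · intro κ _ _ C c S A B hG ⟨p, hp⟩ i hi ε hε
    obtain ⟨ψ, h1, h2, h3⟩ := hjc (projSubCrd hg hG hi hε) (k p); exact ⟨ψ, h1, h2, fun z _ => h3 z⟩

/-! ### The universal property of blow-ups -/

/-- `β` is injective over `D`. -/
def InjOver {X Y : Type*} (β : Y → X) (D : Set X) : Prop := ∀ y y', β y = β y' → β y ∈ D → y = y'

lemma InjOver.eq_of_dense {X Y Z : Type*} [TopologicalSpace Y] [T2Space Y] [TopologicalSpace Z]
    {β : Y → X} {D : Set X} (hβ : InjOver β D) {F F' : Z → Y} (hF : Continuous F)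
    (hF' : Continuous F') (e : ∀ z, β (F z) = β (F' z)) (hd : Dense {z | β (F z) ∈ D}) : F = F' :=
  hF.ext_on hd hF' fun z hz => hβ _ _ (e z) hz

lemma injOver_of_diffeo {D : Set X}
    {f : PartialDiffeomorph Y.I X.I Y X ∞} (hs : f.source = β ⁻¹' D)
    (hf : ∀ y ∈ f.source, f y = β y) :
    InjOver β D := by
  intro y y' e hy; have h1 : y ∈ f.source := by rw [hs]; exact hy
  have h2 : y' ∈ f.source := by rw [hs, mem_preimage, ← e]; exact hy
  exact f.injOn h1 h2 (by rw [hf y h1, hf y' h2, e])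

lemma Blow.injOver (h : Blow β g θ ρ) : InjOver β {p | ∃ a, g p a ≠ 0} := by
  obtain ⟨f, h1, -, h3⟩ := h.diffeo_off; exact injOver_of_diffeo h1 fun y _ => h3 y

lemma IsProj.β_inv [DecidableEq κ] {i : κ} {ε : ℝ} {ψ : Crd Y κ (insert i C)}
    (h : IsProj β c S i ε ψ) {v : κ → ℝ} (hv : v ∈ ψ.target) :
    β (ψ.inv v) = c.inv (projCoord S i ε v) := by
  have h1 := ψ.map_target v hv; rw [← c.left_inv _ (h.1 _ h1), h.2.2 _ h1, ψ.right_inv v hv]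

/-- The description of a blow-up by generators `g` of its centre and projective coordinates. -/
structure LocalBlow (β : Y → X) (g : X → ι → ℝ) : Prop where
  smooth_g : ∀ a, Smooth[X] fun p => g p a
  smooth_β : ContMDiff Y.I X.I ∞ β
  diffeo_off : ∃ e : PartialDiffeomorph Y.I X.I Y X ∞, e.source = β ⁻¹' {p | ∃ a, g p a ≠ 0} ∧
    e.target = {p | ∃ a, g p a ≠ 0} ∧ ∀ y ∈ e.source, e y = β y
  proj : ∀ p, (∀ a, g p a = 0) → ∃ (κ : Type) (_ : Fintype κ) (_ : DecidableEq κ) (C : Set κ)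
    (c : Crd X κ C) (S : Finset κ) (A : X → ι → κ → ℝ) (B : X → κ → ι → ℝ), p ∈ c.source ∧
    Gen g c S A B ∧
    (∀ i ∈ S, ∀ ε : ℝ, (ε = 1 ∨ ε = -1 ∧ i ∉ C) → ∃ ψ : Crd Y κ (insert i C), IsProj β c S i ε ψ) ∧
    ∀ y, β y ∈ c.source → ∃ i ∈ S, ∃ ε : ℝ, (ε = 1 ∨ ε = -1 ∧ i ∉ C) ∧
      ∃ ψ : Crd Y κ (insert i C), IsProj β c S i ε ψ ∧ y ∈ ψ.source

/-- On the overlap, the given generators are also generators with respect to the coordinates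
distinguished by the blow-up (`Gen.transfer`). -/
lemma IsBlowup.localBlow {P : Set X} (h : IsBlowup P β) (hP : P = {p | ∀ a, g p a = 0})
    (hg : ∀ a, Smooth[X] fun p => g p a)
    (hgen : ∀ p, (∀ a, g p a = 0) → GenAt g p) : LocalBlow β g where
  smooth_g := hg
  smooth_β := h.smooth
  diffeo_off := by
    obtain ⟨e, h1, h2, h3⟩ := h.diffeo_off
    have : (Pᶜ : Set X) = {p | ∃ a, g p a ≠ 0} := by ext; simp [hP]
    grind
  proj := by
    classical
    intro p hp; obtain ⟨N, C, S, φ, hpφ, hPφ, hproj, hcov⟩ := h.projective p (by rw [hP]; exact hp)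
    obtain ⟨κ, _, _, C₀, c₀, S₀, A₀, B₀, hp₀, hG₀⟩ := hgen p hp
    have hc' : ∀ q ∈ (Crd.ofChart φ).source, (∀ a, g q a = 0) ↔
        ∀ i ∈ S.toFinset, Crd.ofChart φ q i = 0 := by
      intro q hq; have := hPφ q hq; rw [hP] at this; simp only [mem_toFinset]; exact this
    obtain ⟨V, hV, A, B, hpV, hG⟩ := hG₀.transfer hg (Crd.ofChart φ) S.toFinset hc' hp₀ hpφ hp
    -- a projective chart of `φ`, restricted to the part over `V`
    have key : ∀ (i : Fin N) (ε : ℝ) (ψ : Y.CornerChart N (insert i C)),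
        IsProjectiveChart β φ S i ε ψ → IsProj β ((Crd.ofChart φ).restrict V hV) S.toFinset i ε
          ((Crd.ofChart ψ).restrict (β ⁻¹' V) (hV.preimage h.smooth.continuous)) := by
      intro i ε ψ ⟨h1, h2, h3⟩; have hS : (S.toFinset : Set (Fin N)) = S := coe_toFinset S
      have hpm : ∀ v, projMap S i ε v = projCoord S.toFinset i ε v := fun v => by
        rw [← projMap_eq_projCoord, hS]
      have e3 : ∀ y ∈ ψ.source, Crd.ofChart φ (β y) =
          projCoord S.toFinset i ε (Crd.ofChart ψ y) := by
        intro y hy; ext j; rw [← hpm]; exact h3 y hy j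
      have e2 : (Crd.ofChart ψ).target = projTarget (Crd.ofChart φ) S.toFinset i ε := by
        ext v
        change (v ∈ sect (insert i C) ∧ (sectorModel N (insert i C)).symm (WithLp.toLp 2 v) ∈
          ψ.target) ↔ (v ∈ sect (insert i C) ∧ (projCoord S.toFinset i ε v ∈ sect C ∧
            (sectorModel N C).symm (WithLp.toLp 2 (projCoord S.toFinset i ε v)) ∈ φ.target))
        refine and_congr_right fun hv => ?_; rw [h2]
        have e := sectorModel_symm_val (v := WithLp.toLp 2 v) hv; simp only [mem_ofPred_eq, e, hpm]
        constructor
        · rintro ⟨w, hw, hwe⟩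
          have : projCoord S.toFinset i ε v = w.val.ofLp := funext fun j => (hwe j).symm; rw [this]
          refine ⟨w.2, ?_⟩
          have e4 : (sectorModel N C).symm (WithLp.toLp 2 w.val.ofLp) = w := sectorModel_symm_coe w
          rw [e4]; exact hw
        · rintro ⟨hw1, hw2⟩; refine ⟨_, hw2, fun j => ?_⟩
          rw [sectorModel_symm_val (v := WithLp.toLp 2 (projCoord S.toFinset i ε v)) hw1]
      have hp1 : IsProj β (Crd.ofChart φ) S.toFinset i ε (Crd.ofChart ψ) := ⟨h1, e2, e3⟩
      refine ⟨fun y hy => ⟨h1 hy.1, hy.2⟩, ?_, fun y hy => e3 y hy.1⟩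
      change (Crd.ofChart ψ).target ∩ (Crd.ofChart ψ).inv ⁻¹' (β ⁻¹' V) = _; ext v; constructor
      · rintro ⟨hv1, hv2⟩; rw [mem_preimage, mem_preimage, hp1.β_inv hv1] at hv2; rw [e2] at hv1
        exact ⟨hv1.1, hv1.2, hv2⟩
      · rintro ⟨hv1, hv2, hv3⟩; have : v ∈ (Crd.ofChart ψ).target := by rw [e2]; exact ⟨hv1, hv2⟩
        refine ⟨this, ?_⟩; rw [mem_preimage, mem_preimage, hp1.β_inv this]; exact hv3
    refine ⟨Fin N, inferInstance, inferInstance, C, (Crd.ofChart φ).restrict V hV,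
      S.toFinset, A, B, ⟨hpφ, hpV⟩, hG, ?_, ?_⟩
    · intro i hi ε hε; obtain ⟨ψ, hψ⟩ := hproj i (mem_toFinset.1 hi) ε hε; exact ⟨_, key i ε ψ hψ⟩
    · intro y hy; obtain ⟨i, hi, ε, hε, ψ, hψ, hyψ⟩ := hcov y hy.1
      exact ⟨i, mem_toFinset.2 hi, ε, hε, _, key i ε ψ hψ, hyψ, hy.2⟩

namespace LocalBlow

lemma injOver (h : LocalBlow β g) : InjOver β {p | ∃ a, g p a ≠ 0} := by
  obtain ⟨e, h1, -, h3⟩ := h.diffeo_off; exact injOver_of_diffeo h1 h3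

/-- In projective coordinates, the front face is the zero set of one coordinate. -/
lemma dense (h : LocalBlow β g) : Dense {y | ∃ a, g (β y) a ≠ 0} := by
  intro y
  by_cases hy : ∀ a, g (β y) a = 0
  · obtain ⟨κ, _, _, C, c, S, A, B, hp, hG, -, hcov⟩ := h.proj _ hy
    obtain ⟨i, hi, ε, hε, ψ, hψ, hyψ⟩ := hcov y hp; have hv := ψ.map_source y hyψ
    have h2 := (ψ.continuousOn_inv _ hv).mono (inter_subset_left (t := {v : κ → ℝ | 0 < v i}))
    have h3 := h2.mem_closure_image (hψ.2.1 ▸ projTarget_subset_closure hε (hψ.2.1 ▸ hv))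
    rw [ψ.left_inv y hyψ] at h3; refine closure_mono ?_ h3; rintro _ ⟨v, ⟨hv1, hv2 : 0 < v i⟩, rfl⟩
    by_contra hcon; have hs := ψ.map_target v hv1
    have h4 := (hG.zero_iff (hψ.1 _ hs)).1 (by simpa using hcon) i hi
    rw [hψ.2.2 _ hs, ψ.right_inv v hv1] at h4; simp only [projCoord, if_true] at h4
    grind
  · push Not at hy; exact subset_closure hy

/-- Two blow-ups of the same centre are mapped to each other by identifying projective coordinate
systems with the same index and sign. -/
lemma exists_map (h : LocalBlow β g) {Y' : Mfd.{u}} {β' : Y' → X} (h' : LocalBlow β' g)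
    (hloc : ∀ y, (∀ a, g (β y) a = 0) → ∃ (κ : Type) (_ : Fintype κ) (_ : DecidableEq κ) (C : Set κ)
      (c : Crd X κ C) (S : Finset κ) (i : κ) (ε : ℝ) (ψ : Crd Y κ (insert i C))
      (ψ' : Crd Y' κ (insert i C)), IsProj β c S i ε ψ ∧ IsProj β' c S i ε ψ' ∧ y ∈ ψ.source) :
    ∃ F : Y → Y', ContMDiff Y.I Y'.I ∞ F ∧ ∀ y, β' (F y) = β y := by
  obtain ⟨e, he1, he2, he3⟩ := h'.diffeo_off
  have hes : ∀ p, (∃ a, g p a ≠ 0) → β' (e.symm p) = p := by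
    intro p hp; have h1 : p ∈ e.target := by rw [he2]; exact hp
    exact (he3 _ (e.map_target' h1)).symm.trans (e.right_inv' h1)
  obtain ⟨F, hF, hFD, -⟩ := exists_smooth_glue Y'.I h.dense (fun y => e.symm (β y)) fun y => by
    by_cases hy : ∀ a, g (β y) a = 0
    · obtain ⟨κ, _, _, C, c, S, i, ε, ψ, ψ', h1, h2, hyψ⟩ := hloc y hy
      have ht : ∀ y' ∈ ψ.source, ψ y' ∈ ψ'.target := fun y' hy' => by
        rw [h2.2.1, ← h1.2.1]; exact ψ.map_source y' hy'
      refine ⟨ψ.source, fun y' => ψ'.inv (ψ y'), ψ.open_source, hyψ,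
        ψ'.smooth_inv.comp ψ.smooth ht, ?_⟩
      rintro y' ⟨hy', hyg⟩
      have hb : β' (ψ'.inv (ψ y')) = β y' := by
        rw [h2.β_inv (ht y' hy'), ← h1.2.2 y' hy', c.left_inv _ (h1.1 y' hy')]
      exact h'.injOver _ _ (hb.trans (hes _ hyg).symm) (by rw [hb]; exact hyg)
    · push Not at hy
      refine ⟨_, _, (isOpen_gen_ne h.smooth_g).preimage h.smooth_β.continuous, hy,
        e.contMDiffOn_invFun.comp h.smooth_β.contMDiffOn fun y' hy' => ?_, fun _ _ => rfl⟩
      grind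
  refine ⟨F, hF, congrFun ((h'.smooth_β.continuous.comp hF.continuous).ext_on h.dense
    h.smooth_β.continuous fun z hz => ?_)⟩
  grind

end LocalBlow

/-- Every blow-up of the common zero set of the functions `g a` has the properties of the one
constructed as the closure of a graph. -/
lemma IsBlowup.exists_blow {P : Set X} (h : IsBlowup P β) (hP : P = {p | ∀ a, g p a = 0})
    (hg : ∀ a, Smooth[X] fun p => g p a) (hd : Dense {p | ∃ a, g p a ≠ 0})
    (hgen : ∀ p, (∀ a, g p a = 0) → GenAt g p) (hX : HasCrd X) :
    ∃ (θ : Y → ι → ℝ) (ρ : Y → ℝ), Blow β g θ ρ := by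
  obtain ⟨Y', β', θ', ρ', h'⟩ := _root_.exists_blow hg hd hgen hX; have hl := h.localBlow hP hg hgen
  have hl' := (h'.isBlowup hgen).localBlow rfl hg hgen
  obtain ⟨F, hF, hFβ⟩ := hl.exists_map hl' fun y hy => by
    obtain ⟨κ, _, _, C, c, S, A, B, hp, hG, -, hcov⟩ := hl.proj _ hy
    obtain ⟨i, hi, ε, hε, ψ, hψ, hyψ⟩ := hcov y hp
    obtain ⟨ψ', hψ', -⟩ := h'.exists_isProj hG ⟨_, hp⟩ hi hε
    grind
  obtain ⟨F', hF', hFβ'⟩ := hl'.exists_map hl fun y hy => by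
    obtain ⟨κ, _, _, C, c, S, A, B, hp, hG, hproj, -⟩ := hl.proj _ hy
    obtain ⟨i, hi, ε, hε, hpos⟩ := hG.exists_proj (h'.mem y) hp; obtain ⟨ψ, hψ⟩ := hproj i hi ε hε
    obtain ⟨ψ', hψ', hs⟩ := h'.exists_isProj hG ⟨_, hp⟩ hi hε
    grind
  -- both compositions are the identity over the complement of the centre
  have e1 : F' ∘ F = id := hl.injOver.eq_of_dense (hF'.continuous.comp hF.continuous)
    continuous_id (fun y => by rw [Function.comp_apply, hFβ', hFβ]; rfl)
    (by simp only [Function.comp_apply, hFβ', hFβ]; exact hl.dense)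
  have e2 : F ∘ F' = id := hl'.injOver.eq_of_dense (hF.continuous.comp hF'.continuous)
    continuous_id (fun y => by rw [Function.comp_apply, hFβ, hFβ']; rfl)
    (by simp only [Function.comp_apply, hFβ', hFβ]; exact hl'.dense)
  have e3 : β = β' ∘ F := funext fun y => (hFβ y).symm; refine ⟨θ' ∘ F, ρ' ∘ F, ?_⟩; rw [e3]
  exact h'.comp_diffeo F F' hF hF' (congrFun e1) (congrFun e2)

namespace Blow

/-- The universal property, together with the formulas for the new functions. -/
lemma exists_lift (h : Blow β g θ ρ) {f : Z → X} (hf : ContMDiff Z.I X.I ∞ f)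
    {t : Z → ℝ} {w : Z → ι → ℝ} (hw : ∀ a, Smooth[Z] fun z => w z a) (ht : ∀ z, 0 ≤ t z)
    (htd : Dense {z | t z ≠ 0}) (hw0 : ∀ z, ∃ a, w z a ≠ 0)
    (htw : ∀ z a, g (f z) a = t z * w z a) :
    ∃ F : Z → Y, ContMDiff Z.I Y.I ∞ F ∧ (∀ z, β (F z) = f z) ∧
      (∀ z, ρ (F z) = t z * nrm (w z)) ∧ ∀ z a, θ (F z) a = w z a / nrm (w z) := by
  have hn : ∀ z, nrm (w z) ≠ 0 := fun z => (nrm_pos.2 (hw0 z)).ne'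
  have hgw : ∀ z, g (f z) = fun a => t z * w z a := fun z => funext fun a => htw z a
  have hw' : ∀ a, Smooth[Z] fun z => w z a / nrm (w z) := fun a => (hw a).div₀
    (contMDiffOn_univ.1 (contMDiffOn_nrm (fun a => (hw a).contMDiffOn) fun z _ => hw0 z)) hn
  obtain ⟨F, hF, hF'⟩ := h.lift hf hw' fun z => by
    refine closure_minimal (s := _ '' {z | t z ≠ 0}) ?_ isClosed_closure (mem_closure_image
      (x := z) (hf.continuous.prodMk
        (continuous_pi fun a => (hw' a).continuous)).continuousAt (htd z))
    rintro _ ⟨z, hz, rfl⟩; obtain ⟨a, ha⟩ := hw0 z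
    refine subset_closure ⟨⟨a, by rw [hgw]; exact mul_ne_zero hz ha⟩, funext fun a => ?_⟩
    simp only [hgw, nrm_smul (ht z), mul_div_mul_left _ _ hz]
  refine ⟨F, hF, fun z => (hF' z).1, fun z => ?_, fun z a => congrFun (hF' z).2 a⟩
  rw [h.eq_ρ, (hF' z).1, hgw, nrm_smul (ht z)]

end Blow

/-! ### Labelled corners -/

namespace Crd

variable {κ' : Type} [Fintype κ'] {C' : Set κ'}

open Classical in
/-- A point can be moved in the direction of increasing values of a coordinate. -/
lemma exists_move (c : Crd X κ C) (hp : p ∈ c.source) (i : κ) :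
    ∃ γ : ℝ → X, Tendsto γ (𝓝[>] 0) (𝓝 p) ∧
      ∀ᶠ s in 𝓝[>] 0, 0 < s ∧ γ s ∈ c.source ∧ ∀ k, c (γ s) k = c p k + if k = i then s else 0 := by
  set v : ℝ → κ → ℝ := fun s k => c p k + if k = i then s else 0 with hv
  have hvc : Continuous v := continuous_pi fun k => by simp only [hv]; split_ifs <;> fun_prop
  have hv0 : v 0 = c p := by ext k; simp [hv]
  obtain ⟨O, hO, e⟩ := c.open_target; have hcp := c.map_source p hp
  have h1 : ∀ᶠ s in 𝓝[>] (0 : ℝ), v s ∈ c.target := by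
    have h2 : ∀ᶠ s in 𝓝 (0 : ℝ), v s ∈ O :=
      hvc.continuousAt (hO.mem_nhds (by rw [hv0]; rw [e] at hcp; exact hcp.1))
    filter_upwards [h2.filter_mono nhdsWithin_le_nhds, self_mem_nhdsWithin] with s hs hs0
    rw [e]; refine ⟨hs, fun k hk => ?_⟩; have h3 := c.nonneg hp hk; grind
  refine ⟨fun s => c.inv (v s), ?_, ?_⟩
  · have h3 : Tendsto v (𝓝[>] 0) (𝓝[c.target] (c p)) := by
      rw [← hv0]; exact tendsto_nhdsWithin_iff.2 ⟨(hvc.tendsto 0).mono_left nhdsWithin_le_nhds, h1⟩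
    have h4 := (c.continuousOn_inv _ hcp).tendsto.comp h3; rwa [c.left_inv p hp] at h4
  · filter_upwards [h1, self_mem_nhdsWithin] with s hs hs0
    refine ⟨hs0, c.map_target _ hs, fun k => ?_⟩; rw [c.right_inv _ hs]

/-- The product of two coordinate systems. -/
def prod (c : Crd X κ C) (c' : Crd Y κ' C') :
    Crd (X.prod Y) (κ ⊕ κ') (Sum.inl '' C ∪ Sum.inr '' C') where
  toFun q := Sum.elim (c q.1) (c' q.2)
  inv v := (c.inv fun i => v (Sum.inl i), c'.inv fun i => v (Sum.inr i))
  source := c.source ×ˢ c'.source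
  target := {v | (fun i => v (Sum.inl i)) ∈ c.target ∧ (fun i => v (Sum.inr i)) ∈ c'.target}
  open_source := c.open_source.prod c'.open_source
  open_target := by
    obtain ⟨O, hO, h⟩ := c.open_target; obtain ⟨O', hO', h'⟩ := c'.open_target
    refine ⟨{v | (fun i => v (Sum.inl i)) ∈ O} ∩ {v | (fun i => v (Sum.inr i)) ∈ O'},
      (hO.preimage (by fun_prop)).inter (hO'.preimage (by fun_prop)), ?_⟩
    ext v
    simp only [h, h', mem_inter_iff, mem_ofPred_eq, sect, mem_union, or_imp, forall_and,
      forall_mem_image]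
    tauto
  map_source q hq := ⟨c.map_source _ hq.1, c'.map_source _ hq.2⟩
  map_target v hv := ⟨c.map_target _ hv.1, c'.map_target _ hv.2⟩
  left_inv q hq := Prod.ext (c.left_inv _ hq.1) (c'.left_inv _ hq.2)
  right_inv v hv := by
    ext i
    cases i with
    | inl i => exact congrFun (c.right_inv _ hv.1) i
    | inr i => exact congrFun (c'.right_inv _ hv.2) i
  smooth := by
    refine contMDiffOn_pi_space.2 fun i => ?_
    cases i with
    | inl i => exact (c.smooth_apply i).comp contMDiff_fst.contMDiffOn fun q hq => hq.1
    | inr i => exact (c'.smooth_apply i).comp contMDiff_snd.contMDiffOn fun q hq => hq.2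
  smooth_inv := by
    refine ContMDiffOn.prodMk ?_ ?_
    · exact c.smooth_inv.comp (contMDiffOn_iff_contDiffOn.2 (by fun_prop)) fun v hv => hv.1
    · exact c'.smooth_inv.comp (contMDiffOn_iff_contDiffOn.2 (by fun_prop)) fun v hv => hv.2

/-- The point of the half-line with given coordinate. -/
def _root_.halfPoint (s : ℝ) : EuclideanHalfSpace 1 := (𝓡∂ 1).symm (WithLp.toLp 2 fun _ => s)

lemma _root_.halfPoint_val {s : ℝ} (hs : 0 ≤ s) : (halfPoint s).val 0 = s := by
  have : (𝓡∂ 1) (halfPoint s) = WithLp.toLp 2 fun _ => s :=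
    (𝓡∂ 1).right_inv (by rw [range_modelWithCornersEuclideanHalfSpace]; exact hs)
  change ((𝓡∂ 1) (halfPoint s)) 0 = s; rw [this]

lemma _root_.halfPoint_eq (k : EuclideanHalfSpace 1) : halfPoint (k.val 0) = k := by
  have : (WithLp.toLp 2 fun _ => k.val 0) = (𝓡∂ 1) k := by ext i; fin_cases i; rfl
  rw [halfPoint, this]; exact (𝓡∂ 1).left_inv k

lemma _root_.contMDiff_halfCoord : ContMDiff (𝓡∂ 1) 𝓘(ℝ, ℝ) ∞
    fun k : EuclideanHalfSpace 1 => k.val 0 :=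
  (contMDiff_iff_contDiff.2 (show ContDiff ℝ ∞ fun v : EuclideanSpace ℝ (Fin 1) => v 0 by
    fun_prop)).comp (𝓡∂ 1).contMDiff

lemma _root_.contMDiffOn_halfPoint : ContMDiffOn 𝓘(ℝ, ℝ) (𝓡∂ 1) ∞ halfPoint (Ici 0) := by
  refine (𝓡∂ 1).contMDiffOn_symm.comp (t := range (𝓡∂ 1)) (contMDiff_iff_contDiff.2
    (show ContDiff ℝ ∞ fun s : ℝ => (WithLp.toLp 2 fun _ => s : EuclideanSpace ℝ (Fin 1)) from
      PiLp.contDiff_toLp.comp (contDiff_pi.2 fun _ => contDiff_id))).contMDiffOn ?_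
  intro s hs; rw [mem_preimage, range_modelWithCornersEuclideanHalfSpace]; exact hs

/-- The coordinate system on `X × [0, ∞)` given by one on `X`. -/
def prodHalfLine (c : Crd X κ C) : Crd X.prodHalfLine (Option κ) (insert none (some '' C)) where
  toFun q i := i.elim (q.2.val 0) (c q.1)
  inv v := (c.inv fun i => v (some i), halfPoint (v none))
  source := c.source ×ˢ univ
  target := {v | (fun i => v (some i)) ∈ c.target ∧ 0 ≤ v none}
  open_source := c.open_source.prod isOpen_univ
  open_target := by
    obtain ⟨O, hO, h⟩ := c.open_target
    refine ⟨{v | (fun i => v (some i)) ∈ O}, hO.preimage (by fun_prop), ?_⟩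
    ext v; simp only [h, mem_inter_iff, mem_ofPred_eq, sect, forall_mem_insert, forall_mem_image]
    tauto
  map_source q hq := ⟨c.map_source _ hq.1, q.2.2⟩
  map_target v hv := ⟨c.map_target _ hv.1, trivial⟩
  left_inv q hq := Prod.ext (c.left_inv _ hq.1) (halfPoint_eq q.2)
  right_inv v hv := by
    ext i
    cases i with
    | none => exact halfPoint_val hv.2
    | some i => exact congrFun (c.right_inv _ hv.1) i
  smooth := by
    refine contMDiffOn_pi_space.2 fun i => ?_
    cases i with
    | none => exact (contMDiff_halfCoord.comp contMDiff_snd).contMDiffOn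
    | some i => exact (c.smooth_apply i).comp contMDiff_fst.contMDiffOn fun q hq => hq.1
  smooth_inv := by
    refine ContMDiffOn.prodMk ?_ ?_
    · exact c.smooth_inv.comp (contMDiffOn_iff_contDiffOn.2 (by fun_prop)) fun v hv => hv.1
    · exact contMDiffOn_halfPoint.comp (contMDiffOn_iff_contDiffOn.2 (by fun_prop)) fun v hv => hv.2

end Crd

section LC

/-- Near `p`, the half-line coordinates of `c` vanishing at `p` are, up to positive factors, those
functions `r l` which vanish at `p`; the index of the coordinate for `r l` is `j l`. -/
structure LCAt (c : Crd X κ C) (r : Fin n → X → ℝ) (j : Fin n → κ) (p : X) : Prop where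
  mem : p ∈ c.source
  mem_C : ∀ l, r l p = 0 → j l ∈ C
  inj : ∀ l l', r l p = 0 → r l' p = 0 → j l = j l' → l = l'
  cover : ∀ i ∈ C, c p i = 0 → ∃ l, r l p = 0 ∧ j l = i
  eq : ∀ l, r l p = 0 → ∃ u : X → ℝ, SmoothOn[X] u c.source ∧
    (∀ q ∈ c.source, 0 < u q) ∧ ∀ q ∈ c.source, r l q = u q * c q (j l)

/-- The functions `r l` are a complete family of defining functions of the (possibly disconnected)
boundary hypersurfaces of `X`. -/
structure LC (X : Mfd.{u}) (r : Fin n → X → ℝ) : Prop where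
  smooth : ∀ l, Smooth[X] (r l)
  nonneg : ∀ l p, 0 ≤ r l p
  loc : ∀ p, ∃ (κ : Type) (_ : Fintype κ) (_ : DecidableEq κ) (C : Set κ) (c : Crd X κ C)
    (j : Fin n → κ), LCAt c r j p

/-- In the coordinates `c`, modulo multiples of `m`, the functions `Z a` and the coordinates with
index in `T` generate the same ideal. -/
structure RelGen (c : Crd X κ C) (T : Finset κ) (Z : X → ι → ℝ) (m : X → ℝ)
    (A : X → ι → κ → ℝ) (A₀ : X → ι → ℝ) (B : X → κ → ι → ℝ) (B₀ : X → κ → ℝ) : Prop where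
  nonempty : T.Nonempty
  not_mem_C : ∀ i ∈ T, i ∉ C
  smooth_A : ∀ a i, SmoothOn[X] (fun q => A q a i) c.source
  smooth_A₀ : ∀ a, SmoothOn[X] (fun q => A₀ q a) c.source
  smooth_B : ∀ i a, SmoothOn[X] (fun q => B q i a) c.source
  smooth_B₀ : ∀ i, SmoothOn[X] (fun q => B₀ q i) c.source
  eq_A : ∀ q ∈ c.source, ∀ a, Z q a = ∑ i ∈ T, A q a i * c q i + m q * A₀ q a
  eq_B : ∀ q ∈ c.source, ∀ i ∈ T, c q i = ∑ a, B q i a * Z q a + m q * B₀ q i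

/-- Near `p` there are coordinates adapted to the boundary hypersurfaces `r l` in which, modulo
multiples of `m`, the functions `Z a` generate the same ideal as some coordinates with values in
a line. -/
def LCZ (r : Fin n → X → ℝ) (Z : X → ι → ℝ) (m : X → ℝ) (p : X) : Prop :=
  ∃ (κ : Type) (_ : Fintype κ) (_ : DecidableEq κ) (C : Set κ) (c : Crd X κ C) (j : Fin n → κ)
    (T : Finset κ) (A : X → ι → κ → ℝ) (A₀ : X → ι → ℝ) (B : X → κ → ι → ℝ) (B₀ : X → κ → ℝ),
    LCAt c r j p ∧ RelGen c T Z m A A₀ B B₀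

/-- Functions which are positive multiples of different coordinates generate the ideal of the
corresponding coordinate subspace. -/
lemma Gen.exists_of_eq_mul [DecidableEq κ] (c : Crd X κ C) {J : ι → κ}
    (hinj : Function.Injective J) {f : X → ι → ℝ} {w : ι → X → ℝ}
    (hw : ∀ a, SmoothOn[X] (w a) c.source) (hpos : ∀ a, ∀ q ∈ c.source, 0 < w a q)
    (hweq : ∀ q ∈ c.source, ∀ a, f q a = w a q * c q (J a)) :
    ∃ (A : X → ι → κ → ℝ) (B : X → κ → ι → ℝ), Gen f c (Finset.univ.image J) A B ∧
      ∀ q θ a, dirComp B (q, θ) (J a) = θ a / w a q := by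
  have hone : ∀ (f : ι → ℝ) (a : ι), ∑ b, (if J a = J b then f b else 0) = f a := by
    intro f a; rw [Finset.sum_eq_single a, if_pos rfl]
    · grind
    · simp
  refine ⟨fun q a i => if i = J a then w a q else 0,
    fun q i a => if i = J a then (w a q)⁻¹ else 0, ⟨?_, ?_, ?_, ?_⟩, ?_⟩
  · intro a i; split_ifs
    · exact hw a
    · exact contMDiffOn_const
  · intro i a; split_ifs
    · exact (hw a).inv₀ fun q hq => (hpos a q hq).ne'
    · exact contMDiffOn_const
  · intro q hq a; rw [hweq q hq a]; simp only [ite_mul, zero_mul]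
    rw [Finset.sum_ite_eq', if_pos (Finset.mem_image_of_mem _ (Finset.mem_univ a))]
  · intro q hq i hi; obtain ⟨a, -, rfl⟩ := Finset.mem_image.1 hi; simp only [ite_mul, zero_mul]
    rw [hone, hweq q hq a, inv_mul_cancel_left₀ (hpos a q hq).ne']
  · intro q θ a; simp only [dirComp, ite_mul, zero_mul]; rw [hone, div_eq_inv_mul]

namespace LCAt

variable {j : Fin n → κ}

lemma coord_eq_zero (h : LCAt c r j p) (hl : r l p = 0) : c p (j l) = 0 := by
  obtain ⟨u, -, hu, e⟩ := h.eq l hl; rw [e p h.mem] at hl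
  exact (mul_eq_zero.1 hl).resolve_left (hu p h.mem).ne'

lemma mem_closure (h : LCAt c r j p) (hl : r l p = 0) :
    p ∈ closure {q | r l q ≠ 0 ∧ ∀ l', l' ≠ l → r l' p = 0 → r l' q = 0} := by
  obtain ⟨γ, hγ, hev⟩ := c.exists_move h.mem (j l); refine mem_closure_of_tendsto hγ ?_
  filter_upwards [hev] with s hs
  obtain ⟨hs0, hsm, hsc⟩ := hs; constructor
  · obtain ⟨u, -, hu, e⟩ := h.eq l hl; rw [e _ hsm, hsc, h.coord_eq_zero hl, if_pos rfl, zero_add]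
    exact mul_ne_zero (hu _ hsm).ne' hs0.ne'
  · intro l' hne hl'; obtain ⟨u, -, hu, e⟩ := h.eq l' hl'
    rw [e _ hsm, hsc, h.coord_eq_zero hl', if_neg fun h' => hne (h.inj _ _ hl' hl h'), zero_add,
      mul_zero]

/-- The functions defining a corner generate its ideal. -/
lemma exists_gen [DecidableEq κ] (h : LCAt c r j p)
    (he : Function.Injective e) (hz : ∀ a, r (e a) p = 0) :
    ∃ (w : ι → X → ℝ) (A : X → ι → κ → ℝ) (B : X → κ → ι → ℝ),
      (∀ a, SmoothOn[X] (w a) c.source) ∧ (∀ a, ∀ q ∈ c.source, 0 < w a q) ∧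
      Gen (fun q a => r (e a) q) c (Finset.univ.image fun a => j (e a)) A B ∧
      ∀ q θ a, dirComp B (q, θ) (j (e a)) = θ a / w a q := by
  choose w hw hpos hweq using fun a => h.eq (e a) (hz a)
  obtain ⟨A, B, hG, hd⟩ := Gen.exists_of_eq_mul c (J := fun a => j (e a))
    (fun a b hab => he (h.inj _ _ (hz a) (hz b) hab)) hw hpos fun q hq a => hweq a q hq
  exact ⟨w, A, B, hw, hpos, hG, hd⟩

lemma pullback (e : PartialDiffeomorph Y.I X.I Y X ∞) {y : Y}
    (h : LCAt c r j (e y)) (hy : y ∈ e.source) :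
    LCAt (c.pullback e) (fun l y => r l (e y)) j y where
  mem := ⟨hy, h.mem⟩
  mem_C := h.mem_C
  inj := h.inj
  cover := h.cover
  eq l hl := by
    obtain ⟨u, hu, hpos, e1⟩ := h.eq l hl
    refine ⟨fun y => u (e y), hu.comp (e.contMDiffOn_toFun.mono inter_subset_left) fun y hy => hy.2,
      fun y hy => hpos _ hy.2, fun y hy => e1 _ hy.2⟩

lemma restrict (h : LCAt c r j p) {U : Set X} (hU : IsOpen U) (hp : p ∈ U) :
    LCAt (c.restrict U hU) r j p where
  mem := ⟨h.mem, hp⟩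
  mem_C := h.mem_C
  inj := h.inj
  cover := h.cover
  eq l hl := by
    obtain ⟨u, hu, hpos, e1⟩ := h.eq l hl
    exact ⟨u, hu.mono inter_subset_left, fun q hq => hpos q hq.1, fun q hq => e1 q hq.1⟩

/-- Some of the functions may be changed, as long as this is by positive factors near `p`. -/
lemma congr (h : LCAt c r j p) {r' : Fin n → X → ℝ} {v : Fin n → X → ℝ}
    (hv : ∀ l, SmoothOn[X] (v l) c.source) (hpos : ∀ l, ∀ q ∈ c.source, 0 < v l q)
    (e : ∀ l, ∀ q ∈ c.source, r' l q = v l q * r l q) : LCAt c r' j p := by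
  have hz : ∀ l, r' l p = 0 ↔ r l p = 0 := fun l => by
    rw [e l p h.mem, mul_eq_zero, or_iff_right (hpos l p h.mem).ne']
  refine ⟨h.mem, fun l hl => h.mem_C l ((hz l).1 hl),
    fun l l' hl hl' => h.inj l l' ((hz l).1 hl) ((hz l').1 hl'), fun i hi h0 => ?_, fun l hl => ?_⟩
  · obtain ⟨l, hl, hj⟩ := h.cover i hi h0; grind
  · obtain ⟨u, hu, hup, eu⟩ := h.eq l ((hz l).1 hl)
    refine ⟨fun q => v l q * u q, (hv l).mul hu, fun q hq => mul_pos (hpos l q hq) (hup q hq),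
      fun q hq => ?_⟩
    grind

/-- Adding a function which does not vanish at `p`. -/
lemma cons (h : LCAt c r j p) {r' : Fin (n + 1) → X → ℝ} (h0 : r' 0 p ≠ 0)
    (hs : ∀ l, r' l.succ = r l) (i : κ) : LCAt c r' (Fin.cons i j) p := by
  refine ⟨h.mem, ?_, ?_, ?_, ?_⟩
  · refine Fin.cases (fun h' => absurd h' h0) fun l hl => ?_; rw [hs] at hl; exact h.mem_C l hl
  · refine Fin.cases (fun _ h' => absurd h' h0) fun l => Fin.cases (fun _ h' => absurd h' h0) ?_
    intro l' hl hl' e; rw [hs] at hl hl'; rw [h.inj l l' hl hl' e]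
  · intro i hi hc; obtain ⟨l, hl, hj⟩ := h.cover i hi hc; exact ⟨l.succ, by rw [hs]; exact hl, hj⟩
  · refine Fin.cases (fun h' => absurd h' h0) fun l hl => ?_; rw [hs] at hl ⊢; exact h.eq l hl

end LCAt

namespace LC

lemma hasCrd (h : LC X r) : HasCrd X := fun p => by
  obtain ⟨κ, _, _, C, c, j, hc⟩ := h.loc p; exact ⟨κ, _, C, c, hc.mem⟩

lemma mem_closure (h : LC X r) (hl : r l p = 0) :
    p ∈ closure {q | r l q ≠ 0 ∧ ∀ l', l' ≠ l → r l' p = 0 → r l' q = 0} := by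
  obtain ⟨κ, _, _, C, c, j, hc⟩ := h.loc p; exact hc.mem_closure hl

lemma dense (h : LC X r) (l : Fin n) : Dense {p | r l p ≠ 0} := by
  intro p
  by_cases hp : r l p = 0
  · exact closure_mono (fun q hq => hq.1) (h.mem_closure hp)
  · exact subset_closure hp

lemma genAt (h : LC X r) (he : Function.Injective e) (p : X)
    (hz : ∀ a, r (e a) p = 0) : GenAt (fun q a => r (e a) q) p := by
  obtain ⟨κ, _, _, C, c, j, hc⟩ := h.loc p; obtain ⟨w, A, B, -, -, hG, -⟩ := hc.exists_gen he hz
  exact ⟨κ, _, _, C, c, _, A, B, hc.mem, hG⟩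

lemma dense_gen (h : LC X r) (a : ι) :
    Dense {p | ∃ a, r (e a) p ≠ 0} :=
  (h.dense (e a)).mono fun _ hp => ⟨a, hp⟩

end LC

end LC

/-- A criterion for the lift of `Z` to be `T`. -/
lemma lift_eq {X Y : Type u} [TopologicalSpace X] [TopologicalSpace Y] {β : Y → X} {P Z : Set X}
    {T : Set Y} (hZ : Z ⊆ closure (Z \ P)) (hT : IsClosed T)
    (hT1 : ∀ y, β y ∉ P → (y ∈ T ↔ β y ∈ Z)) (hT2 : T ⊆ closure (T ∩ β ⁻¹' Pᶜ)) :
    lift β P Z = T := by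
  unfold lift; split_ifs with h
  · have h1 : Z = ∅ := by
      rw [sdiff_eq_empty.2 h, closure_empty] at hZ; exact subset_empty_iff.1 hZ
    have h2 : T ∩ β ⁻¹' Pᶜ = ∅ := by grind
    rw [h2, closure_empty] at hT2; grind
  · apply subset_antisymm
    · exact closure_minimal (fun y hy => (hT1 y hy.2).2 hy.1) hT
    · exact hT2.trans (closure_mono fun y hy => ⟨(hT1 y hy.2).1 hy.1, hy.2⟩)

/-! ### Blow-ups of corners -/

/-- The functions `r'` defining the boundary hypersurfaces of a blow-up: `ρ`, the components of the
direction belonging to those `r l` which are among the generators `g`, as specified by the relation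
`D`, and the other functions `r l`. -/
structure BdBlow (β : Y → X) (g : X → ι → ℝ)
    (r : Fin n → X → ℝ) (D : ι → Fin n → Prop) (θ : Y → ι → ℝ) (ρ : Y → ℝ)
    (r' : Fin (n + 1) → Y → ℝ) : Prop where
  blow : Blow β g θ ρ
  base : LC X r
  gen : ∀ {a l}, D a l → ∀ p, g p a = r l p
  zero : r' 0 = ρ
  dir : ∀ {a l}, D a l → ∀ y, r' l.succ y = θ y a
  other : ∀ l, (∀ a, ¬ D a l) → ∀ y, r' l.succ y = r l (β y)

namespace BdBlow

variable {D : ι → Fin n → Prop} (h : BdBlow β g r D θ ρ r')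

include h

lemma mul_dir {a : ι} (ha : D a l) (y : Y) : r l (β y) = ρ y * r' l.succ y := by
  rw [h.dir ha, ← h.gen ha]; exact h.blow.eq y a

lemma smooth (l : Fin (n + 1)) : Smooth[Y] (r' l) := by
  induction l using Fin.cases with
  | zero => rw [h.zero]; exact h.blow.smooth_ρ
  | succ l =>
    by_cases hl : ∃ a, D a l
    · rw [funext (h.dir hl.choose_spec)]; exact h.blow.smooth_θ _
    · rw [funext (h.other l (not_exists.1 hl))]; exact (h.base.smooth l).comp h.blow.smooth_β

lemma pos {y : Y} (hy : ρ y ≠ 0) : 0 < ρ y := lt_of_le_of_ne (h.blow.nonneg y) hy.symm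

lemma nonneg (l : Fin (n + 1)) (y : Y) : 0 ≤ r' l y := by
  refine closure_minimal (s := {y | ρ y ≠ 0}) (fun y hy => ?_)
    (isClosed_le continuous_const (h.smooth l).continuous) (h.blow.dense y)
  change 0 ≤ r' l y
  induction l using Fin.cases with
  | zero => rw [h.zero]; exact h.blow.nonneg y
  | succ l =>
    have h1 := h.base.nonneg l (β y)
    by_cases hl : ∃ a, D a l
    · rw [h.mul_dir hl.choose_spec] at h1; exact nonneg_of_mul_nonneg_right h1 (h.pos hy)
    · rwa [h.other l (not_exists.1 hl)]

/-- The coordinates away from the front face. -/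
lemma lcAt_of_ne {f : PartialDiffeomorph Y.I X.I Y X ∞}
    (hf1 : f.source = β ⁻¹' {p | ∃ a, g p a ≠ 0}) (hf3 : ∀ y, f y = β y) {j : Fin n → κ} {y : Y}
      (hy : ρ y ≠ 0) (hc : LCAt c r j (β y))
    (i : κ) : LCAt (c.pullback f) r' (Fin.cons i j) y := by
  classical
  have h1 : LCAt (c.pullback f) (fun l q => r l (f q)) j y :=
    LCAt.pullback f (by rw [hf3]; exact hc) (by rw [hf1]; exact h.blow.ne_zero_iff.1 hy)
  have hρ : ∀ q ∈ (c.pullback f).source, 0 < ρ q := fun q hq => by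
    have : q ∈ f.source := hq.1; rw [hf1] at this; exact h.pos (h.blow.ne_zero_iff.2 this)
  have h2 : LCAt (c.pullback f) (fun l => r' l.succ) j y := by
    refine h1.congr (v := fun l q => if ∃ a, D a l then (ρ q)⁻¹ else 1) (fun l => ?_)
      (fun l q hq => ?_) fun l q hq => ?_
    · split_ifs
      exacts [h.blow.smooth_ρ.contMDiffOn.inv₀ fun q hq => (hρ q hq).ne', contMDiffOn_const]
    · split_ifs; exacts [inv_pos.2 (hρ q hq), one_pos]
    · rw [hf3]; split_ifs with hl
      · rw [h.mul_dir hl.choose_spec, inv_mul_cancel_left₀ (hρ q hq).ne']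
      · rw [h.other l (not_exists.1 hl), one_mul]
  exact h2.cons (by rw [h.zero]; exact hy) (fun l => rfl) i

/-- Projective coordinates are adapted to the boundary hypersurfaces of the blow-up, if the
half-line coordinates vanishing on the centre are multiples of generators. -/
lemma exists_lcAt [DecidableEq κ] {j : Fin n → κ} {w : ι → X → ℝ} {y : Y}
    (hy : ρ y = 0) (hc : LCAt c r j (β y)) (hG : Gen g c S A B)
    (hw : ∀ a, SmoothOn[X] (w a) c.source) (hw0 : ∀ a, ∀ q ∈ c.source, 0 < w a q)
    (hD : ∀ {a l}, D a l → j l ∈ S ∧ ∀ q θ, dirComp B (q, θ) (j l) = θ a / w a q)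
    (hS : ∀ k ∈ S, k ∈ C → ∃ a l, D a l ∧ j l = k) {i : κ} (hi : i ∈ S) {ε : ℝ}
    (hε : ε = 1 ∨ ε = -1 ∧ i ∉ C) (hpos : 0 < ε * dirComp B (β y, θ y) i) :
    ∃ ψ : Crd Y κ (insert i C), LCAt ψ r' (Fin.cons i j) y ∧ ∀ q ∈ ψ.source,
      β q ∈ c.source ∧ 0 < ε * dirComp B (β q, θ q) i ∧ ψ q = projVal c S B i ε (β q, θ q) := by
  obtain ⟨ψ, hs, -, hval⟩ := h.blow.proj hG ⟨_, hc.mem⟩ i hi ε hε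
  set d : Y → ℝ := fun q => ε * dirComp B (β q, θ q) i with hd
  have hψ : ∀ q ∈ ψ.source, β q ∈ c.source ∧ 0 < d q := fun q hq => by rwa [hs] at hq
  have hyψ : y ∈ ψ.source := by rw [hs]; exact ⟨hc.mem, hpos⟩
  have hβ : ∀ {u : X → ℝ}, SmoothOn[X] u c.source → SmoothOn[Y] (fun q => u (β q)) ψ.source :=
    fun hu => hu.comp h.blow.smooth_β.contMDiffOn fun q hq => (hψ q hq).1
  have hds : SmoothOn[Y] d ψ.source := contMDiffOn_const.mul ((contMDiffOn_dirComp hG i).comp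
    (h.blow.smooth_β.contMDiffOn.prodMk (contMDiffOn_pi_space.2 fun a =>
      (h.blow.smooth_θ a).contMDiffOn)) fun q hq => (hψ q hq).1)
  have hzD : ∀ {a l}, D a l → r l (β y) = 0 := fun ha =>
    (h.gen ha _).symm.trans (h.blow.eq_zero_iff.1 hy _)
  have hzr : ∀ l, r' l.succ y = 0 → r l (β y) = 0 := fun l hl => by
    by_cases hl' : ∃ a, D a l
    · exact hzD hl'.choose_spec
    · rwa [← h.other l (not_exists.1 hl')]
  have hvi : ∀ q ∈ ψ.source, ψ q i = ρ q * d q := fun q hq => by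
    rw [hval q hq]; simp only [projVal, if_true]
    rw [coord_eq_mul_dirComp h.blow.smooth_g hG (h.blow.mem q) (hψ q hq).1 hi, ← h.blow.eq_ρ, hd]
    ring
  have hvD : ∀ q ∈ ψ.source, ∀ {a l}, D a l → j l ≠ i → ψ q (j l) = θ q a / w a (β q) / d q := by
    intro q hq a l ha hl; rw [hval q hq]
    simp only [projVal, if_neg hl, if_pos (hD ha).1, (hD ha).2, hd]
  have hvo : ∀ q ∈ ψ.source, ∀ k ∉ S, ψ q k = c (β q) k := fun q hq k hk => by
    rw [hval q hq]; simp only [projVal, if_neg (fun h' : k = i => hk (h' ▸ hi)), if_neg hk]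
  have hjS : ∀ {l}, r l (β y) = 0 → (∀ a, ¬ D a l) → j l ∉ S := fun hl hl' hj => by
    obtain ⟨a, l', ha, e⟩ := hS _ hj (hc.mem_C _ hl); exact hl' a (hc.inj _ _ (hzD ha) hl e ▸ ha)
  -- the component of the direction at `i` does not vanish at `y`
  have hji : ∀ l, r' l.succ y = 0 → j l ≠ i := by
    rintro l hl rfl
    by_cases hl' : ∃ a, D a l
    · obtain ⟨a, ha⟩ := hl'; simp [(hD ha).2, ← h.dir ha, hl] at hpos
    grind
  refine ⟨ψ, ⟨hyψ, ?_, ?_, fun k hk h0 => ?_, ?_⟩, fun q hq => ⟨(hψ q hq).1, (hψ q hq).2,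
    hval q hq⟩⟩
  · exact Fin.cases (fun _ => mem_insert _ _) fun l hl =>
      mem_insert_of_mem _ (hc.mem_C l (hzr l hl))
  · refine Fin.cases (Fin.cases (fun _ _ _ => rfl) fun l _ hl hj => absurd hj.symm (hji l hl))
      fun l => Fin.cases (fun hl _ hj => absurd hj (hji l hl)) fun l' hl hl' hj => ?_
    rw [hc.inj l l' (hzr l hl) (hzr l' hl') hj]
  · by_cases hki : k = i
    · exact ⟨0, by rw [h.zero]; exact hy, hki.symm⟩
    · have hk := hk.resolve_left hki
      by_cases hkS : k ∈ S
      · obtain ⟨a, l, ha, rfl⟩ := hS k hkS hk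
        rw [hvD y hyψ ha hki, div_eq_zero_iff, or_iff_left (hψ y hyψ).2.ne', div_eq_zero_iff,
          or_iff_left (hw0 a _ hc.mem).ne', ← h.dir ha] at h0
        exact ⟨l.succ, h0, rfl⟩
      · rw [hvo y hyψ k hkS] at h0; obtain ⟨l, hl, rfl⟩ := hc.cover k hk h0
        exact ⟨l.succ, (h.other l (fun a ha => hkS (hD ha).1) y).trans hl, rfl⟩
  · refine Fin.cases (fun _ => ?_) fun l hl => ?_
      -- the front face
    · refine ⟨fun q => (d q)⁻¹, hds.inv₀ fun q hq => (hψ q hq).2.ne',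
        fun q hq => inv_pos.2 (hψ q hq).2, fun q hq => ?_⟩
      change r' 0 q = _ * ψ q i
      rw [h.zero, hvi q hq, mul_comm (ρ q), inv_mul_cancel_left₀ (hψ q hq).2.ne']
    · change ∃ u : Y → ℝ, _ ∧ _ ∧ ∀ q ∈ ψ.source, _ = u q * ψ q (j l)
      by_cases hl' : ∃ a, D a l
      · obtain ⟨a, ha⟩ := hl'
        refine ⟨fun q => w a (β q) * d q, (hβ (hw a)).mul hds,
          fun q hq => mul_pos (hw0 a _ (hψ q hq).1) (hψ q hq).2, fun q hq => ?_⟩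
        rw [h.dir ha, hvD q hq ha (hji l hl), mul_assoc, mul_div_cancel₀ _ (hψ q hq).2.ne',
          mul_div_cancel₀ _ (hw0 a _ (hψ q hq).1).ne']
      · rw [not_exists] at hl'; obtain ⟨v, hv, hv0, e⟩ := hc.eq l (hzr l hl)
        exact ⟨fun q => v (β q), hβ hv, fun q hq => hv0 _ (hψ q hq).1, fun q hq => by
          rw [h.other l hl', e _ (hψ q hq).1, hvo q hq _ (hjS (hzr l hl) hl')]⟩

end BdBlow

/-- The blow-up of the corner in which the functions `r (e a)` vanish, with the functions `r'`
defining the boundary hypersurfaces of the blow-up. -/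
structure CornerBlow (β : Y → X)
    (r : Fin n → X → ℝ) (e : ι → Fin n) (θ : Y → ι → ℝ) (ρ : Y → ℝ) (r' : Fin (n + 1) → Y → ℝ) :
    Prop where
  blow : Blow β (fun p a => r (e a) p) θ ρ
  base : LC X r
  inj : Function.Injective e
  zero : r' 0 = ρ
  dir : ∀ a y, r' (e a).succ y = θ y a
  other : ∀ l, (∀ a, e a ≠ l) → ∀ y, r' l.succ y = r l (β y)

namespace CornerBlow

variable (h : CornerBlow β r e θ ρ r')

include h

lemma genAt (p : X) (hp : ∀ a, r (e a) p = 0) :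
    GenAt (fun q a => r (e a) q) p := h.base.genAt h.inj p hp

lemma hasCrd : HasCrd Y := h.blow.hasCrd h.genAt h.base.hasCrd

lemma bdBlow :
    BdBlow β (fun p a => r (e a) p) r (fun a l => e a = l) θ ρ r' where
  blow := h.blow
  base := h.base
  gen := by rintro a _ rfl p; rfl
  zero := h.zero
  dir := by rintro a _ rfl; exact h.dir a
  other := h.other

lemma θ_nonneg (y : Y) (a : ι) : 0 ≤ θ y a := by rw [← h.dir]; exact h.bdBlow.nonneg _ y

lemma mul_dir (a : ι) (y : Y) : r (e a) (β y) = ρ y * r' (e a).succ y := h.bdBlow.mul_dir rfl y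

lemma smooth (l : Fin (n + 1)) : Smooth[Y] (r' l) := h.bdBlow.smooth l

/-- The coordinates of the blow-up adapted to its boundary hypersurfaces; the coordinates of the
base with values in a line are kept. -/
lemma exists_lcAt [DecidableEq κ] {j : Fin n → κ} {y : Y} (hc : LCAt c r j (β y)) :
    ∃ (ψ : Crd Y κ C) (j' : Fin (n + 1) → κ), LCAt ψ r' j' y ∧ (∀ q ∈ ψ.source, β q ∈ c.source) ∧
      ∀ i ∉ C, ∀ q ∈ ψ.source, ψ q i = c (β q) i := by
  by_cases hz : ∀ a, r (e a) (β y) = 0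
  · obtain ⟨w, A, B, hw, hpos, hG, hdir⟩ := hc.exists_gen h.inj hz
    obtain ⟨a₀, ha₀⟩ := h.blow.exists_θ_ne y; have hiC := hc.mem_C _ (hz a₀)
    have hp := h.bdBlow.exists_lcAt (h.blow.eq_zero_iff.2 hz) hc hG hw hpos
      (by rintro a _ rfl; exact ⟨Finset.mem_image_of_mem _ (Finset.mem_univ a), (hdir · · a)⟩)
      (fun i hi _ => by obtain ⟨a, -, rfl⟩ := Finset.mem_image.1 hi; exact ⟨a, _, rfl, rfl⟩)
      (Finset.mem_image_of_mem _ (Finset.mem_univ a₀)) (Or.inl rfl) (by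
        rw [one_mul, hdir]
        exact div_pos (lt_of_le_of_ne (h.θ_nonneg y a₀) ha₀.symm) (hpos _ _ hc.mem))
    rw [insert_eq_of_mem hiC] at hp; obtain ⟨ψ, hψ, hψ'⟩ := hp
    refine ⟨ψ, _, hψ, fun q hq => (hψ' q hq).1, fun i hi q hq => ?_⟩
    have hiS : i ∉ Finset.univ.image fun a => j (e a) := fun h' => by
      obtain ⟨a, -, rfl⟩ := Finset.mem_image.1 h'; exact hi (hc.mem_C _ (hz a))
    rw [(hψ' q hq).2.2]
    simp only [projVal, if_neg (fun h' : i = j (e a₀) => hi (h' ▸ hiC)), if_neg hiS]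
  · obtain ⟨a, ha⟩ := not_forall.1 hz; obtain ⟨f, hf1, -, hf3⟩ := h.blow.diffeo_off
    refine ⟨_, _, h.bdBlow.lcAt_of_ne hf1 hf3 (h.blow.ne_zero_iff.2 ⟨a, ha⟩) hc (j (e a)),
      fun q hq => ?_, fun i _ q _ => ?_⟩
    · rw [← hf3]; exact hq.2
    · change c (f q) i = _; rw [hf3]

lemma lc : LC Y r' where
  smooth := h.smooth
  nonneg := h.bdBlow.nonneg
  loc y := by
    obtain ⟨κ, _, _, C, c, j, hc⟩ := h.base.loc (β y); obtain ⟨ψ, j', hψ, -⟩ := h.exists_lcAt hc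
    grind

/-- The coordinates transversal to `Z = 0` do not vanish on boundary hypersurfaces, hence are kept
by the blow-up of a corner. -/
lemma lcz {ι' : Type} [Fintype ι'] {Z : X → ι' → ℝ}
    {y : Y} (hc : LCZ r Z m (β y)) : LCZ r' (fun y => Z (β y)) (fun y => m (β y)) y := by
  obtain ⟨κ, _, _, C, c, j, T, A, A₀, B, B₀, hc, hT⟩ := hc
  obtain ⟨ψ, j', hψ, hs, hv⟩ := h.exists_lcAt hc; have hβ := h.blow.smooth_β
  refine ⟨κ, _, inferInstance, C, ψ, j', T, fun y => A (β y), fun y => A₀ (β y), fun y => B (β y),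
    fun y => B₀ (β y), hψ, hT.nonempty, hT.not_mem_C, fun a i =>
      (hT.smooth_A a i).comp hβ.contMDiffOn hs,
    fun a => (hT.smooth_A₀ a).comp hβ.contMDiffOn hs, fun i a => (hT.smooth_B i a).comp
    hβ.contMDiffOn hs, fun i => (hT.smooth_B₀ i).comp hβ.contMDiffOn hs, fun q hq a => ?_,
    fun q hq i hi => ?_⟩
  · rw [hT.eq_A _ (hs q hq)]; congr 1
    exact Finset.sum_congr rfl fun i hi => by rw [hv i (hT.not_mem_C i hi) q hq]
  · rw [hv i (hT.not_mem_C i hi) q hq]; exact hT.eq_B _ (hs q hq) i hi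

/-- The lift of a corner which is not contained in the centre. -/
lemma lift_corner {b : Set (Fin n)} {a₀ : ι} (ha₀ : e a₀ ∉ b) :
    lift β {p | ∀ a, r (e a) p = 0} {p | ∀ l ∈ b, r l p = 0} = {y | ∀ l ∈ b, r' l.succ y = 0} := by
  refine lift_eq ?_ ?_ ?_ ?_
  · intro p hp
    by_cases hP : ∀ a, r (e a) p = 0
    · refine closure_mono ?_ (h.base.mem_closure (hP a₀)); rintro q ⟨hq1, hq2⟩; grind
    · exact subset_closure ⟨hp, hP⟩
  · have : {y | ∀ l ∈ b, r' l.succ y = 0} = ⋂ l ∈ b, {y | r' l.succ y = 0} := by ext; simp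
    rw [this]
    exact isClosed_biInter fun l _ => isClosed_eq (h.smooth _).continuous continuous_const
  · intro y hy; have hρ : ρ y ≠ 0 := fun h' => hy (h.blow.eq_zero_iff.1 h')
    refine forall₂_congr fun l _ => ?_
    by_cases hl : ∃ a, e a = l
    · obtain ⟨a, rfl⟩ := hl; rw [h.mul_dir, mul_eq_zero, or_iff_right hρ]
    · push Not at hl; rw [h.other l hl]
  · intro y hy
    by_cases hρ : ρ y = 0
    · have h1 : r' 0 y = 0 := by rw [h.zero]; exact hρ
      refine closure_mono ?_ (h.lc.mem_closure h1); rintro q ⟨hq1, hq2⟩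
      refine ⟨fun l hl => hq2 _ (Fin.succ_ne_zero l) (hy l hl), fun h' => hq1 ?_⟩
      rw [h.zero, h.blow.eq_zero_iff]; exact h'
    · exact subset_closure ⟨hy, fun h' => hρ (h.blow.eq_zero_iff.2 h')⟩

end CornerBlow

/-! ### Blow-ups of submanifolds of a boundary hypersurface -/

section

/-- The functions generating the ideal of the submanifold `Z = 0` of the hypersurface `r l₀ = 0`. -/
def relFun (r : X → ℝ) (Z : X → ι → ℝ) (p : X) (a : Option ι) : ℝ := a.elim (r p) (Z p)

lemma RelGen.pullback {T : Finset κ} {Z : X → ι → ℝ} {A₀ : X → ι → ℝ} {B₀ : X → κ → ℝ}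
    (h : RelGen c T Z m A A₀ B B₀) (e : PartialDiffeomorph Y.I X.I Y X ∞) :
    RelGen (c.pullback e) T (fun y => Z (e y)) (fun y => m (e y)) (fun y => A (e y))
      (fun y => A₀ (e y)) (fun y => B (e y)) (fun y => B₀ (e y)) where
  nonempty := h.nonempty
  not_mem_C := h.not_mem_C
  smooth_A a i :=
    (h.smooth_A a i).comp (e.contMDiffOn_toFun.mono inter_subset_left) fun _ hq => hq.2
  smooth_A₀ a := (h.smooth_A₀ a).comp (e.contMDiffOn_toFun.mono inter_subset_left) fun _ hq => hq.2
  smooth_B i a :=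
    (h.smooth_B i a).comp (e.contMDiffOn_toFun.mono inter_subset_left) fun _ hq => hq.2
  smooth_B₀ i := (h.smooth_B₀ i).comp (e.contMDiffOn_toFun.mono inter_subset_left) fun _ hq => hq.2
  eq_A _ hq := h.eq_A _ hq.2
  eq_B _ hq := h.eq_B _ hq.2

lemma LCZ.pullback {Z : X → ι → ℝ}
    (e : PartialDiffeomorph Y.I X.I Y X ∞) {y : Y} (h : LCZ r Z m (e y)) (hy : y ∈ e.source) :
    LCZ (fun l y => r l (e y)) (fun y => Z (e y)) (fun y => m (e y)) y := by
  obtain ⟨κ, _, _, C, c, j, T, A, A₀, B, B₀, hc, hT⟩ := h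
  exact ⟨κ, _, inferInstance, C, _, j, T, _, _, _, _, hc.pullback e hy, hT.pullback e⟩

/-- The coordinates for a submanifold of a hypersurface, and their relation to its generators. -/
lemma RelGen.exists_gen [DecidableEq κ] {T : Finset κ} {Z : X → ι → ℝ} {A₀ : X → ι → ℝ}
    {B₀ : X → κ → ℝ} {l₀ : Fin n} (h : RelGen c T Z (fun q => r l₀ q * m q) A A₀ B B₀)
    {j : Fin n → κ} (hc : LCAt c r j p) (hl₀ : r l₀ p = 0)
    (hm : Smooth[X] m) :
    ∃ (w : X → ℝ) (A' : X → Option ι → κ → ℝ) (B' : X → κ → Option ι → ℝ),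
      SmoothOn[X] w c.source ∧ (∀ q ∈ c.source, 0 < w q) ∧
      j l₀ ∉ T ∧
      Gen (relFun (r l₀) Z) c (insert (j l₀) T) A' B' ∧
      (∀ q θ, dirComp B' (q, θ) (j l₀) = θ none / w q) ∧
      (∀ q θ, ∀ i ∈ T, dirComp B' (q, θ) i = ∑ a, B q i a * θ (some a) + m q * B₀ q i * θ none) ∧
      ∀ q a (D : κ → ℝ), ∑ i ∈ insert (j l₀) T, A' q (some a) i * D i =
        m q * w q * A₀ q a * D (j l₀) + ∑ i ∈ T, A q a i * D i := by
  obtain ⟨w, hw, hpos, hweq⟩ := hc.eq l₀ hl₀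
  have hj : j l₀ ∉ T := fun h' => h.not_mem_C _ h' (hc.mem_C _ hl₀)
  have hne : ∀ i ∈ T, i ≠ j l₀ := fun i hi h' => hj (h' ▸ hi)
  have hA : ∀ q a (D : κ → ℝ), ∑ i ∈ insert (j l₀) T,
      (if i = j l₀ then m q * w q * A₀ q a else A q a i) * D i =
        m q * w q * A₀ q a * D (j l₀) + ∑ i ∈ T, A q a i * D i := by
    intro q a D; rw [Finset.sum_insert hj, if_pos rfl]; congr 1
    exact Finset.sum_congr rfl fun i hi => by rw [if_neg (hne i hi)]
  refine ⟨w, fun q a i => a.elim (if i = j l₀ then w q else 0)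
    (fun a => if i = j l₀ then m q * w q * A₀ q a else A q a i),
    fun q i a => a.elim (if i = j l₀ then (w q)⁻¹ else m q * B₀ q i)
    (fun a => if i = j l₀ then 0 else B q i a), hw, hpos, hj, ⟨?_, ?_, ?_, ?_⟩, ?_, ?_, hA⟩
  · intro a i
    cases a with
    | none => simp only [Option.elim_none]; split_ifs; exacts [hw, contMDiffOn_const]
    | some a =>
      simp only [Option.elim_some]; split_ifs
      exacts [(hm.contMDiffOn.mul hw).mul (h.smooth_A₀ a), h.smooth_A a i]
  · intro i a
    cases a with
    | none =>
      simp only [Option.elim_none]; split_ifs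
      exacts [hw.inv₀ fun q hq => (hpos q hq).ne', hm.contMDiffOn.mul (h.smooth_B₀ i)]
    | some a => simp only [Option.elim_some]; split_ifs; exacts [contMDiffOn_const, h.smooth_B i a]
  · intro q hq a
    cases a with
    | none =>
      simp only [Option.elim_none, relFun, ite_mul, zero_mul]
      rw [Finset.sum_ite_eq', if_pos (Finset.mem_insert_self _ _), hweq q hq]
    | some a => simp only [Option.elim_some, relFun]; rw [hA, h.eq_A q hq a, hweq q hq]; ring
  · intro q hq i hi; rw [Fintype.sum_option]; simp only [Option.elim_some, Option.elim_none, relFun]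
    rcases Finset.mem_insert.1 hi with rfl | hi
    · simp only [if_true, zero_mul, Finset.sum_const_zero, add_zero]; grind
    · simp only [if_neg (hne i hi)]; rw [h.eq_B q hq i hi]; ring
  · intro q θ; rw [dirComp, Fintype.sum_option]; simp [div_eq_inv_mul]
  · intro q θ i hi; rw [dirComp, Fintype.sum_option]; grind

/-- The blow-up of the submanifold `Z = 0` of the hypersurface `r l₀ = 0`, with the functions `r'`
defining the boundary hypersurfaces of the blow-up. The functions `Z` need only generate the ideal
of a p-submanifold up to multiples of `r l₀ * m`. -/
structure RelBlow (β : Y → X) (r : Fin n → X → ℝ) (l₀ : Fin n) (Z : X → ι → ℝ) (m : X → ℝ)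
    (θ : Y → Option ι → ℝ) (ρ : Y → ℝ) (r' : Fin (n + 1) → Y → ℝ) : Prop where
  blow : Blow β (relFun (r l₀) Z) θ ρ
  base : LC X r
  smooth_m : Smooth[X] m
  lcz : ∀ p, r l₀ p = 0 → (∀ a, Z p a = 0) → LCZ r Z (fun q => r l₀ q * m q) p
  zero : r' 0 = ρ
  dir : ∀ y, r' l₀.succ y = θ y none
  other : ∀ l, l ≠ l₀ → ∀ y, r' l.succ y = r l (β y)

lemma LCZ.genAt {l₀ : Fin n} {Z : X → ι → ℝ}
    (h : LCZ r Z (fun q => r l₀ q * m q) p) (hm : Smooth[X] m) (hp : r l₀ p = 0) :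
    GenAt (relFun (r l₀) Z) p := by
  obtain ⟨κ, _, _, C, c, j, T, A, A₀, B, B₀, hc, hT⟩ := h
  obtain ⟨w, A', B', -, -, -, hG, -⟩ := hT.exists_gen hc hp hm
  exact ⟨κ, _, inferInstance, C, c, _, A', B', hc.mem, hG⟩

namespace RelBlow

variable {l₀ : Fin n} {Z : X → ι → ℝ} {θ : Y → Option ι → ℝ} (h : RelBlow β r l₀ Z m θ ρ r')

include h

lemma genAt (p : X) (hp : ∀ a, relFun (r l₀) Z p a = 0) :
    GenAt (relFun (r l₀) Z) p :=
  (h.lcz p (hp none) fun a => hp (some a)).genAt h.smooth_m (hp none)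

lemma hasCrd : HasCrd Y := h.blow.hasCrd h.genAt h.base.hasCrd

lemma mul_dir (y : Y) : r l₀ (β y) = ρ y * r' l₀.succ y := by rw [h.dir]; exact h.blow.eq y none

lemma mul_Z (y : Y) (a : ι) : Z (β y) a = ρ y * θ y (some a) := h.blow.eq y (some a)

lemma bdBlow :
    BdBlow β (relFun (r l₀) Z) r (fun a l => a = none ∧ l = l₀) θ ρ r' where
  blow := h.blow
  base := h.base
  gen := by rintro _ _ ⟨rfl, rfl⟩ p; rfl
  zero := h.zero
  dir := by rintro _ _ ⟨rfl, rfl⟩; exact h.dir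
  other l hl := h.other l fun h' => hl none ⟨rfl, h'⟩

lemma θ_nonneg (y : Y) : 0 ≤ θ y none := by rw [← h.dir]; exact h.bdBlow.nonneg _ y

lemma smooth (l : Fin (n + 1)) : Smooth[Y] (r' l) := h.bdBlow.smooth l

/-- The coordinates of the blow-up in the domain of which the direction is dominated by the normal
direction of the hypersurface; in these the functions `Z / ρ` are generators. -/
lemma lcz_of_ne {y : Y} (hy : ρ y = 0) (hθ : θ y none ≠ 0) :
    LCZ r' (fun q a => θ q (some a)) (fun q => m (β q) * r' l₀.succ q) y := by
  have hz := h.blow.eq_zero_iff.1 hy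
  obtain ⟨κ, _, _, C, c, j, T, A, A₀, B, B₀, hc, hT⟩ := h.lcz _ (hz none) fun a => hz (some a)
  obtain ⟨w, A', B', hw, hpos, hjT, hG, hd0, hd1, hAs⟩ := hT.exists_gen hc (hz none) h.smooth_m
  have hiC : j l₀ ∈ C := hc.mem_C _ (hz none)
  have hp := h.bdBlow.exists_lcAt hy hc hG (fun _ => hw) (fun _ => hpos)
    (by rintro _ _ ⟨rfl, rfl⟩; exact ⟨Finset.mem_insert_self _ _, hd0⟩)
    (fun k hk hkC => ⟨none, l₀, ⟨rfl, rfl⟩, ((Finset.mem_insert.1 hk).resolve_right fun h' =>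
      hT.not_mem_C _ h' hkC).symm⟩) (Finset.mem_insert_self _ _) (Or.inl rfl) (by
        rw [one_mul, hd0]
        exact div_pos (lt_of_le_of_ne (h.θ_nonneg y) hθ.symm) (hpos _ hc.mem))
  rw [insert_eq_of_mem hiC] at hp; obtain ⟨ψ, hψ, hψ'⟩ := hp
  have hψs : ∀ q ∈ ψ.source, β q ∈ c.source ∧ 0 < θ q none := fun q hq => by
    obtain ⟨h1, h2, -⟩ := hψ' q hq; rw [one_mul, hd0] at h2
    exact ⟨h1, (div_pos_iff_of_pos_right (hpos _ h1)).1 h2⟩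
  have hvT : ∀ q ∈ ψ.source, ∀ k ∈ T, ψ q k = dirComp B' (β q, θ q) k / (θ q none / w (β q)) := by
    intro q hq k hk; rw [(hψ' q hq).2.2]
    simp only [projVal, if_neg (fun h' : k = j l₀ => hjT (h' ▸ hk)),
      if_pos (Finset.mem_insert_of_mem hk), hd0, one_mul]
  have hsm : ∀ {k : X → ℝ}, SmoothOn[X] k c.source →
      SmoothOn[Y] (fun q => k (β q)) ψ.source := fun hk =>
    hk.comp h.blow.smooth_β.contMDiffOn fun q hq => (hψs q hq).1
  have hθs : SmoothOn[Y] (fun q => θ q none) ψ.source := (h.blow.smooth_θ none).contMDiffOn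
  refine ⟨κ, _, inferInstance, _, ψ, _, T, fun q a i => A (β q) a i * (θ q none / w (β q)),
    fun q a => A₀ (β q) a, fun q i a => B (β q) i a * (w (β q) / θ q none),
    fun q i => B₀ (β q) i * (w (β q) / θ q none), hψ, hT.nonempty, hT.not_mem_C, ?_, ?_, ?_, ?_, ?_,
    ?_⟩
  · exact fun a i => (hsm (hT.smooth_A a i)).mul (hθs.div₀ (hsm hw) fun q hq =>
      (hpos _ (hψs q hq).1).ne')
  · exact fun a => hsm (hT.smooth_A₀ a)
  · exact fun i a => (hsm (hT.smooth_B i a)).mul ((hsm hw).div₀ hθs fun q hq => (hψs q hq).2.ne')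
  · exact fun i => (hsm (hT.smooth_B₀ i)).mul ((hsm hw).div₀ hθs fun q hq => (hψs q hq).2.ne')
  · intro q hq a; have h1 := sum_mul_dirComp hG (h.blow.mem q) (hψs q hq).1 (some a)
    simp only at h1; have h2 := hAs (β q) a fun i => dirComp B' (β q, θ q) i
    have hw0 := (hpos _ (hψs q hq).1).ne'; have hθ0 := (hψs q hq).2.ne'
    rw [← h1, h2, hd0, h.dir, add_comm]; congr 1
    · refine Finset.sum_congr rfl fun i hi => ?_; grind
    · field_simp
  · intro q hq i hi; have hw0 := (hpos _ (hψs q hq).1).ne'; have hθ0 := (hψs q hq).2.ne'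
    rw [hvT q hq i hi, hd1 _ _ i hi, h.dir, add_div, Finset.sum_div]; grind

/-- The only half-line coordinate of the centre is that of the hypersurface `r l₀ = 0`. -/
lemma lc : LC Y r' where
  smooth := h.smooth
  nonneg := h.bdBlow.nonneg
  loc y := by
    by_cases hy : ρ y = 0
    · have hz := h.blow.eq_zero_iff.1 hy
      obtain ⟨κ, _, _, C, c, j, T, A, A₀, B, B₀, hc, hT⟩ := h.lcz _ (hz none) fun a => hz (some a)
      obtain ⟨w, A', B', hw, hpos, -, hG, hd0, -⟩ := hT.exists_gen hc (hz none) h.smooth_m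
      obtain ⟨i, hi, ε, hε, hpos'⟩ := hG.exists_proj (h.blow.mem _) hc.mem
      obtain ⟨ψ, hψ, -⟩ := h.bdBlow.exists_lcAt hy hc hG (fun _ => hw) (fun _ => hpos)
        (by rintro _ _ ⟨rfl, rfl⟩; exact ⟨Finset.mem_insert_self _ _, hd0⟩)
        (fun k hk hkC => ⟨none, l₀, ⟨rfl, rfl⟩, ((Finset.mem_insert.1 hk).resolve_right fun h' =>
          hT.not_mem_C _ h' hkC).symm⟩) hi hε hpos'
      grind
    · obtain ⟨f, hf1, -, hf3⟩ := h.blow.diffeo_off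
      obtain ⟨κ, _, _, C, c, j, hc⟩ := h.base.loc (β y)
      exact ⟨κ, _, inferInstance, C, _, _, h.bdBlow.lcAt_of_ne hf1 hf3 hy hc (j l₀)⟩

/-- The functions `Z / ρ` are generators up to multiples of `m * r' l₀`. -/
lemma lcz_dir {y : Y} (hζ : ∀ a, θ y (some a) = 0) (hy : LCZ r Z (fun q => r l₀ q * m q) (β y)) :
    LCZ r' (fun q a => θ q (some a)) (fun q => m (β q) * r' l₀.succ q) y := by
  by_cases hρ : ρ y = 0
  · refine h.lcz_of_ne hρ fun h0 => ?_; obtain ⟨a, ha⟩ := h.blow.exists_θ_ne y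
    cases a with
    | none => exact ha h0
    | some a => exact ha (hζ a)
  · obtain ⟨f, hf1, -, hf3⟩ := h.blow.diffeo_off
    obtain ⟨κ, _, _, C, c, j, T, A, A₀, B, B₀, hc, hT⟩ := hy; have hT' := hT.pullback f
    have hc' := h.bdBlow.lcAt_of_ne hf1 hf3 hρ hc (j l₀)
    have hρ : ∀ q ∈ (c.pullback f).source, ρ q ≠ 0 := by
      intro q hq; have : q ∈ f.source := hq.1; rw [hf1] at this; exact h.blow.ne_zero_iff.2 this
    have hρs : SmoothOn[Y] ρ (c.pullback f).source := h.blow.smooth_ρ.contMDiffOn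
    refine ⟨κ, _, inferInstance, C, _, _, T, fun q a i => (ρ q)⁻¹ * A (f q) a i,
      fun q a => A₀ (f q) a, fun q i a => B (f q) i a * ρ q, fun q i => B₀ (f q) i * ρ q, hc',
      hT'.nonempty, hT'.not_mem_C, fun a i => (hρs.inv₀ hρ).mul (hT'.smooth_A a i), hT'.smooth_A₀,
      fun i a => (hT'.smooth_B i a).mul hρs, fun i => (hT'.smooth_B₀ i).mul hρs, ?_, ?_⟩
    · intro q hq a; have h1 := hT'.eq_A q hq a; simp only [hf3] at h1; rw [h.mul_Z, h.mul_dir] at h1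
      apply mul_left_cancel₀ (hρ q hq); rw [h1, mul_add, Finset.mul_sum]; grind
    · intro q hq i hi; have h1 := hT'.eq_B q hq i hi; simp only [hf3] at h1; rw [h1, h.mul_dir]
      congr 1
      · refine Finset.sum_congr rfl fun a _ => ?_; rw [h.mul_Z, hf3]; ring
      · rw [hf3]; ring

end RelBlow

end

/-! ### Products -/

section

/-- The coordinate of the factor `[0, ∞)`. -/
def halfCoord (q : X.prodHalfLine) : ℝ := q.2.val 0

lemma contMDiff_halfCoord' : Smooth[X.prodHalfLine] (halfCoord (X := X)) :=
  contMDiff_halfCoord.comp contMDiff_snd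

section

lemma LCAt.prodHalfLine {j : Fin n → κ} {q : X.prodHalfLine}
    (h : LCAt c r j q.1) : LCAt c.prodHalfLine
      (Fin.cons halfCoord fun l (q : X.prodHalfLine) => r l q.1)
      (Fin.cons none fun l => some (j l)) q where
  mem := ⟨h.mem, trivial⟩
  mem_C := Fin.cases (fun _ => mem_insert _ _) fun l hl =>
    mem_insert_of_mem _ (mem_image_of_mem _ (h.mem_C l hl))
  inj := by
    refine Fin.cases (Fin.cases (fun _ _ _ => rfl) fun l _ _ hj => ?_)
      fun l => Fin.cases (fun _ _ hj => ?_) fun l' hl hl' hj => ?_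
    · exact absurd hj (Option.some_ne_none _).symm
    · exact absurd hj (Option.some_ne_none _)
    · rw [h.inj l l' hl hl' (Option.some_injective _ hj)]
  cover := by
    intro i hi h0; rcases hi with rfl | ⟨i, hi, rfl⟩
    · exact ⟨0, h0, rfl⟩
    · obtain ⟨l, hl, hj⟩ := h.cover i hi h0; exact ⟨l.succ, hl, congrArg some hj⟩
  eq := by
    refine Fin.cases (fun _ => ?_) fun l hl => ?_
    · exact ⟨fun _ => 1, contMDiffOn_const, fun _ _ => one_pos, fun q _ => (one_mul _).symm⟩
    · obtain ⟨u, hu, hpos, e⟩ := h.eq l hl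
      exact ⟨fun q => u q.1, hu.comp contMDiff_fst.contMDiffOn fun q hq => hq.1,
        fun q hq => hpos _ hq.1, fun q hq => e _ hq.1⟩

lemma LC.prodHalfLine (h : LC X r) :
    LC X.prodHalfLine (Fin.cons halfCoord fun l (q : X.prodHalfLine) => r l q.1) where
  smooth := Fin.cases contMDiff_halfCoord' fun l => (h.smooth l).comp contMDiff_fst
  nonneg := Fin.cases (fun q => q.2.2) fun l q => h.nonneg l q.1
  loc q := by
    obtain ⟨κ, _, _, C, c, j, hc⟩ := h.loc q.1
    exact ⟨_, _, inferInstance, _, _, _, hc.prodHalfLine⟩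

lemma LCZ.prodHalfLine {Z : X → ι → ℝ} {q : X.prodHalfLine}
    (h : LCZ r Z m q.1) : LCZ (Fin.cons halfCoord fun l (q : X.prodHalfLine) => r l q.1)
      (fun q : X.prodHalfLine => Z q.1) (fun q => m q.1) q := by
  obtain ⟨κ, _, _, C, c, j, T, A, A₀, B, B₀, hc, hT⟩ := h
  have hs : ∀ {k : X → ℝ}, SmoothOn[X] k c.source →
      SmoothOn[X.prodHalfLine] (fun q => k q.1) c.prodHalfLine.source := fun hk =>
    hk.comp contMDiff_fst.contMDiffOn fun q hq => hq.1
  refine ⟨_, _, inferInstance, _, _, _, T.map Function.Embedding.some,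
    fun q a i => i.elim 0 (A q.1 a), fun q => A₀ q.1, fun q i a => i.elim 0 fun i => B q.1 i a,
    fun q i => i.elim 0 (B₀ q.1), hc.prodHalfLine, hT.nonempty.map, ?_, ?_,
    fun a => hs (hT.smooth_A₀ a), ?_, ?_,
    ?_, ?_⟩
  · intro i hi; obtain ⟨i, hi', rfl⟩ := Finset.mem_map.1 hi; have := hT.not_mem_C i hi'
    simpa using this
  · intro a i
    cases i with
    | none => exact contMDiffOn_const
    | some i => exact hs (hT.smooth_A a i)
  · intro i a
    cases i with
    | none => exact contMDiffOn_const
    | some i => exact hs (hT.smooth_B i a)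
  · intro i
    cases i with
    | none => exact contMDiffOn_const
    | some i => exact hs (hT.smooth_B₀ i)
  · intro q hq a; rw [Finset.sum_map]; exact hT.eq_A q.1 hq.1 a
  · intro q hq i hi; obtain ⟨i, hi', rfl⟩ := Finset.mem_map.1 hi; exact hT.eq_B q.1 hq.1 i hi'

end

lemma LC.prod {x : X → ℝ} {y : Y → ℝ} (hX : LC X ![x]) (hY : LC Y ![y]) :
    LC (X.prod Y) ![fun q => x q.1, fun q => y q.2] where
  smooth := by
    intro l; fin_cases l
    · exact (hX.smooth 0).comp contMDiff_fst
    · exact (hY.smooth 0).comp contMDiff_snd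
  nonneg l q := by
    fin_cases l
    · exact hX.nonneg 0 q.1
    · exact hY.nonneg 0 q.2
  loc q := by
    obtain ⟨κ, _, _, C, c, j, hc⟩ := hX.loc q.1; obtain ⟨κ', _, _, C', c', j', hc'⟩ := hY.loc q.2
    refine ⟨_, _, inferInstance, _, c.prod c', ![Sum.inl (j 0), Sum.inr (j' 0)], ⟨hc.mem, hc'.mem⟩,
      ?_, ?_, ?_, ?_⟩
    · intro l hl; fin_cases l
      · exact Or.inl (mem_image_of_mem _ (hc.mem_C 0 hl))
      · exact Or.inr (mem_image_of_mem _ (hc'.mem_C 0 hl))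
    · intro l l' _ _ e; fin_cases l <;> fin_cases l' <;> first | rfl | exact absurd e (by simp)
    · intro i hi h0; rcases hi with ⟨i, hi, rfl⟩ | ⟨i, hi, rfl⟩
      · obtain ⟨l, hl, hj⟩ := hc.cover i hi h0; rw [Subsingleton.elim l 0] at hl hj
        exact ⟨0, hl, congrArg Sum.inl hj⟩
      · obtain ⟨l, hl, hj⟩ := hc'.cover i hi h0; rw [Subsingleton.elim l 0] at hl hj
        exact ⟨1, hl, congrArg Sum.inr hj⟩
    · intro l hl; fin_cases l
      · obtain ⟨v, hv, hpos, e⟩ := hc.eq 0 hl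
        exact ⟨fun q => v q.1, hv.comp contMDiff_fst.contMDiffOn fun q hq => hq.1,
          fun q hq => hpos _ hq.1, fun q hq => e _ hq.1⟩
      · obtain ⟨v, hv, hpos, e⟩ := hc'.eq 0 hl
        exact ⟨fun q => v q.2, hv.comp contMDiff_snd.contMDiffOn fun q hq => hq.2,
          fun q hq => hpos _ hq.2, fun q hq => e _ hq.2⟩

end

/-- Preimages of dense open sets under blow-down maps are dense. -/
lemma Blow.dense_preimage (h : Blow β g θ ρ) {D : Set X} (hD : Dense D) :
    Dense (β ⁻¹' D) := by
  obtain ⟨f, hf1, hf2, hf3⟩ := h.diffeo_off; rw [dense_iff_inter_open]; intro U hU hne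
  obtain ⟨y, hyU, hyρ⟩ := h.dense.inter_open_nonempty U hU hne
  have hyf : y ∈ f.source := by rw [hf1]; exact h.ne_zero_iff.1 hyρ
  have hO : IsOpen (f.target ∩ f.symm ⁻¹' U) :=
    f.contMDiffOn_invFun.continuousOn.isOpen_inter_preimage f.open_target hU
  have hy : f y ∈ f.target ∩ f.symm ⁻¹' U := by
    refine ⟨f.map_source' hyf, ?_⟩; have : f.symm (f y) = y := f.left_inv' hyf
    grind
  obtain ⟨p, ⟨hp1, hp2⟩, hpD⟩ := hD.inter_open_nonempty _ hO ⟨_, hy⟩; refine ⟨f.symm p, hp2, ?_⟩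
  have : f (f.symm p) = p := f.right_inv' hp1; rw [mem_preimage, ← hf3, this]; exact hpD

/-! ### Manifolds with fibred boundary -/

/-- A manifold with boundary with defining function `x`, the boundary of which is fibred. The
relation `R p p'` says that the boundary points `p` and `p'` are in the same fibre, `E` is an
extension of the composition of the fibration with an embedding of its base. Near each point of
`{R p p'}` the difference of the two values of `E` is, modulo the defining functions, equivalent to
a part of a coordinate system. -/
structure FibredBoundary (M : Mfd.{u}) (x : M → ℝ) (R : M → M → Prop) (E : M → ι → ℝ) : Prop where
  lc : LC M ![x]
  smooth_E : ∀ a, Smooth[M] fun p => E p a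
  rel : ∀ p p', R p p' ↔ x p = 0 ∧ x p' = 0 ∧ ∀ a, E p a = E p' a
  chart : ∀ p p', R p p' → ∃ (κ : Type) (_ : Fintype κ) (_ : DecidableEq κ) (C : Set κ)
    (c : Crd (M.prod M) κ C) (i i' : κ) (T : Finset κ) (h h' : M.prod M → ℝ)
    (A : M.prod M → ι → κ → ℝ) (A₁ A₂ : M.prod M → ι → ℝ) (L : M.prod M → κ → ι → ℝ)
    (L₁ L₂ : M.prod M → κ → ℝ),
    (p, p') ∈ c.source ∧ i ≠ i' ∧ i ∈ C ∧ i' ∈ C ∧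
    (∀ k ∈ C, c (p, p') k = 0 → k = i ∨ k = i') ∧ (∀ k ∈ T, k ∉ C) ∧
    (SmoothOn[M.prod M] h c.source ∧ SmoothOn[M.prod M] h' c.source ∧
      (∀ a k, SmoothOn[M.prod M] (fun q => A q a k) c.source) ∧
      (∀ a, SmoothOn[M.prod M] (fun q => A₁ q a) c.source) ∧
      (∀ a, SmoothOn[M.prod M] (fun q => A₂ q a) c.source) ∧
      (∀ k a, SmoothOn[M.prod M] (fun q => L q k a) c.source) ∧
      (∀ k, SmoothOn[M.prod M] (fun q => L₁ q k) c.source) ∧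
      ∀ k, SmoothOn[M.prod M] (fun q => L₂ q k) c.source) ∧
    ∀ q ∈ c.source, 0 < 1 + c q i * h q ∧ 0 < 1 + c q i' * h' q ∧
      x q.1 = (1 + c q i * h q) * c q i ∧ x q.2 = (1 + c q i' * h' q) * c q i' ∧
      (∀ a, E q.1 a - E q.2 a = ∑ k ∈ T, A q a k * c q k + (c q i * A₁ q a + c q i' * A₂ q a)) ∧
      ∀ k ∈ T, c q k = ∑ a, L q k a * (E q.1 a - E q.2 a) + (c q i * L₁ q k + c q i' * L₂ q k)

open Classical in
/-- Dropping a half-line coordinate, where it is positive, from the set of half-line coordinates,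
and subtracting `1` from it. -/
def Crd.shift (c : Crd X κ C) (k : κ) :
    Crd X κ (C \ {k}) :=
  c.change (fun v i => if i = k then v i - 1 else v i) (fun v i => if i = k then v i + 1 else v i)
    (O := {v | 0 < v k}) (O' := {v | -1 < v k}) (isOpen_lt continuous_const (continuous_apply k))
    (isOpen_lt continuous_const (continuous_apply k))
    (contDiff_pi.2 fun i => by split_ifs <;> fun_prop).contDiffOn
    (contDiff_pi.2 fun i => by split_ifs <;> fun_prop).contDiffOn
    (by
      rintro v ⟨hv, hv'⟩; have hv : 0 < v k := hv; refine ⟨by simp [hv], fun i hi => ?_⟩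
      have : i ≠ k := hi.2
      simpa [this] using hv' i hi.1)
    (by
      rintro v ⟨hv, hv'⟩; have hv : -1 < v k := hv; refine ⟨?_, fun i hi => ?_⟩
      · grind
      · by_cases h : i = k
        · grind
        · simpa [h] using hv' i ⟨hi, h⟩)
    (by intro v _; ext i; by_cases h : i = k <;> simp [h])
    (by intro v _; ext i; by_cases h : i = k <;> simp [h])

lemma Crd.shift_apply_self (c : Crd X κ C) (k : κ) (q : X) : c.shift k q k = c q k - 1 := if_pos rfl

lemma Crd.shift_apply_of_ne (c : Crd X κ C) {k i : κ} (h : i ≠ k) (q : X) : c.shift k q i = c q i :=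
  if_neg h

/-! ### The fibre diagonal in the b-double space -/

section

variable {M : Mfd.{u}} {x : M → ℝ} {R : M → M → Prop} {E : M → ι → ℝ}

/-- The defining functions of the two boundary faces of `M × M`. -/
def baseFun (x : M → ℝ) : Fin 2 → M.prod M → ℝ := ![fun q => x q.1, fun q => x q.2]

/-- The functions `l - r` and `E(p) - E(p')`; with the defining function of the front face they
generate the ideal of the fibre diagonal. -/
def diagFun (E : M → ι → ℝ) (β : Y → M.prod M) (θ : Y → Fin 2 → ℝ) (y : Y) (a : Option ι) : ℝ :=
  a.elim (θ y 0 - θ y 1) fun a => E (β y).1 a - E (β y).2 a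

variable {Mb : Mfd.{u}} {β : Mb → M.prod M} {θ : Mb → Fin 2 → ℝ} {ρ : Mb → ℝ}
  (hF : FibredBoundary M x R E) (hb : Blow β (fun p a => baseFun x a p) θ ρ)

lemma FibredBoundary.lc_prod (hF : FibredBoundary M x R E) : LC (M.prod M) (baseFun x) :=
  hF.lc.prod hF.lc

include hF hb

/-- The front face, and the faces over the two factors, of the b-double space. -/
lemma FibredBoundary.cornerBlow :
    CornerBlow β (baseFun x) id θ ρ ![ρ, fun y => θ y 0, fun y => θ y 1] where
  blow := hb
  base := hF.lc_prod
  inj := Function.injective_id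
  zero := rfl
  dir a y := by fin_cases a <;> rfl
  other l hl := absurd rfl (hl l)

lemma FibredBoundary.smooth_diagFun (a : Option ι) :
    Smooth[Mb] fun y => diagFun E β θ y a := by
  cases a with
  | none => exact (hb.smooth_θ 0).sub (hb.smooth_θ 1)
  | some a =>
    exact ((hF.smooth_E a).comp (contMDiff_fst.comp hb.smooth_β)).sub
      ((hF.smooth_E a).comp (contMDiff_snd.comp hb.smooth_β))

/-- Near the fibre diagonal in the front face there are coordinates in which the fibre diagonal is
a coordinate subspace, generated by the functions `diagFun`. The coordinate for `l - r` is
`x' / x - 1`, which takes values in a line. -/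
lemma FibredBoundary.lcz {y : Mb} (hy : ρ y = 0) (hZ : ∀ a, diagFun E β θ y a = 0) :
    LCZ ![ρ, fun y => θ y 0, fun y => θ y 1] (diagFun E β θ) (fun q => ρ q * 1) y := by
  have hx : ∀ a, baseFun x a (β y) = 0 := hb.eq_zero_iff.1 hy
  have hθ01 : θ y 0 = θ y 1 := sub_eq_zero.1 (hZ none)
  -- the two components of the direction agree and are not both zero
  have hθ0 : 0 < θ y 0 := by
    refine lt_of_le_of_ne ((hF.cornerBlow hb).θ_nonneg y 0) fun h0 => ?_
    have h1 := hb.exists_θ_ne y; rw [Fin.exists_fin_two, ← hθ01, ← h0] at h1; simp at h1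
  obtain ⟨κ, _, _, C, c, i, i', T, h, h', A, A₁, A₂, L, L₁, L₂, hmem, hii, hi, hi', hcov, hTC,
    ⟨sh, sh', sA, sA₁, sA₂, sL, sL₁, sL₂⟩, heq⟩ := hF.chart (β y).1 (β y).2
      ((hF.rel _ _).2 ⟨hx 0, hx 1, fun a => sub_eq_zero.1 (hZ (some a))⟩)
  have hmem : β y ∈ c.source := hmem; set u₀ : M.prod M → ℝ := fun q => 1 + c q i * h q with hu₀
  set u₁ : M.prod M → ℝ := fun q => 1 + c q i' * h' q with hu₁
  have su₀ : SmoothOn[M.prod M] u₀ c.source := contMDiffOn_const.add ((c.smooth_apply i).mul sh)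
  have su₁ : SmoothOn[M.prod M] u₁ c.source := contMDiffOn_const.add ((c.smooth_apply i').mul sh')
  -- projective coordinates in which `x` is the coordinate `i`, up to the positive factor `u₀`
  obtain ⟨A', B', hG, hd⟩ := Gen.exists_of_eq_mul c (J := ![i, i'])
    (f := fun q a => baseFun x a q) (w := ![u₀, u₁])
    (by simp [Function.Injective, Fin.forall_fin_two, hii, hii.symm])
    (Fin.forall_fin_two.2 ⟨su₀, su₁⟩)
    (Fin.forall_fin_two.2 ⟨fun q hq => (heq q hq).1, fun q hq => (heq q hq).2.1⟩)
    (fun q hq => Fin.forall_fin_two.2 ⟨(heq q hq).2.2.1, (heq q hq).2.2.2.1⟩)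
  set S := Finset.univ.image ![i, i'] with hS
  have hSm : ∀ k, k ∈ S ↔ k = i ∨ k = i' := fun k => by simp [hS, Fin.exists_fin_two, eq_comm]
  obtain ⟨ψ₀, hs, -, hval⟩ := hb.proj hG ⟨_, hmem⟩ i ((hSm i).2 (Or.inl rfl)) 1 (Or.inl rfl)
  set a₀ : Mb → ℝ := fun q => θ q 0 / u₀ (β q); set a₁ : Mb → ℝ := fun q => θ q 1 / u₁ (β q)
  have hd0 : ∀ q, dirComp B' (β q, θ q) i = a₀ q := fun q => hd _ _ 0
  have hd1 : ∀ q, dirComp B' (β q, θ q) i' = a₁ q := fun q => hd _ _ 1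
  have hci : ∀ q, β q ∈ c.source → c (β q) i = ρ q * a₀ q := fun q hq => by
    rw [← mul_div_assoc, eq_div_iff (heq _ hq).1.ne', mul_comm, ← (heq _ hq).2.2.1]; exact hb.eq q 0
  have hci' : ∀ q, β q ∈ c.source → c (β q) i' = ρ q * a₁ q := fun q hq => by
    rw [← mul_div_assoc, eq_div_iff (heq _ hq).2.1.ne', mul_comm, ← (heq _ hq).2.2.2.1]
    exact hb.eq q 1
  have hv : ∀ q ∈ ψ₀.source, ∀ k, ψ₀ q k = if k = i' then a₁ q / a₀ q else c (β q) k := by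
    intro q hq k; rw [hval q hq]; simp only [projVal, hSm, one_mul, hd0]; split_ifs <;> grind
  set ψ := ψ₀.shift i' with hψ
  have hψs : ∀ q ∈ ψ.source, β q ∈ c.source ∧ 0 < θ q 0 := by
    rintro q ⟨hq, -⟩; rw [hs] at hq; have h2 := hq.2; rw [one_mul, hd0] at h2
    exact ⟨hq.1, (div_pos_iff_of_pos_right (heq _ hq.1).1).1 h2⟩
  have pu₀ : ∀ q ∈ ψ.source, 0 < u₀ (β q) := fun q hq => (heq _ (hψs q hq).1).1
  have hvo : ∀ q ∈ ψ.source, ∀ k, k ≠ i' → ψ q k = c (β q) k := fun q hq k hk => by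
    rw [hψ, Crd.shift_apply_of_ne _ hk, hv q hq.1, if_neg hk]
  have hv1 : ∀ q ∈ ψ.source, a₁ q = a₀ q * (ψ q i' + 1) := fun q hq => by
    rw [hψ, Crd.shift_apply_self, hv q hq.1, if_pos rfl, sub_add_cancel,
      mul_div_cancel₀ _ (div_pos (hψs q hq).2 (pu₀ q hq)).ne']
  -- the value of the coordinate for the quotient at the given point is `1`
  have hyψ : y ∈ ψ.source := by
    have hy₀ : y ∈ ψ₀.source := by
      grind
    refine ⟨hy₀, ?_⟩; change 0 < ψ₀ y i'; rw [hv y hy₀, if_pos rfl]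
    grind
  have hTi : ∀ k ∈ T, k ≠ i' := fun k hk h' => hTC k hk (h' ▸ hi')
  -- `l - r` is a multiple of the coordinate, up to a multiple of the front face function
  set e : Mb → ℝ := fun q => a₀ q ^ 2 * h (β q) - a₁ q ^ 2 * h' (β q) with he
  have hdiff : ∀ q ∈ ψ.source, θ q 0 - θ q 1 = -a₀ q * ψ q i' + ρ q * e q := by
    grind
  have sβ : ∀ {k : M.prod M → ℝ}, SmoothOn[M.prod M] k c.source →
      SmoothOn[Mb] (fun q => k (β q)) ψ.source := fun hk =>
    hk.comp hb.smooth_β.contMDiffOn fun q hq => (hψs q hq).1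
  have s0 : SmoothOn[Mb] a₀ ψ.source :=
    (hb.smooth_θ 0).contMDiffOn.div₀ (sβ su₀) fun q hq => (pu₀ q hq).ne'
  have s1 : SmoothOn[Mb] a₁ ψ.source :=
    (hb.smooth_θ 1).contMDiffOn.div₀ (sβ su₁) fun q hq => (heq _ (hψs q hq).1).2.1.ne'
  have s0' : SmoothOn[Mb] (fun q => u₀ (β q) / θ q 0) ψ.source :=
    (sβ su₀).div₀ (hb.smooth_θ 0).contMDiffOn fun q hq => (hψs q hq).2.ne'
  have se : SmoothOn[Mb] e ψ.source := ((s0.pow 2).mul (sβ sh)).sub ((s1.pow 2).mul (sβ sh'))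
  have hne : ∀ l : Fin 3, ![ρ, fun y => θ y 0, fun y => θ y 1] l y = 0 → l = 0 := by
    intro l hl; fin_cases l; exacts [rfl, absurd hl hθ0.ne', absurd (hθ01.trans hl) hθ0.ne']
  refine ⟨κ, _, inferInstance, _, ψ, fun _ => i, insert i' T,
    fun q a k => a.elim (if k = i' then -a₀ q else 0) fun a => if k = i' then 0 else A (β q) a k,
    fun q a => a.elim (e q) fun a => a₀ q * A₁ (β q) a + a₁ q * A₂ (β q) a,
    fun q k a => if k = i' then a.elim (-(u₀ (β q) / θ q 0)) 0 else a.elim 0 (L (β q) k),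
    fun q k => if k = i' then u₀ (β q) / θ q 0 * e q else a₀ q * L₁ (β q) k + a₁ q * L₂ (β q) k,
    ⟨hyψ, fun l _ => ⟨mem_insert_of_mem _ hi, hii⟩,
      fun l l' hl hl' _ => (hne l hl).trans (hne l' hl').symm, ?_, ?_⟩,
    Finset.insert_nonempty _ _, ?_, ?_, ?_, ?_, ?_, ?_, ?_⟩
  · rintro k ⟨hk1, hk2⟩ h0; refine ⟨0, hy, ?_⟩; rcases hk1 with rfl | hk1
    · rfl
    · exact ((hcov k hk1 (hvo y hyψ k hk2 ▸ h0)).resolve_right hk2).symm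
  · intro l hl; rw [hne l hl]
    refine ⟨fun q => u₀ (β q) / θ q 0, s0', fun q hq => div_pos (pu₀ q hq) (hψs q hq).2,
      fun q hq => ?_⟩
    have h1 := (hψs q hq).2.ne'; have h2 := (pu₀ q hq).ne'; rw [hvo q hq i hii, hci q (hψs q hq).1]
    simp only [a₀]; field_simp; rfl
  · grind
  · rintro (_ | a) k <;> dsimp only [Option.elim] <;> split_ifs
    exacts [s0.neg, contMDiffOn_const, contMDiffOn_const, sβ (sA a k)]
  · rintro (_ | a); exacts [se, (s0.mul (sβ (sA₁ a))).add (s1.mul (sβ (sA₂ a)))]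
  · rintro k (_ | a) <;> split_ifs
    exacts [s0'.neg, contMDiffOn_const, contMDiffOn_const, sβ (sL k a)]
  · intro k; split_ifs; exacts [s0'.mul se, (s0.mul (sβ (sL₁ k))).add (s1.mul (sβ (sL₂ k)))]
  · intro q hq a; have h1 := (hψs q hq).1; rw [Finset.sum_insert fun h' => hTi _ h' rfl]
    cases a with
    | none =>
      simp only [Option.elim_none, if_true, diagFun]
      rw [Finset.sum_eq_zero fun k hk => by rw [if_neg (hTi k hk), zero_mul], hdiff q hq]
      ring
    | some a =>
      simp only [Option.elim_some, if_true, diagFun]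
      rw [(heq _ h1).2.2.2.2.1 a, zero_mul, zero_add, hci q h1, hci' q h1]; congr 1
      · exact Finset.sum_congr rfl fun k hk => by rw [if_neg (hTi k hk), hvo q hq k (hTi k hk)]
      · ring
  · intro q hq k hk; have h1 := (hψs q hq).1; rw [Fintype.sum_option]
    rcases Finset.mem_insert.1 hk with rfl | hk
    · simp only [if_true, Option.elim_none, Option.elim_some, Pi.zero_apply, zero_mul,
        Finset.sum_const_zero, add_zero, diagFun]
      rw [hdiff q hq]; have h1 := (pu₀ q hq).ne'; have h2 := (hψs q hq).2.ne'; simp only [a₀]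
      field_simp; ring
    · simp only [if_neg (hTi k hk), Option.elim_none, Option.elim_some, zero_mul, zero_add, diagFun]
      grind

end

/-! ### Successive blow-ups of disjoint corners -/

lemma InjOver.comp {X Y Z : Type*} {β : Y → X} {γ : Z → Y} {D : Set X} {D' : Set Y}
    (hβ : InjOver β D) (hγ : InjOver γ D') (h : ∀ y, β y ∈ D → y ∈ D') : InjOver (β ∘ γ) D :=
  fun z z' e hz => hγ z z' (hβ _ _ e hz) (h _ hz)

lemma InjOver.mono {X Y : Type*} {β : Y → X} {D D' : Set X} (h : InjOver β D) (hD : D' ⊆ D) :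
    InjOver β D' := fun y y' e hy => h y y' e (hD hy)

/-- A continuous section over the complement of the centre. -/
lemma Blow.exists_section (h : Blow β g θ ρ) :
    ∃ s : X → Y, ContinuousOn s {p | ∃ a, g p a ≠ 0} ∧ ∀ p, (∃ a, g p a ≠ 0) → β (s p) = p := by
  obtain ⟨f, hf1, hf2, hf3⟩ := h.diffeo_off; refine ⟨f.symm, ?_, fun p hp => ?_⟩
  · rw [← hf2]; exact f.contMDiffOn_invFun.continuousOn
  · rw [← hf3]; exact f.right_inv' (by rw [hf2]; exact hp)

/-- A map `f` to `X` for which the ideal of each of the corners `r l = r a = 0`, for `l` in the list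
`L`, becomes the principal ideal generated by `T l`. -/
structure SimFun (r : Fin n → X → ℝ) (a : Fin n) (L : List (Fin n))
    (f : Z → X) (T σ : Fin n → Z → ℝ) (κ : Z → ℝ) : Prop where
  smooth_f : ContMDiff Z.I X.I ∞ f
  smooth_T : ∀ l ∈ L, Smooth[Z] (T l)
  smooth_σ : ∀ l ∈ L, Smooth[Z] (σ l)
  smooth_κ : Smooth[Z] κ
  nonneg : ∀ l ∈ L, ∀ z, 0 ≤ T l z
  eq : ∀ l ∈ L, ∀ z, r l (f z) = T l z * σ l z
  eq_a : ∀ z, r a (f z) = (L.map fun l => T l z).prod * κ z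
  ne : ∀ l ∈ L, ∀ z, σ l z = 0 → κ z ≠ 0
  dense : Dense {z | r a (f z) ≠ 0}

/-- The zero sets of the functions `r l` with `l` in `L` are disjoint. -/
def DisjointOn {X : Type*} (r : Fin n → X → ℝ) (L : List (Fin n)) : Prop :=
  ∀ l ∈ L, ∀ l' ∈ L, l ≠ l' → ∀ p, r l p = 0 → r l' p ≠ 0

/-- The zero set of `T l` is the preimage of the corner `r l = r a = 0`. -/
lemma SimFun.zero_iff {a : Fin n} {L : List (Fin n)}
    {f : Z → X} {T σ : Fin n → Z → ℝ} {κ : Z → ℝ} (h : SimFun r a L f T σ κ)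
    (hL : DisjointOn r L) (hl : l ∈ L) (z : Z) :
    T l z = 0 ↔ r l (f z) = 0 ∧ r a (f z) = 0 := by
  constructor
  · intro h0; rw [h.eq l hl, h.eq_a, h0, zero_mul, mul_eq_zero]
    refine ⟨rfl, Or.inl (List.prod_eq_zero_iff.2 ?_)⟩; rw [← h0]; exact List.mem_map_of_mem hl
    -- otherwise another factor of `r a` vanishes, against the disjointness
  · rintro ⟨h1, h2⟩; by_contra h0
    have h3 : σ l z = 0 := by rw [h.eq l hl] at h1; exact (mul_eq_zero.1 h1).resolve_left h0
    rw [h.eq_a] at h2; have h4 := (mul_eq_zero.1 h2).resolve_right (h.ne l hl z h3)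
    obtain ⟨l', hl', e⟩ := List.mem_map.1 (List.prod_eq_zero_iff.1 h4)
    by_cases hll : l = l'
    · rw [hll] at h0; exact h0 e
    · refine hL l hl l' hl' hll (f z) h1 ?_; rw [h.eq l' hl', e, zero_mul]

/-- The function `r l` is the pull-back of a monomial in the functions `r'`. -/
def IsMonomial {X Y : Type*} {n' : ℕ} (γ : Y → X) (r : Fin n → X → ℝ) (r' : Fin n' → Y → ℝ) :
    Prop :=
  ∀ l, ∃ m : Fin n' → ℕ, ∀ y, r l (γ y) = ∏ i, r' i y ^ m i

lemma IsMonomial.comp {X Y Z : Type*} {n' n'' : ℕ} {γ : Y → X} {δ : Z → Y} {r : Fin n → X → ℝ}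
    {r' : Fin n' → Y → ℝ} {r'' : Fin n'' → Z → ℝ} (h : IsMonomial γ r r')
    (h' : IsMonomial δ r' r'') : IsMonomial (γ ∘ δ) r r'' := by
  intro l; obtain ⟨m, hm⟩ := h l; choose m' hm' using h'
  refine ⟨fun i => ∑ k, m' k i * m k, fun z => ?_⟩; rw [Function.comp_apply, hm]
  simp_rw [hm', ← Finset.prod_pow, ← pow_mul]; rw [Finset.prod_comm]
  exact Finset.prod_congr rfl fun i _ => Finset.prod_pow_eq_pow_sum _ _ _

lemma CornerBlow.isMonomial (h : CornerBlow β r e θ ρ r') : IsMonomial β r r' := by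
  classical
  have hone : ∀ (l : Fin n) (y : Y), ∏ i : Fin n, r' i.succ y ^ (if i = l then 1 else 0) =
      r' l.succ y := by
    intro l y; simp_rw [pow_ite, pow_one, pow_zero]
    rw [Finset.prod_ite_eq' Finset.univ l, if_pos (Finset.mem_univ l)]
  intro l
  by_cases hl : ∃ a, e a = l
  · obtain ⟨a, rfl⟩ := hl; refine ⟨Fin.cons 1 fun i => if i = e a then 1 else 0, fun y => ?_⟩
    rw [Fin.prod_univ_succ, h.mul_dir]; simp only [Fin.cons_zero, Fin.cons_succ, pow_one]
    rw [hone, h.zero]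
  · push Not at hl; refine ⟨Fin.cons 0 fun i => if i = l then 1 else 0, fun y => ?_⟩
    rw [Fin.prod_univ_succ, ← h.other l hl]
    simp only [Fin.cons_zero, Fin.cons_succ, pow_zero, one_mul]; rw [hone]

/-- Over `D`, the zero sets of the functions `r' i` are empty or the preimages of zero sets of
functions `r l`. -/
def FacesOver {X Y : Type*} {n' : ℕ} (γ : Y → X) (r : Fin n → X → ℝ) (r' : Fin n' → Y → ℝ)
    (D : Set X) : Prop :=
  ∀ i, (∀ y, γ y ∈ D → r' i y ≠ 0) ∨ ∃ l, ∀ y, γ y ∈ D → (r' i y = 0 ↔ r l (γ y) = 0)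

lemma FacesOver.comp {X Y Z : Type*} {n' n'' : ℕ} {γ : Y → X} {δ : Z → Y} {r : Fin n → X → ℝ}
    {r' : Fin n' → Y → ℝ} {r'' : Fin n'' → Z → ℝ} {D : Set X} {D' : Set Y}
    (h : FacesOver γ r r' D) (h' : FacesOver δ r' r'' D') (hD : ∀ y, γ y ∈ D → y ∈ D') :
    FacesOver (γ ∘ δ) r r'' D := by
  intro i; rcases h' i with h1 | ⟨l, hl⟩
  · grind
  · rcases h l with h2 | ⟨k, hk⟩
    · grind
    · exact Or.inr ⟨k, fun z hz => (hl z (hD _ hz)).trans (hk _ hz)⟩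

lemma CornerBlow.facesOver
    (h : CornerBlow β r e θ ρ r') : FacesOver β r r' {p | ∃ a, r (e a) p ≠ 0} := by
  refine Fin.cases (Or.inl fun y hy => ?_) fun l => Or.inr ⟨l, fun y hy => ?_⟩
  · rw [h.zero]; exact h.blow.ne_zero_iff.2 hy
  · by_cases hl : ∃ a, e a = l
    · obtain ⟨a, rfl⟩ := hl; rw [h.mul_dir, mul_eq_zero, or_iff_right (h.blow.ne_zero_iff.2 hy)]
    · push Not at hl; rw [h.other l hl]

/-- `Y` is obtained from `X` by blowing up the disjoint corners `r l = r a = 0`, for `l` in the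
list `L`, in this order; the functions `r'` define the boundary hypersurfaces of `Y`, and `T l` the
lifts of the front faces. -/
structure StarBlow {n' : ℕ} (r : Fin n → X → ℝ) (a : Fin n) (L : List (Fin n))
    (γ : Y → X) (r' : Fin n' → Y → ℝ) (T σ : Fin n → Y → ℝ) (κ : Y → ℝ) : Prop where
  lc : LC Y r'
  proper : IsProperMap γ
  monomial : IsMonomial γ r r'
  keep : ∃ k : Fin n → Fin n', Function.Injective k ∧ ∀ z ∉ L, z ≠ a → ∀ y, r' (k z) y = r z (γ y)
  sim : SimFun r a L γ T σ κ
  lift : ∀ {Z : Mfd.{u}} {f : Z → X} {T' σ' : Fin n → Z → ℝ} {κ' : Z → ℝ},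
    SimFun r a L f T' σ' κ' → ∃ F : Z → Y, ContMDiff Z.I Y.I ∞ F ∧ ∀ z, γ (F z) = f z
  lcz : ∀ {ι : Type} [Fintype ι] {Z : X → ι → ℝ} {m : X → ℝ} {y : Y}, LCZ r Z m (γ y) →
    LCZ r' (fun y => Z (γ y)) (fun y => m (γ y)) y
  iter : ∀ zs : List (Fin n), (∀ z ∈ zs, z ∉ L ∧ z ≠ a) →
    IsIteratedBlowup X (L.map fun l => {p | r l p = 0 ∧ r a p = 0})
      (zs.map fun z => {p | r z p = 0})
      Y γ ((zs.map fun z => {y | r z (γ y) = 0}) ++ L.map fun l => {y | T l y = 0})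
  dense : ∀ D : Set X, Dense D → Dense (γ ⁻¹' D)
  injOver : InjOver γ {p | r a p ≠ 0}
  faces : FacesOver γ r r' {p | r a p ≠ 0}
  sec : ∃ s : X → Y, ContinuousOn s {p | r a p ≠ 0} ∧ ∀ p, r a p ≠ 0 → γ (s p) = p

lemma starBlow_nil (hX : LC X r) (a : Fin n) :
    StarBlow r a [] (id : X → X) r (fun _ _ => 1) (fun _ _ => 1) (r a) where
  lc := hX
  proper := isProperMap_id
  monomial l := by
    classical
    refine ⟨fun i => if i = l then 1 else 0, fun y => ?_⟩; simp_rw [pow_ite, pow_one, pow_zero]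
    rw [Finset.prod_ite_eq' Finset.univ l, if_pos (Finset.mem_univ l)]; rfl
  keep := ⟨id, Function.injective_id, fun _ _ _ _ => rfl⟩
  sim :=
    { smooth_f := contMDiff_id
      smooth_T := by simp
      smooth_σ := by simp
      smooth_κ := hX.smooth a
      nonneg := by simp
      eq := by simp
      eq_a := fun z => by simp
      ne := by simp
      dense := hX.dense a }
  lift h := ⟨_, h.smooth_f, fun _ => rfl⟩
  lcz h := h
  iter zs _ := by simp only [List.map_nil, List.append_nil, id]; exact IsIteratedBlowup.nil X _
  dense D hD := hD
  injOver y y' e _ := e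
  faces i := Or.inr ⟨i, fun _ _ => Iff.rfl⟩
  sec := ⟨id, continuousOn_id, fun _ _ => rfl⟩

/-! ### Transport by diffeomorphisms -/

section

/-- The composition of a partial diffeomorphism with a diffeomorphism. -/
def precomp {E' H' N : Type*} [NormedAddCommGroup E'] [NormedSpace ℝ E'] [TopologicalSpace H']
    {J : ModelWithCorners ℝ E' H'} [TopologicalSpace N] [ChartedSpace H' N]
    (f : PartialDiffeomorph Y.I J Y N ∞) (Φ : Z ≃ₘ^∞⟮Z.I, Y.I⟯ Y) :
    PartialDiffeomorph Z.I J Z N ∞ where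
  toFun := f ∘ Φ
  invFun := Φ.symm ∘ f.symm
  source := Φ ⁻¹' f.source
  target := f.target
  map_source' z hz := f.map_source' hz
  map_target' p hp := by
    change Φ (Φ.symm (f.symm p)) ∈ f.source; rw [Φ.apply_symm_apply]; exact f.map_target' hp
  left_inv' z hz := by
    change Φ.symm (f.symm (f (Φ z))) = z; have : f.symm (f (Φ z)) = Φ z := f.left_inv' hz
    rw [this, Φ.symm_apply_apply]
  right_inv' p hp := by
    change f (Φ (Φ.symm (f.symm p))) = p; rw [Φ.apply_symm_apply]; exact f.right_inv' hp
  open_source := f.open_source.preimage Φ.continuous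
  open_target := f.open_target
  contMDiffOn_toFun := f.contMDiffOn_toFun.comp Φ.contMDiff.contMDiffOn fun z hz => hz
  contMDiffOn_invFun := Φ.symm.contMDiff.comp_contMDiffOn f.contMDiffOn_invFun

lemma IsBlowup.comp_diffeo {P : Set X} (h : IsBlowup P β) (Φ : Z ≃ₘ^∞⟮Z.I, Y.I⟯ Y) :
    IsBlowup P (β ∘ Φ) where
  isClosed := h.isClosed
  smooth := h.smooth.comp Φ.contMDiff
  diffeo_off := by
    obtain ⟨e, h1, h2, h3⟩ := h.diffeo_off; refine ⟨precomp e Φ, ?_, h2, fun z hz => h3 _ hz⟩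
    change Φ ⁻¹' e.source = _; rw [h1]; rfl
  projective p hp := by
    obtain ⟨N, C, S, φ, hpφ, hφ, hex, hcov⟩ := h.projective p hp
    have key : ∀ i ε (ψ : Y.CornerChart N (insert i C)), IsProjectiveChart β φ S i ε ψ →
        IsProjectiveChart (β ∘ Φ) φ S i ε (precomp ψ Φ) := fun i ε ψ hψ =>
      ⟨fun z hz => hψ.1 hz, hψ.2.1, fun z hz => hψ.2.2 _ hz⟩
    refine ⟨N, C, S, φ, hpφ, hφ, fun i hi ε hε => ?_, fun z hz => ?_⟩
    · obtain ⟨ψ, hψ⟩ := hex i hi ε hε; exact ⟨_, key i ε ψ hψ⟩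
    · obtain ⟨i, hi, ε, hε, ψ, hψ, hz'⟩ := hcov _ hz; exact ⟨i, hi, ε, hε, _, key i ε ψ hψ, hz'⟩

lemma lift_comp_diffeo (β : Y → X) (P S : Set X) (Φ : Z ≃ₘ^∞⟮Z.I, Y.I⟯ Y) :
    lift (β ∘ Φ) P S = Φ ⁻¹' lift β P S := by
  unfold lift; split_ifs
  · rfl
  · exact (Φ.toHomeomorph.preimage_closure (β ⁻¹' (S \ P))).symm

lemma IsIteratedBlowup.comp_diffeo {Ps Ss : List (Set X)} {γ : Y → X} {Ss' : List (Set Y)}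
    (h : IsIteratedBlowup X Ps Ss Y γ Ss') (hPs : Ps ≠ []) (Φ : Z ≃ₘ^∞⟮Z.I, Y.I⟯ Y) :
    IsIteratedBlowup X Ps Ss Z (γ ∘ Φ) (Ss'.map (Φ ⁻¹' ·)) := by
  induction h with
  | nil => exact absurd rfl hPs
  | @cons X X₁ Y P Ps Ss β γ Ss' hβ hγ ih =>
    cases Ps with
    | nil =>
      cases hγ
      have h1 := IsIteratedBlowup.nil Z (Ss.map (lift (β ∘ Φ) P) ++ [(β ∘ Φ) ⁻¹' P])
      have h2 := IsIteratedBlowup.cons (Ps := []) (hβ.comp_diffeo Φ) h1; convert h2 using 1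
      · rfl
      rw [List.map_append, List.map_map]; congr 1
      exact List.map_congr_left fun S _ => (lift_comp_diffeo β P S Φ).symm
    | cons P' Ps => exact IsIteratedBlowup.cons (γ := γ ∘ Φ) hβ (ih (by simp) Φ)

lemma LC.comp_diffeo (h : LC X r) (Φ : Z ≃ₘ^∞⟮Z.I, X.I⟯ X) :
    LC Z fun l z => r l (Φ z) where
  smooth l := (h.smooth l).comp Φ.contMDiff
  nonneg l z := h.nonneg l _
  loc z := by
    obtain ⟨κ, _, _, C, c, j, hc⟩ := h.loc (Φ z)
    exact ⟨κ, _, inferInstance, C, _, j, LCAt.pullback Φ.toPartialDiffeomorph hc trivial⟩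

/-- Two spaces over `X` are diffeomorphic if there are maps over `X` in both directions, and the
projections to `X` are injective over a subset with dense preimages. -/
lemma exists_diffeo {B : Type*} {γ : Y → B} {δ : Z → B} {D : Set B} (hγ : InjOver γ D)
    (hδ : InjOver δ D) (hγD : Dense (γ ⁻¹' D)) (hδD : Dense (δ ⁻¹' D)) {F : Z → Y} {G : Y → Z}
    (hF : ContMDiff Z.I Y.I ∞ F) (hG : ContMDiff Y.I Z.I ∞ G) (hFγ : ∀ z, γ (F z) = δ z)
    (hGδ : ∀ y, δ (G y) = γ y) : ∃ Φ : Z ≃ₘ^∞⟮Z.I, Y.I⟯ Y, ⇑Φ = F := by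
  have e1 : G ∘ F = id := hδ.eq_of_dense (hG.continuous.comp hF.continuous) continuous_id
    (fun z => by rw [Function.comp_apply, hGδ, hFγ]; rfl)
    (hδD.mono fun z hz => by
      change δ (G (F z)) ∈ D
      rw [hGδ, hFγ]; exact hz)
  have e2 : F ∘ G = id := hγ.eq_of_dense (hF.continuous.comp hG.continuous) continuous_id
    (fun z => by rw [Function.comp_apply, hFγ, hGδ]; rfl)
    (hγD.mono fun z hz => by
      change γ (F (G z)) ∈ D
      rw [hFγ, hGδ]; exact hz)
  exact ⟨⟨⟨F, G, congrFun e1, congrFun e2⟩, hF, hG⟩, rfl⟩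

end

section

variable {Z : X → ι → ℝ}

lemma LCZ.coord_eq_zero {T : Finset κ} {A₀ : X → ι → ℝ} {B₀ : X → κ → ℝ}
    (h : RelGen c T Z m A A₀ B B₀) {q : X} (hq : q ∈ c.source) (hZ : ∀ a, Z q a = 0) (hm : m q = 0)
    {i : κ} (hi : i ∈ T) : c q i = 0 := by
  rw [h.eq_B q hq i hi, hm, zero_mul, add_zero]
  exact Finset.sum_eq_zero fun a _ => by rw [hZ a, mul_zero]

/-- Moving away from `Z = 0` in the directions tangential to all boundary hypersurfaces. -/
lemma LCZ.mem_closure_ne (h : LCZ r Z m p) (hZ : ∀ a, Z p a = 0) (hm : m p = 0) :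
    p ∈ closure {q | (∀ l, r l p = 0 → r l q = 0) ∧ (m q = 0 → ∃ a, Z q a ≠ 0)} := by
  obtain ⟨κ, _, _, C, c, j, T, A, A₀, B, B₀, hc, hT⟩ := h; obtain ⟨i, hi⟩ := hT.nonempty
  obtain ⟨γ, hγ, hev⟩ := c.exists_move hc.mem i; refine mem_closure_of_tendsto hγ ?_
  filter_upwards [hev] with s hs
  obtain ⟨hs0, hsm, hsc⟩ := hs; refine ⟨fun l hl => ?_, fun hm' => ?_⟩
  · obtain ⟨u, -, hu, e⟩ := hc.eq l hl
    have : j l ≠ i := fun h' => hT.not_mem_C i hi (h' ▸ hc.mem_C l hl)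
    rw [e _ hsm, hsc, hc.coord_eq_zero hl, if_neg this, zero_add, mul_zero]
  · by_contra hcon; push Not at hcon; have h1 := LCZ.coord_eq_zero hT hsm hcon hm' hi
    rw [hsc, LCZ.coord_eq_zero hT hc.mem hZ hm hi, if_pos rfl, zero_add] at h1; exact hs0.ne' h1

/-- Moving away from a boundary hypersurface inside `Z = 0`. -/
lemma LCZ.mem_closure_eq (h : LCZ r Z m p) (hZ : ∀ a, Z p a = 0) (hm : m p = 0)
    (hl : r l p = 0) : p ∈ closure {q | r l q ≠ 0 ∧ (∀ l', l' ≠ l → r l' p = 0 → r l' q = 0) ∧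
      (m q = 0 → ∀ a, Z q a = 0)} := by
  obtain ⟨κ, _, _, C, c, j, T, A, A₀, B, B₀, hc, hT⟩ := h
  obtain ⟨γ, hγ, hev⟩ := c.exists_move hc.mem (j l); refine mem_closure_of_tendsto hγ ?_
  filter_upwards [hev] with s hs
  obtain ⟨hs0, hsm, hsc⟩ := hs; refine ⟨?_, fun l' hne hl' => ?_, fun hm' a => ?_⟩
  · obtain ⟨u, -, hu, e⟩ := hc.eq l hl; rw [e _ hsm, hsc, hc.coord_eq_zero hl, if_pos rfl, zero_add]
    exact mul_ne_zero (hu _ hsm).ne' hs0.ne'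
  · obtain ⟨u, -, hu, e⟩ := hc.eq l' hl'
    rw [e _ hsm, hsc, hc.coord_eq_zero hl', if_neg fun h' => hne (hc.inj _ _ hl' hl h'), zero_add,
      mul_zero]
  · rw [hT.eq_A _ hsm, hm', zero_mul, add_zero]; refine Finset.sum_eq_zero fun i hi => ?_
    have : i ≠ j l := fun h' => hT.not_mem_C i hi (h' ▸ hc.mem_C l hl)
    rw [hsc, LCZ.coord_eq_zero hT hc.mem hZ hm hi, if_neg this, zero_add, mul_zero]

end

/-! ### Spaces obtained by blowing up -/

section

lemma LC.dense_ne (h : LC X r) : Dense {p | ∀ l, r l p ≠ 0} := by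
  classical
  have : ∀ s : Finset (Fin n), IsOpen {p | ∀ l ∈ s, r l p ≠ 0} ∧
      Dense {p | ∀ l ∈ s, r l p ≠ 0} := by
    intro s
    induction s using Finset.induction_on with
    | empty => simp
    | insert l s _ ih =>
      have e : {p | ∀ l' ∈ insert l s, r l' p ≠ 0} =
          {p | r l p ≠ 0} ∩ {p | ∀ l ∈ s, r l p ≠ 0} := by
        ext p; simp
      have ho := isOpen_ne_fun (h.smooth l).continuous continuous_const (g := fun _ => (0 : ℝ))
      rw [e]; exact ⟨ho.inter ih.1, (h.dense l).inter_of_isOpen_left ih.2 ho⟩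
  simpa using (this Finset.univ).2

/-- The universal property of a blow-up; the factor `u` is the inverse of the norm of `w`. -/
lemma Blow.exists_lift_unit
    (h : Blow β g θ ρ) {f : Z → X} (hf : ContMDiff Z.I X.I ∞ f) (t : Z → ℝ) (w : Z → ι → ℝ)
    (hw : ∀ a, Smooth[Z] fun z => w z a) (ht : ∀ z, 0 ≤ t z)
    (htd : Dense {z | t z ≠ 0}) (hw0 : ∀ z, ¬ ∀ a, w z a = 0)
    (htw : ∀ z a, g (f z) a = t z * w z a) :
    ∃ (F : Z → Y) (u : Z → ℝ), ContMDiff Z.I Y.I ∞ F ∧ Smooth[Z] u ∧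
      (∀ z, 0 < u z) ∧ (∀ z, β (F z) = f z) ∧ (∀ z, ρ (F z) * u z = t z) ∧
      ∀ z a, θ (F z) a = u z * w z a := by
  have hw0 : ∀ z, ∃ a, w z a ≠ 0 := fun z => not_forall.1 (hw0 z)
  obtain ⟨F, h1, h2, h3, h4⟩ := h.exists_lift hf hw ht htd hw0 htw
  have hp : ∀ z, 0 < nrm (w z) := fun z => nrm_pos.2 (hw0 z)
  refine ⟨F, fun z => (nrm (w z))⁻¹, h1, ?_, fun z => inv_pos.2 (hp z), h2, fun z => ?_,
    fun z a => ?_⟩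
  · refine ContMDiff.inv₀ ?_ fun z => (hp z).ne'
    exact contMDiffOn_univ.1 (contMDiffOn_nrm (fun a => (hw a).contMDiffOn) fun z _ => hw0 z)
  · grind
  · rw [h4, div_eq_inv_mul]

lemma Blow.exists_cornerBlow (h : Blow β (fun p a => r (e a) p) θ ρ) (hX : LC X r)
    (he : Function.Injective e) : ∃ r', CornerBlow β r e θ ρ r' := by
  classical
  refine ⟨Fin.cons ρ fun i y => if hi : ∃ a, e a = i then θ y hi.choose else r i (β y),
    h, hX, he, rfl, fun a y => ?_, fun l hl y => ?_⟩
  · have hi : ∃ a', e a' = e a := ⟨a, rfl⟩; simp only [Fin.cons_succ, dif_pos hi]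
    rw [he hi.choose_spec]
  · have hi : ¬ ∃ a, e a = l := by push Not; exact hl
    simp only [Fin.cons_succ, dif_neg hi]

lemma IsBlowup.exists_cornerBlow [Nonempty ι] {P : Set X} (h : IsBlowup P β)
    (hP : P = {p | ∀ a, r (e a) p = 0}) (hX : LC X r)
    (he : Function.Injective e) : ∃ θ ρ r', CornerBlow β r e θ ρ r' := by
  obtain ⟨θ, ρ, hb⟩ := h.exists_blow hP (fun a => hX.smooth (e a))
    (hX.dense_gen (Classical.arbitrary ι)) (fun p hp => hX.genAt he p hp) hX.hasCrd
  exact ⟨θ, ρ, hb.exists_cornerBlow hX he⟩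

lemma LC.exists_cornerBlow [Nonempty ι] (hX : LC X r)
    (he : Function.Injective e) : ∃ (Y : Mfd.{u}) (β : Y → X) (θ : Y → ι → ℝ) (ρ : Y → ℝ)
      (r' : Fin (n + 1) → Y → ℝ), CornerBlow β r e θ ρ r' := by
  obtain ⟨Y, β, θ, ρ, hb⟩ := exists_blow (g := fun p a => r (e a) p) (fun a => hX.smooth (e a))
    (hX.dense_gen (Classical.arbitrary ι)) (fun p hp => hX.genAt he p hp) hX.hasCrd
  exact ⟨Y, β, θ, ρ, hb.exists_cornerBlow hX he⟩

lemma LC.smooth_relFun (hX : LC X r) {l₀ : Fin n}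
    {Z : X → ι → ℝ} (hZ : ∀ a, Smooth[X] fun p => Z p a) (a : Option ι) :
    Smooth[X] fun p => relFun (r l₀) Z p a := by
  cases a with
  | none => exact hX.smooth l₀
  | some a => exact hZ a

lemma Blow.exists_relBlow {l₀ : Fin n} {Z : X → ι → ℝ}
    {θ : Y → Option ι → ℝ} (h : Blow β (relFun (r l₀) Z) θ ρ) (hX : LC X r)
    (hm : Smooth[X] m)
    (hlcz : ∀ p, r l₀ p = 0 → (∀ a, Z p a = 0) → LCZ r Z (fun q => r l₀ q * m q) p) :
    ∃ r', RelBlow β r l₀ Z m θ ρ r' := by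
  classical
  exact ⟨Fin.cons ρ fun l y => if l = l₀ then θ y none else r l (β y), h, hX, hm, hlcz, rfl,
    fun y => if_pos rfl, fun l hl y => if_neg hl⟩

lemma IsBlowup.exists_relBlow {P : Set X} {l₀ : Fin n} {Z : X → ι → ℝ} (h : IsBlowup P β)
    (hP : P = {p | ∀ a, relFun (r l₀) Z p a = 0}) (hX : LC X r)
    (hZ : ∀ a, Smooth[X] fun p => Z p a) (hm : Smooth[X] m)
    (hlcz : ∀ p, r l₀ p = 0 → (∀ a, Z p a = 0) → LCZ r Z (fun q => r l₀ q * m q) p) :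
    ∃ θ ρ r', RelBlow β r l₀ Z m θ ρ r' := by
  obtain ⟨θ, ρ, hb⟩ := h.exists_blow hP (hX.smooth_relFun hZ)
    ((hX.dense l₀).mono fun _ hq => ⟨none, hq⟩)
    (fun p hp => (hlcz p (hp none) fun a => hp (some a)).genAt hm (hp none)) hX.hasCrd
  exact ⟨θ, ρ, hb.exists_relBlow hX hm hlcz⟩

lemma LC.exists_relBlow (hX : LC X r) {l₀ : Fin n} {Z : X → ι → ℝ}
    (hZ : ∀ a, Smooth[X] fun p => Z p a) (hm : Smooth[X] m)
    (hlcz : ∀ p, r l₀ p = 0 → (∀ a, Z p a = 0) → LCZ r Z (fun q => r l₀ q * m q) p) :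
    ∃ (Y : Mfd.{u}) (β : Y → X) (θ : Y → Option ι → ℝ) (ρ : Y → ℝ) (r' : Fin (n + 1) → Y → ℝ),
      RelBlow β r l₀ Z m θ ρ r' := by
  obtain ⟨Y, β, θ, ρ, hb⟩ := exists_blow (hX.smooth_relFun hZ)
    ((hX.dense l₀).mono fun _ hq => ⟨none, hq⟩)
    (fun p hp => (hlcz p (hp none) fun a => hp (some a)).genAt hm (hp none)) hX.hasCrd
  exact ⟨Y, β, θ, ρ, hb.exists_relBlow hX hm hlcz⟩

lemma RelBlow.isBlowup {l₀ : Fin n} {Z : X → ι → ℝ}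
    {θ : Y → Option ι → ℝ} (h : RelBlow β r l₀ Z m θ ρ r')
    {P : Set X} (hP : P = {p | ∀ a, relFun (r l₀) Z p a = 0}) : IsBlowup P β := by
  rw [hP]; exact h.blow.isBlowup h.genAt

namespace CornerBlow

variable (h : CornerBlow β r e θ ρ r')

include h

lemma isBlowup {P : Set X} (hP : P = {p | ∀ a, r (e a) p = 0}) :
    IsBlowup P β := by
  rw [hP]; exact h.blow.isBlowup h.genAt

lemma lift_pair {P S : Set X} (hP : P = {p | ∀ a, r (e a) p = 0})
    {i j : Fin n} (hS : S = {p | ∀ a, r (![i, j] a) p = 0}) (a₀ : ι) (hi : e a₀ ≠ i)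
    (hj : e a₀ ≠ j) : lift β P S = {y | ∀ a, r' (![i.succ, j.succ] a) y = 0} := by
  have e1 : S = {p | ∀ l ∈ ({i, j} : Set (Fin n)), r l p = 0} := by
    rw [hS]; ext p; simp [Fin.forall_fin_two]
  rw [hP, e1, h.lift_corner (a₀ := a₀) (by simp [hi, hj])]
  ext y; simp [Fin.forall_fin_two]

lemma exists_lift {f : Z → X} (hf : ContMDiff Z.I X.I ∞ f)
    (t : Z → ℝ) (w : Z → ι → ℝ) (hw : ∀ a, Smooth[Z] fun z => w z a)
    (ht : ∀ z, 0 ≤ t z) (htd : Dense {z | t z ≠ 0}) (hw0 : ∀ z, ¬ ∀ a, w z a = 0)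
    (htw : ∀ z a, r (e a) (f z) = t z * w z a) :
    ∃ (F : Z → Y) (u : Z → ℝ), ContMDiff Z.I Y.I ∞ F ∧ Smooth[Z] u ∧
      (∀ z, 0 < u z) ∧ (∀ z, β (F z) = f z) ∧ (∀ z, r' 0 (F z) * u z = t z) ∧
      (∀ z a, r' (e a).succ (F z) = u z * w z a) ∧
      ∀ l, (∀ a, e a ≠ l) → ∀ z, r' l.succ (F z) = r l (f z) := by
  obtain ⟨F, v, h1, h2, h3, h4, h5, h6⟩ := h.blow.exists_lift_unit hf t w hw ht htd hw0 htw
  refine ⟨F, v, h1, h2, h3, h4, fun z => by rw [h.zero, h5], fun z a => by rw [h.dir, h6],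
    fun l hl z => by rw [h.other l hl, h4]⟩

lemma not_forall_dir (y : Y) : ¬ ∀ a, r' (e a).succ y = 0 := by
  intro h'; obtain ⟨a, ha⟩ := h.blow.exists_θ_ne y; exact ha (by rw [← h.dir]; exact h' a)

lemma injOver (a : ι) : InjOver β {p | ∀ l, r l p ≠ 0} :=
  h.blow.injOver.mono fun _ hp => ⟨a, hp (e a)⟩

end CornerBlow

end

/-! ### The `φ`-double space -/

section

variable {M : Mfd.{u}} {x : M → ℝ} {R : M → M → Prop} {E : M → ι → ℝ}
  {Mb : Mfd.{u}} {β : Mb → M.prod M} {θ : Mb → Fin 2 → ℝ} {ρ : Mb → ℝ}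

lemma corner_eq : {p : M.prod M | x p.1 = 0 ∧ x p.2 = 0} = {p | ∀ a, baseFun x a p = 0} := by
  ext p; simp [baseFun, Fin.forall_fin_two]

/-- The functions `R`, `l`, `r` on the b-double space with `x = R l`, `x' = R r`. -/
def bFun (θ : Mb → Fin 2 → ℝ) (ρ : Mb → ℝ) : Fin 3 → Mb → ℝ := ![ρ, fun y => θ y 0, fun y => θ y 1]

variable (hF : FibredBoundary M x R E)

include hF

lemma dense_interior :
    Dense {p : M.prod M | x p.1 ≠ 0 ∧ x p.2 ≠ 0} := by
  refine (hF.lc_prod.dense 0).inter_of_isOpen_left (hF.lc_prod.dense 1) ?_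
  exact isOpen_ne_fun (hF.lc_prod.smooth 0).continuous continuous_const

section

variable (hb : Blow β (fun p a => baseFun x a p) θ ρ)

include hb

/-- The quotient `x / x'` is `l / r` for the components `l`, `r` of the direction. -/
lemma ratioOneAt_iff {Y : Type*} [TopologicalSpace Y] {f : Y → Mb} (hf : Continuous f)
    (hd : Dense {q | x (β (f q)).1 ≠ 0 ∧ x (β (f q)).2 ≠ 0}) (q : Y) :
    RatioOneAt x (fun q => β (f q)) q ↔ θ (f q) 0 = θ (f q) 1 := by
  have hcb := hF.cornerBlow hb; have hx : ∀ p, 0 ≤ x p := fun p => hF.lc.nonneg 0 p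
  set D := {q' | 0 < x (β (f q')).1 ∧ 0 < x (β (f q')).2} with hD
  have hDd : Dense D := hd.mono fun q hq =>
    ⟨lt_of_le_of_ne (hx _) hq.1.symm, lt_of_le_of_ne (hx _) hq.2.symm⟩
  have hne : (𝓝[D] q).NeBot := mem_closure_iff_nhdsWithin_neBot.1 (hDd q)
  have h1 : ∀ q', x (β (f q')).1 = ρ (f q') * θ (f q') 0 := fun q' => hb.eq _ 0
  have h2 : ∀ q', x (β (f q')).2 = ρ (f q') * θ (f q') 1 := fun q' => hb.eq _ 1
  have hc : ∀ a, Tendsto (fun q' => θ (f q') a) (𝓝[D] q) (𝓝 (θ (f q) a)) := fun a =>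
    (((hb.smooth_θ a).continuous.comp hf).tendsto q).mono_left nhdsWithin_le_nhds
  constructor
  · intro h; have h3 := (hc 1).mul h; rw [mul_one] at h3
    refine tendsto_nhds_unique (hc 0) (h3.congr' ?_)
    filter_upwards [self_mem_nhdsWithin] with q' hq'
    grind
  · intro h
    have h0 : θ (f q) 1 ≠ 0 := by
      intro h0; obtain ⟨a, ha⟩ := hb.exists_θ_ne (f q); fin_cases a; exacts [ha (h.trans h0), ha h0]
    have h3 := (hc 0).div (hc 1) h0; rw [h, div_self h0] at h3; refine h3.congr' ?_
    filter_upwards [self_mem_nhdsWithin] with q' hq'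
    obtain ⟨hq1, hq2⟩ : 0 < x (β (f q')).1 ∧ 0 < x (β (f q')).2 := hq'; rw [h2] at hq2
    rw [h1, h2, mul_div_mul_left _ _ (left_ne_zero_of_mul hq2.ne')]; rfl

lemma mem_diag_iff {q : Mb} (hq : ρ q = 0) :
    (θ q 0 = θ q 1 ∧ R (β q).1 (β q).2) ↔ ∀ a, diagFun E β θ q a = 0 := by
  have h2 : x (β q).1 = 0 ∧ x (β q).2 = 0 := ⟨hb.eq_zero_iff.1 hq 0, hb.eq_zero_iff.1 hq 1⟩
  rw [hF.rel, Option.forall]; change _ ↔ θ q 0 - θ q 1 = 0 ∧ ∀ a, E (β q).1 a - E (β q).2 a = 0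
  grind

lemma diag_eq : {q | (x (β q).1 = 0 ∧ x (β q).2 = 0) ∧ RatioOneAt x β q ∧ R (β q).1 (β q).2} =
      {q | ∀ a, relFun (bFun θ ρ 0) (diagFun E β θ) q a = 0} := by
  ext q
  have h1 : RatioOneAt x β q ↔ θ q 0 = θ q 1 :=
    ratioOneAt_iff hF hb continuous_id (hb.dense_preimage (dense_interior hF)) q
  have h2 : (x (β q).1 = 0 ∧ x (β q).2 = 0) ↔ ρ q = 0 := by
    rw [hb.eq_zero_iff, Fin.forall_fin_two]; rfl
  rw [mem_ofPred_eq, mem_ofPred_eq, h1, h2, Option.forall]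
  exact and_congr_right fun h => mem_diag_iff hF hb h

end

lemma exists_phiDouble : Nonempty (PhiDouble M x R) := by
  obtain ⟨Mb, β, θ, ρ, r₁, h₁⟩ := hF.lc_prod.exists_cornerBlow Function.injective_id
  have hb : Blow β (fun p a => baseFun x a p) θ ρ := h₁.blow
  obtain ⟨Y, β', θ', ρ', r', h'⟩ := (hF.cornerBlow hb).lc.exists_relBlow (l₀ := 0)
    (hF.smooth_diagFun hb) contMDiff_const fun p hp hZ => hF.lcz hb hp hZ
  exact ⟨⟨Mb, β, h₁.isBlowup corner_eq, Y, β', h'.isBlowup (diag_eq hF hb)⟩⟩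

/-- The functions defining the faces `φf`, `bf`, `lf` and `rf` of a `φ`-double space. -/
lemma PhiDouble.exists_fun (W : PhiDouble M x R) :
    ∃ (θ : W.Mb → Fin 2 → ℝ) (ρ : W.Mb → ℝ) (θ' : W.space → Option (Option ι) → ℝ)
      (ρ' : W.space → ℝ) (r' : Fin 4 → W.space → ℝ), Blow W.βb (fun p a => baseFun x a p) θ ρ ∧
      RelBlow W.βφ (bFun θ ρ) 0 (diagFun E W.βb θ) (fun _ => 1) θ' ρ' r' ∧
      W.bf = {y | r' 1 y = 0} ∧ W.φf = {y | r' 0 y = 0} ∧ W.lf = {y | r' 2 y = 0} ∧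
      W.rf = {y | r' 3 y = 0} := by
  obtain ⟨θ, ρ, r₁, h₁⟩ := W.blowup_b.exists_cornerBlow corner_eq hF.lc_prod Function.injective_id
  have hb : Blow W.βb (fun p a => baseFun x a p) θ ρ := h₁.blow; have hc := hF.cornerBlow hb
  obtain ⟨θ', ρ', r', hr⟩ := W.blowup_φ.exists_relBlow (l₀ := 0) (diag_eq hF hb) hc.lc
    (hF.smooth_diagFun hb) contMDiff_const fun p hp hZ => hF.lcz hb hp hZ
  have hb' := hr.blow
  have hdiag : W.diag = {q | ∀ a, relFun (bFun θ ρ 0) (diagFun E W.βb θ) q a = 0} := diag_eq hF hb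
  have hcor : W.corner = {p | ∀ a, baseFun x a p = 0} := corner_eq
  -- the fibre diagonal does not meet the lifts of the two side faces
  have hdis : ∀ q ∈ W.diag, ∀ a, θ q a ≠ 0 := by
    intro q hq a h0; rw [hdiag] at hq; have h1 : θ q 0 = θ q 1 := sub_eq_zero.1 (hq (some none))
    obtain ⟨a', ha'⟩ := hb.exists_θ_ne q; refine ha' ?_; fin_cases a <;> fin_cases a'
    exacts [h0, h1.symm.trans h0, h1.trans h0, h0]
  have hside : ∀ a : Fin 2, lift W.βφ W.diag (lift W.βb W.corner {p | baseFun x a p = 0}) =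
      {y | θ (W.βφ y) a = 0} := by
    intro a
    have h1 : lift W.βb W.corner {p | baseFun x a p = 0} = {q | θ q a = 0} := by
      have h2 : {p | baseFun x a p = 0} =
          {p : M.prod M | ∀ l ∈ ({a} : Set (Fin 2)), baseFun x l p = 0} := by ext; simp
      rw [hcor, h2]
      refine (hc.lift_corner (b := {a}) (a₀ := 1 - a) (by fin_cases a <;> simp)).trans ?_
      ext q; fin_cases a <;> simp
    rw [h1]
    refine lift_eq (fun q hq => subset_closure ⟨hq, fun h' => hdis q h' a hq⟩)
      (isClosed_eq ((hb.smooth_θ a).continuous.comp hb'.smooth_β.continuous) continuous_const)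
      (fun y _ => Iff.rfl) fun y hy => subset_closure ⟨hy, fun h' => hdis _ h' a hy⟩
  have r2 : ∀ y, r' 2 y = θ (W.βφ y) 0 := hr.other 1 (by decide)
  have r3 : ∀ y, r' 3 y = θ (W.βφ y) 1 := hr.other 2 (by decide)
  have r1 : ∀ y, r' 1 y = θ' y none := hr.dir
  have r0 : ∀ y, r' 0 y = 0 ↔ ∀ a, relFun (bFun θ ρ 0) (diagFun E W.βb θ) (W.βφ y) a = 0 :=
    fun y => by rw [hr.zero]; exact hb'.eq_zero_iff
  refine ⟨θ, ρ, θ', ρ', r', hb, hr, ?_, ?_, (hside 0).trans (by ext y; rw [mem_ofPred_eq,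
    mem_ofPred_eq, r2]),
    (hside 1).trans (by ext y; rw [mem_ofPred_eq, mem_ofPred_eq, r3])⟩
  swap
  · ext y; change W.βφ y ∈ W.diag ↔ r' 0 y = 0; rw [hdiag, r0]; rfl
  · have h1 : W.βb ⁻¹' W.corner = {q | ρ q = 0} := by
      ext q; rw [mem_preimage, hcor]; exact hb.eq_zero_iff.symm
    unfold PhiDouble.bf; rw [h1, hdiag]
    refine lift_eq ?_ (isClosed_eq (hr.lc.smooth 1).continuous continuous_const) ?_ ?_
    · intro q hq; have hq : ρ q = 0 := hq
      by_cases hP : ∀ a, relFun (bFun θ ρ 0) (diagFun E W.βb θ) q a = 0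
              -- a point of the fibre diagonal is a limit of other points of the front face
      · refine closure_mono ?_ ((hF.lcz hb hq fun a => hP (some a)).mem_closure_ne
          (fun a => hP (some a)) (by rw [hq, zero_mul]))
        rintro q' ⟨h2, h3⟩; have h4 : ρ q' = 0 := h2 0 hq
        obtain ⟨a, ha⟩ := h3 (by rw [h4, zero_mul])
        exact ⟨h4, fun h' => ha (h' (some a))⟩
      · exact subset_closure ⟨hq, hP⟩
    · intro y hy; have h2 : ρ (W.βφ y) = ρ' y * r' 1 y := hr.mul_dir y; rw [← hr.zero] at h2
      grind
    · intro y hy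
      by_cases hρ : r' 0 y = 0
      · refine closure_mono ?_ (hr.lc.mem_closure hρ); rintro q ⟨h2, h3⟩
        grind
      · exact subset_closure ⟨hy, fun h' => hρ ((r0 y).2 h')⟩

end

/-! ### The space `M²_{k,b}` -/

section

variable {M : Mfd.{u}} {x : M → ℝ} {R : M → M → Prop} {E : M → ι → ℝ}

/-- The functions `k`, `x`, `x'` on `M × M × [0, ∞)`. -/
def baseK (x : M → ℝ) : Fin 3 → (M.prod M).prodHalfLine → ℝ :=
  Fin.cons halfCoord fun l q => baseFun x l q.1

lemma FibredBoundary.lc_baseK (hF : FibredBoundary M x R E) :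
    LC (M.prod M).prodHalfLine (baseK x) := hF.lc_prod.prodHalfLine

lemma C111_eq : C111 M x = {p | ∀ a, baseK x (id a) p = 0} := by
  ext p; rw [mem_ofPred_eq, Fin.forall_fin_succ, Fin.forall_fin_two]
  exact ⟨fun h => ⟨h.2.2, h.1, h.2.1⟩, fun h => ⟨h.2.1, h.2.2, h.1⟩⟩

lemma C011_eq : C011 M x = {p | ∀ a, baseK x (![0, 2] a) p = 0} := by
  ext p; rw [mem_ofPred_eq, Fin.forall_fin_two]; exact ⟨fun h => ⟨h.2, h.1⟩, fun h => ⟨h.2, h.1⟩⟩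

lemma C101_eq : C101 M x = {p | ∀ a, baseK x (![0, 1] a) p = 0} := by
  ext p; rw [mem_ofPred_eq, Fin.forall_fin_two]; exact ⟨fun h => ⟨h.2, h.1⟩, fun h => ⟨h.2, h.1⟩⟩

lemma C110_eq : C110 M x = {p | ∀ a, baseK x (![1, 2] a) p = 0} := by
  ext p; rw [mem_ofPred_eq, Fin.forall_fin_two]; rfl

/-- Functions `T` on `Z`, as the defining functions of the boundary hypersurfaces of `M²_{k,b}`,
with which a map `f` to `M × M × [0, ∞)` lifts to `M²_{k,b}`. The functions with index `0`, `1`,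
`2`, `3` belong to the front faces for `C110`, `C101`, `C011`, `C111`, and those with index `4`, `5`,
`6` to the lifts of the hypersurfaces `k = 0`, `x = 0`, `x' = 0`. -/
structure KbFun (x : M → ℝ) (f : Z → (M.prod M).prodHalfLine) (T : Fin 7 → Z → ℝ) :
    Prop where
  smooth_f : ContMDiff Z.I (M.prod M).prodHalfLine.I ∞ f
  smooth : ∀ l, Smooth[Z] (T l)
  nonneg : ∀ z, 0 ≤ T 0 z ∧ 0 ≤ T 1 z ∧ 0 ≤ T 2 z ∧ 0 ≤ T 3 z
  eq_k : ∀ z, baseK x 0 (f z) = T 3 z * (T 2 z * (T 1 z * T 4 z))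
  eq_x : ∀ z, baseK x 1 (f z) = T 3 z * (T 1 z * (T 0 z * T 5 z))
  eq_x' : ∀ z, baseK x 2 (f z) = T 3 z * (T 2 z * (T 0 z * T 6 z))
  ne0 : ∀ z, T 0 z = 0 → T 1 z ≠ 0 ∧ T 2 z ≠ 0 ∧ T 4 z ≠ 0
  ne1 : ∀ z, T 1 z = 0 → T 2 z ≠ 0
  ne5 : ∀ z, T 5 z = 0 → T 2 z ≠ 0 ∧ T 4 z ≠ 0 ∧ T 6 z ≠ 0
  ne6 : ∀ z, T 6 z = 0 → T 1 z ≠ 0 ∧ T 4 z ≠ 0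
  dense : Dense {z | ∀ l, baseK x l (f z) ≠ 0}

/-- The functions defining the boundary hypersurfaces of the spaces used for `M²_{k,b}`. -/
structure KbTower {Y₁ Y₂ Y₃ Y₄ : Mfd.{u}} (x : M → ℝ) (β₁ : Y₁ → (M.prod M).prodHalfLine)
    (β₂ : Y₂ → Y₁) (β₃ : Y₃ → Y₂) (β₄ : Y₄ → Y₃) (T : Fin 7 → Y₄ → ℝ) : Prop where
  exists_fun : ∃ θ₁ ρ₁ r₁ θ₂ ρ₂ r₂ θ₃ ρ₃ r₃ θ₄ ρ₄,
    CornerBlow β₁ (baseK x) id θ₁ ρ₁ r₁ ∧ CornerBlow β₂ r₁ ![1, 3] θ₂ ρ₂ r₂ ∧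
    CornerBlow β₃ r₂ ![2, 3] θ₃ ρ₃ r₃ ∧ CornerBlow β₄ r₃ ![4, 5] θ₄ ρ₄ T

lemma injective_pair {i j : Fin n} (h : i ≠ j) : Function.Injective ![i, j] := by
  intro a b hab; fin_cases a <;> fin_cases b; exacts [rfl, absurd hab h, absurd hab.symm h, rfl]

section

variable {Y₁ Y₂ Y₃ : Mfd.{u}} {β₁ : Y₁ → (M.prod M).prodHalfLine} {β₂ : Y₂ → Y₁} {β₃ : Y₃ → Y₂}
  {θ₁ : Y₁ → Fin 3 → ℝ} {ρ₁ : Y₁ → ℝ} {r₁ : Fin 4 → Y₁ → ℝ} {θ₂ : Y₂ → Fin 2 → ℝ} {ρ₂ : Y₂ → ℝ}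
  {r₂ : Fin 5 → Y₂ → ℝ} {θ₃ : Y₃ → Fin 2 → ℝ} {ρ₃ : Y₃ → ℝ} {r₃ : Fin 6 → Y₃ → ℝ}

lemma lift_C011 (h₁ : CornerBlow β₁ (baseK x) id θ₁ ρ₁ r₁) :
    lift β₁ (C111 M x) (C011 M x) = {y | ∀ a, r₁ (![1, 3] a) y = 0} :=
  h₁.lift_pair C111_eq C011_eq 1 (by decide) (by decide)

lemma lift_C101 (h₁ : CornerBlow β₁ (baseK x) id θ₁ ρ₁ r₁)
    (h₂ : CornerBlow β₂ r₁ ![1, 3] θ₂ ρ₂ r₂) :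
    lift β₂ (lift β₁ (C111 M x) (C011 M x)) (lift β₁ (C111 M x) (C101 M x)) =
      {y | ∀ a, r₂ (![2, 3] a) y = 0} :=
  h₂.lift_pair (lift_C011 h₁) (h₁.lift_pair C111_eq C101_eq 2 (by decide) (by decide)) 1
    (by decide) (by decide)

lemma lift_C110 (h₁ : CornerBlow β₁ (baseK x) id θ₁ ρ₁ r₁) (h₂ : CornerBlow β₂ r₁ ![1, 3] θ₂ ρ₂ r₂)
    (h₃ : CornerBlow β₃ r₂ ![2, 3] θ₃ ρ₃ r₃) :
    lift β₃ (lift β₂ (lift β₁ (C111 M x) (C011 M x)) (lift β₁ (C111 M x) (C101 M x)))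
      (lift β₂ (lift β₁ (C111 M x) (C011 M x)) (lift β₁ (C111 M x) (C110 M x))) =
      {y | ∀ a, r₃ (![4, 5] a) y = 0} :=
  h₃.lift_pair (lift_C101 h₁ h₂) (h₂.lift_pair (lift_C011 h₁)
    (h₁.lift_pair C111_eq C110_eq 0 (by decide) (by decide)) 0 (by decide) (by decide)) 0
    (by decide) (by decide)

end

lemma exists_kBDouble (hF : FibredBoundary M x R E) : Nonempty (KBDouble M x) := by
  obtain ⟨Y₁, β₁, θ₁, ρ₁, r₁, h₁⟩ := hF.lc_baseK.exists_cornerBlow Function.injective_id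
  obtain ⟨Y₂, β₂, θ₂, ρ₂, r₂, h₂⟩ := h₁.lc.exists_cornerBlow (injective_pair (i := 1) (j := 3)
    (by decide))
  obtain ⟨Y₃, β₃, θ₃, ρ₃, r₃, h₃⟩ := h₂.lc.exists_cornerBlow (injective_pair (i := 2) (j := 3)
    (by decide))
  obtain ⟨Y₄, β₄, θ₄, ρ₄, r₄, h₄⟩ := h₃.lc.exists_cornerBlow (injective_pair (i := 4) (j := 5)
    (by decide))
  exact ⟨⟨Y₁, β₁, h₁.isBlowup C111_eq, Y₂, β₂, h₂.isBlowup (lift_C011 h₁), Y₃, β₃,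
    h₃.isBlowup (lift_C101 h₁ h₂), Y₄, β₄, h₄.isBlowup (lift_C110 h₁ h₂ h₃)⟩⟩

/-- The functions on the given spaces leading to `M²_{k,b}`. -/
lemma KBDouble.exists_tower (hF : FibredBoundary M x R E) (K : KBDouble M x) :
    ∃ T, KbTower x K.β₁ K.β₂ K.β₃ K.β₄ T ∧ K.bf = {q | T 0 q = 0} := by
  obtain ⟨θ₁, ρ₁, r₁, h₁⟩ := K.blowup₁.exists_cornerBlow C111_eq hF.lc_baseK Function.injective_id
  obtain ⟨θ₂, ρ₂, r₂, h₂⟩ := K.blowup₂.exists_cornerBlow (lift_C011 h₁) h₁.lc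
    (injective_pair (by decide))
  obtain ⟨θ₃, ρ₃, r₃, h₃⟩ := K.blowup₃.exists_cornerBlow (lift_C101 h₁ h₂) h₂.lc
    (injective_pair (by decide))
  obtain ⟨θ₄, ρ₄, T, h₄⟩ := K.blowup₄.exists_cornerBlow (lift_C110 h₁ h₂ h₃) h₃.lc
    (injective_pair (by decide))
  refine ⟨T, ⟨θ₁, ρ₁, r₁, θ₂, ρ₂, r₂, θ₃, ρ₃, r₃, θ₄, ρ₄, h₁, h₂, h₃, h₄⟩, ?_⟩; unfold KBDouble.bf
  rw [lift_C110 h₁ h₂ h₃]; ext q; rw [h₄.zero]; exact h₄.blow.eq_zero_iff.symm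

namespace KbTower

variable {Y₁ Y₂ Y₃ Y₄ : Mfd.{u}} {β₁ : Y₁ → (M.prod M).prodHalfLine} {β₂ : Y₂ → Y₁}
  {β₃ : Y₃ → Y₂} {β₄ : Y₄ → Y₃} {T : Fin 7 → Y₄ → ℝ}

lemma lc (h : KbTower x β₁ β₂ β₃ β₄ T) : LC Y₄ T := by
  obtain ⟨θ₁, ρ₁, r₁, θ₂, ρ₂, r₂, θ₃, ρ₃, r₃, θ₄, ρ₄, h₁, h₂, h₃, h₄⟩ := h; exact h₄.lc

/-- The blow-down map itself has the lifting data of `KbFun`: the conditions on common zeros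
say that the components of the four directions do not vanish simultaneously. -/
lemma kbFun (hF : FibredBoundary M x R E) (h : KbTower x β₁ β₂ β₃ β₄ T) :
    KbFun x (β₁ ∘ β₂ ∘ β₃ ∘ β₄) T := by
  have hlc := h.lc; obtain ⟨θ₁, ρ₁, r₁, θ₂, ρ₂, r₂, θ₃, ρ₃, r₃, θ₄, ρ₄, h₁, h₂, h₃, h₄⟩ := h
  have t1 : ∀ y, T 1 y = r₃ 0 (β₄ y) := fun y => h₄.other 0 (by decide) y
  have t2 : ∀ y, T 2 y = r₂ 0 (β₃ (β₄ y)) := fun y =>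
    (h₄.other 1 (by decide) y).trans (h₃.other 0 (by decide) _)
  have t3 : ∀ y, T 3 y = r₁ 0 (β₂ (β₃ (β₄ y))) := fun y =>
    ((h₄.other 2 (by decide) y).trans (h₃.other 1 (by decide) _)).trans (h₂.other 0 (by decide) _)
  have t4 : ∀ y, T 4 y = r₃ 3 (β₄ y) := fun y => h₄.other 3 (by decide) y
  have a4 : ∀ y, r₃ 4 (β₄ y) = T 0 y * T 5 y := fun y => by rw [h₄.zero]; exact h₄.mul_dir 0 y
  have a5 : ∀ y, r₃ 5 (β₄ y) = T 0 y * T 6 y := fun y => by rw [h₄.zero]; exact h₄.mul_dir 1 y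
  have b2 : ∀ y, r₂ 2 (β₃ (β₄ y)) = T 1 y * T 4 y := fun y => by
    rw [t1, t4, h₃.zero]; exact h₃.mul_dir 0 _
  have b3 : ∀ y, r₂ 3 (β₃ (β₄ y)) = T 1 y * (T 0 y * T 5 y) := fun y => by
    rw [t1, ← a4, h₃.zero]; exact h₃.mul_dir 1 _
  have b4 : ∀ y, r₂ 4 (β₃ (β₄ y)) = T 0 y * T 6 y := fun y => by
    rw [← a5]; exact (h₃.other 4 (by decide) _).symm
  have c1 : ∀ y, r₁ 1 (β₂ (β₃ (β₄ y))) = T 2 y * (T 1 y * T 4 y) := fun y => by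
    rw [t2, ← b2, h₂.zero]; exact h₂.mul_dir 0 _
  have c3 : ∀ y, r₁ 3 (β₂ (β₃ (β₄ y))) = T 2 y * (T 0 y * T 6 y) := fun y => by
    rw [t2, ← b4, h₂.zero]; exact h₂.mul_dir 1 _
  have c2 : ∀ y, r₁ 2 (β₂ (β₃ (β₄ y))) = T 1 y * (T 0 y * T 5 y) := fun y => by
    rw [← b3]; exact (h₂.other 2 (by decide) _).symm
  -- in each blow-up, the components of the direction have no common zero
  have n1 : ∀ y, ¬ (T 2 y * (T 1 y * T 4 y) = 0 ∧ T 1 y * (T 0 y * T 5 y) = 0 ∧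
      T 2 y * (T 0 y * T 6 y) = 0) := by
    intro y hy; refine h₁.not_forall_dir (β₂ (β₃ (β₄ y))) ?_
    grind
  have n2 : ∀ y, ¬ (T 1 y * T 4 y = 0 ∧ T 0 y * T 6 y = 0) := by
    intro y hy; refine h₂.not_forall_dir (β₃ (β₄ y)) ?_; rw [Fin.forall_fin_two]
    rw [← b2, ← b4] at hy; exact hy
  have n3 : ∀ y, ¬ (T 4 y = 0 ∧ T 0 y * T 5 y = 0) := by
    intro y hy; refine h₃.not_forall_dir (β₄ y) ?_; rw [Fin.forall_fin_two]; rw [t4, ← a4] at hy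
    exact hy
  have n4 : ∀ y, ¬ (T 5 y = 0 ∧ T 6 y = 0) := by
    intro y hy; refine h₄.not_forall_dir y ?_; rw [Fin.forall_fin_two]; exact hy
  refine ⟨h₁.blow.smooth_β.comp (h₂.blow.smooth_β.comp (h₃.blow.smooth_β.comp h₄.blow.smooth_β)),
    hlc.smooth, fun y => ⟨hlc.nonneg _ y, hlc.nonneg _ y, hlc.nonneg _ y, hlc.nonneg _ y⟩,
    fun y => ?_, fun y => ?_, fun y => ?_, fun y h0 => ?_, fun y h0 => ?_,
    fun y h0 => ?_, fun y h0 => ?_, ?_⟩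
  · rw [t3, ← c1, h₁.zero]; exact h₁.mul_dir 0 _
  · rw [t3, ← c2, h₁.zero]; exact h₁.mul_dir 1 _
  · rw [t3, ← c3, h₁.zero]; exact h₁.mul_dir 2 _
  · grind
  · grind
  · grind
  · grind
  · exact h₄.blow.dense_preimage (h₃.blow.dense_preimage (h₂.blow.dense_preimage
      (h₁.blow.dense_preimage hF.lc_baseK.dense_ne)))

lemma injOver (h : KbTower x β₁ β₂ β₃ β₄ T) :
    InjOver (β₁ ∘ β₂ ∘ β₃ ∘ β₄) {p | ∀ l, baseK x l p ≠ 0} := by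
  obtain ⟨θ₁, ρ₁, r₁, θ₂, ρ₂, r₂, θ₃, ρ₃, r₃, θ₄, ρ₄, h₁, h₂, h₃, h₄⟩ := h
  have key : ∀ {X Y : Mfd.{u}} {n : ℕ} {ι : Type} [Fintype ι] {β : Y → X} {r : Fin n → X → ℝ}
      {e : ι → Fin n} {θ : Y → ι → ℝ} {ρ : Y → ℝ} {r' : Fin (n + 1) → Y → ℝ},
      CornerBlow β r e θ ρ r' → (∃ a : ι, True) → ∀ y, (∀ l, r l (β y) ≠ 0) → ∀ l, r' l y ≠ 0 := by
    rintro X Y n ι _ β r e θ ρ r' h ⟨a, -⟩ y hy l hl; rcases h.facesOver l with h' | ⟨l', h'⟩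
    · exact h' y ⟨a, hy _⟩ hl
    · exact hy l' ((h' y ⟨a, hy _⟩).1 hl)
  exact (h₁.injOver 0).comp ((h₂.injOver 0).comp ((h₃.injOver 0).comp (h₄.injOver 0)
    (key h₃ ⟨0, trivial⟩)) (key h₂ ⟨0, trivial⟩)) (key h₁ ⟨0, trivial⟩)

/-- The universal property of `M²_{k,b}`. -/
lemma exists_lift (h : KbTower x β₁ β₂ β₃ β₄ T) {f : Z → (M.prod M).prodHalfLine}
    {S : Fin 7 → Z → ℝ} (hf : KbFun x f S) :
    ∃ F : Z → Y₄, ContMDiff Z.I Y₄.I ∞ F ∧ ∀ z, (β₁ ∘ β₂ ∘ β₃ ∘ β₄) (F z) = f z := by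
  obtain ⟨θ₁, ρ₁, r₁, θ₂, ρ₂, r₂, θ₃, ρ₃, r₃, θ₄, ρ₄, h₁, h₂, h₃, h₄⟩ := h; have hS := hf.smooth
  have hd : Dense {z | S 3 z ≠ 0 ∧ S 2 z ≠ 0 ∧ S 1 z ≠ 0 ∧ S 0 z ≠ 0} := by
    refine hf.dense.mono fun z hz => ?_; have hk := hz 0; have hx := hz 1; rw [hf.eq_k] at hk
    rw [hf.eq_x] at hx; simp only [mul_ne_zero_iff] at hk hx
    grind
  have m0 := fun z => hf.ne0 z; have m1 := fun z => hf.ne1 z; have m5 := fun z => hf.ne5 z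
  have m6 := fun z => hf.ne6 z
  -- the map is lifted successively, changing the remaining functions by positive units `uᵢ`
  obtain ⟨F₁, u₁, s₁, su₁, p₁, e₁, -, d₁, -⟩ := h₁.exists_lift hf.smooth_f (S 3)
    (fun z => ![S 2 z * (S 1 z * S 4 z), S 1 z * (S 0 z * S 5 z), S 2 z * (S 0 z * S 6 z)])
    (by intro a; fin_cases a
        exacts [(hS 2).mul ((hS 1).mul (hS 4)), (hS 1).mul ((hS 0).mul (hS 5)),
          (hS 2).mul ((hS 0).mul (hS 6))])
    (fun z => (hf.nonneg z).2.2.2) (hd.mono fun z hz => hz.1)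
    (by intro z h'
        have i0 : S 2 z * (S 1 z * S 4 z) = 0 := h' 0; have i1 : S 1 z * (S 0 z * S 5 z) = 0 := h' 1
        have i2 : S 2 z * (S 0 z * S 6 z) = 0 := h' 2; simp only [mul_eq_zero] at i0 i1 i2
        specialize m0 z; specialize m1 z; specialize m5 z; specialize m6 z
        tauto)
    (by intro z a; fin_cases a; exacts [hf.eq_k z, hf.eq_x z, hf.eq_x' z])
  obtain ⟨F₂, u₂, s₂, su₂, p₂, e₂, -, d₂, o₂⟩ := h₂.exists_lift s₁ (S 2)
    (fun z => ![u₁ z * (S 1 z * S 4 z), u₁ z * (S 0 z * S 6 z)])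
    (by intro a; fin_cases a
        exacts [su₁.mul ((hS 1).mul (hS 4)), su₁.mul ((hS 0).mul (hS 6))])
    (fun z => (hf.nonneg z).2.2.1) (hd.mono fun z hz => hz.2.1)
    (by intro z h'
        have i0 : u₁ z * (S 1 z * S 4 z) = 0 := h' 0; have i1 : u₁ z * (S 0 z * S 6 z) = 0 := h' 1
        simp only [mul_eq_zero, (p₁ z).ne', false_or] at i0 i1
        specialize m0 z; specialize m1 z; specialize m5 z; specialize m6 z
        tauto)
    (by intro z a; fin_cases a
        · exact (d₁ z 0).trans (mul_left_comm _ _ _)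
        · exact (d₁ z 2).trans (mul_left_comm _ _ _))
  obtain ⟨F₃, u₃, s₃, su₃, p₃, e₃, -, d₃, o₃⟩ := h₃.exists_lift s₂ (S 1)
    (fun z => ![u₂ z * (u₁ z * S 4 z), u₁ z * (S 0 z * S 5 z)])
    (by intro a; fin_cases a
        exacts [su₂.mul (su₁.mul (hS 4)), su₁.mul ((hS 0).mul (hS 5))])
    (fun z => (hf.nonneg z).2.1) (hd.mono fun z hz => hz.2.2.1)
    (by intro z h'
        have i0 : u₂ z * (u₁ z * S 4 z) = 0 := h' 0; have i1 : u₁ z * (S 0 z * S 5 z) = 0 := h' 1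
        simp only [mul_eq_zero, (p₁ z).ne', (p₂ z).ne', false_or] at i0 i1
        specialize m0 z; specialize m5 z
        tauto)
    (by intro z a; fin_cases a
        · exact (d₂ z 0).trans
            (show u₂ z * (u₁ z * (S 1 z * S 4 z)) = S 1 z * (u₂ z * (u₁ z * S 4 z)) by ring)
        · exact (o₂ 2 (by decide) z).trans ((d₁ z 1).trans (mul_left_comm _ _ _)))
  obtain ⟨F₄, u₄, s₄, -, -, e₄, -⟩ := h₄.exists_lift s₃ (S 0)
    (fun z => ![u₃ z * (u₁ z * S 5 z), u₂ z * (u₁ z * S 6 z)])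
    (by intro a; fin_cases a
        exacts [su₃.mul (su₁.mul (hS 5)), su₂.mul (su₁.mul (hS 6))])
    (fun z => (hf.nonneg z).1) (hd.mono fun z hz => hz.2.2.2)
    (by intro z h'
        have i0 : u₃ z * (u₁ z * S 5 z) = 0 := h' 0; have i1 : u₂ z * (u₁ z * S 6 z) = 0 := h' 1
        simp only [mul_eq_zero, (p₁ z).ne', (p₂ z).ne', (p₃ z).ne', false_or] at i0 i1
        exact (m5 z i0).2.2 i1)
    (by intro z a; fin_cases a
        · exact (d₃ z 1).trans
            (show u₃ z * (u₁ z * (S 0 z * S 5 z)) = S 0 z * (u₃ z * (u₁ z * S 5 z)) by ring)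
        · exact (o₃ 4 (by decide) z).trans ((d₂ z 1).trans
            (show u₂ z * (u₁ z * (S 0 z * S 6 z)) = S 0 z * (u₂ z * (u₁ z * S 6 z)) by ring)))
  grind

end KbTower

end

/-! ### Blowing up a corner, and then disjoint corners -/

section

variable {n' : ℕ} {i k : Fin n} {L : List (Fin n)}
  {γ : Y → X} {r' : Fin n' → Y → ℝ} {t I κ : Y → ℝ} {τ σ : Fin n → Y → ℝ}

/-- A map `f` to `X` for which the ideals of the corner `r i = r k = 0`, and then those of
the lifts of the corners `r l = r k = 0`, for `l` in `L`, become principal; the generators are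
`t` and `τ l`. -/
structure PairFun (r : Fin n → X → ℝ) (i k : Fin n) (L : List (Fin n)) (f : Z → X) (t I : Z → ℝ)
    (τ σ : Fin n → Z → ℝ) (κ : Z → ℝ) : Prop where
  smooth_f : ContMDiff Z.I X.I ∞ f
  smooth_t : Smooth[Z] t
  smooth_I : Smooth[Z] I
  smooth_τ : ∀ l ∈ L, Smooth[Z] (τ l)
  smooth_σ : ∀ l ∈ L, Smooth[Z] (σ l)
  smooth_κ : Smooth[Z] κ
  nonneg_t : ∀ z, 0 ≤ t z
  nonneg_τ : ∀ l ∈ L, ∀ z, 0 ≤ τ l z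
  eq_i : ∀ z, r i (f z) = t z * I z
  eq_k : ∀ z, r k (f z) = t z * ((L.map fun l => τ l z).prod * κ z)
  eq : ∀ l ∈ L, ∀ z, r l (f z) = τ l z * σ l z
  ne_i : ∀ z, I z = 0 → (L.map fun l => τ l z).prod * κ z ≠ 0
  ne : ∀ l ∈ L, ∀ z, σ l z = 0 → κ z ≠ 0
  dense : Dense {z | r k (f z) ≠ 0}

/-- `Y` is obtained from `X` by blowing up the corner `r i = r k = 0` and then the lifts of the
corners `r l = r k = 0`, for `l` in `L`. The functions `r'` define the boundary hypersurfaces of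
`Y`, and `t` and `τ l` the lifts of the front faces. -/
structure PairStar (r : Fin n → X → ℝ) (i k : Fin n) (L : List (Fin n)) (γ : Y → X)
    (r' : Fin n' → Y → ℝ) (t I : Y → ℝ) (τ σ : Fin n → Y → ℝ) (κ : Y → ℝ) : Prop where
  ne : i ≠ k
  i_notMem : i ∉ L
  k_notMem : k ∉ L
  disj : DisjointOn r L
  exists_fun : ∃ (X₁ : Mfd.{u}) (β : X₁ → X) (θ : X₁ → Fin 2 → ℝ) (ρ : X₁ → ℝ)
    (r₁ : Fin (n + 1) → X₁ → ℝ) (δ : Y → X₁) (T S : Fin (n + 1) → Y → ℝ),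
    CornerBlow β r ![i, k] θ ρ r₁ ∧ StarBlow r₁ k.succ (L.map Fin.succ) δ r' T S κ ∧
    DisjointOn r₁ (L.map Fin.succ) ∧ γ = β ∘ δ ∧ t = r₁ 0 ∘ δ ∧ I = r₁ i.succ ∘ δ ∧
    τ = (fun l => T l.succ) ∧ σ = fun l => S l.succ

lemma mem_map_succ : l.succ ∈ L.map Fin.succ ↔ l ∈ L :=
  List.mem_map_of_injective (Fin.succ_injective n)

lemma pair_ne (hi : i ∉ L) (hk : k ∉ L) (hl : l ∈ L) (a : Fin 2) : ![i, k] a ≠ l := by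
  rintro rfl; fin_cases a; exacts [hi hl, hk hl]

lemma CornerBlow.disjointOn {θ : Y → Fin 2 → ℝ} {r₁ : Fin (n + 1) → Y → ℝ}
    (h : CornerBlow β r ![i, k] θ ρ r₁) (hi : i ∉ L) (hk : k ∉ L) (hL : DisjointOn r L) :
    DisjointOn r₁ (L.map Fin.succ) := by
  have ho : ∀ l ∈ L, ∀ y, r₁ l.succ y = r l (β y) := fun l hl => h.other l
    (pair_ne hi hk hl)
  intro l hl l' hl' hne y h0; obtain ⟨l, hl, rfl⟩ := List.mem_map.1 hl
  obtain ⟨l', hl', rfl⟩ := List.mem_map.1 hl'; rw [ho l (by assumption)] at h0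
  rw [ho l' (by assumption)]
  exact hL l (by assumption) l' (by assumption) (fun h' => hne (by rw [h'])) _ h0

/-- The statement that the corners `r l = r a = 0`, for `l` in `L`, can be blown up successively. -/
def HasStarBlow (L : List (Fin n)) : Prop :=
  ∀ (X : Mfd.{u}) (r : Fin n → X → ℝ) (a : Fin n), LC X r → L.Nodup → a ∉ L → DisjointOn r L →
    ∃ (Y : Mfd.{u}) (γ : Y → X) (n' : ℕ) (r' : Fin n' → Y → ℝ) (T σ : Fin n → Y → ℝ) (κ : Y → ℝ),
      StarBlow r a L γ r' T σ κ

lemma HasStarBlow.exists_pairStar (hs : HasStarBlow.{u} (L.map Fin.succ)) (hX : LC X r)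
    (hik : i ≠ k)
    (hi : i ∉ L) (hk : k ∉ L) (hnd : L.Nodup) (hL : DisjointOn r L) :
    ∃ (Y : Mfd.{u}) (γ : Y → X) (n' : ℕ) (r' : Fin n' → Y → ℝ) (t I : Y → ℝ)
      (τ σ : Fin n → Y → ℝ) (κ : Y → ℝ), PairStar r i k L γ r' t I τ σ κ := by
  obtain ⟨X₁, β, θ, ρ, r₁, hc⟩ := hX.exists_cornerBlow (injective_pair hik)
  have hd := hc.disjointOn hi hk hL
  obtain ⟨Y, δ, n', r', T, S, κ, hS⟩ := hs X₁ r₁ k.succ hc.lc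
    (hnd.map (Fin.succ_injective _)) (fun h' => hk (mem_map_succ.1 h')) hd
  exact ⟨Y, _, n', r', _, _, _, _, κ, hik, hi, hk, hL, X₁, β, θ, ρ, r₁, δ, T, S, hc, hS, hd, rfl,
    rfl, rfl, rfl, rfl⟩

namespace PairStar

variable (h : PairStar r i k L γ r' t I τ σ κ)

include h

lemma lc : LC Y r' := by obtain ⟨-, -, -, -, X₁, β, θ, ρ, r₁, δ, T, S, hc, hS, -⟩ := h; exact hS.lc

lemma proper : IsProperMap γ := by
  obtain ⟨-, -, -, -, X₁, β, θ, ρ, r₁, δ, T, S, hc, hS, hd, rfl, -⟩ := h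
  exact hc.blow.proper.comp hS.proper

lemma monomial : IsMonomial γ r r' := by
  obtain ⟨-, -, -, -, X₁, β, θ, ρ, r₁, δ, T, S, hc, hS, hd, rfl, -⟩ := h
  exact hc.isMonomial.comp hS.monomial

lemma dense {D : Set X} (hD : Dense D) : Dense (γ ⁻¹' D) := by
  obtain ⟨-, -, -, -, X₁, β, θ, ρ, r₁, δ, T, S, hc, hS, hd, rfl, -⟩ := h
  exact hS.dense _ (hc.blow.dense_preimage hD)

lemma lcz {Z : X → ι → ℝ}
    {y : Y} (hy : LCZ r Z m (γ y)) : LCZ r' (fun y => Z (γ y)) (fun y => m (γ y)) y := by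
  obtain ⟨-, -, -, -, X₁, β, θ, ρ, r₁, δ, T, S, hc, hS, hd, rfl, -⟩ := h; exact hS.lcz (hc.lcz hy)

/-- The functions `t` and `I`, and the functions not involved in the blow-ups,
are among the defining functions of the boundary hypersurfaces. -/
lemma keep : ∃ K : Fin (n + 1) → Fin n', Function.Injective K ∧ r' (K i.succ) = I ∧ r' (K 0) = t ∧
    ∀ z ∉ L, z ≠ i → z ≠ k → ∀ y, r' (K z.succ) y = r z (γ y) := by
  obtain ⟨hik, hi, hk, -, X₁, β, θ, ρ, r₁, δ, T, S, hc, hS, hd, rfl, rfl, rfl, -⟩ := h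
  obtain ⟨K, hK, hK'⟩ := hS.keep
  have hs : ∀ {z}, z ∉ L → z ≠ k → ∀ y, r' (K z.succ) y = r₁ z.succ (δ y) := fun hz hzk =>
    hK' _ (fun h' => hz (mem_map_succ.1 h')) fun h' => hzk (Fin.succ_injective _ h')
  refine ⟨K, hK, funext (hs hi hik), funext (hK' _ (by simp) (Fin.succ_ne_zero k).symm),
    fun z hz hzi hzk y => (hs hz hzk y).trans (hc.other z (fun a => ?_) (δ y))⟩
  fin_cases a; exacts [hzi.symm, hzk.symm]

/-- The blow-ups only change the set over `r k = 0`. -/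
lemma away : InjOver γ {p | r k p ≠ 0} ∧
    FacesOver γ r r' {p | r k p ≠ 0} ∧
    ∃ s : X → Y, ContinuousOn s {p | r k p ≠ 0} ∧ ∀ p, r k p ≠ 0 → γ (s p) = p := by
  obtain ⟨-, -, -, -, X₁, β, θ, ρ, r₁, δ, T, S, hc, hS, hd, rfl, -⟩ := h
  have hm : ∀ y, r k (β y) ≠ 0 → r₁ k.succ y ≠ 0 := fun y hy h' =>
    hy (by
      have := hc.mul_dir 1 y; rwa [show ![i, k] 1 = k from rfl, h', mul_zero] at this)
  refine ⟨(hc.blow.injOver.mono fun p hp => ⟨1, hp⟩).comp hS.injOver hm,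
    FacesOver.comp (D' := {y | r₁ k.succ y ≠ 0}) (fun l => ?_) hS.faces hm, ?_⟩
  · rcases hc.facesOver l with h1 | ⟨l', hl'⟩
    · exact Or.inl fun y hy => h1 y ⟨1, hy⟩
    · exact Or.inr ⟨l', fun y hy => hl' y ⟨1, hy⟩⟩
  · obtain ⟨s, hs, hs'⟩ := hc.blow.exists_section; obtain ⟨s₁, hs₁, hs₁'⟩ := hS.sec
    have hm' : ∀ p, r k p ≠ 0 → r₁ k.succ (s p) ≠ 0 := fun p hp =>
      hm _ (by rw [hs' p ⟨1, hp⟩]; exact hp)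
    refine ⟨s₁ ∘ s, hs₁.comp (hs.mono fun p hp => ⟨1, hp⟩) hm', fun p hp => ?_⟩
    change β (δ (s₁ (s p))) = p; rw [hs₁' _ (hm' p hp), hs' p ⟨1, hp⟩]

/-- On the blow-up itself, the ideals of the centres are principal. -/
lemma pairFun : PairFun r i k L γ t I τ σ κ := by
  obtain ⟨hik, hi, hk, -, X₁, β, θ, ρ, r₁, δ, T, S, hc, hS, hd, rfl, rfl, rfl, rfl, rfl⟩ := h
  have hs := hS.sim
  have e : ∀ y, ((L.map Fin.succ).map fun l => T l y) = L.map fun l => T l.succ y := fun y =>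
    List.map_map
  have hp : ∀ y, r₁ k.succ (δ y) = (L.map fun l => T l.succ y).prod * κ y := fun y => by
    rw [hs.eq_a, e]
  have m0 : ∀ y, r i (β y) = r₁ 0 y * r₁ i.succ y := fun y => by rw [hc.zero]; exact hc.mul_dir 0 y
  have m1 : ∀ y, r k (β y) = r₁ 0 y * r₁ k.succ y := fun y => by rw [hc.zero]; exact hc.mul_dir 1 y
  exact
    { smooth_f := hc.blow.smooth_β.comp hs.smooth_f
      smooth_t := (hc.smooth 0).comp hs.smooth_f
      smooth_I := (hc.smooth _).comp hs.smooth_f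
      smooth_τ := fun l hl => hs.smooth_T _ (mem_map_succ.2 hl)
      smooth_σ := fun l hl => hs.smooth_σ _ (mem_map_succ.2 hl)
      smooth_κ := hs.smooth_κ
      nonneg_t := fun y => hc.bdBlow.nonneg 0 _
      nonneg_τ := fun l hl => hs.nonneg _ (mem_map_succ.2 hl)
      eq_i := fun y => m0 _
      eq_k := fun y => by rw [← hp]; exact m1 _
      eq := fun l hl y => by
        rw [← hs.eq _ (mem_map_succ.2 hl)]
        exact (hc.other l (pair_ne hi hk hl)
          (δ y)).symm
      ne_i := fun y h0 h' => hc.not_forall_dir (δ y) (Fin.forall_fin_two.2 ⟨h0, by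
        rw [← hp] at h'; exact h'⟩)
      ne := fun l hl => hs.ne _ (mem_map_succ.2 hl)
      dense := hS.dense {y | r k (β y) ≠ 0} (hc.blow.dense_preimage (hc.base.dense k)) }

/-- The universal property, with the values of the functions `t`, `I` and of the zero sets
of the functions `τ l`. -/
lemma exists_lift {f : Z → X} {t' I' κ' : Z → ℝ}
    {τ' σ' : Fin n → Z → ℝ} (hf : PairFun r i k L f t' I' τ' σ' κ') :
    ∃ (F : Z → Y) (u : Z → ℝ), ContMDiff Z.I Y.I ∞ F ∧ Smooth[Z] u ∧
      (∀ z, 0 < u z) ∧ (∀ z, γ (F z) = f z) ∧ (∀ z, t (F z) * u z = t' z) ∧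
      (∀ z, I (F z) = u z * I' z) ∧ ∀ l ∈ L, ∀ z, τ l (F z) = 0 ↔ r l (f z) = 0 ∧
        (L.map fun l => τ' l z).prod * κ' z = 0 := by
  obtain ⟨hik, hi, hk, -, X₁, β, θ, ρ, r₁, δ, T, S, hc, hS, hd, rfl, rfl, rfl, rfl, rfl⟩ := h
  have hP : ∀ K : List (Fin n), (∀ l ∈ K, l ∈ L) →
      Smooth[Z] fun z => (K.map fun l => τ' l z).prod := by
    intro K
    induction K with
    | nil => intro _; exact contMDiff_const
    | cons l K ihK =>
      intro hK; simp only [List.map_cons, List.prod_cons]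
      exact (hf.smooth_τ l (hK l List.mem_cons_self)).mul
        (ihK fun l hl => hK l (List.mem_cons_of_mem _ hl))
  have hP := hP L fun _ h' => h'
  obtain ⟨F, u, sF, su, pu, eF, e0, ed, eo⟩ := hc.exists_lift hf.smooth_f t'
    (fun z => ![I' z, (L.map fun l => τ' l z).prod * κ' z])
    (by intro a; fin_cases a; exacts [hf.smooth_I, hP.mul hf.smooth_κ]) hf.nonneg_t
    (hf.dense.mono fun z (hz : r k (f z) ≠ 0) => by
      rw [hf.eq_k] at hz; exact left_ne_zero_of_mul hz)
    (fun z h' => hf.ne_i z (h' 0) (h' 1))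
    (by intro z a; fin_cases a; exacts [hf.eq_i z, hf.eq_k z])
  have e1 : ∀ z, r₁ k.succ (F z) = u z * ((L.map fun l => τ' l z).prod * κ' z) := fun z => ed z 1
  have e2 : ∀ l ∈ L, ∀ z, r₁ l.succ (F z) = r l (f z) := fun l hl => eo l
    (pair_ne hi hk hl)
  have hsim : SimFun r₁ k.succ (L.map Fin.succ) F (Fin.cases 1 τ') (Fin.cases 1 σ')
      (fun z => u z * κ' z) := by
    refine ⟨sF, ?_, ?_, su.mul hf.smooth_κ, ?_, ?_, fun z => ?_, ?_, hf.dense.mono fun z hz => ?_⟩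
    · exact List.forall_mem_map.2 hf.smooth_τ
    · exact List.forall_mem_map.2 hf.smooth_σ
    · exact List.forall_mem_map.2 hf.nonneg_τ
    · exact List.forall_mem_map.2 fun l hl z => (e2 l hl z).trans (hf.eq l hl z)
    · rw [e1, List.map_map, mul_left_comm]; rfl
    · exact List.forall_mem_map.2 fun l hl z h0 => mul_ne_zero (pu z).ne' (hf.ne l hl z h0)
    · have hz : r k (f z) ≠ 0 := hz; rw [hf.eq_k] at hz; change r₁ k.succ (F z) ≠ 0; rw [e1]
      grind
  obtain ⟨G, sG, eG⟩ := hS.lift hsim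
  refine ⟨G, u, sG, su, pu, fun z => ?_, fun z => ?_, fun z => ?_, fun l hl z => ?_⟩
  · grind
  · grind
  · rw [Function.comp_apply, eG]; exact ed z 0
  · rw [hS.sim.zero_iff hd (mem_map_succ.2 hl), eG, e1, e2 l hl, mul_eq_zero,
      or_iff_right (pu z).ne']

/-- The blow-ups as an iterated blow-up, with the lifts of further hypersurfaces `r z = 0`. -/
lemma iter (zs : List (Fin n)) (hzs : ∀ z ∈ zs, z ≠ i ∧ z ≠ k ∧ z ∉ L) :
    IsIteratedBlowup X ({p | r i p = 0 ∧ r k p = 0} :: L.map fun l => {p | r l p = 0 ∧ r k p = 0})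
      (zs.map fun z => {p | r z p = 0}) Y γ
      ((zs.map fun z => {y | r z (γ y) = 0}) ++
        {y | t y = 0} :: L.map fun l => {y | τ l y = 0}) := by
  obtain ⟨hik, hi, hk, -, X₁, β, θ, ρ, r₁, δ, T, S, hc, hS, hd, rfl, rfl, rfl, rfl, rfl⟩ := h
  have hpair : ∀ {W : Mfd.{u}} {N : ℕ} (r : Fin N → W → ℝ) (i j : Fin N),
      {p | r i p = 0 ∧ r j p = 0} = {p | ∀ a, r (![i, j] a) p = 0} := by
    intro W N r i j; ext p; simp [Fin.forall_fin_two]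
  have hP := hpair r i k
  have h1 : ∀ l ∈ L, lift β {p | r i p = 0 ∧ r k p = 0} {p | r l p = 0 ∧ r k p = 0} =
      {y | r₁ l.succ y = 0 ∧ r₁ k.succ y = 0} := fun l hl => by
    rw [hpair r₁]; exact hc.lift_pair hP (hpair r l k) 0 (fun h' : i = l => hi (h' ▸ hl)) hik
  have h2 : ∀ z ∈ zs, lift β {p | r i p = 0 ∧ r k p = 0} {p | r z p = 0} =
      {y | r₁ z.succ y = 0} := fun z hz => by
    have h2 := hc.lift_corner (a₀ := 0) (b := {z}) (fun h' => (hzs z hz).1 (Eq.symm h'))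
    simpa [← hP] using h2
  have h3 : β ⁻¹' {p | r i p = 0 ∧ r k p = 0} = {y | r₁ 0 y = 0} := by
    rw [hP, hc.zero]; ext y; exact hc.blow.eq_zero_iff.symm
  have hit := hS.iter (zs.map Fin.succ ++ [0]) (by
    simp only [List.mem_append, List.mem_map, List.mem_singleton]
    grind)
  have e3 := IsIteratedBlowup.cons (Ps := L.map fun l => {p | r l p = 0 ∧ r k p = 0})
    (Zs := zs.map fun z => {p | r z p = 0}) (hc.isBlowup hP) (by
      convert hit using 1
      · rw [List.map_map, List.map_map]; exact List.map_congr_left h1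
      · rw [List.map_append, List.map_map, List.map_map, h3]; congr 1
        exact List.map_congr_left h2)
  convert e3 using 1
  rw [List.map_append, List.append_assoc, List.map_map, List.map_map]
  refine congrArg₂ _ (List.map_congr_left fun z hz => ?_) rfl
  ext y
  refine iff_of_eq (congrArg (· = 0) (hc.other z (fun a => ?_) (δ y)).symm)
  obtain ⟨h1, h2, -⟩ := hzs z hz
  fin_cases a; exacts [h1.symm, h2.symm]

end PairStar

/-- The blow-up of the first corner, followed by the other ones, is a special case of the blow-up of
a corner followed by disjoint corners. -/
lemma PairStar.starBlow {a : Fin n} (h : PairStar r l a L γ r' t I τ σ κ)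
    (hdis : DisjointOn r (l :: L)) :
    StarBlow r a (l :: L) γ r' (Function.update τ l t) (Function.update σ l I) κ := by
  have hP := h.pairFun
  have hL : ∀ {i}, i ∈ L → i ∈ l :: L := List.mem_cons_of_mem _
  have hl : l ∈ l :: L := List.mem_cons_self
  have hneL : ∀ i ∈ L, i ≠ l := fun i hi h' => h.i_notMem (h' ▸ hi)
  have hu : ∀ {f : Fin n → Y → ℝ} {f₀ : Y → ℝ} {Q : Fin n → (Y → ℝ) → Prop}, Q l f₀ →
      (∀ i ∈ L, Q i (f i)) → ∀ i ∈ l :: L, Q i (Function.update f l f₀ i) := fun h0 h1 =>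
    List.forall_mem_cons.2 ⟨by rwa [Function.update_self], fun i hi => by
      rw [Function.update_of_ne (hneL i hi)]; exact h1 i hi⟩
  have hup : ∀ i ∈ L, Function.update τ l t i = τ i := fun i hi =>
    Function.update_of_ne (hneL i hi) _ _
  obtain ⟨K, hK, -, -, hK'⟩ := h.keep
  refine
    { lc := h.lc
      proper := h.proper
      monomial := h.monomial
      keep := ⟨K ∘ Fin.succ, hK.comp (Fin.succ_injective _), fun z hz => by
        rw [List.mem_cons, not_or] at hz; exact hK' z hz.2 hz.1⟩
      sim :=
        { smooth_f := hP.smooth_f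
          smooth_T := hu (Q := fun _ T => Smooth[Y] T) hP.smooth_t hP.smooth_τ
          smooth_σ := hu (Q := fun _ T => Smooth[Y] T) hP.smooth_I hP.smooth_σ
          smooth_κ := hP.smooth_κ
          nonneg := hu (Q := fun _ T => ∀ z, 0 ≤ T z) hP.nonneg_t hP.nonneg_τ
          eq := List.forall_mem_cons.2 ⟨fun z => by simpa using hP.eq_i z, fun i hi z => by
            simpa [hneL i hi] using hP.eq i hi z⟩
          eq_a := fun z => by
            rw [hP.eq_k, List.map_cons, List.prod_cons, Function.update_self, mul_assoc,
              List.map_congr_left (l := L) fun i hi => congrFun (hup i hi) z]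
          ne := hu (Q := fun _ T => ∀ z, T z = 0 → κ z ≠ 0)
            (fun z h0 => right_ne_zero_of_mul (hP.ne_i z h0)) hP.ne
          dense := hP.dense }
      lift := fun {Z f T' σ' κ'} hf => ?_
      lcz := h.lcz
      iter := fun zs hzs => ?_
      dense := fun D => h.dense
      injOver := h.away.1
      faces := h.away.2.1
      sec := h.away.2.2 }
  · obtain ⟨F, -, sF, -, -, eF, -⟩ := h.exists_lift
      { smooth_f := hf.smooth_f
        smooth_t := hf.smooth_T l hl
        smooth_I := hf.smooth_σ l hl
        smooth_τ := fun i hi => hf.smooth_T i (hL hi)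
        smooth_σ := fun i hi => hf.smooth_σ i (hL hi)
        smooth_κ := hf.smooth_κ
        nonneg_t := hf.nonneg l hl
        nonneg_τ := fun i hi => hf.nonneg i (hL hi)
        eq_i := hf.eq l hl
        eq_k := fun z => by rw [hf.eq_a, List.map_cons, List.prod_cons, mul_assoc]
        eq := fun i hi => hf.eq i (hL hi)
        -- the corners being disjoint, the other generators do not vanish where `σ' l` does
        ne_i := fun z h0 => mul_ne_zero (fun hz => by
          obtain ⟨i, hi, e⟩ := List.mem_map.1 (List.prod_eq_zero_iff.1 hz)
          exact hdis l hl i (hL hi) (hneL i hi).symm (f z) (by rw [hf.eq l hl, h0, mul_zero])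
            (by rw [hf.eq i (hL hi), e, zero_mul])) (hf.ne l hl z h0)
        ne := fun i hi => hf.ne i (hL hi)
        dense := hf.dense }
    exact ⟨F, sF, eF⟩
  · have := h.iter zs fun z hz => by
      grind
    rwa [List.map_cons, List.map_cons, Function.update_self, List.map_congr_left (l := L)
      fun i hi => congrArg (fun f : Y → ℝ => {y | f y = 0}) (hup i hi)]

/-- Induction on the number of corners, the first of which is blown up first. -/
lemma hasStarBlow (L : List (Fin n)) : HasStarBlow.{u} L := by
  induction hk : L.length generalizing n with
  | zero =>
    intro X r a hX _ _ _; rw [List.length_eq_zero_iff.1 hk]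
    exact ⟨X, id, n, r, _, _, _, starBlow_nil hX a⟩
  | succ len ih =>
    intro X r a hX hnd ha hdis
    cases L with
    | nil => simp at hk
    | cons l L =>
      obtain ⟨hla, haL⟩ : l ≠ a ∧ a ∉ L := by grind
      obtain ⟨hlL, hnd⟩ := List.nodup_cons.1 hnd
      obtain ⟨Y, γ, n', r', t, I, τ, σ, κ, h⟩ :=
        (ih (L.map Fin.succ) (by simpa using hk)).exists_pairStar hX hla hlL haL hnd
          fun i hi j hj => hdis i (List.mem_cons_of_mem _ hi) j (List.mem_cons_of_mem _ hj)
      exact ⟨Y, γ, n', r', _, _, κ, h.starBlow hdis⟩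

end

/-! ### The space `M²_{k,b}` as a blow-up of `M²_b × [0, ∞)` -/

section

variable {M : Mfd.{u}} {x : M → ℝ} {R : M → M → Prop} {E : M → ι → ℝ}
  {Mb : Mfd.{u}} {β : Mb → M.prod M} {θ : Mb → Fin 2 → ℝ} {ρ : Mb → ℝ}

/-- The map `β × id`. -/
def prodMap (β : Y → X) (q : Y.prodHalfLine) : X.prodHalfLine := (β q.1, q.2)

lemma contMDiff_prodMap {β : Y → X} (h : ContMDiff Y.I X.I ∞ β) :
    ContMDiff Y.prodHalfLine.I X.prodHalfLine.I ∞ (prodMap β) :=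
  (h.comp contMDiff_fst).prodMk contMDiff_snd

lemma InjOver.prodMap {β : Y → X} {D : Set X} (h : InjOver β D) :
    InjOver (prodMap β) {q | q.1 ∈ D} := fun _ _ e hq =>
  Prod.ext (h _ _ (congrArg Prod.fst e) hq) (congrArg Prod.snd e :)

/-- The functions `k`, `R`, `l`, `r` on `M²_b × [0, ∞)`. -/
def qFun (θ : Mb → Fin 2 → ℝ) (ρ : Mb → ℝ) : Fin 4 → Mb.prodHalfLine → ℝ :=
  Fin.cons halfCoord fun l q => bFun θ ρ l q.1

variable (hF : FibredBoundary M x R E)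
  (hb : Blow β (fun p a => baseFun x a p) θ ρ)

include hb

lemma baseK_prodMap (q : Mb.prodHalfLine) :
    baseK x 0 (prodMap β q) = qFun θ ρ 0 q ∧
    baseK x 1 (prodMap β q) = qFun θ ρ 1 q * qFun θ ρ 2 q ∧
    baseK x 2 (prodMap β q) = qFun θ ρ 1 q * qFun θ ρ 3 q :=
  ⟨rfl, hb.eq q.1 0, hb.eq q.1 1⟩

include hF in
lemma FibredBoundary.lc_qFun : LC Mb.prodHalfLine (qFun θ ρ) := (hF.cornerBlow hb).lc.prodHalfLine

include hF in
lemma dense_prodMap :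
    Dense {q : Mb.prodHalfLine | ∀ l, baseK x l (prodMap β q) ≠ 0} := by
  refine (hF.lc_qFun hb).dense_ne.mono fun q hq l => ?_; obtain ⟨h0, h1, h2⟩ := baseK_prodMap hb q
  fin_cases l
  · exact h0 ▸ hq 0
  · grind
  grind

lemma injOver_prodMap :
    InjOver (prodMap β) {p | ∀ l, baseK x l p ≠ 0} :=
  (hb.injOver.prodMap).mono fun _ hp => ⟨0, hp 1⟩

lemma qFun_ne (q : Mb.prodHalfLine) :
    ¬ (qFun θ ρ 2 q = 0 ∧ qFun θ ρ 3 q = 0) := by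
  intro h; obtain ⟨a, ha⟩ := hb.exists_θ_ne q.1; fin_cases a; exacts [ha h.1, ha h.2]

lemma disjointOn_qFun :
    DisjointOn (qFun θ ρ) [2, 3] := by
  have h := qFun_ne hb; intro l hl l' hl' hne p h0 h1
  grind

variable {Q : Mfd.{u}} {γ : Q → Mb.prodHalfLine} {n' : ℕ} {r' : Fin n' → Q → ℝ} {t I κ : Q → ℝ}
  {τ σ : Fin 4 → Q → ℝ}
  (hQ : PairStar (qFun θ ρ) 1 0 [2, 3] γ r' t I τ σ κ)

include hF hQ

/-- The ideals blown up for `M²_{k,b}` are principal on the blow-up of `M²_b × [0, ∞)`. -/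
lemma PairStar.kbFun :
    KbFun x (prodMap β ∘ γ) ![I, τ 2, τ 3, t, κ, σ 2, σ 3] := by
  have h := hQ.pairFun; have e2 := h.eq 2 (by simp)
  have e3 := h.eq 3 (by simp)
  have ek := h.eq_k; have ei := h.eq_i; have hne := h.ne_i
  simp only [List.map_cons, List.map_nil, List.prod_cons, List.prod_nil, mul_one] at ek hne
  -- the side faces of `M²_b` are disjoint
  have hlr : ∀ z, ¬ (τ 2 z * σ 2 z = 0 ∧ τ 3 z * σ 3 z = 0) := fun z => by
    rw [← e2, ← e3]; exact qFun_ne hb _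
  refine ⟨(contMDiff_prodMap hb.smooth_β).comp h.smooth_f, ?_,
    fun z => ⟨?_, h.nonneg_τ 2 (by simp) z,
    h.nonneg_τ 3 (by simp) z, h.nonneg_t z⟩, fun z => ?_, fun z => ?_, fun z => ?_, fun z h0 => ?_,
    fun z h0 h1 => ?_, fun z h0 => ?_, fun z h0 => ?_, hQ.dense (dense_prodMap hF hb)⟩
  · intro l; fin_cases l
    exacts [h.smooth_I, h.smooth_τ 2 (by simp), h.smooth_τ 3 (by simp), h.smooth_t, h.smooth_κ,
      h.smooth_σ 2 (by simp), h.smooth_σ 3 (by simp)]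
  · obtain ⟨K, -, hl, -⟩ := hQ.keep; exact hl ▸ hQ.lc.nonneg _ z
  · refine ((baseK_prodMap hb _).1.trans (ek z)).trans ?_; change _ = t z * (τ 3 z * (τ 2 z * κ z))
    ring
  · refine (baseK_prodMap hb _).2.1.trans ?_; change _ = t z * (τ 2 z * (I z * σ 2 z))
    rw [ei, e2]; ring
  · refine (baseK_prodMap hb _).2.2.trans ?_; change _ = t z * (τ 3 z * (I z * σ 3 z))
    rw [ei, e3]; ring
  · have := hne z h0; simp only [mul_ne_zero_iff] at this; exact ⟨this.1.1, this.1.2, this.2⟩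
  · have h0 : τ 2 z = 0 := h0; have h1 : τ 3 z = 0 := h1; exact hlr z (by simp [h0, h1])
  · have h0 : σ 2 z = 0 := h0
    exact ⟨fun (h1 : τ 3 z = 0) => hlr z (by simp [h0, h1]), h.ne 2 (by simp) z h0,
      fun (h1 : σ 3 z = 0) => hlr z (by simp [h0, h1])⟩
  · have h0 : σ 3 z = 0 := h0
    exact ⟨fun (h1 : τ 2 z = 0) => hlr z (by simp [h0, h1]), h.ne 3 (by simp) z h0⟩

/-- Maps which lift to `M²_{k,b}` lift to the blow-up of `M²_b × [0, ∞)`. -/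
lemma KbFun.exists_lift {f : Z → (M.prod M).prodHalfLine} {T : Fin 7 → Z → ℝ} (h : KbFun x f T) :
    ∃ F : Z → Q, ContMDiff Z.I Q.I ∞ F ∧ (∀ z, prodMap β (γ (F z)) = f z) ∧
      ∀ z, I (F z) = 0 ↔ T 0 z = 0 := by
  have hT := h.smooth; have m0 := h.ne0; have m1 := h.ne1; have m5 := h.ne5; have m6 := h.ne6
  have hd : Dense {z | T 3 z * T 0 z ≠ 0} := h.dense.mono fun z hz => by
    have hx := hz 1; rw [h.eq_x] at hx; simp only [mul_ne_zero_iff] at hx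
    grind
  -- first lift to `M²_b`, then to the blow-up of `M²_b × [0, ∞)`
  obtain ⟨F, u, sF, su, pu, eF, e0, ed⟩ := hb.exists_lift_unit
    (contMDiff_fst.comp h.smooth_f) (fun z => T 3 z * T 0 z)
    (fun z => ![T 1 z * T 5 z, T 2 z * T 6 z])
    (by intro a; fin_cases a
        exacts [(hT 1).mul (hT 5), (hT 2).mul (hT 6)])
    (fun z => mul_nonneg (h.nonneg z).2.2.2 (h.nonneg z).1) hd
    (by intro z h'
        have i0 : T 1 z * T 5 z = 0 := h' 0; have i1 : T 2 z * T 6 z = 0 := h' 1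
        simp only [mul_eq_zero] at i0 i1; specialize m1 z; specialize m5 z; specialize m6 z
        tauto)
    (by intro z a; fin_cases a
        · exact (h.eq_x z).trans (show T 3 z * (T 1 z * (T 0 z * T 5 z)) =
            T 3 z * T 0 z * (T 1 z * T 5 z) by ring)
        · exact (h.eq_x' z).trans (show T 3 z * (T 2 z * (T 0 z * T 6 z)) =
            T 3 z * T 0 z * (T 2 z * T 6 z) by ring))
  have hui := ContMDiff.inv₀ su fun z => (pu z).ne'
  have e1 : ∀ z, ρ (F z) = T 3 z * (T 0 z * (u z)⁻¹) := fun z => by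
    grind
  have hf : PairFun (qFun θ ρ) 1 0 [2, 3] (fun z => ((F z, (f z).2) : Mb.prodHalfLine)) (T 3)
      (fun z => T 0 z * (u z)⁻¹) ![T 1, T 1, T 1, T 2]
      ![T 5, T 5, fun z => u z * T 5 z, fun z => u z * T 6 z] (T 4) := by
    refine ⟨sF.prodMk (contMDiff_snd.comp h.smooth_f), hT 3, (hT 0).mul hui, ?_, ?_, hT 4,
      fun z => (h.nonneg z).2.2.2, ?_, fun z => e1 z, fun z => ?_, ?_, fun z h0 => ?_, ?_,
      h.dense.mono fun z (hz : ∀ l, baseK x l (f z) ≠ 0) => hz 0⟩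
    · simpa using ⟨hT 1, hT 2⟩
    · simpa using ⟨su.mul (hT 5), su.mul (hT 6)⟩
    · simpa using ⟨fun z => (h.nonneg z).2.1, fun z => (h.nonneg z).2.2.1⟩
    · refine (h.eq_k z).trans ?_
      simp only [List.map_cons, List.map_nil, List.prod_cons, List.prod_nil, mul_one]
      change _ = T 3 z * (T 1 z * T 2 z * T 4 z); ring
    · have j0 : ∀ z, qFun θ ρ 2 (F z, (f z).2) = T 1 z * (u z * T 5 z) := fun z =>
        (ed z 0).trans (mul_left_comm _ _ _)
      have j1 : ∀ z, qFun θ ρ 3 (F z, (f z).2) = T 2 z * (u z * T 6 z) := fun z =>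
        (ed z 1).trans (mul_left_comm _ _ _)
      simpa using ⟨j0, j1⟩
    · obtain ⟨a1, a2, a3⟩ := m0 z ((mul_eq_zero.1 h0).resolve_right (inv_pos.2 (pu z)).ne')
      simp only [List.map_cons, List.map_nil, List.prod_cons, List.prod_nil, mul_one]
      exact mul_ne_zero (mul_ne_zero a1 a2) a3
    · simpa [fun z => (pu z).ne'] using ⟨fun z hz => (m5 z hz).2.1, fun z hz => (m6 z hz).2⟩
  obtain ⟨G, v, sG, -, pv, eG, -, ei, -⟩ := hQ.exists_lift hf
  refine ⟨G, sG, fun z => ?_, fun z => ?_⟩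
  · rw [eG]; exact Prod.ext (eF z) rfl
  grind

/-- `M²_{k,b}` is also a blow-up of `M²_b × [0, ∞)`. -/
lemma KbTower.exists_diffeo {Y₁ Y₂ Y₃ Y₄ : Mfd.{u}}
    {β₁ : Y₁ → (M.prod M).prodHalfLine} {β₂ : Y₂ → Y₁} {β₃ : Y₃ → Y₂} {β₄ : Y₄ → Y₃}
    {T : Fin 7 → Y₄ → ℝ} (h : KbTower x β₁ β₂ β₃ β₄ T) :
    ∃ Φ : Y₄ ≃ₘ^∞⟮Y₄.I, Q.I⟯ Q, (∀ z, prodMap β (γ (Φ z)) = (β₁ ∘ β₂ ∘ β₃ ∘ β₄) z) ∧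
      ∀ z, I (Φ z) = 0 ↔ T 0 z = 0 := by
  have hk := h.kbFun hF; obtain ⟨F, sF, eF, hI⟩ := hk.exists_lift hF hb hQ
  obtain ⟨G, sG, eG⟩ := h.exists_lift (hQ.kbFun hF hb)
  obtain ⟨Φ, rfl⟩ := _root_.exists_diffeo ((injOver_prodMap hb).comp hQ.away.1 fun y hy => by
    have := hy 0
    rwa [(baseK_prodMap hb y).1] at this) h.injOver (hQ.kbFun hF hb).dense hk.dense sF sG eF eG
  exact ⟨Φ, eF, hI⟩

end

/-! ### The space `M²_{k,φ}` -/

section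

variable {M : Mfd.{u}} {x : M → ℝ} {R : M → M → Prop} {E : M → ι → ℝ}
  {Mb : Mfd.{u}} {β : Mb → M.prod M} {θ : Mb → Fin 2 → ℝ} {ρ : Mb → ℝ} {Q : Mfd.{u}}
  {γ : Q → Mb.prodHalfLine} {n' : ℕ} {r' : Fin n' → Q → ℝ} {l l' : Fin n'} {κ : Q → ℝ}
  {τ σ : Fin 4 → Q → ℝ}

/-- The functions `diagFun` on a space over `M²_b × [0, ∞)`. -/
def diagFun' (E : M → ι → ℝ) (β : Mb → M.prod M) (θ : Mb → Fin 2 → ℝ) (γ : Q → Mb.prodHalfLine)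
    (y : Q) (a : Option ι) : ℝ := diagFun E β θ (γ y).1 a

/-- The blow-ups of the two fibre diagonals, described on the blow-up `Q` of `M²_b × [0, ∞)`, with
the functions defining the boundary hypersurfaces. -/
structure KTower (E : M → ι → ℝ) (β : Mb → M.prod M) (θ : Mb → Fin 2 → ℝ) (γ : Q → Mb.prodHalfLine)
    (r' : Fin n' → Q → ℝ) (l l' : Fin n') {Ksc K : Mfd.{u}} (Φ : Y ≃ₘ^∞⟮Y.I, Q.I⟯ Q)
    (β₅ : Ksc → Y) (β₆ : K → Ksc) (θ₅ : Ksc → Option (Option ι) → ℝ) (ρ₅ : Ksc → ℝ)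
    (r₅ : Fin (n' + 1) → Ksc → ℝ) (θ₆ : K → Option (Option ι) → ℝ) (ρ₆ : K → ℝ)
    (r₆ : Fin (n' + 1 + 1) → K → ℝ) : Prop where
  rel₅ : RelBlow β₅ (fun j z => r' j (Φ z)) l (fun z => diagFun' E β θ γ (Φ z))
    (fun z => r' l' (Φ z)) θ₅ ρ₅ r₅
  rel₆ : RelBlow β₆ r₅ l'.succ (fun q a => θ₅ q (some a)) (r₅ l.succ) θ₆ ρ₆ r₆

/-- An auxiliary b-double space and the blow-up of its product with the half-line. -/
lemma exists_aux (hF : FibredBoundary M x R E) {Mb : Mfd.{u}} {β : Mb → M.prod M}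
    {θ : Mb → Fin 2 → ℝ} {ρ : Mb → ℝ} (hb : Blow β (fun p a => baseFun x a p) θ ρ) :
    ∃ (Q : Mfd.{u}) (γ : Q → Mb.prodHalfLine) (n' : ℕ) (r' : Fin n' → Q → ℝ) (l l' : Fin n')
      (τ σ : Fin 4 → Q → ℝ) (κ : Q → ℝ), l ≠ l' ∧
      PairStar (qFun θ ρ) 1 0 [2, 3] γ r' (r' l') (r' l) τ σ κ := by
  obtain ⟨Q, γ, n', r', t, I, τ, σ, κ, hQ⟩ :=
    (hasStarBlow _).exists_pairStar (hF.lc_qFun hb) (i := 1) (k := 0)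
    (by decide) (by decide) (by decide) (by decide) (disjointOn_qFun hb)
  obtain ⟨K, hK, rfl, rfl, -⟩ := hQ.keep
  exact ⟨Q, γ, n', r', _, _, τ, σ, κ, fun h => Fin.succ_ne_zero _ (hK h), hQ⟩

variable (hF : FibredBoundary M x R E)
  (hb : Blow β (fun p a => baseFun x a p) θ ρ)
  (hQ : PairStar (qFun θ ρ) 1 0 [2, 3] γ r' (r' l') (r' l) τ σ κ)

include hb

lemma KBDouble.base_iff {y : Mb.prodHalfLine}
    {p : (M.prod M).prodHalfLine} (h : prodMap β y = p) :
    (x p.1.1 = 0 ∧ x p.1.2 = 0) ↔ ρ y.1 = 0 := by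
  rw [hb.eq_zero_iff, Fin.forall_fin_two, ← h]; rfl

include hF

lemma KBDouble.ratioOneAt_iff {p : Y → (M.prod M).prodHalfLine}
    {f : Y → Mb.prodHalfLine} (hf : Continuous f) (h : ∀ z, prodMap β (f z) = p z)
    (hd : Dense {z | ∀ l, baseK x l (p z) ≠ 0}) (z : Y) :
    RatioOneAt x (fun z => (p z).1) z ↔ θ (f z).1 0 = θ (f z).1 1 := by
  have e : (fun z => (p z).1) = fun z => β (f z).1 := funext fun z => by rw [← h]; rfl
  rw [e]; refine _root_.ratioOneAt_iff hF hb (continuous_fst.comp hf) (hd.mono fun z hz => ?_) z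
  have h1 := hz 1; have h2 := hz 2; rw [← h] at h1 h2; exact ⟨h1, h2⟩

include hQ

lemma PairStar.smooth_diagFun' (a : Option ι) :
    Smooth[Q] fun y => diagFun' E β θ γ y a :=
  (hF.smooth_diagFun hb a).comp (contMDiff_fst.comp hQ.pairFun.smooth_f)

lemma PairStar.lcz_diagFun {y : Q}
    (hy : r' l y * r' l' y = 0) (hZ : ∀ a, diagFun' E β θ γ y a = 0) :
    LCZ r' (diagFun' E β θ γ) (fun y => r' l y * r' l' y) y := by
  have e : ∀ y, ρ (γ y).1 * 1 = r' l y * r' l' y := fun y => by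
    rw [mul_one, mul_comm (r' l y)]; exact hQ.pairFun.eq_i y
  have h1 := hQ.lcz (y := y) (hF.lcz hb (y := (γ y).1) (by rw [← mul_one (ρ _), e, hy])
    hZ).prodHalfLine
  simp only [e] at h1; exact h1

variable {Ksc K : Mfd.{u}} {Φ : Y ≃ₘ^∞⟮Y.I, Q.I⟯ Q} {β₅ : Ksc → Y} {β₆ : K → Ksc}
  {θ₅ : Ksc → Option (Option ι) → ℝ} {ρ₅ : Ksc → ℝ} {r₅ : Fin (n' + 1) → Ksc → ℝ}
  {θ₆ : K → Option (Option ι) → ℝ} {ρ₆ : K → ℝ} {r₆ : Fin (n' + 1 + 1) → K → ℝ}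

lemma PairStar.lcz₅ (Φ : Y ≃ₘ^∞⟮Y.I, Q.I⟯ Q) {z : Y}
    (hz : r' l (Φ z) * r' l' (Φ z) = 0) (hZ : ∀ a, diagFun' E β θ γ (Φ z) a = 0) :
    LCZ (fun j z => r' j (Φ z)) (fun z => diagFun' E β θ γ (Φ z))
      (fun z => r' l (Φ z) * r' l' (Φ z)) z :=
  LCZ.pullback Φ.toPartialDiffeomorph (hQ.lcz_diagFun hF hb hz hZ) trivial

lemma PairStar.lcz₆ (hne : l ≠ l')
    (h₅ : RelBlow β₅ (fun j z => r' j (Φ z)) l (fun z => diagFun' E β θ γ (Φ z))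
      (fun z => r' l' (Φ z)) θ₅ ρ₅ r₅) {q : Ksc} (hq : r₅ l'.succ q = 0)
    (hζ : ∀ a, θ₅ q (some a) = 0) :
    LCZ r₅ (fun q a => θ₅ q (some a)) (fun q => r₅ l'.succ q * r₅ l.succ q) q := by
  have e : ∀ q, r₅ l'.succ q = r' l' (Φ (β₅ q)) := h₅.other l' hne.symm
  have h1 := h₅.lcz_dir hζ (hQ.lcz₅ hF hb Φ (z := β₅ q) (by rw [← e, hq, mul_zero]) fun a => by
    rw [h₅.mul_Z, hζ, mul_zero])
  grind

variable {Kb : KBDouble M x}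

lemma KBDouble.diagSc_eq
    (Φ : Kb.space ≃ₘ^∞⟮Kb.space.I, Q.I⟯ Q) (hΦ : ∀ z, prodMap β (γ (Φ z)) = Kb.total z)
    (hbf : ∀ z, r' l (Φ z) = 0 ↔ z ∈ Kb.bf) (hd : Dense {z | ∀ l, baseK x l (Kb.total z) ≠ 0}) :
    Kb.diagSc R =
      {z | ∀ a, relFun (fun z => r' l (Φ z)) (fun z => diagFun' E β θ γ (Φ z)) z a = 0} := by
  ext z
  have h1 := KBDouble.ratioOneAt_iff hF hb
    (hQ.pairFun.smooth_f.continuous.comp Φ.contMDiff.continuous) hΦ hd z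
  unfold KBDouble.diagSc; rw [mem_ofPred_eq, mem_ofPred_eq, ← hbf, h1, Option.forall]
  refine and_congr_right fun h => ?_
  have h2 : ρ (γ (Φ z)).1 = 0 := by
    have h3 : ρ (γ (Φ z)).1 = r' l' (Φ z) * r' l (Φ z) := hQ.pairFun.eq_i (Φ z)
    rw [h3, h, mul_zero]
  rw [← hΦ]; exact mem_diag_iff hF hb h2

/-- The closure in the definition of `diagPhi` adds the points over `bf` at which the generators
`Z / ρ₅` vanish: from such a point one can move away from the front face of the first blow-up. -/
lemma KBDouble.diagPhi_eq (hne : l ≠ l')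
    (Φ : Kb.space ≃ₘ^∞⟮Kb.space.I, Q.I⟯ Q) (hΦ : ∀ z, prodMap β (γ (Φ z)) = Kb.total z)
    (hbf : ∀ z, r' l (Φ z) = 0 ↔ z ∈ Kb.bf) (hd : Dense {z | ∀ l, baseK x l (Kb.total z) ≠ 0})
    {β₅ : Ksc → Kb.space} (h₅ : RelBlow β₅ (fun j z => r' j (Φ z)) l
      (fun z => diagFun' E β θ γ (Φ z)) (fun z => r' l' (Φ z)) θ₅ ρ₅ r₅) :
    Kb.diagPhi R β₅ = {q | ∀ a, relFun (r₅ l'.succ) (fun q a => θ₅ q (some a)) q a = 0} := by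
  have ht : ∀ q, r₅ l'.succ q = r' l' (Φ (β₅ q)) := h₅.other l' hne.symm
  have hI : ∀ q, r' l (Φ (β₅ q)) = r₅ 0 q * r₅ l.succ q := fun q => by
    rw [h₅.zero]; exact h₅.mul_dir q
  -- the lift of `bf` does not meet the set where the generators `Z / ρ₅` vanish
  have hθ : ∀ q, (∀ a, θ₅ q (some a) = 0) → r₅ l.succ q ≠ 0 := by
    intro q hq h0; obtain ⟨a, ha⟩ := h₅.blow.exists_θ_ne q
    cases a with
    | none => exact ha (by rw [← h₅.dir]; exact h0)
    | some a => exact ha (hq a)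
  -- the set of which `diagPhi` is the closure lies off the front face of the first blow-up
  have key : {q | Kb.total (β₅ q) ∈ C111 M x ∧ β₅ q ∉ Kb.bf ∧
      RatioOneAt x (fun q' => (Kb.total (β₅ q')).1) q ∧
      R (Kb.total (β₅ q)).1.1 (Kb.total (β₅ q)).1.2} =
      {q | r₅ l'.succ q = 0 ∧ r₅ 0 q ≠ 0 ∧ ∀ a, θ₅ q (some a) = 0} := by
    ext q
    have h1 := KBDouble.ratioOneAt_iff hF hb (p := fun q => Kb.total (β₅ q))
      (hQ.pairFun.smooth_f.continuous.comp (Φ.contMDiff.continuous.comp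
        h₅.blow.smooth_β.continuous)) (fun q => hΦ (β₅ q)) (h₅.blow.dense_preimage hd) q
    have h2 : ρ (γ (Φ (β₅ q))).1 = r' l' (Φ (β₅ q)) * r' l (Φ (β₅ q)) := hQ.pairFun.eq_i _
    have h20 (h : r' l' (Φ (β₅ q)) = 0) : ρ (γ (Φ (β₅ q))).1 = 0 := by rw [h2, h, zero_mul]
    have h3 : halfCoord (Kb.total (β₅ q)) = r' l' (Φ (β₅ q)) * _ :=
      (congrArg halfCoord (hΦ (β₅ q))).symm.trans (hQ.pairFun.eq_k _)
    have h4 : Kb.total (β₅ q) ∈ C111 M x ↔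
        ρ (γ (Φ (β₅ q))).1 = 0 ∧ halfCoord (Kb.total (β₅ q)) = 0 := by
      rw [← KBDouble.base_iff hb (hΦ (β₅ q)), and_assoc]; rfl
    have h5 : (∀ a, diagFun' E β θ γ (Φ (β₅ q)) a = 0) ↔ ∀ a, ρ₅ q * θ₅ q (some a) = 0 :=
      forall_congr' fun a => by rw [← h₅.mul_Z]
    rw [mem_ofPred_eq, mem_ofPred_eq, h1, h4, ← hbf, h2, hI, ht]; constructor
    · rintro ⟨⟨e1, -⟩, e2, e3⟩; have e5 := left_ne_zero_of_mul e2
      have e4 := (mul_eq_zero.1 e1).resolve_right e2; rw [← hΦ] at e3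
      have e6 := h5.1 ((mem_diag_iff hF hb (h20 e4)).1 e3); rw [h₅.zero] at e5
      grind
    · rintro ⟨e1, e2, e3⟩; rw [h3, ← hΦ, e1, zero_mul, zero_mul]
      exact ⟨⟨rfl, rfl⟩, mul_ne_zero e2 (hθ q e3), (mem_diag_iff hF hb (h20 e1)).2
        (h5.2 fun a => by rw [e3, mul_zero])⟩
  unfold KBDouble.diagPhi; rw [key]; apply subset_antisymm
  · refine closure_minimal (fun q hq => Option.forall.2 ⟨hq.1, hq.2.2⟩) ?_
    have : {q | ∀ a, relFun (r₅ l'.succ) (fun q a => θ₅ q (some a)) q a = 0} =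
        ⋂ a, {q | relFun (r₅ l'.succ) (fun q a => θ₅ q (some a)) q a = 0} := by ext; simp
    rw [this]; refine isClosed_iInter fun a => isClosed_eq ?_ continuous_const
    cases a with
    | none => exact (h₅.lc.smooth _).continuous
    | some a => exact (h₅.blow.smooth_θ (some a)).continuous
  · intro q hq; have hq1 : r₅ l'.succ q = 0 := hq none
    have hq2 : ∀ a, θ₅ q (some a) = 0 := fun a => hq (some a)
    by_cases h0 : r₅ 0 q = 0
    · refine closure_mono ?_ ((hQ.lcz₆ hF hb hne h₅ hq1 hq2).mem_closure_eq hq2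
        (by rw [hq1, zero_mul]) h0)
      rintro q' ⟨e1, e2, e3⟩; have e4 := e2 _ (Fin.succ_ne_zero l') hq1
      grind
    · exact subset_closure ⟨hq1, h0, hq2⟩

/-- The functions on the spaces leading to a given space `M²_{k,φ}`. -/
lemma KPhiDouble.exists_fun (K : KPhiDouble M x R) (hne : l ≠ l') :
    ∃ (Φ : K.Kb.space ≃ₘ^∞⟮K.Kb.space.I, Q.I⟯ Q) (θ₅ : K.Ksc → Option (Option ι) → ℝ)
      (ρ₅ : K.Ksc → ℝ) (r₅ : Fin (n' + 1) → K.Ksc → ℝ) (θ₆ : K.space → Option (Option ι) → ℝ)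
      (ρ₆ : K.space → ℝ) (r₆ : Fin (n' + 1 + 1) → K.space → ℝ),
      KTower E β θ γ r' l l' Φ K.β₅ K.β₆ θ₅ ρ₅ r₅ θ₆ ρ₆ r₆ ∧
      (∀ z, prodMap β (γ (Φ z)) = K.Kb.total z) ∧ K.φf₀ = {z | ρ₆ z = 0} ∧
      InjOver K.Kb.total {p | ∀ l, baseK x l p ≠ 0} ∧
      Dense {z | ∀ l, baseK x l (K.Kb.total z) ≠ 0} := by
  obtain ⟨T, hT, hbf⟩ := K.Kb.exists_tower hF; obtain ⟨Φ, hΦ, hI⟩ := hT.exists_diffeo hF hb hQ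
  have hbf' : ∀ z, r' l (Φ z) = 0 ↔ z ∈ K.Kb.bf := fun z => by rw [hbf]; exact hI z
  have hd := (hT.kbFun hF).dense
  obtain ⟨θ₅, ρ₅, r₅, h₅⟩ := K.blowup₅.exists_relBlow (l₀ := l)
    (K.Kb.diagSc_eq hF hb hQ Φ hΦ hbf' hd) (hQ.lc.comp_diffeo Φ)
    (fun a => (hQ.smooth_diagFun' hF hb a).comp Φ.contMDiff)
    ((hQ.lc.smooth l').comp Φ.contMDiff)
    fun z hz hZ => hQ.lcz₅ hF hb Φ (by rw [hz, zero_mul]) hZ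
  have hphi := K.Kb.diagPhi_eq hF hb hQ hne Φ hΦ hbf' hd h₅
  obtain ⟨θ₆, ρ₆, r₆, h₆⟩ := K.blowup₆.exists_relBlow (l₀ := l'.succ) (m := r₅ l.succ) hphi h₅.lc
    (fun a => h₅.blow.smooth_θ (some a)) (h₅.lc.smooth _)
    fun q hq hζ => hQ.lcz₆ hF hb hne h₅ hq hζ
  refine ⟨Φ, θ₅, ρ₅, r₅, θ₆, ρ₆, r₆, ⟨h₅, h₆⟩, hΦ, ?_, hT.injOver, hd⟩; ext z
  change K.β₆ z ∈ K.Kb.diagPhi R K.β₅ ↔ ρ₆ z = 0; rw [hphi]; exact h₆.blow.eq_zero_iff.symm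

end

/-- The blow-ups defining `M²_{k,φ}` exist. -/
lemma exists_kPhiDouble {M : Mfd.{u}} {x : M → ℝ} {R : M → M → Prop}
    {E : M → ι → ℝ} (hF : FibredBoundary M x R E) : Nonempty (KPhiDouble M x R) := by
  obtain ⟨Mb, β, θ, ρ, r₁, h₁⟩ := hF.lc_prod.exists_cornerBlow Function.injective_id
  have hb : Blow β (fun p a => baseFun x a p) θ ρ := h₁.blow
  obtain ⟨Q, γ, n', r', l, l', τ, σ, κ, hne, hQ⟩ := exists_aux hF hb
  obtain ⟨Kb⟩ := exists_kBDouble hF; obtain ⟨T, hT, hbf⟩ := Kb.exists_tower hF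
  obtain ⟨Φ, hΦ, hI⟩ := hT.exists_diffeo hF hb hQ
  have hbf' : ∀ z, r' l (Φ z) = 0 ↔ z ∈ Kb.bf := fun z => by rw [hbf]; exact hI z
  have hd := (hT.kbFun hF).dense
  obtain ⟨Ksc, β₅, θ₅, ρ₅, r₅, h₅⟩ := (hQ.lc.comp_diffeo Φ).exists_relBlow (l₀ := l)
    (m := fun z => r' l' (Φ z)) (fun a => (hQ.smooth_diagFun' hF hb a).comp Φ.contMDiff)
    ((hQ.lc.smooth l').comp Φ.contMDiff)
    fun z hz hZ => hQ.lcz₅ hF hb Φ (by rw [hz, zero_mul]) hZ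
  obtain ⟨K, β₆, θ₆, ρ₆, r₆, h₆⟩ := h₅.lc.exists_relBlow (l₀ := l'.succ) (m := r₅ l.succ)
    (fun a => h₅.blow.smooth_θ (some a)) (h₅.lc.smooth _)
    fun q hq hζ => hQ.lcz₆ hF hb hne h₅ hq hζ
  exact ⟨⟨Kb, Ksc, β₅, h₅.isBlowup (Kb.diagSc_eq hF hb hQ Φ hΦ hbf' hd), K, β₆,
    h₆.isBlowup (Kb.diagPhi_eq hF hb hQ hne Φ hΦ hbf' hd h₅)⟩⟩

/-! ### The space `M²_{k,φ}` as a blow-up of `M²_φ × [0, ∞)` -/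

section

variable {M : Mfd.{u}} {x : M → ℝ} {R : M → M → Prop} {E : M → ι → ℝ}
  {Mb : Mfd.{u}} {β : Mb → M.prod M} {θ : Mb → Fin 2 → ℝ} {ρ : Mb → ℝ}
  {N : Mfd.{u}} {β' : N → Mb} {θ' : N → Option (Option ι) → ℝ} {ρ' : N → ℝ} {s : Fin 4 → N → ℝ}
  {Q : Mfd.{u}} {γ : Q → Mb.prodHalfLine} {r : Fin n → Q → ℝ} {l' : Fin n} {κ : Q → ℝ}
  {τ σ : Fin 4 → Q → ℝ} {Y₄ Ksc K : Mfd.{u}} {Φ : Y₄ ≃ₘ^∞⟮Y₄.I, Q.I⟯ Q} {β₅ : Ksc → Y₄}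
  {β₆ : K → Ksc} {θ₅ : Ksc → Option (Option ι) → ℝ} {ρ₅ : Ksc → ℝ} {r₅ : Fin (n + 1) → Ksc → ℝ}
  {θ₆ : K → Option (Option ι) → ℝ} {ρ₆ : K → ℝ} {r₆ : Fin (n + 1 + 1) → K → ℝ}

/-- The functions `k` and those defining the faces `φf`, `bf`, `lf`, `rf` on `M²_φ × [0, ∞)`. -/
def wFun (s : Fin 4 → N → ℝ) : Fin 5 → N.prodHalfLine → ℝ := Fin.cons halfCoord fun l q => s l q.1

variable (hb : Blow β (fun p a => baseFun x a p) θ ρ)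
  (hr : RelBlow β' (bFun θ ρ) 0 (diagFun E β θ) (fun _ => 1) θ' ρ' s)
  (hQ : PairStar (qFun θ ρ) 1 0 [2, 3] γ r (r l') (r l) τ σ κ) (hne : l ≠ l')
  (hT : KTower E β θ γ r l l' Φ β₅ β₆ θ₅ ρ₅ r₅ θ₆ ρ₆ r₆)

section

include hb hr

/-- The faces `φf`, `lf` and `rf` are pairwise disjoint. -/
lemma RelBlow.side_ne (w : N) :
    (s 0 w = 0 → s 2 w ≠ 0 ∧ s 3 w ≠ 0) ∧ ¬ (s 2 w = 0 ∧ s 3 w = 0) := by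
  have r2 : s 2 w = θ (β' w) 0 := hr.other 1 (by decide) w
  have r3 : s 3 w = θ (β' w) 1 := hr.other 2 (by decide) w
  have h := hb.exists_θ_ne (β' w); rw [Fin.exists_fin_two, ← r2, ← r3] at h
  refine ⟨fun h0 => ?_, by tauto⟩
  rw [hr.zero] at h0; have e : θ (β' w) 0 - θ (β' w) 1 = ρ' w * θ' w (some none) := hr.mul_Z w none
  grind

lemma disjointOn_wFun :
    DisjointOn (wFun s) [1, 3, 4] := by
  intro i hi j hj hne p h0 h1; obtain ⟨a, b⟩ := hr.side_ne hb p.1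
  simp only [List.mem_cons, List.not_mem_nil, or_false] at hi hj
  rcases hi with rfl | rfl | rfl <;> rcases hj with rfl | rfl | rfl
  exacts [hne rfl, (a h0).1 h1, (a h0).2 h1, (a h1).1 h0, hne rfl, b ⟨h0, h1⟩, (a h1).2 h0,
    b ⟨h1, h0⟩, hne rfl]

lemma dense_prodMap₂ :
    Dense {w : N.prodHalfLine | ∀ l, baseK x l (prodMap β (prodMap β' w)) ≠ 0} := by
  refine (LC.prodHalfLine hr.lc).dense_ne.mono fun w (hw : ∀ l, wFun s l w ≠ 0) l => ?_
  have h1 : qFun θ ρ 1 (prodMap β' w) ≠ 0 := by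
    refine (hr.mul_dir w.1).trans_ne (mul_ne_zero ?_ (hw 2)); rw [← hr.zero]; exact hw 1
  obtain ⟨a0, a1, a2⟩ := baseK_prodMap hb (prodMap β' w)
  have b0 : s 2 w.1 = qFun θ ρ 2 (prodMap β' w) := hr.other 1 (by decide) w.1
  have b1 : s 3 w.1 = qFun θ ρ 3 (prodMap β' w) := hr.other 2 (by decide) w.1
  fin_cases l
  · exact hw 0
  · exact a1.trans_ne (mul_ne_zero h1 (b0 ▸ hw 3))
  · exact a2.trans_ne (mul_ne_zero h1 (b1 ▸ hw 4))

end

include hQ hne hT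

/-- The relations between the functions on `M²_{k,φ}` which describe the lifts of the defining
functions and of the generators of the fibre diagonal. -/
lemma KTower.eqs (z : K) :
    r l' (Φ (β₅ (β₆ z))) = ρ₆ z * θ₆ z none ∧
    r l (Φ (β₅ (β₆ z))) = ρ₅ (β₆ z) * θ₅ (β₆ z) none ∧
    (∀ a, diagFun E β θ (γ (Φ (β₅ (β₆ z)))).1 a = ρ₅ (β₆ z) * (ρ₆ z * θ₆ z (some a))) ∧
    (θ₆ z none = 0 → ∃ a, θ₆ z (some a) ≠ 0) ∧
    (θ₅ (β₆ z) none = 0 → ρ₆ z ≠ 0 ∧ ∃ a, θ₆ z (some a) ≠ 0) ∧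
    (ρ₅ (β₆ z) * θ₅ (β₆ z) none = 0 →
      τ 2 (Φ (β₅ (β₆ z))) * (τ 3 (Φ (β₅ (β₆ z))) * κ (Φ (β₅ (β₆ z)))) ≠ 0) := by
  have e5 : r l (Φ (β₅ (β₆ z))) = ρ₅ (β₆ z) * θ₅ (β₆ z) none := hT.rel₅.blow.eq _ none
  refine ⟨?_, e5, fun a => ?_, fun h => ?_, fun h => ?_, fun h => ?_⟩
  · rw [← hT.rel₅.other l' hne.symm]; exact hT.rel₆.blow.eq z none
  · rw [← hT.rel₆.mul_Z z a]; exact hT.rel₅.mul_Z _ a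
  · obtain ⟨a, ha⟩ := hT.rel₆.blow.exists_θ_ne z
    cases a with
    | none => exact absurd h ha
    | some a => exact ⟨a, ha⟩
  · obtain ⟨a, ha⟩ := hT.rel₅.blow.exists_θ_ne (β₆ z)
    cases a with
    | none => exact absurd h ha
    | some a =>
      rw [hT.rel₆.mul_Z z a] at ha; exact ⟨left_ne_zero_of_mul ha, a, right_ne_zero_of_mul ha⟩
  · have := hQ.pairFun.ne_i (Φ (β₅ (β₆ z))) (e5.trans h); simpa [mul_assoc] using this

include hb hr

/-- The space `M²_{k,φ}` maps to `M²_φ`, and to the blow-ups of `M²_φ × [0, ∞)`. -/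
lemma KTower.exists_map (hd : Dense {z | ∀ l, baseK x l (prodMap β (γ (Φ (β₅ (β₆ z))))) ≠ 0}) :
    ∃ G : K → N, ContMDiff K.I N.I ∞ G ∧ (∀ z, β' (G z) = (γ (Φ (β₅ (β₆ z)))).1) ∧
      ∀ {L : List (Fin 5)}, L.Perm [1, 3, 4] → ∀ {Y : Mfd.{u}} {δ : Y → N.prodHalfLine} {n' : ℕ}
        {r' : Fin n' → Y → ℝ} {t I κ' : Y → ℝ} {T S : Fin 5 → Y → ℝ},
        PairStar (wFun s) 2 0 L δ r' t I T S κ' → ∃ F : K → Y, ContMDiff K.I Y.I ∞ F ∧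
          (∀ z, δ (F z) = (G z, (γ (Φ (β₅ (β₆ z)))).2)) ∧ ∀ z, T 1 (F z) = 0 ↔ ρ₆ z = 0 := by
  have e := hT.eqs hQ hne; have s₆ := hT.rel₆.blow.smooth_β
  have sΦ : ContMDiff K.I Q.I ∞ fun z => Φ (β₅ (β₆ z)) :=
    Φ.contMDiff.comp (hT.rel₅.blow.smooth_β.comp s₆)
  have sγ := hQ.pairFun.smooth_f.comp sΦ; have sρ₅ := hT.rel₅.blow.smooth_ρ.comp s₆
  have sθ₅ := (hT.rel₅.blow.smooth_θ none).comp s₆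
  -- `x` and `x'` are multiples of the product of the functions of the four faces over the corner
  have eR : ∀ z, ρ (γ (Φ (β₅ (β₆ z)))).1 = ρ₆ z * θ₆ z none * (ρ₅ (β₆ z) * θ₅ (β₆ z) none) :=
    fun z => by rw [← (e z).1, ← (e z).2.1]; exact hQ.pairFun.eq_i _
  have hdR : Dense {z | ρ₅ (β₆ z) * ρ₆ z ≠ 0} := hd.mono fun z (hz : ∀ l, _) => by
    have := hz 1; rw [(baseK_prodMap hb _).2.1] at this; have := left_ne_zero_of_mul this
    rw [show qFun θ ρ 1 (γ (Φ (β₅ (β₆ z)))) = ρ (γ (Φ (β₅ (β₆ z)))).1 from rfl, eR] at this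
    grind
  -- the ideal of the fibre diagonal becomes principal, with generator `ρ₅ ρ₆`
  obtain ⟨G, u, sG, su, pu, eG, e0, ed⟩ := hr.blow.exists_lift_unit
    (contMDiff_fst.comp sγ) (fun z => ρ₅ (β₆ z) * ρ₆ z)
    (fun z a => a.elim (θ₆ z none * θ₅ (β₆ z) none) fun a => θ₆ z (some a))
    (by
      rintro (_ | a)
      exacts [(hT.rel₆.blow.smooth_θ none).mul sθ₅, hT.rel₆.blow.smooth_θ (some a)])
    (fun z => mul_nonneg (hT.rel₅.blow.nonneg _) (hT.rel₆.blow.nonneg z)) hdR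
    (fun z h => by
      obtain ⟨-, -, -, n6, n5, -⟩ := e z
      have h0 : ∀ a, ¬ θ₆ z (some a) ≠ 0 := fun a => not_not.2 (h (some a))
      rcases mul_eq_zero.1 (show θ₆ z none * θ₅ (β₆ z) none = 0 from h none) with h1 | h1
      exacts [(n6 h1).elim h0, (n5 h1).2.elim h0])
    (by
      rintro z (_ | a)
      · exact (eR z).trans (by simp only [Option.elim_none]; ring)
      · exact ((e z).2.2.1 a).trans (mul_assoc _ _ _).symm)
  have sui := su.inv₀ fun z => (pu z).ne'
  refine ⟨G, sG, eG, fun {L} hL Y δ n' r' t I κ' T S h => ?_⟩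
  have hmem : ∀ {P : Fin 5 → Prop}, P 1 → P 3 → P 4 → ∀ i ∈ L, P i := fun h1 h3 h4 i hi => by
    grind
  have hprod : ∀ t : Fin 5 → ℝ, (L.map t).prod = t 1 * (t 3 * t 4) := fun t => by
    rw [(hL.map t).prod_eq]; simp
  have r2 : ∀ z, s 2 (G z) = θ (γ (Φ (β₅ (β₆ z)))).1 0 := fun z =>
    (hr.other 1 (by decide) _).trans (congrArg (θ · 0) (eG z))
  have r3 : ∀ z, s 3 (G z) = θ (γ (Φ (β₅ (β₆ z)))).1 1 := fun z =>
    (hr.other 2 (by decide) _).trans (congrArg (θ · 1) (eG z))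
  have hQf := hQ.pairFun
  -- the generators of the ideals of the corners: `θ₆ none` for `bf × {0}`, `ρ₆` for `φf × {0}`,
  -- and those for `M²_{k,b}` at `lf × {0}` and `rf × {0}`
  obtain ⟨F, v, sF, -, -, eF, -, -, hz⟩ := h.exists_lift (Z := K)
    (f := fun z => (G z, (γ (Φ (β₅ (β₆ z)))).2)) (t' := fun z => θ₆ z none)
    (I' := fun z => u z * θ₅ (β₆ z) none)
    (τ' := ![0, ρ₆, 0, fun z => τ 2 (Φ (β₅ (β₆ z))), fun z => τ 3 (Φ (β₅ (β₆ z)))])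
    (σ' := ![0, fun z => ρ₅ (β₆ z) * (u z)⁻¹, 0, fun z => σ 2 (Φ (β₅ (β₆ z))),
      fun z => σ 3 (Φ (β₅ (β₆ z)))]) (κ' := fun z => κ (Φ (β₅ (β₆ z))))
    { smooth_f := sG.prodMk (contMDiff_snd.comp sγ)
      smooth_t := hT.rel₆.blow.smooth_θ none
      smooth_I := su.mul sθ₅
      smooth_τ := hmem hT.rel₆.blow.smooth_ρ ((hQf.smooth_τ 2 (by simp)).comp sΦ)
        ((hQf.smooth_τ 3 (by simp)).comp sΦ)
      smooth_σ := hmem (sρ₅.mul sui) ((hQf.smooth_σ 2 (by simp)).comp sΦ)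
        ((hQf.smooth_σ 3 (by simp)).comp sΦ)
      smooth_κ := hQf.smooth_κ.comp sΦ
      nonneg_t := hT.rel₆.θ_nonneg
      nonneg_τ := hmem hT.rel₆.blow.nonneg (fun z => hQf.nonneg_τ 2 (by simp) _)
        fun z => hQf.nonneg_τ 3 (by simp) _
      eq_i := fun z => (hr.dir (G z)).trans ((ed z none).trans (mul_left_comm _ _ _))
      eq_k := fun z => by
        rw [hprod]; refine (hQf.eq_k (Φ (β₅ (β₆ z)))).trans ?_; rw [(e z).1]
        simp only [List.map_cons, List.map_nil, List.prod_cons, List.prod_nil, mul_one]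
        change _ = θ₆ z none * (ρ₆ z * (τ 2 (Φ (β₅ (β₆ z))) * τ 3 (Φ (β₅ (β₆ z)))) * _); ring
      eq := hmem (fun z => by
          change s 0 (G z) = ρ₆ z * (ρ₅ (β₆ z) * (u z)⁻¹)
          rw [hr.zero, ← mul_assoc, mul_comm (ρ₆ z), ← e0, mul_inv_cancel_right₀ (pu z).ne'])
        (fun z => (r2 z).trans (hQf.eq 2 (by simp) _)) fun z => (r3 z).trans (hQf.eq 3 (by simp) _)
      ne_i := fun z h0 => by
        have h1 := (mul_eq_zero.1 h0).resolve_left (pu z).ne'; obtain ⟨-, -, -, -, n5, n0⟩ := e z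
        rw [hprod, mul_assoc, mul_assoc]; exact mul_ne_zero (n5 h1).1 (n0 (by rw [h1, mul_zero]))
      ne := hmem (fun z h0 => by
          have h1 := (mul_eq_zero.1 h0).resolve_right (inv_pos.2 (pu z)).ne'
          have := (e z).2.2.2.2.2 (by rw [h1, zero_mul])
          exact right_ne_zero_of_mul (right_ne_zero_of_mul this))
        (fun z => hQf.ne 2 (by simp) _) fun z => hQf.ne 3 (by simp) _
      dense := hd.mono fun z (hz : ∀ l, baseK x l (prodMap β (γ (Φ (β₅ (β₆ z))))) ≠ 0) => hz 0 }
  refine ⟨F, sF, eF, fun z => (hz 1 (hL.mem_iff.2 (by simp)) z).trans ?_⟩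
  rw [hprod]; change s 0 (G z) = 0 ∧ ρ₆ z * (_ * _) * κ (Φ (β₅ (β₆ z))) = 0 ↔ _; constructor
  · rintro ⟨h1, h2⟩; by_contra h3; have h4 := e0 z; rw [← hr.zero, h1, zero_mul] at h4
    have h5 := (mul_eq_zero.1 h4.symm).resolve_right h3
    have := (e z).2.2.2.2.2 (by rw [h5, zero_mul])
    rw [mul_assoc, mul_assoc] at h2; exact this ((mul_eq_zero.1 h2).resolve_left h3)
  · intro h1; have h4 := e0 z; rw [h1, mul_zero, ← hr.zero] at h4
    grind

/-- The blow-ups of `M²_φ × [0, ∞)` map to the space `M²_{k,φ}`. -/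
lemma KTower.exists_inv {L : List (Fin 5)} (hL : L.Perm [1, 3, 4]) {δ : Y → N.prodHalfLine} {n' : ℕ}
    {r' : Fin n' → Y → ℝ} {t I κ' : Y → ℝ} {T S : Fin 5 → Y → ℝ}
    (h : PairStar (wFun s) 2 0 L δ r' t I T S κ') :
    ∃ F : Y → K, ContMDiff Y.I K.I ∞ F ∧ ∀ y, γ (Φ (β₅ (β₆ (F y)))) = prodMap β' (δ y) := by
  have hprod : ∀ t : Fin 5 → ℝ, (L.map t).prod = t 1 * (t 3 * t 4) := fun t => by
    rw [(hL.map t).prod_eq]; simp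
  have hP := h.pairFun; have m1 : (1 : Fin 5) ∈ L := hL.mem_iff.2 (by simp)
  have m3 : (3 : Fin 5) ∈ L := hL.mem_iff.2 (by simp)
  have m4 : (4 : Fin 5) ∈ L := hL.mem_iff.2 (by simp)
  have ef : ∀ y, s 0 (δ y).1 = T 1 y * S 1 y := hP.eq 1 m1
  have el : ∀ y, s 2 (δ y).1 = T 3 y * S 3 y := hP.eq 3 m3
  have er : ∀ y, s 3 (δ y).1 = T 4 y * S 4 y := hP.eq 4 m4
  have eb : ∀ y, s 1 (δ y).1 = t y * I y := hP.eq_i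
  have hdW : Dense {y | ∀ l, wFun s l (δ y) ≠ 0} :=
    h.dense (D := {w | ∀ l, wFun s l w ≠ 0}) (LC.prodHalfLine hr.lc).dense_ne
  have hdf : Dense {y | T 1 y * S 1 y ≠ 0} := hdW.mono fun y (hy : ∀ l, _) => by
    have := hy 1; rwa [hP.eq 1 m1] at this
  have hdk : Dense {y | halfCoord (δ y) ≠ 0} :=
    hdW.mono fun y (hy : ∀ l, wFun s l (δ y) ≠ 0) => hy 0
  have nI : ∀ y, I y = 0 → T 1 y ≠ 0 ∧ T 3 y * T 4 y ≠ 0 ∧ κ' y ≠ 0 := fun y hy => by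
    have := hP.ne_i y hy; rw [hprod, mul_ne_zero_iff, mul_ne_zero_iff] at this
    grind
  -- by continuity, from the complement of `φf`
  have nS : ∀ y, 0 ≤ S 1 y := fun y => by
    refine closure_minimal (s := {y | T 1 y * S 1 y ≠ 0}) (t := {y | 0 ≤ S 1 y}) (fun y hy => ?_)
      (isClosed_le continuous_const (hP.smooth_σ 1 m1).continuous) (hdf y)
    have h1 := hr.lc.nonneg 0 (δ y).1; rw [ef] at h1
    exact nonneg_of_mul_nonneg_right h1
      (lt_of_le_of_ne (hP.nonneg_τ 1 m1 y) (left_ne_zero_of_mul hy).symm)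
  have sδ : ContMDiff Y.I N.I ∞ fun y => (δ y).1 := contMDiff_fst.comp hP.smooth_f
  have hρ : ∀ w, ρ (β' w) = s 0 w * s 1 w := fun w => by rw [hr.zero]; exact hr.mul_dir w
  -- lift to the blow-up of `M²_b × [0, ∞)`: its corner `ρ = k = 0` has the generator `t * T 1`
  obtain ⟨F₄, u, sF₄, su, pu, eF₄, et, eI, -⟩ := hQ.exists_lift (Z := Y)
    (f := fun y => prodMap β' (δ y)) (t' := fun y => t y * T 1 y) (I' := fun y => I y * S 1 y)
    (τ' := ![0, 0, T 3, T 4]) (σ' := ![0, 0, S 3, S 4]) (κ' := κ')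
    { smooth_f := (contMDiff_prodMap hr.blow.smooth_β).comp hP.smooth_f
      smooth_t := hP.smooth_t.mul (hP.smooth_τ 1 m1)
      smooth_I := hP.smooth_I.mul (hP.smooth_σ 1 m1)
      smooth_τ := by simpa using ⟨hP.smooth_τ 3 m3, hP.smooth_τ 4 m4⟩
      smooth_σ := by simpa using ⟨hP.smooth_σ 3 m3, hP.smooth_σ 4 m4⟩
      smooth_κ := hP.smooth_κ
      nonneg_t := fun y => mul_nonneg (hP.nonneg_t y) (hP.nonneg_τ 1 m1 y)
      nonneg_τ := by simpa using ⟨hP.nonneg_τ 3 m3, hP.nonneg_τ 4 m4⟩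
      eq_i := fun y => (hρ (δ y).1).trans (by rw [ef, eb]; ring)
      eq_k := fun y => by
        refine (hP.eq_k y).trans ?_; rw [hprod]
        simp only [List.map_cons, List.map_nil, List.prod_cons, List.prod_nil, mul_one]
        change _ = t y * T 1 y * (T 3 y * T 4 y * κ' y); ring
      eq := by
        have j0 : ∀ y, qFun θ ρ 2 (prodMap β' (δ y)) = T 3 y * S 3 y := fun y =>
          (hr.other 1 (by decide) _).symm.trans (el y)
        have j1 : ∀ y, qFun θ ρ 3 (prodMap β' (δ y)) = T 4 y * S 4 y := fun y =>
          (hr.other 2 (by decide) _).symm.trans (er y)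
        simpa using ⟨j0, j1⟩
      ne_i := fun y h0 => by
        simp only [List.map_cons, List.map_nil, List.prod_cons, List.prod_nil, mul_one]
        change T 3 y * T 4 y * κ' y ≠ 0; rcases mul_eq_zero.1 h0 with h0 | h0
        · grind
        · have h1 := (hr.side_ne hb (δ y).1).1 (by rw [ef, h0, mul_zero])
          rw [el, er] at h1
          exact mul_ne_zero (mul_ne_zero (left_ne_zero_of_mul h1.1) (left_ne_zero_of_mul h1.2))
            (hP.ne 1 m1 y h0)
      ne := by simpa using ⟨hP.ne 3 m3, hP.ne 4 m4⟩
      dense := hdk }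
  have eZ : ∀ y a, diagFun E β θ (γ (F₄ y)).1 a = S 1 y * (T 1 y * θ' (δ y).1 (some a)) :=
    fun y a => by rw [eF₄]; refine (hr.mul_Z (δ y).1 a).trans ?_; rw [← hr.zero, ef]; ring
  have nθ : ∀ y, s 1 (δ y).1 = 0 → (∀ a, θ' (δ y).1 (some a) = 0) → False := fun y h0 h1 => by
    obtain ⟨a, ha⟩ := hr.blow.exists_θ_ne (δ y).1
    cases a with
    | none => exact ha ((hr.dir _).symm.trans h0)
    | some a => exact ha (h1 a)
  have eΦ : ∀ q, Φ (Φ.symm q) = q := Φ.apply_symm_apply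
  -- the ideal of `diag_{k,sc,φ}` becomes principal, with generator `S 1`
  obtain ⟨F₅, u₅, sF₅, su₅, pu₅, eF₅, -, ed₅⟩ := hT.rel₅.blow.exists_lift_unit
    (Φ.symm.contMDiff.comp sF₄) (S 1)
    (fun y a => a.elim (u y * I y) fun a => T 1 y * θ' (δ y).1 (some a))
    (by
      rintro (_ | a)
      exacts [su.mul hP.smooth_I, (hP.smooth_τ 1 m1).mul ((hr.blow.smooth_θ (some a)).comp sδ)])
    nS (hdf.mono fun y hy => right_ne_zero_of_mul hy)
    (fun y h0 => by
      have h1 : I y = 0 := (mul_eq_zero.1 (h0 none)).resolve_left (pu y).ne'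
      exact nθ y (by rw [eb, h1, mul_zero]) fun a =>
        (mul_eq_zero.1 (h0 (some a))).resolve_left (nI y h1).1)
    (by
      rintro y (_ | a)
      · change r l (Φ (Φ.symm (F₄ y))) = S 1 y * (u y * I y); rw [eΦ, eI]; ring
      · change diagFun E β θ (γ (Φ (Φ.symm (F₄ y)))).1 a = _
        rw [eΦ]; exact eZ y a)
  have eT : ∀ y, r₅ l'.succ (F₅ y) = T 1 y * (t y * (u y)⁻¹) := fun y => by
    rw [hT.rel₅.other l' hne.symm, eF₅, Function.comp_apply, eΦ, ← mul_assoc, mul_comm (T 1 y),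
      ← et,
      mul_inv_cancel_right₀ (pu y).ne']
  -- the ideal of `diag_{k,φ}` becomes principal, with generator `T 1`
  obtain ⟨F₆, -, sF₆, -, -, eF₆, -⟩ := hT.rel₆.blow.exists_lift_unit sF₅ (T 1)
    (fun y a => a.elim (t y * (u y)⁻¹) fun a => u₅ y * θ' (δ y).1 (some a))
    (by
      rintro (_ | a)
      exacts [hP.smooth_t.mul (su.inv₀ fun z => (pu z).ne'),
        su₅.mul ((hr.blow.smooth_θ (some a)).comp sδ)])
    (hP.nonneg_τ 1 m1) (hdf.mono fun y hy => left_ne_zero_of_mul hy)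
    (fun y h0 => by
      have h1 : t y = 0 := (mul_eq_zero.1 (h0 none)).resolve_right (inv_pos.2 (pu y)).ne'
      exact nθ y (by rw [eb, h1, zero_mul]) fun a =>
        (mul_eq_zero.1 (h0 (some a))).resolve_left (pu₅ y).ne')
    (by
      rintro y (_ | a)
      · exact eT y
      · exact (ed₅ y (some a)).trans (mul_left_comm _ _ _))
  grind

end

/-- The map `β'`, and the description of `M²_{k,φ}` as an iterated blow-up in the given order. -/
lemma KPhiDouble.exists_map {M : Mfd.{u}} {x : M → ℝ} {R : M → M → Prop} {E : M → ι → ℝ}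
    (hF : FibredBoundary M x R E) (W : PhiDouble M x R)
    (K : KPhiDouble M x R) : ∃ (s : Fin 4 → W.space → ℝ) (b : K.space → W.space.prodHalfLine),
      LC W.space s ∧ W.bf = {y | s 1 y = 0} ∧ W.φf = {y | s 0 y = 0} ∧ W.lf = {y | s 2 y = 0} ∧
      W.rf = {y | s 3 y = 0} ∧ (∀ q, (W.total (b q).1, (b q).2) = K.total q) ∧
      ∀ L : List (Fin 5), L.Perm [1, 3, 4] → ∃ (Y : Mfd.{u}) (δ : Y → W.space.prodHalfLine) (n' : ℕ)
        (r' : Fin n' → Y → ℝ) (t I : Y → ℝ) (T S : Fin 5 → Y → ℝ) (κ' : Y → ℝ)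
        (Ψ : K.space ≃ₘ^∞⟮K.space.I, Y.I⟯ Y), PairStar (wFun s) 2 0 L δ r' t I T S κ' ∧
          b = δ ∘ Ψ ∧ {z | T 1 (Ψ z) = 0} = K.φf₀ := by
  obtain ⟨θ, ρ, θ', ρ', s, hb, hr, e1, e0, e2, e3⟩ := W.exists_fun hF
  obtain ⟨Q, γ, n, r, l, l', τ, σ, κ, hne, hQ⟩ := exists_aux hF hb
  obtain ⟨Φ, θ₅, ρ₅, r₅, θ₆, ρ₆, r₆, hT, hΦ, hφ, hinj, hd⟩ := K.exists_fun hF hb hQ hne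
  have htot : ∀ z, prodMap W.βb (γ (Φ (K.β₅ (K.β₆ z)))) = K.total z := fun z => hΦ _
  have hdK : Dense (K.total ⁻¹' {p | ∀ l, baseK x l p ≠ 0}) :=
    hT.rel₆.blow.dense_preimage (hT.rel₅.blow.dense_preimage hd)
  have hII : ∀ y, (∀ l, baseK x l (K.Kb.total y) ≠ 0) → r l (Φ y) ≠ 0 ∧ r l' (Φ y) ≠ 0 := by
    intro y hy; have h1 := hy 1; rw [← hΦ, (baseK_prodMap hb _).2.1, hQ.pairFun.eq_i] at h1
    grind
  have hiK : InjOver K.total {p | ∀ l, baseK x l p ≠ 0} :=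
    hinj.comp (D' := {y | r l (Φ y) ≠ 0 ∧ r l' (Φ y) ≠ 0})
      ((hT.rel₅.blow.injOver.mono fun y hy => ⟨none, hy.1⟩).comp (D' := {q | r₅ l'.succ q ≠ 0})
        (hT.rel₆.blow.injOver.mono fun y hy => ⟨none, hy⟩) fun q hq => by
          rw [mem_ofPred_eq, hT.rel₅.other l' hne.symm]; exact hq.2) hII
  have hk : ∀ z, (K.total z).2 = (γ (Φ (K.β₅ (K.β₆ z)))).2 := fun z =>
    (congrArg Prod.snd (htot z) :).symm
  obtain ⟨G, sG, eG, hG⟩ := hT.exists_map hb hr hQ hne (hdK.mono fun z hz => by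
    rw [mem_ofPred_eq, htot]; exact hz)
  refine ⟨s, fun z => (G z, (K.total z).2), hr.lc, e1, e0, e2, e3, fun z => ?_, fun L hL => ?_⟩
  · exact Prod.ext ((congrArg W.βb (eG z)).trans (congrArg Prod.fst (htot z) :)) rfl
  · obtain ⟨Y, δ, n', r', t, I, T, S, κ', h⟩ :=
      (hasStarBlow (L.map Fin.succ)).exists_pairStar (LC.prodHalfLine hr.lc)
      (i := 2) (k := 0) (by decide) (by rw [hL.mem_iff]; decide) (by rw [hL.mem_iff]; decide)
      (hL.nodup_iff.2 (by decide)) fun i hi j hj =>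
        disjointOn_wFun hb hr i (hL.mem_iff.1 hi) j (hL.mem_iff.1 hj)
    have h : PairStar (wFun s) 2 0 L δ r' t I T S κ' := h; obtain ⟨F, sF, eF, hz⟩ := hG hL h
    obtain ⟨F', sF', eF'⟩ := hT.exists_inv hb hr hQ hne hL h
    have hY : ∀ y, prodMap W.βb (prodMap W.βφ (δ y)) = K.total (F' y) := fun y => by
      rw [← htot, eF']
    have hR : ∀ y : W.Mb.prodHalfLine, (∀ l, baseK x l (prodMap W.βb y) ≠ 0) →
        ρ y.1 ≠ 0 ∧ halfCoord y ≠ 0 := fun y hy => by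
      refine ⟨fun h0 => hy 1 ?_, hy 0⟩
      rw [(baseK_prodMap hb y).2.1, show qFun θ ρ 1 y = 0 from h0, zero_mul]
    obtain ⟨Ψ, rfl⟩ := exists_diffeo (γ := prodMap W.βb ∘ prodMap W.βφ ∘ δ) (δ := K.total)
      ((injOver_prodMap hb).comp (D' := {y | ρ y.1 ≠ 0 ∧ halfCoord y ≠ 0})
        ((hr.blow.injOver.prodMap.mono fun y hy => ⟨none, hy.1⟩).comp h.away.1 fun y hy => hy.2) hR)
      hiK (h.dense (dense_prodMap₂ hb hr)) hdK sF sF'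
      (fun z => by
        rw [Function.comp_apply, Function.comp_apply, eF, ← htot]
        exact Prod.ext (congrArg W.βb (eG z)) rfl) fun y => (hY y).symm
    grind

/-! ### Boundary hypersurfaces -/

section

variable {κ' : Type} [Fintype κ'] {C' : Set κ'} {S : Set X}

/-- The change of coordinates maps the vectors tangential to all boundary hypersurfaces to such
vectors: on a curve with such a derivative a boundary coordinate has a minimum. -/
lemma Crd.exists_change (c : Crd X κ C) (c' : Crd X κ' C') {q : X} (hq : q ∈ c.source)
    (hq' : q ∈ c'.source) : ∃ D : (κ → ℝ) ≃ₗ[ℝ] (κ' → ℝ), ∀ w, (∀ k ∈ C, c q k = 0 → w k = 0) →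
      ∀ i ∈ C', c' q i = 0 → D w i = 0 := by
  obtain ⟨T, -, -, hT⟩ := c.exists_tangentEquiv hq
  obtain ⟨T', hc', hT', -⟩ := c'.exists_tangentEquiv hq'
  refine ⟨T.symm.trans T', fun w hw i hi h0 => ?_⟩; have hct := c.map_source q hq
  set v : ℝ → κ → ℝ := fun s => c q + s • w with hv; have hv0 : v 0 = c q := by simp [hv]
  have hvd : HasFDerivAt v (ContinuousLinearMap.toSpanSingleton ℝ w) 0 := by
    simpa [hv] using (((hasDerivAt_id (0 : ℝ)).smul_const w).const_add (c q)).hasFDerivAt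
  obtain ⟨O, hO, e⟩ := c.open_target
  have hev : ∀ᶠ s in 𝓝 (0 : ℝ), v s ∈ c.target := by
    have h1 : ∀ᶠ s in 𝓝 (0 : ℝ), v s ∈ O := hvd.continuousAt (hO.mem_nhds (by
      rw [hv0]; rw [e] at hct; exact hct.1))
    have h2 : ∀ᶠ s in 𝓝 (0 : ℝ), ∀ k, k ∈ C → 0 ≤ v s k := by
      refine eventually_all.2 fun k => ?_
      by_cases hk : k ∈ C ∧ c q k ≠ 0
      · have h3 : 0 < v 0 k := by rw [hv0]; exact lt_of_le_of_ne (c.nonneg hq hk.1) hk.2.symm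
        filter_upwards [((continuous_apply k).continuousAt.comp hvd.continuousAt).eventually
          (lt_mem_nhds h3)] with s hs _ using le_of_lt hs
      · refine Eventually.of_forall fun s hkC => ?_
        have h3 : c q k = 0 := by_contra fun h' => hk ⟨hkC, h'⟩; simp [hv, h3, hw k hkC h3]
    filter_upwards [h1, h2] with s h1 h2
    rw [e]; exact ⟨h1, h2⟩
  have hinv : HasMFDerivWithinAt 𝓘(ℝ, κ → ℝ) X.I c.inv c.target (v 0)
      (mfderivWithin 𝓘(ℝ, κ → ℝ) X.I c.inv c.target (v 0)) := by
    rw [hv0]; exact ((c.smooth_inv _ hct).mdifferentiableWithinAt (by simp)).hasMFDerivWithinAt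
  have h1 := (hinv.comp (0 : ℝ) (hvd.hasMFDerivAt.hasMFDerivWithinAt (s := v ⁻¹' c.target))
    fun s hs => hs).hasMFDerivAt hev
  have hi0 : (c.inv ∘ v) 0 = q := by rw [Function.comp_apply, hv0, c.left_inv q hq]
  have h2 : HasMFDerivAt X.I 𝓘(ℝ, κ' → ℝ) c' ((c.inv ∘ v) 0)
      (mfderiv X.I 𝓘(ℝ, κ' → ℝ) c' ((c.inv ∘ v) 0)) := by rw [hi0]; exact hc'
  have h3 := (hasMFDerivAt_iff_hasFDerivAt.1 (h2.comp (0 : ℝ) h1))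
  have h4 := (hasFDerivAt_pi'.1 h3) i
  have hmin : IsLocalMin (fun s => (c' ∘ c.inv ∘ v) s i) 0 := by
    have h5 : (c' ∘ c.inv ∘ v) 0 i = 0 := by change c' ((c.inv ∘ v) 0) i = 0; rw [hi0, h0]
    have h6 : ∀ᶠ s in 𝓝 (0 : ℝ), (c.inv ∘ v) s ∈ c'.source :=
      h1.continuousAt (by rw [hi0]; exact c'.mem_nhds hq')
    filter_upwards [h6] with s hs
    rw [h5]; exact c'.nonneg hs hi
  have h7 := DFunLike.congr_fun (hmin.hasFDerivAt_eq_zero h4) 1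
  have h8 : T.symm w =
      (mfderivWithin 𝓘(ℝ, κ → ℝ) X.I c.inv c.target (v 0) : (κ → ℝ) →L[ℝ] X.E) w := by
    rw [hT, hv0]
  have h9 : T' (T.symm w) = (mfderiv X.I 𝓘(ℝ, κ' → ℝ) c' ((c.inv ∘ v) 0) : X.E →L[ℝ] (κ' → ℝ))
      (T.symm w) := by
    rw [hT', hi0]
  change T' (T.symm w) i = 0; rw [h9, h8]
  have h10 : ContinuousLinearMap.toSpanSingleton ℝ w (1 : ℝ) = w := by simp
  rw [← h10]; exact h7

/-- At the points of codimension one exactly one of the defining functions vanishes. -/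
lemma LC.mem_codimSet (h : LC X r) (q : X) : q ∈ X.codimSet 1 ↔ ∃ l, ∀ l', r l' q = 0 ↔ l' = l := by
  classical
  obtain ⟨κ, _, _, C, c, j, hc⟩ := h.loc q; constructor
  · rintro ⟨N, C', φ, hφ, h1⟩; obtain ⟨i₀, hi₀⟩ := ncard_eq_one.1 h1
    set c' := Crd.ofChart φ with hc'
    have hI : ∀ i, (i ∈ C' ∧ c' q i = 0) ↔ i = i₀ := fun i => Set.ext_iff.1 hi₀ i
    obtain ⟨D, hD⟩ := c.exists_change c' hc.mem hφ; obtain ⟨D', hD'⟩ := c'.exists_change c hφ hc.mem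
    have hj : ∀ l, r l q = 0 → c q (j l) = 0 := fun l hl => hc.coord_eq_zero hl
    have hex : ∃ l, r l q = 0 := by
      by_contra hcon; push Not at hcon
      have h2 := hD (D.symm fun _ => 1) (fun k hk h0 => by
        obtain ⟨l, hl, -⟩ := hc.cover k hk h0
        exact absurd hl (hcon l)) i₀ ((hI i₀).2 rfl).1 ((hI i₀).2 rfl).2
      simp at h2
    obtain ⟨l, hl⟩ := hex; refine ⟨l, fun l' => ⟨fun hl' => ?_, fun e => e ▸ hl⟩⟩; by_contra hne
    have hjne : j l' ≠ j l := fun e => hne (hc.inj _ _ hl' hl e)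
    have key : ∀ w : Fin N → ℝ, w i₀ = 0 → D' w (j l) = 0 ∧ D' w (j l') = 0 := fun w hw =>
      have h0 : ∀ k ∈ C', c' q k = 0 → w k = 0 := fun k hk h0 => by rw [(hI k).1 ⟨hk, h0⟩, hw]
      ⟨hD' w h0 _ (hc.mem_C l hl) (hj l hl), hD' w h0 _ (hc.mem_C l' hl') (hj l' hl')⟩
    set v₁ := D'.symm (Pi.single (j l) 1); set v₂ := D'.symm (Pi.single (j l') 1)
    have h2 := key (v₂ i₀ • v₁ - v₁ i₀ • v₂) (by simp; ring)
    simp [v₁, v₂, hjne, hjne.symm] at h2; have h3 := (key v₁ h2.2).1; simp [v₁] at h3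
  · rintro ⟨l, hl⟩; have hl0 := (hl l).2 rfl
    refine ⟨_, _, (c.reindex (Fintype.equivFin κ)).toChart, hc.mem, ?_⟩; rw [ncard_eq_one]
    refine ⟨Fintype.equivFin κ (j l), ?_⟩; ext i
    rw [mem_ofPred_eq, Crd.toChart_val _ (show q ∈ (c.reindex _).source from hc.mem)]
    change i ∈ _ '' C ∧ c q ((Fintype.equivFin κ).symm i) = 0 ↔ _; constructor
    · rintro ⟨⟨k, hk, rfl⟩, h0⟩; rw [Equiv.symm_apply_apply] at h0
      obtain ⟨l', hl', rfl⟩ := hc.cover k hk h0; rw [(hl l').1 hl']; rfl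
    · rintro rfl
      exact ⟨mem_image_of_mem _ (hc.mem_C l hl0), by
        rw [Equiv.symm_apply_apply]; exact hc.coord_eq_zero hl0⟩

/-- Near each of its points, the zero set of `r l` is the closure of a connected set of points of
codimension one. -/
lemma LC.exists_preconnected (h : LC X r) {q : X} (hq : r l q = 0) :
    ∃ U ∈ 𝓝 q, ∃ P : Set X, IsPreconnected P ∧ (∀ p ∈ P, ∀ l', r l' p = 0 ↔ l' = l) ∧
      ∀ p ∈ U, r l p = 0 → p ∈ closure P := by
  classical
  obtain ⟨κ, _, _, C, c, j, hc⟩ := h.loc q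
  have hV : IsOpen {p | ∀ l', r l' q ≠ 0 → r l' p ≠ 0} := by
    simp only [ofPred_forall]
    refine isOpen_iInter_of_finite fun l' => isOpen_iInter_of_finite fun _ =>
      isOpen_ne_fun (h.smooth l').continuous continuous_const
  have hc := hc.restrict hV fun l' h' => h'; set c := c.restrict _ hV
  have hcV : ∀ p ∈ c.source, ∀ l', r l' q ≠ 0 → r l' p ≠ 0 := fun p hp => hp.2
  obtain ⟨O, hO, e⟩ := c.open_target; have hct := c.map_source q hc.mem
  obtain ⟨ε, hε, hb⟩ := Metric.isOpen_iff.1 hO (c q) (by rw [e] at hct; exact hct.1)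
  -- the face of codimension one in a ball of the sector, a convex set
  set B : Set (κ → ℝ) := {v | v ∈ Metric.ball (c q) ε ∧ v ∈ sect C ∧ v (j l) = 0 ∧
    ∀ l', l' ≠ l → r l' q = 0 → 0 < v (j l')} with hB
  have hBt : B ⊆ c.target := fun v hv => by rw [e]; exact ⟨hb hv.1, hv.2.1⟩
  have hBc : Convex ℝ B := by
    refine (convex_ball _ _).inter (convex_sect.inter fun v hv w hw a b ha hb hab => ?_)
    refine ⟨by simp [hv.1, hw.1], fun l' h1 h2 => ?_⟩
    have e1 := hv.2 l' h1 h2; have e2 := hw.2 l' h1 h2; change 0 < a * v (j l') + b * w (j l')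
    rcases ha.eq_or_lt with rfl | ha
    · rw [zero_add] at hab; rw [hab]; linarith
    · have := mul_pos ha e1; have := mul_nonneg hb e2.le; linarith
  have hz : ∀ p ∈ c.source, ∀ l', r l' q = 0 → (r l' p = 0 ↔ c p (j l') = 0) := by
    intro p hp l' hl'; obtain ⟨u, -, hu, e1⟩ := hc.eq l' hl'
    grind
  refine ⟨c.source ∩ c ⁻¹' Metric.ball (c q) ε,
    (c.isOpen_inter_preimage Metric.isOpen_ball).mem_nhds ⟨hc.mem, Metric.mem_ball_self hε⟩,
    c.inv '' B, hBc.isPreconnected.image _ (c.continuousOn_inv.mono hBt), ?_, ?_⟩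
  · rintro _ ⟨v, hv, rfl⟩ l'; have hs := c.map_target v (hBt hv)
    by_cases hl' : r l' q = 0
    · rw [hz _ hs l' hl', c.right_inv v (hBt hv)]; refine ⟨fun h0 => ?_, fun e => e ▸ hv.2.2.1⟩
      grind
    grind
  · rintro p ⟨hp, hpb⟩ h0
        -- the direction in which the other defining functions increase
    set w : κ → ℝ := fun k => if ∃ l', l' ≠ l ∧ r l' q = 0 ∧ j l' = k then 1 else 0 with hw
    have hw0 : ∀ k, 0 ≤ w k := fun k => by simp only [hw]; split_ifs <;> norm_num
    have hvc : Continuous fun s : ℝ => c p + s • w := by fun_prop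
    have hv0 : c p + (0 : ℝ) • w = c p := by simp
    have hev : ∀ᶠ s in 𝓝[>] (0 : ℝ), c p + s • w ∈ B := by
      have h1 : ∀ᶠ s in 𝓝 (0 : ℝ), c p + s • w ∈ Metric.ball (c q) ε :=
        hvc.continuousAt (Metric.isOpen_ball.mem_nhds (by rw [hv0]; exact hpb))
      filter_upwards [h1.filter_mono nhdsWithin_le_nhds, self_mem_nhdsWithin] with s hs hs0
      have hs0 : 0 < s := hs0; refine ⟨hs, fun k hk => ?_, ?_, fun l' h2 h3 => ?_⟩
      · exact add_nonneg (c.nonneg hp hk) (mul_nonneg hs0.le (hw0 k))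
      · have h2 : ¬ ∃ l', l' ≠ l ∧ r l' q = 0 ∧ j l' = j l := by
          rintro ⟨l', a, b, d⟩; exact a (hc.inj _ _ b hq d)
        have h3 := (hz p hp l hq).1 h0; simp [hw, h2, h3]
      · have h4 : w (j l') = 1 := if_pos ⟨l', h2, h3, rfl⟩; have h5 := c.nonneg hp (hc.mem_C l' h3)
        change 0 < c p (j l') + s * w (j l'); rw [h4]; linarith
    have h2 : Tendsto (fun s : ℝ => c.inv (c p + s • w)) (𝓝[>] 0) (𝓝 p) := by
      have h3 : Tendsto (fun s : ℝ => c p + s • w) (𝓝[>] 0) (𝓝[c.target] (c p)) := by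
        refine tendsto_nhdsWithin_iff.2 ⟨?_, hev.mono fun s hs => hBt hs⟩
        have := (hvc.tendsto 0).mono_left (nhdsWithin_le_nhds (s := Ioi 0)); rwa [hv0] at this
      have h4 := (c.continuousOn_inv _ (c.map_source p hp)).tendsto.comp h3
      rwa [c.left_inv p hp] at h4
    exact mem_closure_of_tendsto h2 (hev.mono fun s hs => mem_image_of_mem _ hs)

/-- `S` is a connected component of the zero set of `r l`, and open in it. -/
structure IsFace (r : Fin n → X → ℝ) (l : Fin n) (S : Set X) : Prop where
  isClosed : IsClosed S
  isPreconnected : IsPreconnected S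
  nonempty : S.Nonempty
  eq_zero : ∀ q ∈ S, r l q = 0
  nhds : ∀ q ∈ S, ∃ U ∈ 𝓝 q, ∀ p ∈ U, r l p = 0 → p ∈ S

lemma IsFace.exists_isOpen (h : IsFace r l S) :
    ∃ V, IsOpen V ∧ S ⊆ V ∧ ∀ p ∈ V, r l p = 0 → p ∈ S := by
  refine ⟨interior {p | r l p = 0 → p ∈ S}, isOpen_interior, fun q hq => ?_, fun p hp =>
    interior_subset hp⟩
  obtain ⟨U, hU, h'⟩ := h.nhds q hq; exact mem_interior_iff_mem_nhds.2 (mem_of_superset hU h')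

lemma IsFace.subset (h : IsFace r l S) {P : Set X} (hP : IsPreconnected P)
    (h0 : ∀ p ∈ P, r l p = 0) (hPS : (P ∩ S).Nonempty) : P ⊆ S := by
  obtain ⟨V, hV, hSV, hV'⟩ := h.exists_isOpen; by_contra hcon
  obtain ⟨p, hp, hpS⟩ := not_subset.1 hcon
  obtain ⟨p', hp', h1, h2⟩ := hP V Sᶜ hV h.isClosed.isOpen_compl
    (fun p hp => (em (p ∈ S)).imp (fun h' => hSV h') id) (hPS.mono (inter_subset_inter_right _ hSV))
    ⟨p, hp, hpS⟩
  grind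

lemma IsFace.eq (h : IsFace r l S) {S' : Set X} (h' : IsFace r l S') (hS : (S ∩ S').Nonempty) :
    S = S' :=
  subset_antisymm (h'.subset h.isPreconnected h.eq_zero hS)
    (h.subset h'.isPreconnected h'.eq_zero (by rwa [inter_comm]))

/-- A component of the points of codimension one lies in the zero set of one `r l`; its closure is
open in this zero set by `LC.exists_preconnected`. -/
lemma LC.isFace_closure (h : LC X r) (hp : ∀ l', r l' p = 0 ↔ l' = l) :
    IsFace r l (closure (connectedComponentIn (X.codimSet 1) p)) := by
  have hpc : p ∈ X.codimSet 1 := (h.mem_codimSet p).2 ⟨l, hp⟩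
  have hcc := isPreconnected_connectedComponentIn (x := p) (F := X.codimSet 1)
  have hsub := connectedComponentIn_subset (X.codimSet 1) p
  have hmem := mem_connectedComponentIn hpc
  have h0 : ∀ q ∈ connectedComponentIn (X.codimSet 1) p, r l q = 0 := by
    intro q hq; by_contra hne
    have hu : IsOpen {q | ∀ l', l' ≠ l → r l' q ≠ 0} := by
      simp only [ofPred_forall]
      exact isOpen_iInter_of_finite fun l' => isOpen_iInter_of_finite fun _ =>
        isOpen_ne_fun (h.smooth l').continuous continuous_const
    obtain ⟨q', hq', h1, h2⟩ := hcc _ {q | r l q ≠ 0} hu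
      (isOpen_ne_fun (h.smooth l).continuous continuous_const) (fun q hq => by
        obtain ⟨l₁, hl₁⟩ := (h.mem_codimSet q).1 (hsub hq)
        by_cases hl : r l q = 0
        · grind
        · exact Or.inr hl) ⟨p, hmem, fun l' hne h' => hne ((hp l').1 h')⟩ ⟨q, hq, hne⟩
    obtain ⟨l₁, hl₁⟩ := (h.mem_codimSet q').1 (hsub hq'); have h3 := (hl₁ l₁).2 rfl
    grind
  have h0' : ∀ q ∈ closure (connectedComponentIn (X.codimSet 1) p), r l q = 0 := fun q hq =>
    closure_minimal h0 (isClosed_eq (h.smooth l).continuous continuous_const) hq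
  refine ⟨isClosed_closure, hcc.closure, ⟨p, subset_closure hmem⟩, h0', fun q hq => ?_⟩
  obtain ⟨U, hU, P, hP, hPl, hUP⟩ := h.exists_preconnected (h0' q hq)
  obtain ⟨q', hq'U, hq'⟩ := mem_closure_iff_nhds.1 hq U hU
  have h1 : IsPreconnected (insert q' P) := hP.subset_closure (subset_insert _ _)
    (insert_subset (hUP q' hq'U (h0 q' hq')) subset_closure)
  have h2 : insert q' P ⊆ connectedComponentIn (X.codimSet 1) p := by
    rw [connectedComponentIn_eq hq']
    exact h1.subset_connectedComponentIn (mem_insert _ _) (insert_subset (hsub hq') fun p hp =>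
      (h.mem_codimSet p).2 ⟨l, hPl p hp⟩)
  exact ⟨U, hU, fun p hp hl => closure_mono ((subset_insert _ _).trans h2) (hUP p hp hl)⟩

lemma LC.exists_isFace (h : LC X r) (hS : S ∈ X.hypersurfaces) : ∃ l, IsFace r l S := by
  obtain ⟨p, hp, rfl⟩ := hS; obtain ⟨l, hl⟩ := (h.mem_codimSet p).1 hp
  exact ⟨l, h.isFace_closure hl⟩

lemma LC.exists_hypersurface (h : LC X r) {q : X} (hq : r l q = 0) :
    ∃ S ∈ X.hypersurfaces, IsFace r l S ∧ q ∈ S := by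
  obtain ⟨U, hU, P, hP, hPl, hUP⟩ := h.exists_preconnected hq
  have hqP := hUP q (mem_of_mem_nhds hU) hq; obtain ⟨p, hp⟩ := closure_nonempty_iff.1 ⟨q, hqP⟩
  have hsub : ∀ p ∈ P, p ∈ X.codimSet 1 := fun p hp => (h.mem_codimSet p).2 ⟨l, hPl p hp⟩
  exact ⟨_, ⟨p, hsub p hp, rfl⟩, h.isFace_closure (hPl p hp),
    closure_mono (hP.subset_connectedComponentIn hp hsub) hqP⟩

/-- A boundary hypersurface is a face for one index only. -/
lemma LC.label_unique (h : LC X r) {l' : Fin n} (hS : S ∈ X.hypersurfaces) (h1 : IsFace r l S)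
    (h2 : IsFace r l' S) : l = l' := by
  obtain ⟨p, hp, rfl⟩ := hS; obtain ⟨l₁, hl⟩ := (h.mem_codimSet p).1 hp
  have hm := subset_closure (mem_connectedComponentIn hp)
  rw [(hl l).1 (h1.eq_zero p hm), (hl l').1 (h2.eq_zero p hm)]

/-- The family of the boundary hypersurfaces is locally finite. -/
lemma LC.exists_nhds (h : LC X r) (q : X) :
    ∃ U ∈ 𝓝 q, ∀ S ∈ X.hypersurfaces, (S ∩ U).Nonempty → q ∈ S := by
  have h1 : ∀ l, ∃ U ∈ 𝓝 q, ∀ S, IsFace r l S → (S ∩ U).Nonempty → q ∈ S := by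
    intro l
    by_cases hl : r l q = 0
    · obtain ⟨S₀, -, hS₀, hq⟩ := h.exists_hypersurface hl; obtain ⟨U, hU, hU'⟩ := hS₀.nhds q hq
      refine ⟨U, hU, fun S hS ⟨p, hp, hpU⟩ => ?_⟩
      rw [hS.eq hS₀ ⟨p, hp, hU' p hpU (hS.eq_zero p hp)⟩]; exact hq
    · exact ⟨{p | r l p ≠ 0}, (isOpen_ne_fun (h.smooth l).continuous continuous_const).mem_nhds hl,
        fun S hS ⟨p, hp, hpU⟩ => absurd (hS.eq_zero p hp) hpU⟩
  choose U hU hU' using h1; refine ⟨⋂ l, U l, iInter_mem.2 hU, fun S hS hne => ?_⟩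
  obtain ⟨l, hl⟩ := h.exists_isFace hS
  exact hU' l S hl (hne.mono (inter_subset_inter_right _ (iInter_subset _ l)))

/-- There are only finitely many boundary hypersurfaces if all of them meet a compact set. -/
lemma LC.finite_hypersurfaces (h : LC X r) {K : Set X} (hK : IsCompact K)
    (hm : ∀ S ∈ X.hypersurfaces, (S ∩ K).Nonempty) : X.hypersurfaces.Finite := by
  choose U hU hU' using h.exists_nhds; obtain ⟨t, -, ht⟩ := hK.elim_nhds_subcover U fun q _ => hU q
  refine (t.finite_toSet.biUnion (t := fun q => {S ∈ X.hypersurfaces | q ∈ S}) fun q _ => ?_).subset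
    fun S hS => ?_
  · refine (finite_iUnion (f := fun l => {S | IsFace r l S ∧ q ∈ S}) fun l => ?_).subset
      fun S hS => ?_
    · exact Set.Subsingleton.finite fun S hS S' hS' => hS.1.eq hS'.1 ⟨q, hS.2, hS'.2⟩
    · obtain ⟨l, hl⟩ := h.exists_isFace hS.1; exact mem_iUnion.2 ⟨l, hl, hS.2⟩
  · obtain ⟨p, hp, hpK⟩ := hm S hS; obtain ⟨q, hq, hpq⟩ := mem_iUnion₂.1 (ht hpK)
    exact mem_iUnion₂.2 ⟨q, hq, hS, hU' q S hS ⟨p, hp, hpq⟩⟩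

end

/-! ### b-maps -/

section

variable {n' : ℕ} {r' : Fin n' → Y → ℝ} {S : Set X}

/-- Where it vanishes, the differential of a boundary defining function does not. -/
lemma LC.mfderiv_ne (h : LC X r) {q : X} (hq : r l q = 0) :
    mfderiv X.I 𝓘(ℝ, ℝ) (r l) q ≠ 0 := by
  classical
  obtain ⟨κ, _, _, C, c, j, hc⟩ := h.loc q; obtain ⟨T, hT, hT', -⟩ := c.exists_tangentEquiv hc.mem
  obtain ⟨u, su, hu, e⟩ := hc.eq l hq; intro h0
  have h1 : HasMFDerivAt X.I 𝓘(ℝ, ℝ) (r l) q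
      (0 : TangentSpace X.I q →L[ℝ] TangentSpace 𝓘(ℝ, ℝ) (r l q)) := by
    rw [← h0]; exact ((h.smooth l).contMDiffAt.mdifferentiableAt (by simp)).hasMFDerivAt
  have hn := c.mem_nhds hc.mem
  have h2 := (((su.inv₀ fun p hp => (hu p hp).ne').contMDiffAt hn).mdifferentiableAt
    (by simp)).hasMFDerivAt
  have h3 := (h1.mul h2).congr_of_eventuallyEq (f₁ := fun p => c p (j l))
    (by filter_upwards [hn] with p hp
        rw [Pi.mul_apply, e p hp, mul_comm (u p), mul_inv_cancel_right₀ (hu p hp).ne'])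
  have h4 := (((ContinuousLinearMap.proj (R := ℝ) (φ := fun _ : κ => ℝ) (j l)).hasFDerivAt
    (x := c q)).hasMFDerivAt.comp q hT)
  have h5 := DFunLike.congr_fun (hasMFDerivAt_unique h4 h3) (T.symm (Pi.single (j l) 1))
  have h6 := hT' (T.symm (Pi.single (j l) 1)); rw [LinearEquiv.apply_symm_apply] at h6
  have h7 : (mfderiv X.I 𝓘(ℝ, κ → ℝ) c q : X.E →L[ℝ] (κ → ℝ)) (T.symm (Pi.single (j l) 1)) (j l) =
      r l q * _ + _ * 0 := h5
  rw [← h6, hq, Pi.single_eq_same, zero_mul, mul_zero, add_zero] at h7; exact one_ne_zero h7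

/-- The function `r l` is modified away from the component `S` of its zero set by a cut-off. -/
lemma LC.exists_isDefiningFunction [SigmaCompactSpace X] (h : LC X r) (hS : IsFace r l S) :
    ∃ ρ : X → ℝ, IsDefiningFunction S ρ ∧ ∀ q ∈ S, ρ =ᶠ[𝓝 q] r l := by
  obtain ⟨p, hp⟩ := hS.nonempty; obtain ⟨κ, _, _, C, c, j, hc⟩ := h.loc p
  have := c.finiteDimensional hc.mem
  have := Manifold.locallyCompact_of_finiteDimensional (M := X) X.I
  obtain ⟨V, hV, hSV, hV'⟩ := hS.exists_isOpen
  have hcl : IsClosed ({q | r l q = 0} ∩ Vᶜ) :=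
    (isClosed_eq (h.smooth l).continuous continuous_const).inter hV.isClosed_compl
  obtain ⟨χ, h0, h1, hχ⟩ := exists_contMDiffMap_zero_one_nhds_of_isClosed X.I (n := ⊤) hcl
    hS.isClosed (disjoint_left.2 fun q hq hqS => hq.2 (hSV hqS))
  have heq : ∀ q ∈ S, (fun q => r l q * χ q + (1 - χ q)) =ᶠ[𝓝 q] r l := fun q hq => by
    filter_upwards [h1.filter_mono (nhds_le_nhdsSet hq)] with q' hq'
    grind
  refine ⟨fun q => r l q * χ q + (1 - χ q),
    ⟨((h.smooth l).mul χ.contMDiff).add (contMDiff_const.sub χ.contMDiff), fun q =>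
    add_nonneg (mul_nonneg (h.nonneg l q) (hχ q).1) (sub_nonneg.2 (hχ q).2), fun q =>
    ⟨fun hq => ?_, fun hq => ?_⟩, fun q hq => ?_⟩, heq⟩
  · obtain ⟨h2, h3⟩ := (add_eq_zero_iff_of_nonneg (mul_nonneg (h.nonneg l q) (hχ q).1)
      (sub_nonneg.2 (hχ q).2)).1 hq
    have h4 : χ q = 1 := (sub_eq_zero.1 h3).symm; rw [h4, mul_one] at h2; by_contra hqS
    have h5 : χ q = 0 := h0.self_of_nhdsSet q ⟨h2, fun hqV => hqS (hV' q hqV h2)⟩; rw [h5] at h4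
    exact zero_ne_one h4
  · exact (heq q hq).eq_of_nhds.trans (hS.eq_zero q hq)
  · rw [(heq q hq).mfderiv_eq]; exact h.mfderiv_ne (hS.eq_zero q hq)

/-- Near `q` the function `a` is a smooth nonvanishing multiple of `b`. -/
def UnitAt (a b : Y → ℝ) (q : Y) : Prop :=
  ∃ h : Y → ℝ, ∀ᶠ p in 𝓝 q, ContMDiffAt Y.I 𝓘(ℝ, ℝ) ∞ h p ∧ h p ≠ 0 ∧ a p = h p * b p

lemma UnitAt.of_eq {a b : Y → ℝ} {q : Y} (h : a =ᶠ[𝓝 q] b) : UnitAt a b q :=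
  ⟨fun _ => 1, h.mono fun p hp => ⟨contMDiffAt_const, one_ne_zero, by rw [hp, one_mul]⟩⟩

lemma UnitAt.mul {a b a' b' : Y → ℝ} {q : Y} (h : UnitAt a b q) (h' : UnitAt a' b' q) :
    UnitAt (fun p => a p * a' p) (fun p => b p * b' p) q := by
  obtain ⟨k, hk⟩ := h; obtain ⟨k', hk'⟩ := h'; refine ⟨fun p => k p * k' p, ?_⟩
  filter_upwards [hk, hk'] with p ⟨h1, h2, h3⟩ ⟨h4, h5, h6⟩
  exact ⟨h1.mul h4, mul_ne_zero h2 h5, by rw [h3, h6]; ring⟩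

lemma UnitAt.prod {ι : Type*} (s : Finset ι) {a b : ι → Y → ℝ} {q : Y}
    (h : ∀ i ∈ s, UnitAt (a i) (b i) q) :
    UnitAt (fun p => ∏ i ∈ s, a i p) (fun p => ∏ i ∈ s, b i p) q := by
  classical
  induction s using Finset.induction_on with
  | empty => exact UnitAt.of_eq (by simp)
  | insert i s hi ih =>
    simp only [Finset.prod_insert hi]
    exact (h i (Finset.mem_insert_self _ _)).mul (ih fun j hj => h j (Finset.mem_insert_of_mem hj))

lemma UnitAt.of_ne {a b : Y → ℝ} {q : Y} (ha : Smooth[Y] a)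
    (hb : Smooth[Y] b) (ha0 : a q ≠ 0) (hb0 : b q ≠ 0) : UnitAt a b q := by
  refine ⟨fun p => a p * (b p)⁻¹, ?_⟩
  filter_upwards [ha.continuous.continuousAt.eventually_ne ha0,
    hb.continuous.continuousAt.eventually_ne hb0] with p h1 h2
  exact ⟨ha.contMDiffAt.mul (hb.contMDiffAt.inv₀ h2), mul_ne_zero h1 (inv_ne_zero h2),
    by rw [inv_mul_cancel_right₀ h2]⟩

/-- The local quotients agree where `b` does not vanish, hence everywhere. -/
lemma exists_unit {a b : Y → ℝ} (h : ∀ q, UnitAt a b q) (hb : Dense {q | b q ≠ 0}) :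
    ∃ u : Y → ℝ, Smooth[Y] u ∧ (∀ q, u q ≠ 0) ∧ ∀ q, a q = u q * b q := by
  have hloc : ∀ q, ∃ (U : Set Y) (k : Y → ℝ), IsOpen U ∧ q ∈ U ∧ SmoothOn[Y] k U ∧
      ∀ p ∈ U, k p ≠ 0 ∧ a p = k p * b p := by
    intro q; obtain ⟨k, hk⟩ := h q; obtain ⟨U, hU, hUo, hq⟩ := eventually_nhds_iff.1 hk
    exact ⟨U, k, hUo, hq, fun p hp => (hU p hp).1.contMDiffWithinAt, fun p hp => (hU p hp).2⟩
  have he : ∀ {U : Set Y} {k : Y → ℝ}, (∀ p ∈ U, k p ≠ 0 ∧ a p = k p * b p) →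
      ∀ p ∈ U ∩ {q | b q ≠ 0}, k p = a p / b p := fun hk p hp => by
    grind
  obtain ⟨u, su, -, hu⟩ := exists_smooth_glue 𝓘(ℝ, ℝ) hb (fun q => a q / b q) fun q => by
    obtain ⟨U, k, hU, hq, sk, hk⟩ := hloc q; exact ⟨U, k, hU, hq, sk, he hk⟩
  have key : ∀ q, u q ≠ 0 ∧ a q = u q * b q := fun q => by
    obtain ⟨U, k, hU, hq, sk, hk⟩ := hloc q; rw [hu U k hU sk.continuousOn (he hk) hq]
    exact hk q hq
  grind

/-- A smooth map for which the defining functions pull back to monomials is a b-map. -/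
lemma IsMonomial.isBMap [SigmaCompactSpace X] [SigmaCompactSpace Y] [Nonempty (Fin n)]
    [Nonempty (Fin n')] {f : Y → X} (hm : IsMonomial f r r') (hf : ContMDiff Y.I X.I ∞ f)
    (hX : LC X r) (hY : LC Y r') (hfin : Y.hypersurfaces.Finite) : IsBMap f := by
  classical
  choose! v hv using fun (S : Set X) (hS : S ∈ X.hypersurfaces) => hX.exists_isFace hS
  choose! ρ hρ hρe using fun (S : Set X) (hS : S ∈ X.hypersurfaces) =>
    hX.exists_isDefiningFunction (hv S hS)
  choose! v' hv' using fun (S : Set Y) (hS : S ∈ Y.hypersurfaces) => hY.exists_isFace hS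
  choose! ρ' hρ' hρe' using fun (S : Set Y) (hS : S ∈ Y.hypersurfaces) =>
    hY.exists_isDefiningFunction (hv' S hS)
  choose m hm using hm; set Fs := hfin.toFinset with hFs
  let g : Set X → Set Y → ℕ := fun S S' =>
    if S' ∈ Y.hypersurfaces ∧ ∀ q ∈ S', f q ∈ S then m (v S) (v' S') else 0
  have hg : ∀ S S', g S S' ≠ 0 → S' ∈ Y.hypersurfaces ∧ ∀ q ∈ S', f q ∈ S := fun S S' h =>
    by_contra fun h' => h (if_neg h')
  refine ⟨hf, ρ, ρ', fun S => Finsupp.onFinset Fs (g S) fun S' h => hfin.mem_toFinset.2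
    (hg S S' h).1,
    hρ, hρ', fun S hS => ⟨fun S' hS' => ?_, ?_⟩⟩
  · grind
  have hprod : ∀ q, (Finsupp.onFinset Fs (g S) fun S' h =>
      hfin.mem_toFinset.2 (hg S S' h).1).prod (fun S' m => ρ' S' q ^ m) =
      ∏ S' ∈ Fs, ρ' S' q ^ g S S' := fun q =>
    Finsupp.onFinset_prod _ fun S' => pow_zero _
  simp only [hprod]; have hF : ∀ S' ∈ Fs, S' ∈ Y.hypersurfaces := fun S' h => hfin.mem_toFinset.1 h
  have sρ' : ∀ S' ∈ Fs, Smooth[Y] fun q => ρ' S' q ^ g S S' := fun S' h =>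
    (hρ' S' (hF S' h)).smooth.pow _
  have hne : ∀ S' ∈ Fs, ∀ q ∉ S', ρ' S' q ^ g S S' ≠ 0 := fun S' h q hq =>
    pow_ne_zero _ fun h0 => hq (((hρ' S' (hF S' h)).zero_iff q).1 h0)
  refine exists_unit (fun q => ?_) (hY.dense_ne.mono fun q (hq : ∀ l, r' l q ≠ 0) => ?_)
  swap
  · exact Finset.prod_ne_zero_iff.2 fun S' h =>
      hne S' h q fun hqS => hq _ ((hv' S' (hF S' h)).eq_zero q hqS)
  by_cases hqS : f q ∈ S
  · -- near `q`, both sides are products over the indices of defining functions on `Y`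
    have h1 : (fun q => ρ S (f q)) =ᶠ[𝓝 q] fun q => ∏ i, r' i q ^ m (v S) i := by
      filter_upwards [hf.continuous.continuousAt.eventually (hρe S hS (f q) hqS)] with p hp
      rw [hp, hm]
    have h2 : ∀ i, UnitAt (fun q => r' i q ^ m (v S) i)
        (fun q => ∏ S' ∈ Fs with v' S' = i, ρ' S' q ^ g S S') q := by
      intro i
      have hs : ∀ s : Finset (Set Y), s ⊆ Fs →
          Smooth[Y] fun q => ∏ S' ∈ s, ρ' S' q ^ g S S' := fun s hs =>
        contMDiff_finsetProd fun S' h => sρ' S' (hs h)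
      by_cases hi : r' i q = 0
      · obtain ⟨S₀, hS₀, hi₀, hq⟩ := hY.exists_hypersurface hi
        have hv₀ : v' S₀ = i := hY.label_unique hS₀ (hv' S₀ hS₀) hi₀
        have hmem : S₀ ∈ Fs.filter fun S' => v' S' = i :=
          Finset.mem_filter.2 ⟨hfin.mem_toFinset.2 hS₀, hv₀⟩
        have hg₀ : g S S₀ = m (v S) i := by
          by_cases h0 : m (v S) i = 0
          · grind
                      -- `f` maps the connected set `S₀` into `r (v S) = 0`, and `q` into `S`
          · have h3 : ∀ p ∈ S₀, f p ∈ S := fun p hp => by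
              refine (hv S hS).subset (hi₀.isPreconnected.image f hf.continuous.continuousOn) ?_
                ⟨f q, mem_image_of_mem f hq, hqS⟩ (mem_image_of_mem f hp)
              rintro _ ⟨p, hp, rfl⟩; rw [hm]
              exact Finset.prod_eq_zero (Finset.mem_univ i) (by rw [hi₀.eq_zero p hp, zero_pow h0])
            grind
        have h4 : (fun q => ∏ S' ∈ Fs with v' S' = i, ρ' S' q ^ g S S') = fun q =>
            ρ' S₀ q ^ g S S₀ * ∏ S' ∈ (Fs.filter fun S' => v' S' = i).erase S₀, ρ' S' q ^ g S S' :=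
          funext fun q => (Finset.mul_prod_erase _ _ hmem).symm
        have h5 : (fun q => r' i q ^ m (v S) i) = fun q => r' i q ^ m (v S) i * 1 := by simp
        rw [h4, h5, hg₀]
        refine UnitAt.mul (.of_eq ?_) (.of_ne contMDiff_const
          (hs _ ((Finset.erase_subset _ _).trans (Finset.filter_subset _ _))) one_ne_zero
          (Finset.prod_ne_zero_iff.2 fun S' h => ?_))
        · filter_upwards [hρe' S₀ hS₀ q hq] with p hp
          rw [hp, hv₀]
        · obtain ⟨hne', h⟩ := Finset.mem_erase.1 h; obtain ⟨h, hvi⟩ := Finset.mem_filter.1 h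
          exact hne S' h q fun hq' => hne' ((hvi ▸ hv' S' (hF S' h)).eq hi₀ ⟨q, hq', hq⟩)
      · refine .of_ne ((hY.smooth i).pow _) (hs _ (Finset.filter_subset _ _)) (pow_ne_zero _ hi)
          (Finset.prod_ne_zero_iff.2 fun S' h => ?_)
        obtain ⟨h, hvi⟩ := Finset.mem_filter.1 h
        exact hne S' h q fun hq' => hi (hvi ▸ (hv' S' (hF S' h)).eq_zero q hq')
    have h3 := UnitAt.prod Finset.univ fun i _ => h2 i; simp only [Finset.prod_fiberwise] at h3
    obtain ⟨k, hk⟩ := h3; refine ⟨k, ?_⟩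
    filter_upwards [h1, hk] with p h4 h5
    grind
  · refine .of_ne ((hρ S hS).smooth.comp hf) (contMDiff_finsetProd fun S' h => sρ' S' h)
      (fun h0 => hqS (((hρ S hS).zero_iff _).1 h0)) (Finset.prod_ne_zero_iff.2 fun S' h => ?_)
    by_cases hq : q ∈ S'
    · rw [show g S S' = 0 from by_contra fun h' => hqS ((hg S S' h').2 q hq), pow_zero]
      exact one_ne_zero
    · exact hne S' h q hq

end

/-! ### The b-map from `M²_{k,φ}` to `M²_φ × [0, ∞)` -/

section

variable {M : Mfd.{u}} {x : M → ℝ} {R : M → M → Prop} {E : M → ι → ℝ}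
  {N K : Mfd.{u}} {s : Fin 4 → N → ℝ} {i : Fin 5} {L : List (Fin 5)} {δ : Y → N.prodHalfLine}
    {r : Fin n → Y → ℝ} {t I κ : Y → ℝ} {T S : Fin 5 → Y → ℝ}

lemma continuousOn_halfPoint : ContinuousOn halfPoint (Ici 0) := contMDiffOn_halfPoint.continuousOn

instance : SigmaCompactSpace (EuclideanHalfSpace 1) := by
  refine ⟨⟨fun n => halfPoint '' Icc 0 n, fun n => isCompact_Icc.image_of_continuousOn
    (continuousOn_halfPoint.mono Icc_subset_Ici_self), ?_⟩⟩
  refine eq_univ_of_forall fun k => ?_; obtain ⟨n, hn⟩ := exists_nat_ge (k.val 0)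
  exact mem_iUnion.2 ⟨n, k.val 0, ⟨k.2, hn⟩, halfPoint_eq k⟩

lemma IsProperMap.sigmaCompactSpace {X Y : Type*} [TopologicalSpace X] [TopologicalSpace Y]
    [SigmaCompactSpace X] {f : Y → X} (h : IsProperMap f) : SigmaCompactSpace Y := by
  refine ⟨⟨fun n => f ⁻¹' compactCovering X n, fun n =>
    h.isCompact_preimage (isCompact_compactCovering X n), ?_⟩⟩
  rw [← preimage_iUnion, iUnion_compactCovering, preimage_univ]

instance [CompactSpace N] : SigmaCompactSpace N.prodHalfLine :=
  inferInstanceAs (SigmaCompactSpace (N × EuclideanHalfSpace 1))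

/-- Every boundary hypersurface contains points with `k ≤ 1`: away from `k = 0` the space is a
product with a half-line. -/
lemma PairStar.exists_le_one (h : PairStar (wFun s) i 0 L δ r t I T S κ)
    (Ψ : K ≃ₘ^∞⟮K.I, Y.I⟯ Y) {A : Set K} (hA : IsFace (fun l z => r l (Ψ z)) l A) :
    ∃ z ∈ A, halfCoord (δ (Ψ z)) ≤ 1 := by
  obtain ⟨q, hq⟩ := hA.nonempty; rcases le_or_gt (halfCoord (δ (Ψ q))) 1 with h1 | h1
  · exact ⟨q, hq, h1⟩
  obtain ⟨hinj, hf, σ, hσ, hσ'⟩ := h.away; set p := δ (Ψ q) with hp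
  have h0 : r l (Ψ q) = 0 := hA.eq_zero q hq
  have hpk : halfCoord p ≠ 0 := (zero_lt_one.trans h1).ne'
  -- the path lowering `k` to `1` stays in the zero set
  set c : ℝ → N.prodHalfLine := fun τ => (p.1, halfPoint τ) with hc
  have hck : ∀ τ ∈ Icc 1 (halfCoord p), halfCoord (c τ) = τ := fun τ hτ =>
    halfPoint_val (zero_le_one.trans hτ.1)
  have hc0 : ∀ τ ∈ Icc 1 (halfCoord p), halfCoord (c τ) ≠ 0 := fun τ hτ => by
    grind
  have hcc : ContinuousOn c (Icc 1 (halfCoord p)) :=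
    continuousOn_const.prodMk (continuousOn_halfPoint.mono fun τ hτ => zero_le_one.trans hτ.1)
  have hδ : ∀ τ ∈ Icc 1 (halfCoord p), δ (Ψ (Ψ.symm (σ (c τ)))) = c τ := fun τ hτ => by
    rw [Ψ.apply_symm_apply, hσ' _ (hc0 τ hτ)]
  have hend : Ψ.symm (σ (c (halfCoord p))) = q := by
    rw [show c (halfCoord p) = p from Prod.ext rfl (halfPoint_eq p.2)]
    have := hinj (σ p) (Ψ q) (hσ' p hpk) (by rw [hσ' p hpk]; exact hpk)
    rw [this, Ψ.symm_apply_apply]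
  have hz : ∀ τ ∈ Icc 1 (halfCoord p), r l (Ψ (Ψ.symm (σ (c τ)))) = 0 := fun τ hτ => by
    rcases hf l with h2 | ⟨m, hm⟩
    · exact absurd h0 (h2 _ hpk)
    · rw [hm _ (by rw [hδ τ hτ]; exact hc0 τ hτ), hδ τ hτ]
      have h3 := (hm (Ψ q) hpk).1 h0
      induction m using Fin.cases with
      | zero => exact absurd h3 hpk
      | succ m => exact h3
  have h4 := hA.subset (isPreconnected_Icc.image (fun τ => Ψ.symm (σ (c τ)))
    (Ψ.symm.continuous.comp_continuousOn (hσ.comp hcc hc0))) (by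
      rintro _ ⟨τ, hτ, rfl⟩; exact hz τ hτ) ⟨q, ⟨_, right_mem_Icc.2 h1.le, hend⟩, hq⟩
  have h5 := left_mem_Icc.2 h1.le; exact ⟨_, h4 ⟨1, h5, rfl⟩, by rw [hδ 1 h5, hck 1 h5]⟩

/-- By `PairStar.exists_le_one`, all boundary hypersurfaces meet a compact set, so that there are
only finitely many. -/
lemma PairStar.isBMap [CompactSpace N] (hs : LC N s) (h : PairStar (wFun s) i 0 L δ r t I T S κ)
    (Ψ : K ≃ₘ^∞⟮K.I, Y.I⟯ Y) : IsBMap (δ ∘ Ψ) := by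
  have hp : IsProperMap (δ ∘ Ψ) := h.proper.comp Ψ.toHomeomorph.isProperMap
  have := hp.sigmaCompactSpace; obtain ⟨K, -⟩ := h.keep; have : Nonempty (Fin n) := ⟨K 0⟩
  have hm : IsMonomial (δ ∘ Ψ) (wFun s) fun l z => r l (Ψ z) := fun l =>
    (h.monomial l).imp fun m hm z => hm _
  have hK := h.lc.comp_diffeo Ψ
  refine hm.isBMap (h.pairFun.smooth_f.comp Ψ.contMDiff) (LC.prodHalfLine hs) hK
    (hK.finite_hypersurfaces (hp.isCompact_preimage (K := univ ×ˢ (halfPoint '' Icc 0 1))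
      (isCompact_univ.prod (isCompact_Icc.image_of_continuousOn
        (continuousOn_halfPoint.mono Icc_subset_Ici_self)))) fun A hA => ?_)
  obtain ⟨l, hl⟩ := hK.exists_isFace hA; obtain ⟨z, hz, hz'⟩ := h.exists_le_one Ψ hl
  exact ⟨z, hz, trivial, _, ⟨(δ (Ψ z)).2.2, hz'⟩, halfPoint_eq _⟩

lemma PhiDouble.compactSpace [CompactSpace M] (hF : FibredBoundary M x R E) (W : PhiDouble M x R) :
    CompactSpace W.space := by
  obtain ⟨θ, ρ, θ', ρ', s, hb, hr, -⟩ := W.exists_fun hF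
  have hc : CompactSpace (M.prod M) := inferInstanceAs (CompactSpace (M × M))
  exact ⟨(hb.proper.comp hr.blow.proper).isCompact_preimage isCompact_univ⟩

/-- The statement about the map to `M²_φ × [0, ∞)`, for a boundary fibration given by functions. -/
lemma KPhiDouble.exists_bMap [CompactSpace M] (hF : FibredBoundary M x R E) (W : PhiDouble M x R)
    (K : KPhiDouble M x R) : ∃ b : K.space → W.space.prodHalfLine, IsBMap b ∧
      (∀ q, (W.total (b q).1, (b q).2) = K.total q) ∧
      ∀ L : List (Fin 3), L.Perm [0, 1, 2] → ∃ (F₀ : Set K.space) (Fc : Fin 3 → Set K.space),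
        IsIteratedBlowup W.space.prodHalfLine (W.timesZero W.bf ::
          L.map ![W.timesZero W.φf, W.timesZero W.lf, W.timesZero W.rf]) [] K.space b
          (F₀ :: L.map Fc) ∧ Fc 0 = K.φf₀ := by
  obtain ⟨s, b, hs, e1, e0, e2, e3, hb, hL⟩ := K.exists_map hF W; have := W.compactSpace hF
  refine ⟨b, ?_, hb, fun L hL' => ?_⟩
  · obtain ⟨Y, δ, n, r, t, I, T, S, κ, Ψ, h, rfl, -⟩ := hL _ (List.Perm.refl _); exact h.isBMap hs Ψ
  · obtain ⟨Y, δ, n, r, t, I, T, S, κ, Ψ, h, rfl, hφ⟩ := hL (L.map ![1, 3, 4]) (hL'.map _)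
    refine ⟨Ψ ⁻¹' {y | t y = 0}, fun a => Ψ ⁻¹' {y | T (![1, 3, 4] a) y = 0}, ?_, hφ⟩
    have := (h.iter [] (by simp)).comp_diffeo (by simp) Ψ
    rw [List.map_nil, List.map_nil, List.nil_append] at this
    convert this using 1
    · rw [List.map_map]; congr 1
      · rw [e1]; rfl
      · refine List.map_congr_left fun a _ => ?_; fin_cases a
        · rw [e0]; rfl
        · rw [e2]; rfl
        · rw [e3]; rfl
    · rw [List.map_cons, List.map_map, List.map_map]; rfl

end

/-! ### Coordinates adapted to the fibration of the boundary -/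

/-- The coordinate system which a chart `φ` of the manifold `N`, followed by a linear isomorphism
`T`, induces on `X` by means of the diffeomorphism `Ψ` between open sets. -/
def Crd.ofExtend {E' H' N : Type*}
    [NormedAddCommGroup E'] [NormedSpace ℝ E'] [TopologicalSpace H'] (J : ModelWithCorners ℝ E' H')
    [TopologicalSpace N] [ChartedSpace H' N] (Ψ : PartialDiffeomorph X.I J X N ∞)
    (φ : OpenPartialHomeomorph N H') (hφ : φ ∈ IsManifold.maximalAtlas J ∞ N)
    (T : E' ≃L[ℝ] (κ → ℝ)) (hT : ∀ v, v ∈ range J ↔ T v ∈ sect C) : Crd X κ C where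
  toFun q := T (φ.extend J (Ψ q))
  inv v := Ψ.symm ((φ.extend J).symm (T.symm v))
  source := Ψ.source ∩ Ψ ⁻¹' φ.source
  target := {v | T.symm v ∈ (φ.extend J).target ∧ (φ.extend J).symm (T.symm v) ∈ Ψ.target}
  open_source := Ψ.contMDiffOn_toFun.continuousOn.isOpen_inter_preimage Ψ.open_source φ.open_source
  open_target := by
    refine ⟨(fun v => J.symm (T.symm v)) ⁻¹' (φ.target ∩ φ.symm ⁻¹' Ψ.target),
      (φ.symm.isOpen_inter_preimage Ψ.open_target).preimage
        (J.continuous_symm.comp T.symm.continuous), ?_⟩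
    ext v; have := hT (T.symm v); rw [T.apply_symm_apply] at this
    rw [mem_ofPred_eq, φ.extend_target, mem_inter_iff, mem_inter_iff, ← this]
    exact ⟨fun h => ⟨⟨h.1.1, h.2⟩, h.1.2⟩, fun h => ⟨⟨h.1.1, h.2⟩, h.1.2⟩⟩
  map_source q hq := by
    have h : Ψ q ∈ (φ.extend J).source := by rw [φ.extend_source]; exact hq.2
    refine ⟨?_, ?_⟩
    · rw [T.symm_apply_apply]; exact (φ.extend J).map_source h
    · rw [T.symm_apply_apply, (φ.extend J).left_inv h]; exact Ψ.map_source' hq.1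
  map_target v hv := by
    refine ⟨Ψ.map_target' hv.2, ?_⟩
    have h : Ψ (Ψ.symm ((φ.extend J).symm (T.symm v))) = _ := Ψ.right_inv' hv.2
    rw [mem_preimage, h, ← φ.extend_source (I := J)]; exact (φ.extend J).map_target hv.1
  left_inv q hq := by
    have h : Ψ q ∈ (φ.extend J).source := by rw [φ.extend_source]; exact hq.2
    rw [T.symm_apply_apply, (φ.extend J).left_inv h]; exact Ψ.left_inv' hq.1
  right_inv v hv := by
    have h : Ψ (Ψ.symm ((φ.extend J).symm (T.symm v))) = _ := Ψ.right_inv' hv.2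
    rw [h, (φ.extend J).right_inv hv.1, T.apply_symm_apply]
  smooth := (contMDiff_iff_contDiff.2 T.contDiff).comp_contMDiffOn
    ((OpenPartialHomeomorph.contMDiffOn_extend hφ).comp
      (Ψ.contMDiffOn_toFun.mono inter_subset_left) inter_subset_right)
  smooth_inv := by
    refine Ψ.contMDiffOn_invFun.comp ((contMDiffOn_extend_symm hφ).comp
      (contMDiff_iff_contDiff.2 T.symm.contDiff).contMDiffOn ?_) fun v hv => hv.2
    intro v hv; have := hv.1; rw [φ.extend_target] at this; exact ⟨_, this.1, J.right_inv this.2⟩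

/-- The identity, as a diffeomorphism between open sets. -/
def PartialDiffeomorph.refl (X : Mfd.{u}) : PartialDiffeomorph X.I X.I X X ∞ :=
  (Diffeomorph.refl X.I X ∞).toPartialDiffeomorph

lemma ModelWithCorners.isBoundaryPoint_iff_of_mem_maximalAtlas [NeZero n] {M : Type*}
    [TopologicalSpace M] [ChartedSpace (EuclideanHalfSpace n) M] [IsManifold (𝓡∂ n) ∞ M]
    {φ : OpenPartialHomeomorph M (EuclideanHalfSpace n)}
    (hφ : φ ∈ IsManifold.maximalAtlas (𝓡∂ n) ∞ M) {p : M} (hp : p ∈ φ.source) :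
    p ∈ (𝓡∂ n).boundary M ↔ φ.extend (𝓡∂ n) p 0 = 0 := by
  have h1 : IsLocalDiffeomorphAt (𝓡∂ n) (𝓡∂ n) ∞ φ p :=
    ⟨{ toPartialEquiv := φ.toPartialEquiv
       open_source := φ.open_source
       open_target := φ.open_target
       contMDiffOn_toFun := contMDiffOn_of_mem_maximalAtlas hφ
       contMDiffOn_invFun := contMDiffOn_symm_of_mem_maximalAtlas hφ }, hp, fun _ _ => rfl⟩
  have h2 := h1.isBoundaryPoint_iff (by simp)
  change (𝓡∂ n).IsBoundaryPoint p ↔ _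
  rw [h2, ModelWithCorners.isBoundaryPoint_iff, frontier_range_modelWithCornersEuclideanHalfSpace]
  simp only [mfld_simps, mem_ofPred_eq]; exact eq_comm

/-- The coordinates of the boundary are changed by `τ`, and the boundary coordinate is multiplied by
a positive function of the coordinates of the boundary. -/
lemma Crd.exists_twist {κ' : Type} [Fintype κ']
    (c : Crd X (Option κ) {none}) {O : Set (κ → ℝ)} {O' : Set (κ' → ℝ)} (hO : IsOpen O)
    (hO' : IsOpen O') {τ : (κ → ℝ) → κ' → ℝ} {τ' : (κ' → ℝ) → κ → ℝ} {u : (κ → ℝ) → ℝ}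
    (hτ : ContDiffOn ℝ ∞ τ O) (hτ' : ContDiffOn ℝ ∞ τ' O') (hu : ContDiffOn ℝ ∞ u O)
    (hu0 : ∀ w ∈ O, 0 < u w) (hm : ∀ w ∈ O, τ w ∈ O' ∧ τ' (τ w) = w)
    (hm' : ∀ w ∈ O', τ' w ∈ O ∧ τ (τ' w) = w) :
    ∃ c' : Crd X (Option κ') {none},
      (∀ q, q ∈ c'.source ↔ q ∈ c.source ∧ (fun k => c q (some k)) ∈ O) ∧
      (∀ q, c' q none = u (fun k => c q (some k)) * c q none) ∧
      ∀ q k, c' q (some k) = τ (fun k => c q (some k)) k := by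
  have hext : ∀ {ν ν' : Type} [Fintype ν] [Fintype ν'] {O : Set (ν → ℝ)} {f : (ν → ℝ) → ν' → ℝ}
      {g : (ν → ℝ) → ℝ}, ContDiffOn ℝ ∞ f O → ContDiffOn ℝ ∞ g O →
      ContDiffOn ℝ ∞ (fun (v : Option ν → ℝ) (i : Option ν') =>
        i.elim (g (fun k => v (some k)) * v none) (f fun k => v (some k)))
        ((fun (v : Option ν → ℝ) k => v (some k)) ⁻¹' O ∩ sect {none}) := by
    intro ν ν' _ _ O f g hf hg; refine contDiffOn_pi.2 fun i => ?_
    cases i with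
    | none => exact (hg.comp (by fun_prop) fun v hv => hv.1).mul (by fun_prop)
    | some i =>
      exact (contDiff_apply ℝ ℝ i).comp_contDiffOn (hf.comp (by fun_prop) fun v hv => hv.1)
  have hu' : ∀ w ∈ O', 0 < u (τ' w) := fun w hw => hu0 _ (hm' w hw).1
  refine ⟨c.change _ _ (hO.preimage (by fun_prop)) (hO'.preimage (by fun_prop)) (hext hτ hu)
    (hext hτ' ((hu.comp hτ' fun w hw => (hm' w hw).1).inv fun w hw => (hu' w hw).ne'))
    (fun v hv => ⟨(hm _ hv.1).1, ?_⟩) (fun v hv => ⟨(hm' _ hv.1).1, ?_⟩)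
    (fun v hv => ?_) fun v hv => ?_, fun q => Iff.rfl, fun q => rfl, fun q k => rfl⟩
  · rintro _ rfl; exact mul_nonneg (hu0 _ hv.1).le (hv.2 none rfl)
  · rintro _ rfl; exact mul_nonneg (inv_pos.2 (hu' _ hv.1)).le (hv.2 none rfl)
  · ext (_ | i)
    · change (u (τ' (τ _)))⁻¹ * (u _ * _) = _
      grind
    · exact congrFun (hm _ hv.1).2 i
  · ext (_ | i)
    · exact mul_inv_cancel_left₀ (hu' _ hv.1).ne' _
    · exact congrFun (hm' _ hv.1).2 i

lemma Crd.exists_eq_mul (c : Crd X (Option κ) {none})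
    (hp : p ∈ c.source) (hp0 : c p none = 0) {U : Set X} (hU : IsOpen U) (hpU : p ∈ U) {f : X → ℝ}
    (hf : SmoothOn[X] f U) (h0 : ∀ q ∈ c.source ∩ U, c q none = 0 → f q = 0) :
    ∃ V ⊆ c.source ∩ U, IsOpen V ∧ p ∈ V ∧ ∃ a : X → ℝ, SmoothOn[X] a V ∧
      ∀ q ∈ V, f q = a q * c q none := by
  classical
  obtain ⟨V, hVc, hV, hpV, A, hA, eA⟩ := c.hadamard {none} hp (by simpa using hp0) hU hpU
    (h := fun q (_ : Unit) => f q) (fun _ => hf) fun q hq hq0 _ => h0 q hq (hq0 none (by simp))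
  exact ⟨V, hVc, hV, hpV, _, hA () none, fun q hq => by simpa using eA q hq ()⟩

/-- The boundary coordinate can be chosen such that its quotient by the defining function `x` is
`1` on the boundary. -/
lemma Crd.exists_normalized (c : Crd X (Option κ) {none}) (hp : p ∈ c.source) {x : X → ℝ}
    (hx : Smooth[X] x) (hnn : ∀ q, 0 ≤ x q)
    (h0 : ∀ q ∈ c.source, x q = 0 ↔ c q none = 0) (hpx : x p = 0)
    (hne : mfderiv X.I 𝓘(ℝ, ℝ) x p ≠ 0) :
    ∃ (c' : Crd X (Option κ) {none}) (h : X → ℝ), p ∈ c'.source ∧ c'.source ⊆ c.source ∧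
      SmoothOn[X] h c'.source ∧ ∀ q ∈ c'.source, 0 < 1 + c' q none * h q ∧
        x q = (1 + c' q none * h q) * c' q none ∧ ∀ k, c' q (some k) = c q (some k) := by
  have hp0 : c p none = 0 := (h0 p hp).1 hpx
  obtain ⟨V, hVc, hV, hpV, a, sa, hxa⟩ := c.exists_eq_mul hp hp0 isOpen_univ (mem_univ p)
    hx.contMDiffOn fun q hq => (h0 q hq.1).2
  have hVp := hV.mem_nhds hpV; have sap := sa.contMDiffAt hVp
  -- at `p` the differential of `x` is `a p` times that of the coordinate
  have hap : a p ≠ 0 := fun h => by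
    have h3 := ((sap.mdifferentiableAt (by simp)).hasMFDerivAt.mul
      (((c.smooth_apply none).contMDiffAt (c.mem_nhds hp)).mdifferentiableAt
        (by simp)).hasMFDerivAt).congr_of_eventuallyEq (f₁ := x) (eventually_of_mem hVp hxa)
    refine hne ?_; rw [h3.mfderiv, h, hp0]; ext v; change (0 : ℝ) * _ + 0 * _ = 0; ring
  have hapos : 0 < a p := by
    refine lt_of_le_of_ne (not_lt.1 fun hlt => hne ?_) hap.symm
    have : x =ᶠ[𝓝 p] fun _ => 0 := by
      filter_upwards [sap.continuousAt.eventually_lt continuousAt_const hlt, hVp] with q hq hq1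
      refine le_antisymm ?_ (hnn q); rw [hxa q hq1]
      exact mul_nonpos_of_nonpos_of_nonneg (le_of_lt hq) (c.nonneg (hVc hq1).1 rfl)
    rw [this.mfderiv_eq]; exact mfderiv_const
  obtain ⟨c₁, hc₁, hpc₁, hs₁⟩ : ∃ c₁ : Crd X (Option κ) {none}, c₁.toFun = c.toFun ∧
      p ∈ c₁.source ∧ ∀ q ∈ c₁.source, q ∈ V ∧ 0 < a q :=
    ⟨c.restrict _ (sa.continuousOn.isOpen_inter_preimage hV isOpen_Ioi), rfl, ⟨hp, hpV, hapos⟩,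
      fun q hq => hq.2⟩
  obtain ⟨O, hO, eO⟩ := c₁.open_target
  -- the new coordinate is the product of the old one and the restriction of `a` to the boundary
  let z : (κ → ℝ) → Option κ → ℝ := fun w i => i.elim 0 w
  have sz : ContDiff ℝ ∞ z := contDiff_pi.2 fun i => by
    cases i with
    | none => exact contDiff_const
    | some i => exact contDiff_apply ℝ ℝ i
  have hz : ∀ w ∈ z ⁻¹' O, z w ∈ c₁.target := fun w hw => by
    rw [eO]; exact ⟨hw, by rintro _ rfl; exact le_rfl⟩
  have hzc : ∀ q, c₁ q none = 0 → z (fun k => c₁ q (some k)) = c₁ q := fun q hq => by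
    ext (_ | i); exacts [hq.symm, rfl]
  let u : (κ → ℝ) → ℝ := fun w => a (c₁.inv (z w))
  have su : ContDiffOn ℝ ∞ u (z ⁻¹' O) := contMDiffOn_iff_contDiffOn.1 <|
    (sa.mono fun q hq => (hs₁ q hq).1).comp (c₁.smooth_inv.comp
      (contMDiff_iff_contDiff.2 sz).contMDiffOn hz) fun w hw => c₁.map_target _ (hz w hw)
  have hu0 : ∀ w ∈ z ⁻¹' O, 0 < u w := fun w hw => (hs₁ _ (c₁.map_target _ (hz w hw))).2
  obtain ⟨c₂, hs, hn, hk⟩ := c₁.exists_twist (τ := id) (τ' := id) (hO.preimage sz.continuous)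
    (hO.preimage sz.continuous) contDiffOn_id contDiffOn_id su hu0 (fun w hw => ⟨hw, rfl⟩)
    fun w hw => ⟨hw, rfl⟩
  have hp₂ : p ∈ c₂.source := by
    have h1 := c₁.map_source p hpc₁; rw [eO] at h1; refine (hs p).2 ⟨hpc₁, ?_⟩
    rw [mem_preimage, hzc p (by rw [hc₁]; exact hp0)]
    exact h1.1
  have hs' : ∀ q ∈ c₂.source, 0 < u (fun k => c₁ q (some k)) ∧ q ∈ V ∧ 0 < a q := fun q hq =>
    ⟨hu0 _ ((hs q).1 hq).2, hs₁ q ((hs q).1 hq).1⟩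
  have suc : SmoothOn[X] (fun q => u fun k => c₁ q (some k)) c₂.source :=
    (contMDiffOn_iff_contDiffOn.2 su).comp (contMDiffOn_pi_space.2 fun k =>
      (c₁.smooth_apply (some k)).mono fun q hq => ((hs q).1 hq).1) fun q hq => ((hs q).1 hq).2
    -- the quotient by the new coordinate is `1` on the boundary
  obtain ⟨V₂, hV₂c, hV₂, hpV₂, h, sh, eh⟩ := c₂.exists_eq_mul hp₂ (by rw [hn, hc₁, hp0, mul_zero])
    c₂.open_source hp₂ (((sa.mono fun q hq => (hs' q hq).2.1).div₀ suc fun q hq =>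
      (hs' q hq).1.ne').sub (contMDiffOn_const (c := (1 : ℝ)))) fun q hq hq0 => by
      rw [hn, mul_eq_zero, or_iff_right (hs' q hq.1).1.ne'] at hq0
      change a q / a (c₁.inv (z _)) - 1 = 0
      rw [hzc q hq0, c₁.left_inv q ((hs q).1 hq.1).1, div_self (hs' q hq.1).2.2.ne', sub_self]
  refine ⟨c₂.restrict V₂ hV₂, h, ⟨hp₂, hpV₂⟩, fun q hq => (hVc (hs' q hq.1).2.1).1,
    sh.mono inter_subset_right, fun q hq => ?_⟩
  obtain ⟨h1, h2, h3⟩ := hs' q hq.1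
  have h4 : 1 + c₂ q none * h q = a q / u fun k => c₁ q (some k) := by
    rw [mul_comm, ← eh q hq.2]; exact add_sub_cancel _ _
  refine ⟨h4 ▸ div_pos h3 h1, ?_, fun k => (hk q k).trans (by rw [hc₁]; rfl)⟩
  refine Eq.trans ?_ (congrArg₂ (· * ·) h4.symm (hn q).symm)
  grind

universe v

section

variable {D : Mfd.{v}} {κ' κ₀ : Type} [Fintype κ'] [Fintype κ₀]
  {ι : D → X} {a : D}

/-- If an embedded submanifold which is a slice `G = 0` in linear coordinates is the boundary, then
its coordinates, extended to `X`, and the boundary coordinate form a coordinate system. -/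
lemma Crd.exists_slice (hι : Topology.IsEmbedding ι) {o : κ₀} (c : Crd X κ₀ {o}) (δ : Crd D κ ∅)
    (ha : a ∈ δ.source) {G : Type*} [AddCommGroup G] [Module ℝ G]
    (L : ((κ → ℝ) × G) ≃ₗ[ℝ] (κ₀ → ℝ))
    (hL : ∀ y ∈ δ.source, ι y ∈ c.source ∧ c (ι y) = L (δ y, 0))
    (hr : ∀ q ∈ c.source, q ∈ range ι ↔ c q o = 0) :
    ∃ c' : Crd X (Option κ) {none}, ι a ∈ c'.source ∧
      (∀ q ∈ c'.source, q ∈ range ι ↔ c' q none = 0) ∧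
      ∀ y, ι y ∈ c'.source → y ∈ δ.source ∧ ∀ k, c' (ι y) (some k) = δ y k := by
  obtain ⟨U, hU, eU⟩ := hι.isInducing.isOpen_iff.1 δ.open_source
  have hUy : ∀ y, ι y ∈ U ↔ y ∈ δ.source := fun y => by rw [← eU]; rfl
  have haU : ι a ∈ U := (hUy a).2 ha
  have hL0 : ∀ y ∈ δ.source, L (δ y, 0) o = 0 := fun y hy => by
    rw [← (hL y hy).2]; exact (hr _ (hL y hy).1).1 (mem_range_self y)
  -- a small multiple of any vector can be added to a point of an open set
  have small : ∀ {ν : Type} [Fintype ν] {O : Set (ν → ℝ)} (_ : IsOpen O) {p : ν → ℝ} (_ : p ∈ O)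
      (w : ν → ℝ), ∃ ε : ℝ, ε ≠ 0 ∧ p + ε • w ∈ O := by
    intro ν _ O hO p hp w
    have h1 : Tendsto (fun ε : ℝ => p + ε • w) (𝓝[≠] 0) (𝓝 p) := by
      have : ContinuousAt (fun ε : ℝ => p + ε • w) 0 := by fun_prop
      simpa [ContinuousAt] using this.tendsto.mono_left nhdsWithin_le_nhds
    obtain ⟨ε, h2, h3⟩ := ((h1.eventually (hO.mem_nhds hp)).and self_mem_nhdsWithin).exists
    exact ⟨ε, h3, h2⟩
  -- the slice coincides with the subspace on which the boundary coordinate vanishes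
  have h1 : ∀ w, L (w, 0) o = 0 := by
    intro w; obtain ⟨O, hO, eO⟩ := δ.open_target; have haO := δ.map_source a ha; rw [eO] at haO
    obtain ⟨ε, hε, hmem⟩ := small hO haO.1 w
    have hmem' : δ a + ε • w ∈ δ.target := by rw [eO]; exact ⟨hmem, fun i hi => hi.elim⟩
    have h2 := hL0 _ (δ.map_target _ hmem'); rw [δ.right_inv _ hmem'] at h2
    have h3 : ((δ a + ε • w, 0) : (κ → ℝ) × G) = (δ a, 0) + ε • (w, 0) := by simp
    rw [h3, map_add, map_smul, Pi.add_apply, hL0 a ha, zero_add, Pi.smul_apply, smul_eq_mul,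
      mul_eq_zero, or_iff_right hε] at h2
    exact h2
  have h2 : ∀ v : κ₀ → ℝ, v o = 0 → ∃ w, L (w, 0) = v := by
    intro v hv; obtain ⟨O, hO, eO⟩ := (c.restrict U hU).open_target
    have haO := (c.restrict U hU).map_source (ι a) ⟨(hL a ha).1, haU⟩; rw [eO] at haO
    obtain ⟨ε, hε, hmem⟩ := small hO haO.1 v
    have h0 : c (ι a) o = 0 := (hr _ (hL a ha).1).1 (mem_range_self a)
    have h0' : (c (ι a) + ε • v) o = 0 := by
      rw [Pi.add_apply, h0, Pi.smul_apply, hv, smul_zero, zero_add]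
    have hmem' : c (ι a) + ε • v ∈ (c.restrict U hU).target := by
      rw [eO]; refine ⟨hmem, fun i hi => ?_⟩; rw [mem_singleton_iff.1 hi]; exact h0'.ge
    have h3 := (c.restrict U hU).map_target _ hmem'; have h4 := c.right_inv _ hmem'.1
    obtain ⟨y, hy⟩ := (hr _ h3.1).2 (by
      rw [show c ((c.restrict U hU).inv _) = _ from h4]; exact h0')
    have hyδ : y ∈ δ.source := (hUy y).1 (by rw [hy]; exact h3.2)
    have h5 := (hL y hyδ).2
    rw [hy, show c ((c.restrict U hU).inv _) = _ from h4, (hL a ha).2] at h5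
    refine ⟨ε⁻¹ • (δ y - δ a), ?_⟩
    have h6 : ((ε⁻¹ • (δ y - δ a), 0) : (κ → ℝ) × G) = ε⁻¹ • ((δ y, 0) - (δ a, 0)) := by simp
    rw [h6, map_smul, map_sub, ← h5, add_sub_cancel_left, smul_smul, inv_mul_cancel₀ hε, one_smul]
  obtain ⟨T, hT0, hT⟩ : ∃ T : (κ₀ → ℝ) ≃ₗ[ℝ] (Option κ → ℝ), (∀ v, T v none = v o) ∧
      ∀ w k, T (L (w, 0)) (some k) = w k := by
    let f : (κ₀ → ℝ) →ₗ[ℝ] (Option κ → ℝ) :=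
      { toFun := fun v i => i.elim (v o) fun k => (L.symm v).1 k
        map_add' := fun v w => by ext i; cases i <;> simp
        map_smul' := fun t v => by ext i; cases i <;> simp }
    have hf0 : ∀ v, f v none = v o := fun _ => rfl
    have hf : ∀ v k, f v (some k) = (L.symm v).1 k := fun _ _ => rfl
    refine ⟨LinearEquiv.ofBijective f ⟨?_, ?_⟩, hf0, fun w k => ?_⟩
    · refine (injective_iff_map_eq_zero f).2 fun v hv => ?_
      obtain ⟨w, rfl⟩ := h2 v ((hf0 v).symm.trans (congrFun hv none))
      have : w = 0 := by
        ext k; have := hf (L (w, 0)) k; rw [hv, L.symm_apply_apply] at this; exact this.symm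
      rw [this]; exact map_zero L
    · intro w
      classical
      refine ⟨w none • Pi.single o 1 + L (fun k => w (some k) -
        w none * (L.symm (Pi.single o 1)).1 k, 0), ?_⟩
      ext i
      cases i with
      | none => simp [hf0, h1]
      | some k => simp [hf]
    · change f _ _ = _; rw [hf, L.symm_apply_apply]
  have hmaps : ∀ v, v ∈ sect {o} ↔ T v ∈ sect {none} := fun v => by simp [sect, hT0]
  refine ⟨(c.change T T.symm (C' := {none}) isOpen_univ isOpen_univ ?_ ?_
    (fun v hv => ⟨trivial, (hmaps v).1 hv.2⟩) (fun v hv => ⟨trivial, (hmaps _).2 (by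
      rw [T.apply_symm_apply]; exact hv.2)⟩) (fun v _ => T.symm_apply_apply v)
    fun v _ => T.apply_symm_apply v).restrict U hU, ⟨⟨(hL a ha).1, trivial⟩, haU⟩, ?_, ?_⟩
  · exact T.toContinuousLinearEquiv.contDiff.contDiffOn
  · exact T.symm.toContinuousLinearEquiv.contDiff.contDiffOn
  · intro q hq; refine (hr q hq.1.1).trans ?_; change c q o = 0 ↔ T (c q) none = 0; rw [hT0]
  · intro y hy; have hyδ := (hUy y).1 hy.2; refine ⟨hyδ, fun k => ?_⟩
    rw [← hT (δ y) k, ← (hL y hyδ).2]; rfl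

/-- A coordinate system of the boundary which extends to `X` can be replaced by any other one. -/
lemma Crd.exists_change_boundary (c : Crd X (Option κ) {none}) (δ : Crd D κ ∅) (χ : Crd D κ' ∅)
    (ha : ι a ∈ c.source) (hδ : a ∈ δ.source) (hχ : a ∈ χ.source)
    (hr : ∀ q ∈ c.source, q ∈ range ι ↔ c q none = 0)
    (hc : ∀ y, ι y ∈ c.source → y ∈ δ.source ∧ ∀ k, c (ι y) (some k) = δ y k) :
    ∃ c' : Crd X (Option κ') {none}, ι a ∈ c'.source ∧
      (∀ q ∈ c'.source, q ∈ range ι ↔ c' q none = 0) ∧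
      (∀ q ∈ c'.source, (fun k => c' q (some k)) ∈ χ.target) ∧
      ∀ y, ι y ∈ c'.source → y ∈ χ.source ∧ ∀ k, c' (ι y) (some k) = χ y k := by
  have htriv : ∀ {ν : Type} [Fintype ν] {O : Set (ν → ℝ)}, O ∩ sect ∅ = O := fun {ν} _ O =>
    inter_eq_left.2 fun v _ i hi => hi.elim
  obtain ⟨O, hO, eO⟩ := (δ.restrict _ χ.open_source).open_target
  obtain ⟨O', hO', eO'⟩ := (χ.restrict _ δ.open_source).open_target; rw [htriv] at eO eO'
  have hsm : ContDiffOn ℝ ∞ (fun v => χ (δ.inv v)) O := by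
    rw [← contMDiffOn_iff_contDiffOn, ← eO]
    exact χ.smooth.comp (δ.smooth_inv.mono inter_subset_left) fun v hv => hv.2
  have hsm' : ContDiffOn ℝ ∞ (fun v => δ (χ.inv v)) O' := by
    rw [← contMDiffOn_iff_contDiffOn, ← eO']
    exact δ.smooth.comp (χ.smooth_inv.mono inter_subset_left) fun v hv => hv.2
  have hm : ∀ v ∈ O, χ (δ.inv v) ∈ O' ∧ δ (χ.inv (χ (δ.inv v))) = v := by
    intro v hv; rw [← eO] at hv
    have h1 := (χ.restrict _ δ.open_source).map_source (δ.inv v) ⟨hv.2, δ.map_target v hv.1⟩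
    rw [eO'] at h1; exact ⟨h1, by rw [χ.left_inv _ hv.2, δ.right_inv v hv.1]⟩
  have hm' : ∀ v ∈ O', δ (χ.inv v) ∈ O ∧ χ (δ.inv (δ (χ.inv v))) = v := by
    intro v hv; rw [← eO'] at hv
    have h1 := (δ.restrict _ χ.open_source).map_source (χ.inv v) ⟨hv.2, χ.map_target v hv.1⟩
    rw [eO] at h1; exact ⟨h1, by rw [δ.left_inv _ hv.2, χ.right_inv v hv.1]⟩
  obtain ⟨c', hs, hn, hk⟩ := c.exists_twist hO hO' hsm hsm' contDiffOn_const
    (fun _ _ => zero_lt_one) hm hm'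
  have hcy : ∀ y, ι y ∈ c.source → (fun k => c (ι y) (some k)) = δ y := fun y hy =>
    funext (hc y hy).2
  refine ⟨c', (hs _).2 ⟨ha, ?_⟩, fun q hq => ?_, fun q hq => ?_, fun y hy => ?_⟩
  · rw [hcy a ha, ← eO]; exact (δ.restrict _ χ.open_source).map_source a ⟨hδ, hχ⟩
  · grind
  · rw [funext (hk q)]; have := (hm _ ((hs q).1 hq).2).1; rw [← eO'] at this; exact this.1
  · obtain ⟨h1, h2⟩ := (hs _).1 hy; rw [hcy y h1, ← eO] at h2; have h3 := h2.2
    rw [mem_preimage, δ.left_inv y (hc y h1).1] at h3; refine ⟨h3, fun k => ?_⟩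
    rw [hk, hcy y h1, δ.left_inv y (hc y h1).1]

end

/-- A manifold without boundary, as an object of `Mfd`. -/
def mfdOfBoundaryless (d : ℕ) (D : Type v) [TopologicalSpace D]
    [ChartedSpace (EuclideanSpace ℝ (Fin d)) D] [IsManifold (𝓡 d) ∞ D] [T2Space D] : Mfd.{v} where
  I := 𝓡 d
  carrier := D

section

variable {d b f : ℕ} [NeZero n] {M : Type u} [TopologicalSpace M]
  [ChartedSpace (EuclideanHalfSpace n) M] [IsManifold (𝓡∂ n) ∞ M] [T2Space M]
  {D : Type v} [TopologicalSpace D] [ChartedSpace (EuclideanSpace ℝ (Fin d)) D]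
  [IsManifold (𝓡 d) ∞ D] [T2Space D] {ι : D → M} {x : M → ℝ}

lemma mem_range_halfSpace_iff (v : EuclideanSpace ℝ (Fin n)) :
    v ∈ range (𝓡∂ n) ↔ EuclideanSpace.equiv (Fin n) ℝ v ∈ sect {0} := by
  rw [range_modelWithCornersEuclideanHalfSpace]; simp [sect]

/-- Coordinates of the boundary extend to coordinates of the manifold, where the boundary
coordinate is, up to the factor `1 + c q none * h q`, the given defining function. -/
lemma exists_boundaryCrd (hι : Manifold.IsSmoothEmbedding (𝓡 d) (𝓡∂ n) ∞ ι)
    (hιr : range ι = (𝓡∂ n).boundary M)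
    (hx : IsDefiningFunction (X := mfdOf n M) ((𝓡∂ n).boundary M) x)
    (χ : Crd (mfdOfBoundaryless d D) κ ∅) {a : D} (ha : a ∈ χ.source) :
    ∃ (c : Crd (mfdOf n M) (Option κ) {none}) (h : mfdOf n M → ℝ), ι a ∈ c.source ∧
      SmoothOn[mfdOf n M] h c.source ∧
      (∀ q ∈ c.source, 0 < 1 + c q none * h q ∧ x q = (1 + c q none * h q) * c q none) ∧
      (∀ q ∈ c.source, (fun k => c q (some k)) ∈ χ.target) ∧
      ∀ y, ι y ∈ c.source → y ∈ χ.source ∧ ∀ k, c (ι y) (some k) = χ y k := by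
  have hi := hι.isImmersion.isImmersionAt a
  let Ψ₁ : PartialDiffeomorph (mfdOf n M).I (𝓡∂ n) (mfdOf n M) M ∞ := PartialDiffeomorph.refl _
  let Ψ₂ : PartialDiffeomorph (mfdOfBoundaryless d D).I (𝓡 d) (mfdOfBoundaryless d D) D ∞ :=
    PartialDiffeomorph.refl _
  obtain ⟨c₀, hc₀, hcs⟩ : ∃ c₀ : Crd (mfdOf n M) (Fin n) {0},
      (∀ q, c₀ q = EuclideanSpace.equiv (Fin n) ℝ (hi.codChart.extend (𝓡∂ n) q)) ∧
      c₀.source = hi.codChart.source :=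
    ⟨Crd.ofExtend (X := mfdOf n M) (N := M) (𝓡∂ n) Ψ₁ hi.codChart
      hi.codChart_mem_maximalAtlas (EuclideanSpace.equiv (Fin n) ℝ) mem_range_halfSpace_iff,
      fun q => rfl, univ_inter _⟩
  obtain ⟨δ, hδ, hδs⟩ : ∃ δ : Crd (mfdOfBoundaryless d D) (Fin d) ∅,
      (∀ q, δ q = EuclideanSpace.equiv (Fin d) ℝ (hi.domChart.extend (𝓡 d) q)) ∧
      δ.source = hi.domChart.source :=
    ⟨Crd.ofExtend (X := mfdOfBoundaryless d D) (N := D) (𝓡 d) Ψ₂ hi.domChart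
      hi.domChart_mem_maximalAtlas (EuclideanSpace.equiv (Fin d) ℝ) (by simp [sect]),
      fun q => rfl, univ_inter _⟩
  have haδ : a ∈ δ.source := by rw [hδs]; exact hi.mem_domChart_source
    -- the charts of an immersion make the boundary a slice; pass to the given coordinates of it
  obtain ⟨c₁, h1, h2, h3⟩ := Crd.exists_slice (X := mfdOf n M) (D := mfdOfBoundaryless d D)
    hι.isEmbedding c₀ δ haδ
    (((EuclideanSpace.equiv (Fin d) ℝ).symm.toLinearEquiv.prodCongr (LinearEquiv.refl ℝ _)).trans
      (hi.equiv.toLinearEquiv.trans (EuclideanSpace.equiv (Fin n) ℝ).toLinearEquiv))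
    (fun y hy => by
      rw [hδs] at hy; refine ⟨by rw [hcs]; exact hi.source_subset_preimage_source hy, ?_⟩
      have hy' : y ∈ (hi.domChart.extend (𝓡 d)).source := by
        rw [hi.domChart.extend_source]; exact hy
      have h := hi.writtenInCharts ((hi.domChart.extend (𝓡 d)).map_source hy')
      simp only [Function.comp_apply] at h; rw [(hi.domChart.extend (𝓡 d)).left_inv hy'] at h
      refine (hc₀ (ι y)).trans ?_; rw [h, hδ]
      simp) fun q hq => by
      rw [hcs] at hq; rw [hc₀]; refine (Set.ext_iff.1 hιr q).trans ?_
      exact ModelWithCorners.isBoundaryPoint_iff_of_mem_maximalAtlas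
        hi.codChart_mem_maximalAtlas hq
  obtain ⟨c₂, h4, h5, h6, h7⟩ := Crd.exists_change_boundary c₁ δ χ h1 haδ ha h2 h3
  have hxr : ∀ q : M, x q = 0 ↔ q ∈ range ι := fun q => by rw [hιr]; exact hx.zero_iff q
  obtain ⟨c, h, h8, h9, h10, h11⟩ := c₂.exists_normalized h4 hx.smooth hx.nonneg
    (fun q hq => (hxr q).trans (h5 q hq)) ((hxr _).2 (mem_range_self a))
    (hx.mfderiv_ne _ (by rw [← hιr]; exact mem_range_self a))
  refine ⟨c, h, h8, h10, fun q hq => ⟨(h11 q hq).1, (h11 q hq).2.1⟩, fun q hq => ?_, fun y hy => ?_⟩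
  · grind
  · refine ⟨(h7 y (h9 hy)).1, fun k => ?_⟩; rw [(h11 _ hy).2.2]; exact (h7 y (h9 hy)).2 k

end

section

variable {d b f : ℕ} {D : Type v} [TopologicalSpace D] [ChartedSpace (EuclideanSpace ℝ (Fin d)) D]
  [IsManifold (𝓡 d) ∞ D] [T2Space D]
  {B : Type*} [TopologicalSpace B] [ChartedSpace (EuclideanSpace ℝ (Fin b)) B]
  [IsManifold (𝓡 b) ∞ B]
  {F : Type*} [TopologicalSpace F] [ChartedSpace (EuclideanSpace ℝ (Fin f)) F]
  [IsManifold (𝓡 f) ∞ F] {φ : D → B}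

/-- Near any point of the total space there are coordinates the first of which are lifts of
coordinates of the base. -/
lemma IsFibration.exists_crd (hφ : IsFibration d b f F φ) (a : D) (y₀ : B) {O : Set B}
    (hO : IsOpen O) (haO : φ a ∈ O) (hOs : O ⊆ (chartAt (EuclideanSpace ℝ (Fin b)) y₀).source) :
    ∃ χ : Crd (mfdOfBoundaryless d D) (Fin b ⊕ Fin f) ∅, a ∈ χ.source ∧
      ContMDiffOn (𝓡 d) (𝓡 b) ∞ φ χ.source ∧
      ∀ a' ∈ χ.source, φ a' ∈ O ∧ ∀ k, χ a' (Sum.inl k) = extChartAt (𝓡 b) y₀ (φ a') k := by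
  obtain ⟨U, hU, haU, Ψ, hs, ht, hΨ⟩ := hφ (φ a); have haΨ : a ∈ Ψ.source := by rw [hs]; exact haU
  let ψ := (chartAt (EuclideanSpace ℝ (Fin b)) y₀).prod
    (chartAt (EuclideanSpace ℝ (Fin f)) (Ψ a).2)
  have hψ : ψ ∈ IsManifold.maximalAtlas ((𝓡 b).prod (𝓡 f)) ∞ (B × F) :=
    IsManifold.subset_maximalAtlas (mem_image2_of_mem (chart_mem_atlas _ _) (chart_mem_atlas _ _))
  obtain ⟨χ₀, h0, h0s⟩ : ∃ χ₀ : Crd (mfdOfBoundaryless d D) (Fin b ⊕ Fin f) ∅,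
      (∀ a' k, χ₀ a' (Sum.inl k) = extChartAt (𝓡 b) y₀ (Ψ a').1 k) ∧
      χ₀.source = Ψ.source ∩ Ψ ⁻¹' ψ.source :=
    ⟨Crd.ofExtend (X := mfdOfBoundaryless d D) ((𝓡 b).prod (𝓡 f)) Ψ ψ hψ
      (((EuclideanSpace.equiv (Fin b) ℝ).prodCongr (EuclideanSpace.equiv (Fin f) ℝ)).trans
        (LinearEquiv.sumArrowLequivProdArrow (Fin b) (Fin f) ℝ ℝ).symm.toContinuousLinearEquiv)
      (by simp [sect]), fun a' k => rfl, rfl⟩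
  have hφs : ContMDiffOn (𝓡 d) (𝓡 b) ∞ φ Ψ.source :=
    (contMDiff_fst.comp_contMDiffOn Ψ.contMDiffOn_toFun).congr fun a' ha' => (hΨ a' ha').symm
  have hV : IsOpen (Ψ.source ∩ φ ⁻¹' O) := hφs.continuousOn.isOpen_inter_preimage Ψ.open_source hO
  refine ⟨χ₀.restrict (Ψ.source ∩ φ ⁻¹' O) hV, ⟨?_, haΨ, haO⟩,
    hφs.mono fun a' ha' => ha'.2.1, fun a' ha' => ⟨ha'.2.2, fun k => ?_⟩⟩
  · rw [h0s]; refine ⟨haΨ, ?_, mem_chart_source _ _⟩; rw [hΨ a haΨ]; exact hOs haO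
  · rw [← hΨ a' ha'.2.1]; exact h0 a' k

/-- An embedding of the base into a Euclidean space, some components of which are coordinates near a
given point. -/
lemma exists_separating [CompactSpace B] [T2Space B] :
    ∃ (N : ℕ) (e : B → Fin N × Option (Fin b) → ℝ),
      ContMDiff (𝓡 b) 𝓘(ℝ, Fin N × Option (Fin b) → ℝ) ∞ e ∧ Function.Injective e ∧
      ∀ y, ∃ (y₀ : B) (j : Fin N) (O : Set B), IsOpen O ∧ y ∈ O ∧
        O ⊆ (chartAt (EuclideanSpace ℝ (Fin b)) y₀).source ∧
        ∀ z ∈ O, ∀ k, e z (j, some k) = extChartAt (𝓡 b) y₀ z k := by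
  obtain ⟨J, g, -⟩ := SmoothBumpCovering.exists_isSubordinate (𝓡 b) (M := B) isClosed_univ
    (U := fun _ => univ) fun y _ => univ_mem
  have := g.fintype; obtain ⟨N, ⟨τ⟩⟩ := Finite.exists_equiv_fin J
    -- a bump function `g i`, and its products with the coordinates of a chart
  refine ⟨N, fun y p => p.2.elim (g (τ.symm p.1) y)
    fun k => g (τ.symm p.1) y * extChartAt (𝓡 b) (g.c (τ.symm p.1)) y k, ?_, fun y y' h => ?_,
    fun y => ?_⟩
  · refine contMDiff_pi_space.2 fun p => ?_; obtain ⟨j, k⟩ := p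
    cases k with
    | none => exact (g _).contMDiff
    | some k =>
      exact ((EuclideanSpace.proj (𝕜 := ℝ) k).contDiff.contMDiff).comp
        ((g (τ.symm j)).contMDiff_smul contMDiffOn_extChartAt)
  · obtain ⟨j, hj⟩ := τ.symm.surjective (g.ind y (mem_univ y))
    have h0 := g.apply_ind y (mem_univ y)
    have h1 : g (τ.symm j) y = g (τ.symm j) y' := congrFun h (j, none); rw [← hj] at h0
    refine (extChartAt (𝓡 b) (g.c (τ.symm j))).injOn (g.mem_extChartAt_source_of_eq_one h0)
      (g.mem_extChartAt_source_of_eq_one (h1.symm.trans h0)) ?_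
    ext k
    have h2 : g (τ.symm j) y * extChartAt (𝓡 b) (g.c (τ.symm j)) y k =
      g (τ.symm j) y' * extChartAt (𝓡 b) (g.c (τ.symm j)) y' k := congrFun h (j, some k)
    grind
  · obtain ⟨j, hj⟩ := τ.symm.surjective (g.ind y (mem_univ y))
    have h0 := g.eventuallyEq_one y (mem_univ y); rw [← hj] at h0
    obtain ⟨O, hO, hOo, hy⟩ := eventually_nhds_iff.1 h0
    refine ⟨g.c (τ.symm j), j, O, hOo, hy,
      fun z hz => g.mem_chartAt_source_of_eq_one (hO z hz), fun z hz k => ?_⟩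
    change g (τ.symm j) z * _ = _; rw [hO z hz, Pi.one_apply, one_mul]

end

/-! ### Defining functions and extensions on a manifold with fibred boundary -/

section

variable {d b f : ℕ} [NeZero n] {M : Type u} [TopologicalSpace M]
  [ChartedSpace (EuclideanHalfSpace n) M] [IsManifold (𝓡∂ n) ∞ M] [T2Space M]
  {D : Type v} [TopologicalSpace D] [ChartedSpace (EuclideanSpace ℝ (Fin d)) D]
  [IsManifold (𝓡 d) ∞ D] {ι : D → M} {x : M → ℝ}
  {B : Type*} [TopologicalSpace B] [ChartedSpace (EuclideanSpace ℝ (Fin b)) B]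
  [IsManifold (𝓡 b) ∞ B]
  {F : Type*} [TopologicalSpace F] [ChartedSpace (EuclideanSpace ℝ (Fin f)) F]
  [IsManifold (𝓡 f) ∞ F] {φ : D → B}

/-- Functions on the base, pulled back to the boundary, extend to the manifold. -/
lemma exists_extension [CompactSpace M] (hι : Manifold.IsSmoothEmbedding (𝓡 d) (𝓡∂ n) ∞ ι)
    (hιr : range ι = (𝓡∂ n).boundary M)
    (hx : IsDefiningFunction (X := mfdOf n M) ((𝓡∂ n).boundary M) x)
    (hφ : IsFibration d b f F φ) {α : Type} [Fintype α] {g : B → α → ℝ}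
    (hg : ContMDiff (𝓡 b) 𝓘(ℝ, α → ℝ) ∞ g) :
    ∃ E : M → α → ℝ, ContMDiff (𝓡∂ n) 𝓘(ℝ, α → ℝ) ∞ E ∧ ∀ a, E (ι a) = g (φ a) := by
  have := hι.isEmbedding.t2Space
  suffices h : ∃ E : ContMDiffMap (𝓡∂ n) 𝓘(ℝ, α → ℝ) M (α → ℝ) ∞,
      ∀ p, E p ∈ {v | ∀ a, ι a = p → v = g (φ a)} by
    obtain ⟨E, hE⟩ := h; exact ⟨E, E.contMDiff, fun a => hE (ι a) a rfl⟩
  refine exists_contMDiffMap_forall_mem_convex_of_local (n := ⊤) (𝓡∂ n) ?_ ?_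
  · intro p v hv w hw s t _ _ hst a ha; rw [hv a ha, hw a ha, ← add_smul, hst, one_smul]
  · intro p
    by_cases hp : p ∈ range ι
    · obtain ⟨a, rfl⟩ := hp
      obtain ⟨χ, haχ, sφ, -⟩ := hφ.exists_crd a (φ a) (chartAt _ (φ a)).open_source
        (mem_chart_source _ _) subset_rfl
      obtain ⟨c, h, hac, -, -, hct, hcχ⟩ := exists_boundaryCrd hι hιr hx χ haχ
            -- locally, functions are extended to be independent of the boundary coordinate
      refine ⟨c.source, c.mem_nhds hac, fun q => g (φ (χ.inv fun k => c q (some k))), ?_, ?_⟩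
      · refine hg.comp_contMDiffOn (sφ.comp (χ.smooth_inv.comp (contMDiffOn_pi_space.2 fun k =>
          c.smooth_apply (some k)) hct) fun q hq => χ.map_target _ (hct q hq))
      · rintro q hq a rfl; obtain ⟨h1, h2⟩ := hcχ a hq
        change g (φ (χ.inv fun k => c (ι a) (some k))) = _; rw [funext h2, χ.left_inv a h1]
    · refine ⟨(range ι)ᶜ, IsOpen.mem_nhds ?_ hp, fun _ => 0, contMDiffOn_const, ?_⟩
      · rw [hιr, isOpen_compl_iff]
        have : (𝓡∂ n).boundary M = x ⁻¹' {0} := Set.ext fun q => (hx.zero_iff q).symm; rw [this]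
        exact isClosed_singleton.preimage (ContMDiff.continuous hx.smooth)
      grind

/-- The boundary defining function is a complete family of defining functions. -/
lemma LC.of_isDefiningFunction (hι : Manifold.IsSmoothEmbedding (𝓡 d) (𝓡∂ n) ∞ ι)
    (hιr : range ι = (𝓡∂ n).boundary M)
    (hx : IsDefiningFunction (X := mfdOf n M) ((𝓡∂ n).boundary M) x)
    (hφ : IsFibration d b f F φ) : LC (mfdOf n M) ![x] := by
  have := hι.isEmbedding.t2Space; refine ⟨fun l => ?_, fun l => ?_, fun (p : M) => ?_⟩
  · rw [Subsingleton.elim l 0]; exact hx.smooth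
  · rw [Subsingleton.elim l 0]; exact hx.nonneg
  by_cases hp : p ∈ (𝓡∂ n).boundary M
  · have hp' := hp; rw [← hιr] at hp'; obtain ⟨a, rfl⟩ := hp'
    obtain ⟨χ, haχ, -⟩ := hφ.exists_crd a (φ a) (chartAt _ (φ a)).open_source
      (mem_chart_source _ _) subset_rfl
    obtain ⟨c, h, hac, sh, hc, -⟩ := exists_boundaryCrd hι hιr hx χ haχ
    refine ⟨_, _, inferInstance, _, c, fun _ => none, hac, fun _ _ => rfl,
      fun _ _ _ _ _ => Subsingleton.elim _ _, fun i hi _ => ⟨0, (hx.zero_iff _).2 hp,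
      (mem_singleton_iff.1 hi).symm⟩, fun l _ => ?_⟩
    rw [Subsingleton.elim l 0]
    exact ⟨_, contMDiffOn_const.add ((c.smooth_apply none).mul sh), fun q hq => (hc q hq).1,
      fun q hq => (hc q hq).2⟩
  · let Ψ : PartialDiffeomorph (mfdOf n M).I (𝓡∂ n) (mfdOf n M) M ∞ := PartialDiffeomorph.refl _
    have hl : ∀ l, (![x] : Fin 1 → mfdOf n M → ℝ) l p ≠ 0 := fun l => by
      rw [Subsingleton.elim l 0]; exact fun h => hp ((hx.zero_iff p).1 h)
    refine ⟨_, _, inferInstance, _, Crd.ofExtend (X := mfdOf n M) (N := M) (𝓡∂ n) Ψ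
      (chartAt (EuclideanHalfSpace n) p) (IsManifold.chart_mem_maximalAtlas p)
      (EuclideanSpace.equiv (Fin n) ℝ) mem_range_halfSpace_iff, fun _ => 0,
      ⟨trivial, mem_chart_source (EuclideanHalfSpace n) (p : M)⟩, fun l h => absurd h (hl l),
      fun l _ h => absurd h (hl l), fun i hi h0 => ?_, fun l h => absurd h (hl l)⟩
    rw [mem_singleton_iff.1 hi] at h0
    exact absurd ((ModelWithCorners.isBoundaryPoint_iff_of_mem_maximalAtlas
      (IsManifold.chart_mem_maximalAtlas p) (mem_chart_source _ _)).2 h0) hp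

end

/-- Replacing in a product of coordinate systems some coordinates `y` of the first factor by the
differences `y - y'` to those of the second factor. -/
lemma Crd.exists_prod_sub {β γ : Type} [Fintype β] [Fintype γ]
    (c : Crd X (Option (β ⊕ γ)) {none}) (c' : Crd Y (Option (β ⊕ γ)) {none}) :
    ∃ e : Crd (X.prod Y) (Option (β ⊕ γ) ⊕ Option (β ⊕ γ)) {Sum.inl none, Sum.inr none},
      (∀ q, q ∈ e.source ↔ q.1 ∈ c.source ∧ q.2 ∈ c'.source) ∧
      (∀ q, e q (Sum.inl none) = c q.1 none) ∧ (∀ q, e q (Sum.inr none) = c' q.2 none) ∧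
      ∀ q k, e q (Sum.inl (some (Sum.inl k))) =
        c q.1 (some (Sum.inl k)) - c' q.2 (some (Sum.inl k)) := by
  let s : (Option (β ⊕ γ) ⊕ Option (β ⊕ γ) → ℝ) → Option (β ⊕ γ) ⊕ Option (β ⊕ γ) → ℝ := fun v =>
    Sum.elim (fun o => o.elim 0 (Sum.elim (fun k => v (Sum.inr (some (Sum.inl k)))) 0)) 0
  have hs : ContDiff ℝ ∞ s := by
    refine contDiff_pi.2 fun i => ?_; rcases i with (_ | k | k) | i
    · exact contDiff_const
    · exact contDiff_apply ℝ ℝ _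
    · exact contDiff_const
    · exact contDiff_const
  have hsect : ∀ {v w : Option (β ⊕ γ) ⊕ Option (β ⊕ γ) → ℝ}, w (Sum.inl none) = v (Sum.inl none) →
      w (Sum.inr none) = v (Sum.inr none) → v ∈ sect (Sum.inl '' {none} ∪ Sum.inr '' {none}) →
      w ∈ sect {Sum.inl none, Sum.inr none} := by
    rintro v w h1 h2 hv i (rfl | rfl)
    · rw [h1]; exact hv _ (Or.inl ⟨none, rfl, rfl⟩)
    · rw [h2]; exact hv _ (Or.inr ⟨none, rfl, rfl⟩)
  have hC : ({Sum.inl none, Sum.inr none} : Set (Option (β ⊕ γ) ⊕ Option (β ⊕ γ))) =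
      Sum.inl '' {none} ∪ Sum.inr '' {none} := by
    grind
  refine ⟨(c.prod c').change (fun v => v - s v) (fun v => v + s v) isOpen_univ isOpen_univ
    (contDiff_id.sub hs).contDiffOn (contDiff_id.add hs).contDiffOn
    (fun v hv => ⟨trivial, hsect (sub_zero _) (sub_zero _) hv.2⟩)
    (fun v hv => ⟨trivial, hC ▸ hsect (add_zero _) (add_zero _) (hC ▸ hv.2)⟩) (fun v _ => ?_)
    fun v _ => ?_, fun q => ⟨fun h => h.1, fun h => ⟨h, trivial⟩⟩,
    fun q => sub_zero _, fun q => sub_zero _,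
    fun q k => rfl⟩
  · have : s (v - s v) = s v := by
      ext i; rcases i with (_ | k | k) | i
      · rfl
      · exact sub_zero _
      · rfl
      · rfl
    rw [this, sub_add_cancel]
  · have : s (v + s v) = s v := by
      ext i; rcases i with (_ | k | k) | i
      · rfl
      · exact add_zero _
      · rfl
      · rfl
    grind

/-- The components of `E` extend those of an embedding of the base. -/
lemma exists_fibredBoundary {d b f : ℕ} [NeZero n] {M : Type u} [TopologicalSpace M]
    [ChartedSpace (EuclideanHalfSpace n) M] [IsManifold (𝓡∂ n) ∞ M] [T2Space M] [CompactSpace M]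
    {D : Type v} [TopologicalSpace D] [ChartedSpace (EuclideanSpace ℝ (Fin d)) D]
    [IsManifold (𝓡 d) ∞ D] {ι : D → M} {x : M → ℝ}
    {B : Type*} [TopologicalSpace B] [ChartedSpace (EuclideanSpace ℝ (Fin b)) B]
    [IsManifold (𝓡 b) ∞ B] [CompactSpace B] [T2Space B]
    {F : Type*} [TopologicalSpace F] [ChartedSpace (EuclideanSpace ℝ (Fin f)) F]
    [IsManifold (𝓡 f) ∞ F] {φ : D → B} (hι : Manifold.IsSmoothEmbedding (𝓡 d) (𝓡∂ n) ∞ ι)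
    (hιr : range ι = (𝓡∂ n).boundary M)
    (hx : IsDefiningFunction (X := mfdOf n M) ((𝓡∂ n).boundary M) x)
    (hφ : IsFibration d b f F φ) :
    ∃ (N : ℕ) (E : mfdOf n M → Fin N × Option (Fin b) → ℝ),
      FibredBoundary (mfdOf n M) x (sameFibre ι φ) E := by
  have := hι.isEmbedding.t2Space; obtain ⟨N, e, se, einj, he⟩ := exists_separating (b := b) (B := B)
  obtain ⟨E, sE, hE⟩ := exists_extension hι hιr hx hφ se
  have sE' : ∀ a, Smooth[mfdOf n M] fun p : mfdOf n M => E p a := fun a => contMDiff_pi_space.1 sE a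
  have hx0 : ∀ p : M, x p = 0 ↔ p ∈ range ι := fun p => by rw [hιr]; exact hx.zero_iff p
  refine ⟨N, E, LC.of_isDefiningFunction hι hιr hx hφ, sE', fun p p' => ⟨?_, ?_⟩, ?_⟩
  · rintro ⟨a, a', rfl, rfl, h⟩
    grind
  · rintro ⟨h1, h2, h3⟩; obtain ⟨a, rfl⟩ := (hx0 p).1 h1; obtain ⟨a', rfl⟩ := (hx0 p').1 h2
    refine ⟨a, a', rfl, rfl, einj ?_⟩; rw [← hE, ← hE]; exact funext h3
  rintro _ _ ⟨a, a', rfl, rfl, haa'⟩; obtain ⟨y₀, j, O, hO, haO, hOs, hOe⟩ := he (φ a)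
  have key : ∀ a, φ a ∈ O → ∃ (c : Crd (mfdOf n M) (Option (Fin b ⊕ Fin f)) {none})
      (h : mfdOf n M → ℝ),
      ι a ∈ c.source ∧ SmoothOn[mfdOf n M] h c.source ∧ c (ι a) none = 0 ∧
      (∀ q ∈ c.source, 0 < 1 + c q none * h q ∧ x q = (1 + c q none * h q) * c q none) ∧
      ∀ q ∈ c.source, c q none = 0 → ∃ y : D, ι y = q ∧ φ y ∈ O ∧
        ∀ k, c q (some (Sum.inl k)) = extChartAt (𝓡 b) y₀ (φ y) k := by
    intro a haO; obtain ⟨χ, haχ, -, hχ⟩ := hφ.exists_crd a y₀ hO haO hOs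
    obtain ⟨c, h, hac, sh, hc, -, hcχ⟩ := exists_boundaryCrd hι hιr hx χ haχ
    have h1 := (hc _ hac).2
    rw [(hx0 _).2 (mem_range_self a), eq_comm, mul_eq_zero, or_iff_right (hc _ hac).1.ne'] at h1
    refine ⟨c, h, hac, sh, h1, hc, fun q hq hq0 => ?_⟩
    obtain ⟨y, rfl⟩ := (hx0 q).1 (by rw [(hc q hq).2, hq0, mul_zero])
    obtain ⟨h1, h2⟩ := hcχ y hq; exact ⟨y, rfl, (hχ y h1).1, fun k => (h2 _).trans ((hχ y h1).2 k)⟩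
  obtain ⟨c, h, hac, sh, hxa, hc, hb1⟩ := key a haO
  obtain ⟨c', h', hac', sh', hxa', hc', hb2⟩ := key a' (haa' ▸ haO)
  -- coordinates of `M × M`, among them the differences of the coordinates of the base
  obtain ⟨w, hw, hw1, hw2, hwk⟩ := c.exists_prod_sub c'
  have hp : ((ι a, ι a') : (mfdOf n M).prod (mfdOf n M)) ∈ w.source := (hw _).2 ⟨hac, hac'⟩
  have hp1 := (hw1 (ι a, ι a')).trans hxa; have hp2 := (hw2 (ι a, ι a')).trans hxa'
  -- on the boundary, the coordinates of the base are components of `E`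
  have hbd : ∀ q ∈ w.source, w q (Sum.inl none) = 0 → w q (Sum.inr none) = 0 → ∃ y y',
      q = (ι y, ι y') ∧ φ y ∈ O ∧ φ y' ∈ O ∧ ∀ k, w q (Sum.inl (some (Sum.inl k))) =
        extChartAt (𝓡 b) y₀ (φ y) k - extChartAt (𝓡 b) y₀ (φ y') k := fun q hq h1 h2 => by
    obtain ⟨y, hy, hyO, hyk⟩ := hb1 _ ((hw q).1 hq).1 ((hw1 q).symm.trans h1)
    obtain ⟨y', hy', hyO', hyk'⟩ := hb2 _ ((hw q).1 hq).2 ((hw2 q).symm.trans h2)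
    exact ⟨y, y', Prod.ext hy.symm hy'.symm, hyO, hyO', fun k => by rw [hwk, hyk, hyk']⟩
  have hkk : ∀ k, w (ι a, ι a') (Sum.inl (some (Sum.inl k))) = 0 := by
    obtain ⟨y, y', e, -, -, hk⟩ := hbd _ hp hp1 hp2
    rw [← hι.isEmbedding.injective (congrArg Prod.fst e),
      ← hι.isEmbedding.injective (congrArg Prod.snd e), haa'] at hk
    exact fun k => (hk k).trans (sub_self _)
  let T : Finset (Option (Fin b ⊕ Fin f) ⊕ Option (Fin b ⊕ Fin f)) := Finset.univ.map
    ⟨fun k : Fin b => Sum.inl (some (Sum.inl k)), fun k k' h => by simpa using h⟩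
  have hT : ∀ k, k ∈ T ↔ ∃ l, Sum.inl (some (Sum.inl l)) = k := by
    simp only [T, Finset.mem_map, Finset.mem_univ, true_and]; exact fun _ => Iff.rfl
  have sfst : ContMDiff ((mfdOf n M).prod (mfdOf n M)).I (mfdOf n M).I ∞
    (fun q : (mfdOf n M).prod (mfdOf n M) => q.1) := contMDiff_fst
  have ssnd : ContMDiff ((mfdOf n M).prod (mfdOf n M)).I (mfdOf n M).I ∞
    (fun q : (mfdOf n M).prod (mfdOf n M) => q.2) := contMDiff_snd
  have sdiff : ∀ k, Smooth[(mfdOf n M).prod (mfdOf n M)] fun q : (mfdOf n M).prod (mfdOf n M) =>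
    E q.1 k - E q.2 k := fun k =>
    ((sE' k).comp sfst).sub ((sE' k).comp ssnd)
  have hi1 : Sum.inl none ∉ insert (Sum.inr none) T := by simp [hT]
  have hi2 : Sum.inr none ∉ T := by simp [hT]
  -- the difference of the values of `E` vanishes where the points are on the boundary in one fibre
  obtain ⟨V₁, hV₁w, hV₁, hpV₁, A, sA, eA⟩ := w.hadamard
    (insert (Sum.inl none) (insert (Sum.inr none) T)) hp
    (Finset.forall_mem_insert _ _ _ |>.2 ⟨hp1, Finset.forall_mem_insert _ _ _ |>.2 ⟨hp2,
      fun i hi => by obtain ⟨k, rfl⟩ := (hT i).1 hi; exact hkk k⟩⟩) isOpen_univ (mem_univ _)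
    (h := fun q k => E q.1 k - E q.2 k) (fun k => (sdiff k).contMDiffOn) fun q hq hq0 k => by
      obtain ⟨h1, hq0⟩ := (Finset.forall_mem_insert _ _ _).1 hq0
      obtain ⟨h2, h3⟩ := (Finset.forall_mem_insert _ _ _).1 hq0
      obtain ⟨y, y', rfl, hyO, hyO', hk⟩ := hbd q hq.1 h1 h2
      have h4 : φ y = φ y' := by
        refine (extChartAt (𝓡 b) y₀).injOn (by rw [extChartAt_source]; exact hOs hyO)
          (by rw [extChartAt_source]; exact hOs hyO') ?_
        ext l; rw [← sub_eq_zero, ← hk]; exact h3 _ ((hT _).2 ⟨l, rfl⟩)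
      rw [hE, hE, h4, sub_self]
  -- the coordinates of the base are components of `E`, up to functions vanishing on the boundary
  obtain ⟨V₂, hV₂w, hV₂, hpV₂, G, sG, eG⟩ := w.hadamard {Sum.inl none, Sum.inr none} hp
    (Finset.forall_mem_insert _ _ _ |>.2 ⟨hp1, by simpa using hp2⟩) w.open_source hp
    (h := fun q k => w q (Sum.inl (some (Sum.inl k))) - (E q.1 (j, some k) - E q.2 (j, some k)))
    (fun k => (w.smooth_apply _).sub (sdiff _).contMDiffOn) fun q hq hq0 k => by
      grind
  -- extension by zero of functions of the indices in `T`
  let z : (Fin b → ℝ) → Option (Fin b ⊕ Fin f) ⊕ Option (Fin b ⊕ Fin f) → ℝ := fun g =>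
    Sum.elim (fun o => o.elim 0 (Sum.elim g 0)) 0
  have sz : ∀ {g : (mfdOf n M).prod (mfdOf n M) → Fin b → ℝ} {U : Set _},
      (∀ k, SmoothOn[(mfdOf n M).prod (mfdOf n M)] (fun q => g q k) U) →
      ∀ k, SmoothOn[(mfdOf n M).prod (mfdOf n M)] (fun q => z (g q) k) U := by
    rintro g U hg ((_ | k | k) | k)
    exacts [contMDiffOn_const, hg k, contMDiffOn_const, contMDiffOn_const]
  have hws : ∀ q ∈ w.source ∩ (V₁ ∩ V₂), q ∈ V₁ ∧ q ∈ V₂ := fun q hq => hq.2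
  refine ⟨_, _, inferInstance, _, w.restrict _ (hV₁.inter hV₂), Sum.inl none, Sum.inr none, T,
    fun q => h q.1, fun q => h' q.2, A, fun q k => A q k (Sum.inl none),
    fun q k => A q k (Sum.inr none), fun _ k m => z (fun l => if m = (j, some l) then 1 else 0) k,
    fun q => z fun k => G q k (Sum.inl none), fun q => z fun k => G q k (Sum.inr none),
    ⟨hp, hpV₁, hpV₂⟩, by simp, Or.inl rfl, Or.inr rfl, fun k hk _ => hk, fun k hk => ?_,
    ⟨sh.comp sfst.contMDiffOn fun q hq => ((hw q).1 hq.1).1,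
      sh'.comp ssnd.contMDiffOn fun q hq => ((hw q).1 hq.1).2,
      fun k i => (sA k i).mono fun q hq => (hws q hq).1,
      fun k => (sA k _).mono fun q hq => (hws q hq).1,
      fun k => (sA k _).mono fun q hq => (hws q hq).1,
      fun k m => contMDiffOn_const,
      sz fun k => (sG k _).mono fun q hq => (hws q hq).2,
      sz fun k => (sG k _).mono fun q hq => (hws q hq).2⟩, fun q hq => ?_⟩
  · grind
  have hq1 := hc _ ((hw q).1 hq.1).1; have hq2 := hc' _ ((hw q).1 hq.1).2; rw [← hw1] at hq1
  rw [← hw2] at hq2; refine ⟨hq1.1, hq2.1, hq1.2, hq2.2, fun k => ?_, fun k hk => ?_⟩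
  · have h1 := eA q (hws q hq).1 k; rw [Finset.sum_insert hi1, Finset.sum_insert hi2] at h1; rw [h1]
    change _ = ∑ k' ∈ T, A q k k' * w q k' +
      (w q (Sum.inl none) * A q k (Sum.inl none) + w q (Sum.inr none) * A q k (Sum.inr none))
    ring
  · obtain ⟨l, rfl⟩ := (hT k).1 hk; have h1 := eG q (hws q hq).2 l
    rw [Finset.sum_pair (by simp)] at h1
    change w q (Sum.inl (some (Sum.inl l))) =
      ∑ m, (if m = (j, some l) then 1 else 0) * (E q.1 m - E q.2 m) +
        (w q (Sum.inl none) * G q l (Sum.inl none) + w q (Sum.inr none) * G q l (Sum.inr none))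
    simp only [ite_mul, one_mul, zero_mul, Finset.sum_ite_eq', Finset.mem_univ, if_true]; linarith

end

theorem mainTheorem9 {n d b f : ℕ} [NeZero n]
    -- the compact manifold with boundary
    (M : Type u) [TopologicalSpace M] [ChartedSpace (EuclideanHalfSpace n) M]
    [IsManifold (𝓡∂ n) ∞ M] [CompactSpace M] [T2Space M]
    -- its boundary, as a manifold
    (D : Type*) [TopologicalSpace D] [ChartedSpace (EuclideanSpace ℝ (Fin d)) D]
    [IsManifold (𝓡 d) ∞ D]
    (ι : D → M) (hι : Manifold.IsSmoothEmbedding (𝓡 d) (𝓡∂ n) ∞ ι)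
    (hιr : range ι = (𝓡∂ n).boundary M)
    -- the fibration of the boundary
    (B : Type*) [TopologicalSpace B] [ChartedSpace (EuclideanSpace ℝ (Fin b)) B]
    [IsManifold (𝓡 b) ∞ B] [CompactSpace B] [T2Space B]
    (F : Type*) [TopologicalSpace F] [ChartedSpace (EuclideanSpace ℝ (Fin f)) F]
    [IsManifold (𝓡 f) ∞ F] [CompactSpace F] [T2Space F]
    (φ : D → B) (hφ : IsFibration d b f F φ)
    -- the boundary defining function
    (x : M → ℝ) (hx : IsDefiningFunction (X := mfdOf n M) ((𝓡∂ n).boundary M) x) :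
    -- the blow-ups defining `M²_φ` and `M²_{k,φ}` exist, and for these spaces:
    Nonempty (PhiDouble (mfdOf n M) x (sameFibre ι φ)) ∧
    Nonempty (KPhiDouble (mfdOf n M) x (sameFibre ι φ)) ∧
    ∀ (W : PhiDouble (mfdOf n M) x (sameFibre ι φ))
      (K : KPhiDouble (mfdOf n M) x (sameFibre ι φ)),
      ∃ β' : K.space → W.space.prodHalfLine,
        IsBMap β' ∧
        -- `β'` extends the identity of the interior, over which `K.total` and `W.total × id` are
        -- diffeomorphisms
        (∀ q, (W.total (β' q).1, (β' q).2) = K.total q) ∧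
        -- `β'` is the blow-down map for `bf × {0}` and then `φf × {0}`, `lf × {0}`, `rf × {0}` in
        -- any order `L`; the list of lifted front faces has the entry `Fc 0` for `φf × {0}`
        ∀ L : List (Fin 3), L.Perm [0, 1, 2] →
          ∃ (F₀ : Set K.space) (Fc : Fin 3 → Set K.space),
            IsIteratedBlowup W.space.prodHalfLine
              (W.timesZero W.bf ::
                L.map ![W.timesZero W.φf, W.timesZero W.lf, W.timesZero W.rf])
              [] K.space β' (F₀ :: L.map Fc) ∧
            Fc 0 = K.φf₀ := by
  obtain ⟨N, E, hF⟩ := exists_fibredBoundary hι hιr hx hφ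
  have : CompactSpace (mfdOf n M) := inferInstanceAs (CompactSpace M)
  exact ⟨exists_phiDouble hF, exists_kPhiDouble hF, fun W K => K.exists_bMap hF W⟩
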